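/- Let $m>0$ and let $q^{ij}:\mathbb Z\to\mathbb R$ ($i,j\in\{1,2\}$) satisfy $q^{12}_n=q^{21}_n$ and $q^{21}_n\neq-1$ for all $n\in\mathbb Z$. For two-component complex sequences $\mathbf w=(u,v)$ on $\mathbb Z$ let $$(\mathcal D\mathbf w)_n=\begin{pmatrix} m u_n+v_n-v_{n+1}+q^{11}_nu_n+q^{12}_nv_n\\ u_n-u_{n-1}-mv_n+q^{21}_nu_n+q^{22}_nv_n\end{pmatrix},\qquad n\in\mathbb Z .$$ For $1\le p\le\infty$ and $\sigma\in\mathbb R$ let $\ell^p_\sigma$ be the space of sequences on $\mathbb Z$ for which $n\mapsto(1+|n|)^\sigma u(n)$ lies in $\ell^p(\mathbb Z)$, with the $\ell^p$ norm of that sequence as norm; put $\mathbf l^p_\sigma=\ell^p_\sigma\oplus\ell^p_\sigma$ and $\mathbf l^p=\mathbf l^p_0$. A real number $\lambda$ is called a resonance if $\mathcal D\mathbf w=\lambda\mathbf w$ has a nonzero solution $\mathbf w\in\mathbf l^\infty$. The resonant case is the one in which at least one of $\pm m$, $\pm\sqrt{m^2+4}$ is a resonance; otherwise we are in the non-resonant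 case. Assume that all $q^{ij}\in\ell^1_2$ in the non-resonant case, and that all $q^{ij}\in\ell^1_3$ in the resonant case. Regard $\mathcal D$ as a (bounded, self-adjoint) operator on $\mathbf l^2$, and let $P_c$ be the orthogonal projection in $\mathbf l^2$ onto its continuous subspace, that is, onto the orthogonal complement of the eigenvectors of $\mathcal D$. Then $$\|e^{-it\mathcal D}P_c\|_{\mathbf l^1\to\mathbf l^\infty}=\mathcal O(t^{-1/3}),\qquad t\to\infty,$$ and, for every $\sigma>1/2$, $$\|e^{-it\mathcal D}P_c\|_{\mathbf l^2_\sigma\to\mathbf l^2_{-\sigma}}=\mathcal O(t^{-1/2}),\qquad t\to\infty .$$ -/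

import Mathlib

noncomputable section

namespace DiscreteDirac

/-- Norm of the weighted space of sequences on the integers with exponent `p` (used for
`1 ≤ p ≤ ∞`) and weight `(1 + |n|) ^ σ`, as an extended nonnegative real
(`⊤` when the sequence is not in the space). -/
def weightedNorm {E : Type*} [NormedAddCommGroup E] (p : ENNReal) (σ : ℝ) (u : ℤ → E) : ENNReal :=
  if p = ⊤ then ⨆ n : ℤ, ENNReal.ofReal ((1 + |(n : ℝ)|) ^ σ * ‖u n‖)
  else (∑' n : ℤ, ENNReal.ofReal ((1 + |(n : ℝ)|) ^ (p.toReal * σ) * ‖u n‖ ^ p.toReal))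
    ^ (1 / p.toReal)

/-- Membership in the weighted sequence space. -/
def MemWeighted {E : Type*} [NormedAddCommGroup E] (p : ENNReal) (σ : ℝ) (u : ℤ → E) : Prop :=
  weightedNorm p σ u < ⊤

/-- The two-component vectors `(u, v)`. -/
abbrev Spinor : Type := EuclideanSpace ℂ (Fin 2)

/-- The Hilbert space of square summable two-component sequences `n ↦ (u n, v n)`. -/
abbrev L2 : Type := lp (fun _ : ℤ => Spinor) 2

/-- The difference expression `D₀ + Q` acting on arbitrary two-component sequences, where
`D₀ = (m, d; d*, -m)`, `(d v) n = v n - v (n + 1)` and `(d* u) n = u n - u (n - 1)`. -/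
def diracSeq (m : ℝ) (Q : ℤ → Matrix (Fin 2) (Fin 2) ℝ) (w : ℤ → Spinor) (n : ℤ) : Spinor :=
  !₂[m * w n 0 + (w n 1 - w (n + 1) 1) + (Q n 0 0 * w n 0 + Q n 0 1 * w n 1),
     (w n 0 - w (n - 1) 0) - m * w n 1 + (Q n 1 0 * w n 0 + Q n 1 1 * w n 1)]

/-- Boundedness of all entries of the potential. -/
def BoundedPotential (Q : ℤ → Matrix (Fin 2) (Fin 2) ℝ) : Prop :=
  ∃ B : ℝ, ∀ n i j, |Q n i j| ≤ B

theorem boundedPotential_of_memWeighted {Q : ℤ → Matrix (Fin 2) (Fin 2) ℝ} {s : ℝ} (hs : 0 ≤ s)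
    (h : ∀ i j, MemWeighted 1 s (fun n => Q n i j)) : BoundedPotential Q := by
  have key : ∀ i j, ∃ B : ℝ, ∀ n, |Q n i j| ≤ B := by
    intro i j
    have h1 := h i j
    simp only [MemWeighted, weightedNorm, ENNReal.one_ne_top, if_false, ENNReal.toReal_one,
      one_mul, Real.rpow_one, div_one, ENNReal.rpow_one, Real.norm_eq_abs] at h1
    refine ⟨(∑' n : ℤ, ENNReal.ofReal ((1 + |(n : ℝ)|) ^ s * |Q n i j|)).toReal, fun n => ?_⟩
    have h3 := (ENNReal.ofReal_le_iff_le_toReal h1.ne).1 (ENNReal.le_tsum n)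
    refine le_trans ?_ h3
    have : (1 : ℝ) ≤ (1 + |(n : ℝ)|) ^ s :=
      Real.one_le_rpow (by linarith [abs_nonneg (n : ℝ)]) hs
    exact le_mul_of_one_le_left (abs_nonneg _) this
  choose B hB using key
  refine ⟨∑ i, ∑ j, |B i j|, fun n i j => (hB i j n).trans ((le_abs_self _).trans ?_)⟩
  refine le_trans ?_ (Finset.single_le_sum (f := fun i => ∑ j, |B i j|)
    (fun i _ => Finset.sum_nonneg fun j _ => abs_nonneg _) (Finset.mem_univ i))
  exact Finset.single_le_sum (f := fun j => |B i j|) (fun j _ => abs_nonneg _) (Finset.mem_univ j)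

theorem diracSeq_bound {m : ℝ} {Q : ℤ → Matrix (Fin 2) (Fin 2) ℝ} (hQ : BoundedPotential Q) :
    ∃ C : ℝ, 0 ≤ C ∧ ∀ (w : ℤ → Spinor) (n : ℤ),
      ‖diracSeq m Q w n‖ ≤ C * (‖w n‖ + ‖w (n + 1)‖ + ‖w (n - 1)‖) := by
  obtain ⟨B, hB⟩ := hQ
  have hB0 : 0 ≤ B := (abs_nonneg _).trans (hB 0 0 0)
  have hn : ∀ x : Spinor, ‖x‖ ≤ ‖x 0‖ + ‖x 1‖ := by
    intro x
    rw [EuclideanSpace.norm_eq, Fin.sum_univ_two]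
    refine Real.sqrt_le_iff.2 ⟨by positivity, ?_⟩
    nlinarith [norm_nonneg (x 0), norm_nonneg (x 1)]
  have hc : ∀ (x : Spinor) i, ‖x i‖ ≤ ‖x‖ := fun x i => PiLp.norm_apply_le x i
  have hq : ∀ n i j (z : ℂ), ‖(Q n i j : ℂ) * z‖ ≤ B * ‖z‖ := by
    intro n i j z
    rw [norm_mul, Complex.norm_real, Real.norm_eq_abs]
    exact mul_le_mul_of_nonneg_right (hB n i j) (norm_nonneg _)
  have hm : ∀ z : ℂ, ‖(m : ℂ) * z‖ = |m| * ‖z‖ := by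
    intro z
    rw [norm_mul, Complex.norm_real, Real.norm_eq_abs]
  refine ⟨2 * (|m| + 2 * B + 1), by positivity, fun w n => (hn _).trans ?_⟩
  have e0 : ‖diracSeq m Q w n 0‖ ≤ |m| * ‖w n‖ + ‖w n‖ + ‖w (n + 1)‖ + 2 * B * ‖w n‖ := by
    have h0 : diracSeq m Q w n 0 = m * w n 0 + (w n 1 - w (n + 1) 1)
      + (Q n 0 0 * w n 0 + Q n 0 1 * w n 1) := rfl
    rw [h0]
    have a1 := norm_add_le (m * w n 0 + (w n 1 - w (n + 1) 1)) (Q n 0 0 * w n 0 + Q n 0 1 * w n 1)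
    have a2 := norm_add_le ((m : ℂ) * w n 0) (w n 1 - w (n + 1) 1)
    have a3 := norm_sub_le (w n 1) (w (n + 1) 1)
    have a4 := norm_add_le ((Q n 0 0 : ℂ) * w n 0) (Q n 0 1 * w n 1)
    have a5 := hq n 0 0 (w n 0)
    have a6 := hq n 0 1 (w n 1)
    rw [hm] at a2
    have b1 := mul_le_mul_of_nonneg_left (hc (w n) 0) (abs_nonneg m)
    have b2 := mul_le_mul_of_nonneg_left (hc (w n) 0) hB0
    have b3 := mul_le_mul_of_nonneg_left (hc (w n) 1) hB0
    linarith [hc (w n) 1, hc (w (n + 1)) 1]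
  have e1 : ‖diracSeq m Q w n 1‖ ≤ |m| * ‖w n‖ + ‖w n‖ + ‖w (n - 1)‖ + 2 * B * ‖w n‖ := by
    have h0 : diracSeq m Q w n 1 = (w n 0 - w (n - 1) 0) - m * w n 1
      + (Q n 1 0 * w n 0 + Q n 1 1 * w n 1) := rfl
    rw [h0]
    have a1 := norm_add_le ((w n 0 - w (n - 1) 0) - m * w n 1) (Q n 1 0 * w n 0 + Q n 1 1 * w n 1)
    have a2 := norm_sub_le (w n 0 - w (n - 1) 0) ((m : ℂ) * w n 1)
    have a3 := norm_sub_le (w n 0) (w (n - 1) 0)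
    have a4 := norm_add_le ((Q n 1 0 : ℂ) * w n 0) (Q n 1 1 * w n 1)
    have a5 := hq n 1 0 (w n 0)
    have a6 := hq n 1 1 (w n 1)
    rw [hm] at a2
    have b1 := mul_le_mul_of_nonneg_left (hc (w n) 1) (abs_nonneg m)
    have b2 := mul_le_mul_of_nonneg_left (hc (w n) 0) hB0
    have b3 := mul_le_mul_of_nonneg_left (hc (w n) 1) hB0
    linarith [hc (w n) 0, hc (w (n - 1)) 0]
  have p1 : 0 ≤ (|m| + 2 * B) * ‖w (n + 1)‖ := by positivity
  have p2 : 0 ≤ (|m| + 2 * B) * ‖w (n - 1)‖ := by positivity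
  nlinarith [norm_nonneg (w n), norm_nonneg (w (n + 1)), norm_nonneg (w (n - 1))]

theorem diracSeq_sum_le {m : ℝ} {Q : ℤ → Matrix (Fin 2) (Fin 2) ℝ} (hQ : BoundedPotential Q) :
    ∃ C : ℝ, 0 ≤ C ∧ ∀ (w : L2) (s : Finset ℤ),
      ∑ n ∈ s, ‖diracSeq m Q w n‖ ^ (2 : ENNReal).toReal ≤ (C * ‖w‖) ^ (2 : ENNReal).toReal := by
  obtain ⟨C, hC, h⟩ := diracSeq_bound (m := m) hQ
  refine ⟨3 * C, by positivity, fun w s => ?_⟩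
  have h2 : (0 : ℝ) < (2 : ENNReal).toReal := by norm_num
  have hsh : ∀ e : ℤ ≃ ℤ, ∑ n ∈ s, ‖w (e n)‖ ^ 2 ≤ ‖w‖ ^ 2 := by
    intro e
    have := lp.sum_rpow_le_norm_rpow h2 w (s.map e.toEmbedding)
    rw [Finset.sum_map] at this
    simpa using this
  have s0 := hsh (Equiv.refl ℤ)
  have s1 := hsh (Equiv.addRight 1)
  have s2 := hsh (Equiv.subRight 1)
  simp only [Equiv.refl_apply, Equiv.coe_addRight, Equiv.subRight_apply] at s0 s1 s2
  simp only [ENNReal.toReal_ofNat, Real.rpow_ofNat]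
  calc ∑ n ∈ s, ‖diracSeq m Q w n‖ ^ 2
      ≤ ∑ n ∈ s, 3 * C ^ 2 * (‖w n‖ ^ 2 + ‖w (n + 1)‖ ^ 2 + ‖w (n - 1)‖ ^ 2) := by
        refine Finset.sum_le_sum fun n _ => ?_
        have h1 := pow_le_pow_left₀ (norm_nonneg _) (h w n) 2
        rw [mul_pow] at h1
        refine h1.trans ?_
        have : (‖w n‖ + ‖w (n + 1)‖ + ‖w (n - 1)‖) ^ 2
            ≤ 3 * (‖w n‖ ^ 2 + ‖w (n + 1)‖ ^ 2 + ‖w (n - 1)‖ ^ 2) := by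
          nlinarith [sq_nonneg (‖w n‖ - ‖w (n + 1)‖), sq_nonneg (‖w n‖ - ‖w (n - 1)‖),
            sq_nonneg (‖w (n + 1)‖ - ‖w (n - 1)‖)]
        nlinarith [sq_nonneg C]
    _ = 3 * C ^ 2 * (∑ n ∈ s, ‖w n‖ ^ 2 + ∑ n ∈ s, ‖w (n + 1)‖ ^ 2
          + ∑ n ∈ s, ‖w (n - 1)‖ ^ 2) := by
        rw [← Finset.mul_sum, Finset.sum_add_distrib, Finset.sum_add_distrib]
    _ ≤ 3 * C ^ 2 * (‖w‖ ^ 2 + ‖w‖ ^ 2 + ‖w‖ ^ 2) := by gcongr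
    _ = (3 * C * ‖w‖) ^ 2 := by ring

theorem memℓp_diracSeq {m : ℝ} {Q : ℤ → Matrix (Fin 2) (Fin 2) ℝ} (hQ : BoundedPotential Q)
    (w : L2) : Memℓp (diracSeq m Q w) 2 := by
  obtain ⟨C, -, h⟩ := diracSeq_sum_le (m := m) hQ
  exact memℓp_gen' (h w)

/-- The bounded operator `D = D₀ + Q` on the Hilbert space of square summable sequences. -/
def dirac (m : ℝ) (Q : ℤ → Matrix (Fin 2) (Fin 2) ℝ) (hQ : BoundedPotential Q) : L2 →L[ℂ] L2 :=
  LinearMap.mkContinuousOfExistsBound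
    { toFun := fun w => ⟨diracSeq m Q w, memℓp_diracSeq hQ w⟩
      map_add' := by
        intro x y
        refine lp.ext (funext fun n => ?_)
        change diracSeq m Q (x + y : L2) n = diracSeq m Q x n + diracSeq m Q y n
        ext i
        fin_cases i <;> simp [diracSeq] <;> ring
      map_smul' := by
        intro c x
        refine lp.ext (funext fun n => ?_)
        change diracSeq m Q (c • x : L2) n = c • diracSeq m Q x n
        ext i
        fin_cases i <;> simp [diracSeq] <;> ring }
    (by
      obtain ⟨C, hC, h⟩ := diracSeq_sum_le (m := m) hQ
      exact ⟨C, fun w => lp.norm_le_of_forall_sum_le (by norm_num) (by positivity) (h w)⟩)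

/-- The orthogonal projection onto the continuous subspace of a (self-adjoint) bounded operator,
that is, onto the orthogonal complement of all eigenvectors. -/
def continuousProjection (A : L2 →L[ℂ] L2) : L2 →L[ℂ] L2 :=
  (⨆ z : ℂ, Module.End.eigenspace (A : L2 →ₗ[ℂ] L2) z)ᗮ.starProjection

/-- The propagator `exp (-i t A)`. -/
def propagator (A : L2 →L[ℂ] L2) (t : ℝ) : L2 →L[ℂ] L2 :=
  NormedSpace.exp ((-Complex.I * (t : ℂ)) • A)

/-- Norm of `A` as an operator from the weighted space with parameters `(p, σ)` to the one with
parameters `(p', σ')`, as an extended nonnegative real. It is used only when the first space is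
contained in `L2`, so that the supremum runs over the whole unit ball of the first space. -/
def weightedOpNorm (p : ENNReal) (σ : ℝ) (p' : ENNReal) (σ' : ℝ) (A : L2 →L[ℂ] L2) : ENNReal :=
  ⨆ (f : L2) (_ : weightedNorm p σ (f : ℤ → Spinor) ≤ 1), weightedNorm p' σ' (A f : ℤ → Spinor)

/-- `E` is a resonance: the difference equation `D w = E w` has a nonzero bounded solution. -/
def IsResonance (m : ℝ) (Q : ℤ → Matrix (Fin 2) (Fin 2) ℝ) (E : ℝ) : Prop :=
  ∃ w : ℤ → Spinor, w ≠ 0 ∧ MemWeighted ⊤ 0 w ∧ ∀ n, diracSeq m Q w n = (E : ℂ) • w n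

/-- The resonant case: at least one of the four edges `±m`, `±√(4 + m²)` of the continuous
spectrum is a resonance. -/
def ResonantCase (m : ℝ) (Q : ℤ → Matrix (Fin 2) (Fin 2) ℝ) : Prop :=
  ∃ E ∈ ({m, -m, √(4 + m ^ 2), -√(4 + m ^ 2)} : Set ℝ), IsResonance m Q E

end DiscreteDirac

end

/-! ### Oscillatory integrals: van der Corput estimates -/

noncomputable section

namespace DiscreteDirac

open MeasureTheory intervalIntegral Set

/-! The free operator has symbol eigenvalues ±ω(θ) with ω(θ) = √(m² + 2 − 2 cos θ), so the
continuous spectrum consists of the two bands m ≤ |λ| ≤ √(m² + 4), whose edges correspond to θ = 0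
and θ = π. By Stone's formula the kernel of the propagator on the continuous subspace is the
integral of e^{-itλ} against the jump of the resolvent across the bands. After the substitution λ =
±ω(θ) it is a combination of integrals over (0, π) of e^{∓itω(θ)} e^{ipθ} a(θ), with |p| ≤ |x| + |y|
+ 2 for the entry between the sites x and y (`Admissible.exists_specDensity_eq`,
`Admissible.exists_amp`). Two facts are needed: decay for the phase tω + pθ, and bounds on a and a'
that do not depend on the sites.

Phase. On (0, π) the second derivative of ω has exactly one zero, and this zero is simple
(`exists_inflection`). Van der Corput estimates give t^{-1/3} uniformly in p. If |p| ≤ ct with c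
small, the phase is not stationary near the inflection point, and the rate improves to t^{-1/2}
(`exists_subintervalBound_third`, `exists_subintervalBound_half`).

Amplitude. The equation is a first order recurrence with transfer matrices of determinant one, and
Jost solutions are limits of products of them. The normalized free matrix has eigenvalues 1 and ζ²,
with ζ = e^{iθ}; these merge at the band edges, so its powers grow linearly, and r derivatives in θ
cost r + 1 moments of the potential (`Admissible.exists_contDiff_jost`). The resolvent kernel is
−f₊(n) f₋(l) / W with l ≤ n. The right Jost solution f₊ is controlled uniformly for n ≥ 0 and the
left one f₋ for l ≤ 1; elsewhere one of them is replaced, through the scattering relation, by the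
other and its conjugate. The inequality |W| ≥ c |sin θ| shows that W vanishes only at the edges, to
first order at most, and such a zero is a resonance. The numerators of the scattering coefficients
then vanish as well, and the quotients still have bounded derivative provided one more derivative
exists (`exists_bddC1_div`). That derivative costs the third moment.

Spectral theory. The potential is a compact perturbation, so off the bands the operator is bounded
below on the orthogonal complement of its eigenvectors (`Admissible.bounded_below`); inside the
bands a decaying solution is zero. Hence the propagator on the continuous subspace is a strong limit
of functions of the operator cut off to compact parts of the open bands
(`tendsto_inner_exp_starProjection`), where the limiting absorption principle
`Admissible.exists_resolvent` makes Stone's formula explicit.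

The kernel bound t^{-1/3} is the first estimate. For the second, sites are split at a distance R
comparable to t: inside, the kernel is O(t^{-1/2}) and the weights are square summable; outside, the
weight is at most a multiple of t^{-σ} ≤ t^{-1/2} and the propagator is a contraction
(`weightedOpNorm_two_le`). -/

/-- Every subinterval of `[a, b]` contributes at most `K` to the integral of `E`. -/
def SubintervalBound (E : ℝ → ℂ) (a b K : ℝ) : Prop :=
  ∀ x y, a ≤ x → x ≤ y → y ≤ b → ‖∫ θ in x..y, E θ‖ ≤ K

theorem SubintervalBound.trans {E : ℝ → ℂ} (hE : Continuous E) {a b c K L : ℝ}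
    (h₁ : SubintervalBound E a b K) (h₂ : SubintervalBound E b c L) (hK : 0 ≤ K) (hL : 0 ≤ L) :
    SubintervalBound E a c (K + L) := by
  intro x y hx hxy hy
  rcases le_total y b with hyb | hyb
  · exact (h₁ x y hx hxy hyb).trans (by linarith)
  rcases le_total b x with hbx | hbx
  · exact (h₂ x y hbx hxy hy).trans (by linarith)
  rw [← integral_add_adjacent_intervals (hE.intervalIntegrable x b) (hE.intervalIntegrable b y)]
  exact (norm_add_le _ _).trans (add_le_add (h₁ x b hx hbx le_rfl) (h₂ b y le_rfl hyb hy))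

theorem SubintervalBound.mono {E : ℝ → ℂ} {a b K L : ℝ} (h : SubintervalBound E a b K)
    (hKL : K ≤ L) : SubintervalBound E a b L :=
  fun x y hx hxy hy => (h x y hx hxy hy).trans hKL

theorem subintervalBound_of_norm_le_one {E : ℝ → ℂ} (hE : ∀ θ, ‖E θ‖ ≤ 1) {a b K : ℝ}
    (hK : b - a ≤ K) : SubintervalBound E a b K := by
  intro x y hx hxy hy
  refine (norm_integral_le_of_norm_le_const (C := 1) fun θ _ => hE θ).trans ?_
  rw [abs_of_nonneg (by linarith)]
  linarith

theorem hasDerivAt_cexp_phase {φ φ' : ℝ → ℝ} (hφ : ∀ θ, HasDerivAt φ (φ' θ) θ) (θ : ℝ) :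
    HasDerivAt (fun θ => Complex.exp (Complex.I * φ θ))
      (Complex.exp (Complex.I * φ θ) * (Complex.I * φ' θ)) θ :=
  ((hφ θ).ofReal_comp.const_mul Complex.I).cexp

theorem norm_cexp_phase (x : ℝ) : ‖Complex.exp (Complex.I * x)‖ = 1 := by
  rw [mul_comm]; exact Complex.norm_exp_ofReal_mul_I x

/-- Conjugation flips the phase, so a negative second derivative reduces to a positive one. -/
theorem norm_integral_phase_neg {φ : ℝ → ℝ} (x y : ℝ) :
    ‖∫ θ in x..y, Complex.exp (Complex.I * ((-φ θ : ℝ) : ℂ))‖ =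
      ‖∫ θ in x..y, Complex.exp (Complex.I * φ θ)‖ := by
  rw [← Complex.norm_conj (∫ θ in x..y, Complex.exp (Complex.I * φ θ)),
    ← intervalIntegral_conj]
  congr 2
  ext θ
  rw [← Complex.exp_conj]
  simp

/-- First derivative test with monotone derivative. -/
theorem norm_integral_phase_le_of_monotone {φ φ' φ'' : ℝ → ℝ} (hφ : ∀ θ, HasDerivAt φ (φ' θ) θ)
    (hφ' : ∀ θ, HasDerivAt φ' (φ'' θ) θ) (hc : Continuous φ'') {a b l : ℝ} (hab : a ≤ b)
    (hl : 0 < l) (h1 : ∀ θ ∈ Icc a b, l ≤ |φ' θ|) (h2 : ∀ θ ∈ Icc a b, 0 ≤ φ'' θ) :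
    ‖∫ θ in a..b, Complex.exp (Complex.I * φ θ)‖ ≤ 4 / l := by
  have hne : ∀ θ ∈ Icc a b, φ' θ ≠ 0 := fun θ hθ h => by
    have := h1 θ hθ; rw [h, abs_zero] at this; linarith
  have hcφ : Continuous φ := continuous_iff_continuousAt.2 fun θ => (hφ θ).continuousAt
  have hcφ' : Continuous φ' := continuous_iff_continuousAt.2 fun θ => (hφ' θ).continuousAt
  set E : ℝ → ℂ := fun θ => Complex.exp (Complex.I * φ θ)
  have hcE : Continuous E := by fun_prop
  have hu : ∀ θ ∈ Icc a b, HasDerivAt (fun θ => (φ' θ)⁻¹) (-φ'' θ / φ' θ ^ 2) θ :=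
    fun θ hθ => (hφ' θ).inv (hne θ hθ)
  have hcu : ContinuousOn (fun θ => -φ'' θ / φ' θ ^ 2) (Icc a b) :=
    (hc.neg.continuousOn).div (hcφ'.pow 2).continuousOn fun θ hθ => pow_ne_zero 2 (hne θ hθ)
  have hui : IntervalIntegrable (fun θ => -φ'' θ / φ' θ ^ 2) volume a b :=
    (hcu.mono (by rw [uIcc_of_le hab])).intervalIntegrable
  -- Since E' = iφ'E, the integrand E equals (iφ')⁻¹ E', and integration by parts moves the
  -- derivative onto 1/φ'.
  have key := integral_mul_deriv_eq_deriv_mul (a := a) (b := b)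
    (u := fun θ => (((φ' θ)⁻¹ : ℝ) : ℂ)) (u' := fun θ => ((-φ'' θ / φ' θ ^ 2 : ℝ) : ℂ))
    (v := E) (v' := fun θ => E θ * (Complex.I * φ' θ))
    (fun θ hθ => (hu θ (by rwa [uIcc_of_le hab] at hθ)).ofReal_comp)
    (fun θ _ => hasDerivAt_cexp_phase hφ θ) ⟨hui.1.ofReal, hui.2.ofReal⟩
    (Continuous.intervalIntegrable (by fun_prop) _ _)
  have h3 : (∫ θ in a..b, (((φ' θ)⁻¹ : ℝ) : ℂ) * (E θ * (Complex.I * φ' θ)))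
      = Complex.I * ∫ θ in a..b, E θ := by
    rw [← intervalIntegral.integral_const_mul]
    refine integral_congr fun θ hθ => ?_
    rw [uIcc_of_le hab] at hθ
    have : (φ' θ : ℂ) ≠ 0 := by exact_mod_cast hne θ hθ
    push_cast
    field_simp
  have hinv : ∀ θ ∈ Icc a b, |(φ' θ)⁻¹| ≤ 1 / l := fun θ hθ => by
    rw [abs_inv, ← one_div]; exact one_div_le_one_div_of_le hl (h1 θ hθ)
  -- The derivative of 1/φ' has constant sign, so its absolute integral is the difference of the end
  -- values of 1/φ', each at most 1/l in size.
  have h4 : ‖∫ θ in a..b, ((-φ'' θ / φ' θ ^ 2 : ℝ) : ℂ) * E θ‖ ≤ 2 / l := by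
    have : ‖∫ θ in a..b, ((-φ'' θ / φ' θ ^ 2 : ℝ) : ℂ) * E θ‖
        ≤ ∫ θ in a..b, -(-φ'' θ / φ' θ ^ 2) := by
      refine norm_integral_le_of_norm_le hab ?_ hui.neg
      refine Filter.Eventually.of_forall fun θ hθ => ?_
      rw [norm_mul, norm_cexp_phase, mul_one, Complex.norm_real, Real.norm_eq_abs,
        abs_of_nonpos]
      exact div_nonpos_of_nonpos_of_nonneg (by linarith [h2 θ ⟨hθ.1.le, hθ.2⟩]) (by positivity)
    refine this.trans ?_
    rw [intervalIntegral.integral_neg, integral_eq_sub_of_hasDerivAt (f := fun θ => (φ' θ)⁻¹)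
      (fun θ hθ => hu θ (by rwa [uIcc_of_le hab] at hθ)) hui]
    have ha := abs_le.1 (hinv a ⟨le_rfl, hab⟩)
    have hb := abs_le.1 (hinv b ⟨hab, le_rfl⟩)
    have : 2 / l = 1 / l + 1 / l := by ring
    rw [this]; linarith
  rw [h3] at key
  have h5 : ‖∫ θ in a..b, E θ‖ = ‖Complex.I * ∫ θ in a..b, E θ‖ := by simp
  have h6 : ∀ θ ∈ Icc a b, ‖(((φ' θ)⁻¹ : ℝ) : ℂ) * E θ‖ ≤ 1 / l := fun θ hθ => by
    rw [norm_mul, norm_cexp_phase, mul_one, Complex.norm_real]; exact hinv θ hθ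
  rw [h5, key]
  refine (norm_sub_le _ _).trans ?_
  have : 4 / l = 1 / l + 1 / l + 2 / l := by ring
  rw [this]
  exact add_le_add ((norm_sub_le _ _).trans
    (add_le_add (h6 b ⟨hab, le_rfl⟩) (h6 a ⟨le_rfl, hab⟩))) h4

/-- Second derivative test. -/
theorem norm_integral_phase_le_of_deriv_two {φ φ' φ'' : ℝ → ℝ}
    (hφ : ∀ θ, HasDerivAt φ (φ' θ) θ) (hφ' : ∀ θ, HasDerivAt φ' (φ'' θ) θ) (hc : Continuous φ'')
    {a b l : ℝ} (hab : a ≤ b) (hl : 0 < l) (h2 : ∀ θ ∈ Icc a b, l ≤ φ'' θ) :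
    ‖∫ θ in a..b, Complex.exp (Complex.I * φ θ)‖ ≤ 10 / √l := by
  have hcφ : Continuous φ := continuous_iff_continuousAt.2 fun θ => (hφ θ).continuousAt
  have hcφ' : Continuous φ' := continuous_iff_continuousAt.2 fun θ => (hφ' θ).continuousAt
  have hmvt : ∀ x ∈ Icc a b, ∀ y ∈ Icc a b, x ≤ y → l * (y - x) ≤ φ' y - φ' x := by
    intro x hx y hy hxy
    refine (convex_Icc a b).mul_sub_le_image_sub_of_le_deriv hcφ'.continuousOn
      (fun θ _ => (hφ' θ).differentiableAt.differentiableWithinAt) (fun θ hθ => ?_) x hx y hy hxy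
    rw [(hφ' θ).deriv]
    exact h2 θ (interior_subset hθ)
  -- The point c is the zero of the increasing function φ', or the end point nearest to it when φ'
  -- keeps its sign. Away from c the derivative grows at rate l.
  obtain ⟨c, hc0, hcR, hcL⟩ : ∃ c ∈ Icc a b, (∀ θ ∈ Icc a b, c < θ → l * (θ - c) ≤ φ' θ) ∧
      ∀ θ ∈ Icc a b, θ < c → φ' θ ≤ -(l * (c - θ)) := by
    by_cases ha : 0 ≤ φ' a
    · refine ⟨a, ⟨le_rfl, hab⟩, fun θ hθ _ => ?_, fun θ hθ h => absurd hθ.1 (not_le.2 h)⟩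
      linarith [hmvt a ⟨le_rfl, hab⟩ θ hθ hθ.1]
    by_cases hb : φ' b ≤ 0
    · refine ⟨b, ⟨hab, le_rfl⟩, fun θ hθ h => absurd hθ.2 (not_le.2 h), fun θ hθ _ => ?_⟩
      linarith [hmvt θ hθ b ⟨hab, le_rfl⟩ hθ.2]
    push Not at ha hb
    obtain ⟨c, hc1, hc2⟩ := intermediate_value_Icc hab hcφ'.continuousOn ⟨ha.le, hb.le⟩
    refine ⟨c, hc1, fun θ hθ h => ?_, fun θ hθ h => ?_⟩
    · linarith [hmvt c hc1 θ hθ h.le]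
    · linarith [hmvt θ hθ c hc1 h.le]
  -- This radius balances the trivial bound 2δ near c with the first derivative bound 4 / (lδ) on
  -- either side.
  set δ : ℝ := 1 / √l
  have hsl : 0 < √l := Real.sqrt_pos.2 hl
  have hδ : 0 < δ := by positivity
  have hlδ : l * δ = √l := by
    simp only [δ]; rw [mul_one_div, div_eq_iff hsl.ne', Real.mul_self_sqrt hl.le]
  have hi : ∀ x y, IntervalIntegrable (fun θ => Complex.exp (Complex.I * φ θ)) volume x y :=
    fun x y => Continuous.intervalIntegrable (by fun_prop) _ _
  have ha1 : ‖∫ θ in a..max a (c - δ), Complex.exp (Complex.I * φ θ)‖ ≤ 4 / √l := by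
    rcases le_total a (c - δ) with h | h
    · rw [max_eq_right h, ← hlδ]
      have hb : ∀ θ ∈ Icc a (c - δ), θ ∈ Icc a b := fun θ hθ =>
        ⟨hθ.1, by linarith [hθ.2, hc0.2]⟩
      refine norm_integral_phase_le_of_monotone hφ hφ' hc h (by positivity) (fun θ hθ => ?_)
        fun θ hθ => hl.le.trans (h2 θ (hb θ hθ))
      have h3 := hcL θ (hb θ hθ) (by linarith [hθ.2])
      have h4 : l * δ ≤ l * (c - θ) := mul_le_mul_of_nonneg_left (by linarith [hθ.2]) hl.le
      exact le_abs.2 (Or.inr (by linarith))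
    · rw [max_eq_left h, integral_same, norm_zero]; positivity
  have hb1 : ‖∫ θ in min b (c + δ)..b, Complex.exp (Complex.I * φ θ)‖ ≤ 4 / √l := by
    rcases le_total (c + δ) b with h | h
    · rw [min_eq_right h, ← hlδ]
      have hb : ∀ θ ∈ Icc (c + δ) b, θ ∈ Icc a b := fun θ hθ =>
        ⟨by linarith [hθ.1, hc0.1], hθ.2⟩
      refine norm_integral_phase_le_of_monotone hφ hφ' hc h (by positivity) (fun θ hθ => ?_)
        fun θ hθ => hl.le.trans (h2 θ (hb θ hθ))
      have h3 := hcR θ (hb θ hθ) (by linarith [hθ.1])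
      have h4 : l * δ ≤ l * (θ - c) := mul_le_mul_of_nonneg_left (by linarith [hθ.1]) hl.le
      exact le_abs.2 (Or.inl (by linarith))
    · rw [min_eq_left h, integral_same, norm_zero]; positivity
  have hm1 : ‖∫ θ in max a (c - δ)..min b (c + δ), Complex.exp (Complex.I * φ θ)‖
      ≤ 2 / √l := by
    refine (norm_integral_le_of_norm_le_const (C := 1) fun θ _ => (norm_cexp_phase _).le).trans ?_
    have : 2 / √l = 2 * δ := by simp only [δ]; ring
    rw [this, one_mul, abs_le]
    have h3 : c - δ ≤ max a (c - δ) := le_max_right _ _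
    have h4 : min b (c + δ) ≤ c + δ := min_le_right _ _
    have h5 : max a (c - δ) ≤ c := max_le hc0.1 (by linarith)
    have h6 : c ≤ min b (c + δ) := le_min hc0.2 (by linarith)
    constructor <;> linarith
  rw [← integral_add_adjacent_intervals (hi a (max a (c - δ))) (hi _ b),
    ← integral_add_adjacent_intervals (hi (max a (c - δ)) (min b (c + δ))) (hi _ b)]
  refine (norm_add_le _ _).trans ((add_le_add ha1 ((norm_add_le _ _).trans
    (add_le_add hm1 hb1))).trans (le_of_eq ?_))
  ring

/-- An amplitude with bounded derivative can be inserted into an oscillatory integral. -/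
theorem SubintervalBound.norm_integral_mul_le {E : ℝ → ℂ} (hE : Continuous E) {a b K M : ℝ}
    (hab : a < b) (hEn : ∀ θ, ‖E θ‖ ≤ 1)
    (h : SubintervalBound E a b K) {g : ℝ → ℂ} (hg : ContDiffOn ℝ 1 g (Ioo a b))
    (hM : ∀ θ ∈ Ioo a b, ‖g θ‖ ≤ M) (hM' : ∀ θ ∈ Ioo a b, ‖deriv g θ‖ ≤ M) :
    ‖∫ θ in a..b, E θ * g θ‖ ≤ K * M * (1 + (b - a)) := by
  have hK : 0 ≤ K := (norm_nonneg _).trans (h a a le_rfl le_rfl hab.le)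
  obtain ⟨θ₀, hθ₀⟩ : (Ioo a b).Nonempty := nonempty_Ioo.2 hab
  have hM0 : 0 ≤ M := (norm_nonneg _).trans (hM θ₀ hθ₀)
  have hint : IntervalIntegrable (fun θ => E θ * g θ) volume a b := by
    rw [intervalIntegrable_iff_integrableOn_Ioo_of_le hab.le]
    refine Integrable.of_bound (C := M) ?_ ?_
    · exact (hE.continuousOn.mul hg.continuousOn).aestronglyMeasurable measurableSet_Ioo
    · refine (ae_restrict_iff' measurableSet_Ioo).2 (Filter.Eventually.of_forall fun θ hθ => ?_)
      rw [norm_mul]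
      exact (mul_le_mul (hEn θ) (hM θ hθ) (norm_nonneg _) zero_le_one).trans (one_mul M).le
  -- The amplitude is only known to be C¹ inside (a, b), so the estimate is made on compact
  -- subintervals and extended by continuity of the integral in its end points.
  have hsub : ∀ x y, a < x → x ≤ y → y < b →
      ‖∫ θ in x..y, E θ * g θ‖ ≤ K * M * (1 + (b - a)) := by
    intro x y hx hxy hy
    have hI : ∀ θ ∈ Icc x y, θ ∈ Ioo a b := fun θ hθ => ⟨hx.trans_le hθ.1, hθ.2.trans_lt hy⟩
    have hg' : ∀ θ ∈ Icc x y, HasDerivAt g (deriv g θ) θ := fun θ hθ =>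
      ((hg.differentiableOn one_ne_zero).differentiableAt
        (isOpen_Ioo.mem_nhds (hI θ hθ))).hasDerivAt
    have hgc : ContinuousOn (deriv g) (Icc x y) :=
      (hg.continuousOn_deriv_of_isOpen isOpen_Ioo le_rfl).mono hI
    -- The oscillating factor is replaced by its primitive from x; bounding this primitive at every
    -- θ is what the bound over all subintervals is for.
    have key := integral_mul_deriv_eq_deriv_mul (a := x) (b := y) (u := g) (u' := deriv g)
      (v := fun θ => ∫ s in x..θ, E s) (v' := E)
      (fun θ hθ => hg' θ (by rwa [uIcc_of_le hxy] at hθ))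
      (fun θ _ => integral_hasDerivAt_right (hE.intervalIntegrable _ _)
        hE.stronglyMeasurable.stronglyMeasurableAtFilter hE.continuousAt)
      (hgc.mono (by rw [uIcc_of_le hxy])).intervalIntegrable (hE.intervalIntegrable _ _)
    simp only [integral_same, mul_zero, sub_zero] at key
    rw [show (fun θ => E θ * g θ) = fun θ => g θ * E θ from funext fun θ => mul_comm _ _, key]
    have h1 : ‖g y * ∫ s in x..y, E s‖ ≤ M * K := by
      rw [norm_mul]
      exact mul_le_mul (hM y (hI y ⟨hxy, le_rfl⟩)) (h x y hx.le hxy hy.le) (norm_nonneg _) hM0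
    have h2 : ‖∫ θ in x..y, deriv g θ * ∫ s in x..θ, E s‖ ≤ M * K * (b - a) := by
      refine (intervalIntegral.norm_integral_le_of_norm_le_const (C := M * K) (f := fun θ => deriv g θ * ∫ s in x..θ, E s) fun θ hθ => ?_).trans ?_
      · rw [uIoc_of_le hxy] at hθ
        rw [norm_mul]
        exact mul_le_mul (hM' θ (hI θ ⟨hθ.1.le, hθ.2⟩))
          (h x θ hx.le hθ.1.le (hθ.2.trans hy.le)) (norm_nonneg _) hM0
      · rw [abs_of_nonneg (by linarith)]
        exact mul_le_mul_of_nonneg_left (by linarith) (by positivity)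
    refine (norm_sub_le _ _).trans ((add_le_add h1 h2).trans (le_of_eq ?_))
    ring
  have hcont : ContinuousOn (fun p : ℝ × ℝ => ∫ θ in p.1..p.2, E θ * g θ)
      (Icc a b ×ˢ Icc a b) := by
    have h0 : ContinuousOn (fun x => ∫ θ in a..x, E θ * g θ) (Icc a b) := by
      have := continuousOn_primitive_interval' hint left_mem_uIcc
      rwa [uIcc_of_le hab.le] at this
    have h1 : ContinuousOn (fun p : ℝ × ℝ => (∫ θ in a..p.2, E θ * g θ)
        - ∫ θ in a..p.1, E θ * g θ) (Icc a b ×ˢ Icc a b) :=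
      (h0.comp continuousOn_snd fun p hp => hp.2).sub
        (h0.comp continuousOn_fst fun p hp => hp.1)
    refine h1.congr fun p hp => ?_
    have hs : ∀ x ∈ Icc a b, IntervalIntegrable (fun θ => E θ * g θ) volume a x := fun x hx =>
      hint.mono_set (by rw [uIcc_of_le hx.1, uIcc_of_le hab.le]; exact Icc_subset_Icc_right hx.2)
    exact (integral_interval_sub_left (hs _ hp.2) (hs _ hp.1)).symm
  have hlim : Filter.Tendsto (fun ε : ℝ => ∫ θ in (a + ε)..(b - ε), E θ * g θ)
      (nhdsWithin 0 (Ioi 0)) (nhds (∫ θ in a..b, E θ * g θ)) := by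
    have h1 := hcont (a, b) ⟨⟨le_rfl, hab.le⟩, ⟨hab.le, le_rfl⟩⟩
    refine h1.tendsto.comp (f := fun ε : ℝ => ((a + ε, b - ε) : ℝ × ℝ)) ?_
    refine tendsto_nhdsWithin_iff.2 ⟨?_, ?_⟩
    · have : ContinuousAt (fun ε : ℝ => ((a + ε, b - ε) : ℝ × ℝ)) 0 := by fun_prop
      have h2 := this.tendsto
      simp only [add_zero, sub_zero] at h2
      exact h2.mono_left nhdsWithin_le_nhds
    · filter_upwards [Ioo_mem_nhdsGT (show (0 : ℝ) < (b - a) / 2 by linarith)] with ε hε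
      exact ⟨⟨by linarith [hε.1], by linarith [hε.2]⟩, ⟨by linarith [hε.2], by linarith [hε.1]⟩⟩
  refine le_of_tendsto hlim.norm ?_
  filter_upwards [Ioo_mem_nhdsGT (show (0 : ℝ) < (b - a) / 2 by linarith)] with ε hε
  exact hsub _ _ (by linarith [hε.1]) (by linarith [hε.2]) (by linarith [hε.1])

/-! ### The dispersion relation and decay of its phase integrals -/

/-- The dispersion relation of the free operator. -/
def omega (m θ : ℝ) : ℝ := √(m ^ 2 + 2 - 2 * Real.cos θ)

theorem omega_arg_pos {m : ℝ} (hm : 0 < m) (θ : ℝ) : 0 < m ^ 2 + 2 - 2 * Real.cos θ := by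
  nlinarith [Real.cos_le_one θ]

theorem omega_pos {m : ℝ} (hm : 0 < m) (θ : ℝ) : 0 < omega m θ :=
  Real.sqrt_pos.2 (omega_arg_pos hm θ)

theorem omega_sq {m : ℝ} (hm : 0 < m) (θ : ℝ) :
    omega m θ ^ 2 = m ^ 2 + 2 - 2 * Real.cos θ :=
  Real.sq_sqrt (omega_arg_pos hm θ).le

theorem omega_le {m : ℝ} (hm : 0 < m) (θ : ℝ) : omega m θ ≤ m + 2 :=
  Real.sqrt_le_iff.2 ⟨by positivity, by nlinarith [Real.neg_one_le_cos θ]⟩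

theorem hasDerivAt_omega {m : ℝ} (hm : 0 < m) (θ : ℝ) :
    HasDerivAt (omega m) (Real.sin θ / omega m θ) θ := by
  have h1 : HasDerivAt (fun θ => m ^ 2 + 2 - 2 * Real.cos θ) (2 * Real.sin θ) θ := by
    simpa using ((Real.hasDerivAt_cos θ).const_mul 2).const_sub (m ^ 2 + 2)
  have h2 := h1.sqrt (omega_arg_pos hm θ).ne'
  have h3 : 2 * Real.sin θ / (2 * √(m ^ 2 + 2 - 2 * Real.cos θ)) = Real.sin θ / omega m θ :=
    mul_div_mul_left _ _ two_ne_zero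
  rwa [h3] at h2

/-- The second derivative of the dispersion relation. -/
def omegaDeriv₂ (m θ : ℝ) : ℝ :=
  ((m ^ 2 + 2) * Real.cos θ - Real.cos θ ^ 2 - 1) / omega m θ ^ 3

theorem continuous_omega (m : ℝ) : Continuous (omega m) := by unfold omega; fun_prop

theorem hasDerivAt_omega_deriv {m : ℝ} (hm : 0 < m) (θ : ℝ) :
    HasDerivAt (fun θ => Real.sin θ / omega m θ) (omegaDeriv₂ m θ) θ := by
  have h0 := omega_pos hm θ
  refine ((Real.hasDerivAt_sin θ).div (hasDerivAt_omega hm θ) h0.ne').congr_deriv ?_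
  unfold omegaDeriv₂
  have h1 := omega_sq hm θ
  have h2 := Real.sin_sq_add_cos_sq θ
  field_simp
  linear_combination Real.cos θ * h1 - h2

theorem continuous_omegaDeriv₂ {m : ℝ} (hm : 0 < m) : Continuous (omegaDeriv₂ m) := by
  unfold omegaDeriv₂
  have := continuous_omega m
  exact Continuous.div (by fun_prop) (by fun_prop) fun θ => pow_ne_zero 3 (omega_pos hm θ).ne'

/-- The numerator of ω'' is a quadratic polynomial in cos θ whose roots have product one; one root c
lies in (0, 1), the other is 1/c. Hence ω'' changes sign on [0, π] only at arccos c, and Jordan's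
inequality makes the zero quantitatively simple. -/
theorem exists_inflection {m : ℝ} (hm : 0 < m) :
    ∃ θ₀ κ : ℝ, 0 < θ₀ ∧ θ₀ < Real.pi ∧ 0 < κ ∧
      (∀ θ ∈ Icc 0 θ₀, κ * (θ₀ - θ) ≤ omegaDeriv₂ m θ) ∧
      ∀ θ ∈ Icc θ₀ Real.pi, omegaDeriv₂ m θ ≤ -(κ * (θ - θ₀)) := by
  obtain ⟨c, hc0, hc1, hc⟩ : ∃ c : ℝ, 0 < c ∧ c < 1 ∧ (m ^ 2 + 2) * c - c ^ 2 - 1 = 0 := by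
    have : ∃ c ∈ Ioo (0 : ℝ) 1, (m ^ 2 + 2) * c - c ^ 2 - 1 = 0 :=
      intermediate_value_Ioo (f := fun c : ℝ => (m ^ 2 + 2) * c - c ^ 2 - 1) zero_le_one
        (by fun_prop) ⟨by norm_num, by nlinarith [sq_pos_of_pos hm]⟩
    obtain ⟨c, h1, h2⟩ := this
    exact ⟨c, h1.1, h1.2, h2⟩
  have hpi := Real.pi_pos
  set θ₀ := Real.arccos c
  have hcos : Real.cos θ₀ = c := Real.cos_arccos (by linarith) hc1.le
  have h0 : 0 < θ₀ := Real.arccos_pos.2 hc1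
  have hh : θ₀ < Real.pi / 2 := Real.arccos_lt_pi_div_two.2 hc0
  have hs : 0 < Real.sin (θ₀ / 2) := Real.sin_pos_of_pos_of_lt_pi (by linarith) (by linarith)
  -- This uses θ₀ < π/2: on the interval of half-sums the sine is smallest at the left end.
  have hsin : ∀ θ ∈ Icc 0 Real.pi, Real.sin (θ₀ / 2) ≤ Real.sin ((θ + θ₀) / 2) := by
    intro θ hθ
    rcases le_total ((θ + θ₀) / 2) (Real.pi / 2) with h | h
    · exact Real.sin_le_sin_of_le_of_le_pi_div_two (by linarith) h (by linarith [hθ.1])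
    · rw [← Real.sin_pi_sub ((θ + θ₀) / 2)]
      exact Real.sin_le_sin_of_le_of_le_pi_div_two (by linarith) (by linarith) (by linarith [hθ.2])
  have hfac : ∀ x : ℝ, (m ^ 2 + 2) * x - x ^ 2 - 1 = (x - c) * (1 / c - x) := by
    intro x
    field_simp
    linear_combination x * hc
  have h1c : 0 < 1 / c - 1 := by rw [sub_pos, lt_div_iff₀ hc0]; linarith
  set κ := 2 * Real.sin (θ₀ / 2) / Real.pi * (1 / c - 1) / (m + 2) ^ 3
  have hκ : 0 < κ := by positivity
  have hw : ∀ θ, 0 < omega m θ ^ 3 ∧ omega m θ ^ 3 ≤ (m + 2) ^ 3 := fun θ =>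
    ⟨pow_pos (omega_pos hm θ) 3, pow_le_pow_left₀ (omega_pos hm θ).le (omega_le hm θ) 3⟩
  have hjordan : ∀ x, 0 ≤ x → x ≤ Real.pi → x / Real.pi ≤ Real.sin (x / 2) := by
    intro x hx hx'
    have := Real.mul_le_sin (x := x / 2) (by linarith) (by linarith)
    calc x / Real.pi = 2 / Real.pi * (x / 2) := by ring
      _ ≤ _ := this
  refine ⟨θ₀, κ, h0, by linarith, hκ, fun θ hθ => ?_, fun θ hθ => ?_⟩
  · have hd : 2 * Real.sin (θ₀ / 2) / Real.pi * (θ₀ - θ) ≤ Real.cos θ - c := by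
      rw [← hcos, Real.cos_sub_cos, ← neg_sub θ₀ θ, neg_div, Real.sin_neg]
      have h1 := hsin θ ⟨hθ.1, by linarith [hθ.2]⟩
      have h2 := hjordan (θ₀ - θ) (by linarith [hθ.2]) (by linarith [hθ.1])
      have h3 := mul_le_mul h1 h2 (div_nonneg (by linarith [hθ.2]) hpi.le) (hs.le.trans h1)
      calc _ = 2 * (Real.sin (θ₀ / 2) * ((θ₀ - θ) / Real.pi)) := by ring
        _ ≤ 2 * (Real.sin ((θ + θ₀) / 2) * Real.sin ((θ₀ - θ) / 2)) := by linarith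
        _ = _ := by ring
    rw [omegaDeriv₂, hfac, le_div_iff₀ (hw θ).1]
    have hd0 : 0 ≤ 2 * Real.sin (θ₀ / 2) / Real.pi * (θ₀ - θ) :=
      mul_nonneg (by positivity) (by linarith [hθ.2])
    calc κ * (θ₀ - θ) * omega m θ ^ 3 ≤ κ * (θ₀ - θ) * (m + 2) ^ 3 :=
          mul_le_mul_of_nonneg_left (hw θ).2 (mul_nonneg hκ.le (by linarith [hθ.2]))
      _ = 2 * Real.sin (θ₀ / 2) / Real.pi * (θ₀ - θ) * (1 / c - 1) := by
          simp only [κ]; field_simp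
      _ ≤ (Real.cos θ - c) * (1 / c - Real.cos θ) :=
          mul_le_mul hd (by linarith [Real.cos_le_one θ]) h1c.le (hd0.trans hd)
  · have hd : 2 * Real.sin (θ₀ / 2) / Real.pi * (θ - θ₀) ≤ c - Real.cos θ := by
      rw [← hcos, Real.cos_sub_cos, ← neg_sub θ θ₀, neg_div, Real.sin_neg, add_comm θ₀]
      have h1 := hsin θ ⟨by linarith [hθ.1], hθ.2⟩
      have h2 := hjordan (θ - θ₀) (by linarith [hθ.1]) (by linarith [hθ.2])
      have h3 := mul_le_mul h1 h2 (div_nonneg (by linarith [hθ.1]) hpi.le) (hs.le.trans h1)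
      calc _ = 2 * (Real.sin (θ₀ / 2) * ((θ - θ₀) / Real.pi)) := by ring
        _ ≤ 2 * (Real.sin ((θ + θ₀) / 2) * Real.sin ((θ - θ₀) / 2)) := by linarith
        _ = _ := by ring
    rw [omegaDeriv₂, hfac, div_le_iff₀ (hw θ).1]
    have hd0 : 0 ≤ 2 * Real.sin (θ₀ / 2) / Real.pi * (θ - θ₀) :=
      mul_nonneg (by positivity) (by linarith [hθ.1])
    have h4 : κ * (θ - θ₀) * omega m θ ^ 3 ≤ (c - Real.cos θ) * (1 / c - Real.cos θ) :=
      calc κ * (θ - θ₀) * omega m θ ^ 3 ≤ κ * (θ - θ₀) * (m + 2) ^ 3 :=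
            mul_le_mul_of_nonneg_left (hw θ).2 (mul_nonneg hκ.le (by linarith [hθ.1]))
        _ = 2 * Real.sin (θ₀ / 2) / Real.pi * (θ - θ₀) * (1 / c - 1) := by
            simp only [κ]; field_simp
        _ ≤ _ := mul_le_mul hd (by linarith [Real.cos_le_one θ]) h1c.le (hd0.trans hd)
    linarith

/-- The oscillating exponential of the free evolution. -/
def phaseExp (m t p θ : ℝ) : ℂ := Complex.exp (Complex.I * ((t * omega m θ + p * θ : ℝ) : ℂ))

theorem continuous_phaseExp (m t p : ℝ) : Continuous (phaseExp m t p) := by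
  have := continuous_omega m
  unfold phaseExp
  fun_prop

theorem norm_phaseExp (m t p θ : ℝ) : ‖phaseExp m t p θ‖ = 1 := norm_cexp_phase _

theorem hasDerivAt_phase {m : ℝ} (hm : 0 < m) (t p θ : ℝ) :
    HasDerivAt (fun θ => t * omega m θ + p * θ) (t * (Real.sin θ / omega m θ) + p) θ := by
  exact (((hasDerivAt_omega hm θ).const_mul t).add ((hasDerivAt_id θ).const_mul p)).congr_deriv
    (by ring)

theorem hasDerivAt_phase_deriv {m : ℝ} (hm : 0 < m) (t p θ : ℝ) :
    HasDerivAt (fun θ => t * (Real.sin θ / omega m θ) + p) (t * omegaDeriv₂ m θ) θ := by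
  simpa using ((hasDerivAt_omega_deriv hm θ).const_mul t).add_const p

/-- Second derivative test for the phase, with either sign of the second derivative. -/
theorem subintervalBound_phaseExp_of_deriv_two {m : ℝ} (hm : 0 < m) {t p a b l : ℝ} (hl : 0 < l)
    (h : (∀ θ ∈ Icc a b, l ≤ t * omegaDeriv₂ m θ) ∨ ∀ θ ∈ Icc a b, t * omegaDeriv₂ m θ ≤ -l) :
    SubintervalBound (phaseExp m t p) a b (10 / √l) := by
  intro x y hx hxy hy
  have hc := continuous_omegaDeriv₂ hm
  rcases h with h | h
  · exact norm_integral_phase_le_of_deriv_two (hasDerivAt_phase hm t p)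
      (hasDerivAt_phase_deriv hm t p) (by fun_prop) hxy hl
      fun θ hθ => h θ ⟨hx.trans hθ.1, hθ.2.trans hy⟩
  · unfold phaseExp
    rw [← norm_integral_phase_neg]
    exact norm_integral_phase_le_of_deriv_two (φ'' := fun θ => -(t * omegaDeriv₂ m θ))
      (fun θ => (hasDerivAt_phase hm t p θ).neg)
      (fun θ => (hasDerivAt_phase_deriv hm t p θ).neg) (by fun_prop) hxy hl
      fun θ hθ => by linarith [h θ ⟨hx.trans hθ.1, hθ.2.trans hy⟩]

/-- First derivative test for the phase. -/
theorem subintervalBound_phaseExp_of_deriv_one {m : ℝ} (hm : 0 < m) {t p a b l : ℝ} (hl : 0 < l)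
    (h1 : ∀ θ ∈ Icc a b, l ≤ |t * (Real.sin θ / omega m θ) + p|)
    (h : (∀ θ ∈ Icc a b, 0 ≤ t * omegaDeriv₂ m θ) ∨ ∀ θ ∈ Icc a b, t * omegaDeriv₂ m θ ≤ 0) :
    SubintervalBound (phaseExp m t p) a b (4 / l) := by
  intro x y hx hxy hy
  have hc := continuous_omegaDeriv₂ hm
  rcases h with h | h
  · exact norm_integral_phase_le_of_monotone (hasDerivAt_phase hm t p)
      (hasDerivAt_phase_deriv hm t p) (by fun_prop) hxy hl
      (fun θ hθ => h1 θ ⟨hx.trans hθ.1, hθ.2.trans hy⟩)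
      fun θ hθ => h θ ⟨hx.trans hθ.1, hθ.2.trans hy⟩
  · unfold phaseExp
    rw [← norm_integral_phase_neg]
    exact norm_integral_phase_le_of_monotone (φ'' := fun θ => -(t * omegaDeriv₂ m θ))
      (fun θ => (hasDerivAt_phase hm t p θ).neg)
      (fun θ => (hasDerivAt_phase_deriv hm t p θ).neg) (by fun_prop) hxy hl
      (fun θ hθ => by rw [abs_neg]; exact h1 θ ⟨hx.trans hθ.1, hθ.2.trans hy⟩)
      fun θ hθ => by linarith [h θ ⟨hx.trans hθ.1, hθ.2.trans hy⟩]

/-- The oscillatory integral decays as `t ^ (-1/3)`, uniformly in the space variable. -/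
theorem exists_subintervalBound_third {m : ℝ} (hm : 0 < m) :
    ∃ C : ℝ, ∀ t p : ℝ, 1 ≤ t →
      SubintervalBound (phaseExp m t p) 0 Real.pi (C * t ^ (-(1 / 3) : ℝ)) := by
  obtain ⟨θ₀, κ, h0, hpi, hκ, hL, hR⟩ := exists_inflection hm
  refine ⟨10 / √κ + (2 + 10 / √κ), fun t p ht => ?_⟩
  have ht0 : 0 < t := by linarith
  -- With η = t^{-1/3} the excluded neighbourhood has length 2η, and outside it the second
  -- derivative of the phase is at least tκη = κη⁻², so both contributions are of order η.
  set η : ℝ := t ^ (-(1 / 3) : ℝ)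
  have hη : 0 < η := Real.rpow_pos_of_pos ht0 _
  have hl : 0 < t * (κ * η) := by positivity
  have hval : 10 / √(t * (κ * η)) = 10 / √κ * η := by
    have h3 : t * η = (η⁻¹) ^ 2 := by
      simp only [η]
      rw [← Real.rpow_neg ht0.le, ← Real.rpow_natCast, ← Real.rpow_mul ht0.le]
      nth_rewrite 1 [← Real.rpow_one t]
      rw [← Real.rpow_add ht0]; norm_num
    rw [show t * (κ * η) = κ * (η⁻¹) ^ 2 by rw [← h3]; ring, Real.sqrt_mul hκ.le,
      Real.sqrt_sq (by positivity)]
    have := Real.sqrt_pos.2 hκ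
    field_simp
  have hE := continuous_phaseExp m t p
  have h1 : SubintervalBound (phaseExp m t p) 0 (θ₀ - η) (10 / √κ * η) := by
    rw [← hval]
    refine subintervalBound_phaseExp_of_deriv_two hm hl (Or.inl fun θ hθ => ?_)
    refine mul_le_mul_of_nonneg_left (le_trans ?_ (hL θ ⟨hθ.1, by linarith [hθ.2]⟩)) ht0.le
    exact mul_le_mul_of_nonneg_left (by linarith [hθ.2]) hκ.le
  have h2 : SubintervalBound (phaseExp m t p) (θ₀ - η) (θ₀ + η) (2 * η) :=
    subintervalBound_of_norm_le_one (fun θ => (norm_phaseExp m t p θ).le) (by linarith)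
  have h3 : SubintervalBound (phaseExp m t p) (θ₀ + η) Real.pi (10 / √κ * η) := by
    rw [← hval]
    refine subintervalBound_phaseExp_of_deriv_two hm hl (Or.inr fun θ hθ => ?_)
    have h4 := hR θ ⟨by linarith [hθ.1], hθ.2⟩
    have h5 : κ * η ≤ κ * (θ - θ₀) := mul_le_mul_of_nonneg_left (by linarith [hθ.1]) hκ.le
    calc t * omegaDeriv₂ m θ ≤ t * (-(κ * η)) :=
          mul_le_mul_of_nonneg_left (by linarith) ht0.le
      _ = _ := by ring
  refine (h1.trans hE (h2.trans hE h3 (by positivity) (by positivity)) (by positivity)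
    (by positivity)).mono (le_of_eq (by ring))

/-- The oscillatory integral decays as `t ^ (-1/2)` well inside the light cone. -/
theorem exists_subintervalBound_half {m : ℝ} (hm : 0 < m) :
    ∃ C c : ℝ, 0 < c ∧ ∀ t p : ℝ, 1 ≤ t → |p| ≤ c * t →
      SubintervalBound (phaseExp m t p) 0 Real.pi (C * t ^ (-(1 / 2) : ℝ)) := by
  obtain ⟨θ₀, κ, h0, hpi, hκ, hL, hR⟩ := exists_inflection hm
  have hv : 0 < Real.sin θ₀ / omega m θ₀ :=
    div_pos (Real.sin_pos_of_pos_of_lt_pi h0 hpi) (omega_pos hm θ₀)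
  set v := Real.sin θ₀ / omega m θ₀
  -- Near the inflection point the group velocity stays above half its value there. Outside this
  -- fixed neighbourhood the second derivative test already gives t^{-1/2}.
  obtain ⟨η, hη, hη0, hηpi, hηv⟩ : ∃ η > 0, η ≤ θ₀ ∧ η ≤ Real.pi - θ₀ ∧
      ∀ θ, |θ - θ₀| ≤ η → v / 2 ≤ Real.sin θ / omega m θ := by
    have hc := (hasDerivAt_omega_deriv hm θ₀).continuousAt
    obtain ⟨δ, hδ, h⟩ := Metric.continuousAt_iff.1 hc (v / 2) (by positivity)
    refine ⟨min (δ / 2) (min θ₀ (Real.pi - θ₀)), lt_min (by positivity)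
      (lt_min h0 (by linarith)), (min_le_right _ _).trans (min_le_left _ _),
      (min_le_right _ _).trans (min_le_right _ _), fun θ hθ => ?_⟩
    have := h (x := θ) (by rw [Real.dist_eq]; linarith [min_le_left (δ / 2) (min θ₀ (Real.pi - θ₀))])
    rw [Real.dist_eq, abs_lt] at this
    linarith [this.1]
  refine ⟨10 / √(κ * η) + (16 / v + (16 / v + 10 / √(κ * η))), v / 4, by positivity,
    fun t p ht hp => ?_⟩
  have ht0 : 0 < t := by linarith
  have hsq : t ^ (-(1 / 2) : ℝ) = (√t)⁻¹ := by
    rw [Real.rpow_neg ht0.le, Real.sqrt_eq_rpow]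
  have hst : 0 < √t := Real.sqrt_pos.2 ht0
  have hκη : 0 < √(κ * η) := Real.sqrt_pos.2 (by positivity)
  have hE := continuous_phaseExp m t p
  have hl : 0 < t * (κ * η) := by positivity
  have hval : 10 / √(t * (κ * η)) = 10 / √(κ * η) * t ^ (-(1 / 2) : ℝ) := by
    rw [Real.sqrt_mul ht0.le, hsq]; field_simp
  have hvt : 4 / (t * (v / 4)) ≤ 16 / v * t ^ (-(1 / 2) : ℝ) := by
    rw [hsq]
    have h1 : √t ≤ t := Real.sqrt_le_self_iff.2 (Or.inr ht) 
    calc 4 / (t * (v / 4)) = 16 / v * t⁻¹ := by field_simp; norm_num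
      _ ≤ _ := mul_le_mul_of_nonneg_left (inv_anti₀ hst h1) (by positivity)
  -- The velocity term is at least tv/2 and |p| ≤ tv/4, so the phase has no stationary point here.
  -- The neighbourhood is later cut at θ₀ because the first derivative test needs a second
  -- derivative of one sign.
  have hvel : ∀ θ, |θ - θ₀| ≤ η → t * (v / 4) ≤ |t * (Real.sin θ / omega m θ) + p| := by
    intro θ hθ
    have h1 := mul_le_mul_of_nonneg_left (hηv θ hθ) ht0.le
    have h2 := (abs_le.1 hp).1
    exact le_abs.2 (Or.inl (by linarith))
  have h1 : SubintervalBound (phaseExp m t p) 0 (θ₀ - η)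
      (10 / √(κ * η) * t ^ (-(1 / 2) : ℝ)) := by
    rw [← hval]
    refine subintervalBound_phaseExp_of_deriv_two hm hl (Or.inl fun θ hθ => ?_)
    refine mul_le_mul_of_nonneg_left (le_trans ?_ (hL θ ⟨hθ.1, by linarith [hθ.2]⟩)) ht0.le
    exact mul_le_mul_of_nonneg_left (by linarith [hθ.2]) hκ.le
  have h4 : SubintervalBound (phaseExp m t p) (θ₀ + η) Real.pi
      (10 / √(κ * η) * t ^ (-(1 / 2) : ℝ)) := by
    rw [← hval]
    refine subintervalBound_phaseExp_of_deriv_two hm hl (Or.inr fun θ hθ => ?_)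
    have h4 := hR θ ⟨by linarith [hθ.1], hθ.2⟩
    have h5 : κ * η ≤ κ * (θ - θ₀) := mul_le_mul_of_nonneg_left (by linarith [hθ.1]) hκ.le
    calc t * omegaDeriv₂ m θ ≤ t * (-(κ * η)) :=
          mul_le_mul_of_nonneg_left (by linarith) ht0.le
      _ = _ := by ring
  have h2 : SubintervalBound (phaseExp m t p) (θ₀ - η) θ₀ (16 / v * t ^ (-(1 / 2) : ℝ)) := by
    refine (subintervalBound_phaseExp_of_deriv_one hm (by positivity) (fun θ hθ => hvel θ ?_)
      (Or.inl fun θ hθ => mul_nonneg ht0.le ?_)).mono hvt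
    · exact abs_le.2 ⟨by linarith [hθ.1], by linarith [hθ.2]⟩
    · exact (mul_nonneg hκ.le (by linarith [hθ.2])).trans (hL θ ⟨by linarith [hθ.1], hθ.2⟩)
  have h3 : SubintervalBound (phaseExp m t p) θ₀ (θ₀ + η) (16 / v * t ^ (-(1 / 2) : ℝ)) := by
    refine (subintervalBound_phaseExp_of_deriv_one hm (by positivity) (fun θ hθ => hvel θ ?_)
      (Or.inr fun θ hθ => mul_nonpos_of_nonneg_of_nonpos ht0.le ?_)).mono hvt
    · exact abs_le.2 ⟨by linarith [hθ.1], by linarith [hθ.2]⟩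
    · have := hR θ ⟨hθ.1, by linarith [hθ.2]⟩
      have h5 : 0 ≤ κ * (θ - θ₀) := mul_nonneg hκ.le (by linarith [hθ.1])
      linarith
  have ht2 : 0 < t ^ (-(1 / 2) : ℝ) := Real.rpow_pos_of_pos ht0 _
  refine (h1.trans hE (h2.trans hE (h3.trans hE h4 ?_ ?_) ?_ ?_) ?_ ?_).mono
    (le_of_eq (by ring)) <;> positivity

end DiscreteDirac
end

/-! ### Functional calculus and Stone's formula -/

noncomputable section

namespace DiscreteDirac

open MeasureTheory Set Filter Topology ComplexConjugate

section Spectral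

variable {H : Type*} [NormedAddCommGroup H] [InnerProductSpace ℂ H] [CompleteSpace H]
variable {H' : Type*} [NormedAddCommGroup H'] [InnerProductSpace ℂ H'] [CompleteSpace H']

/-- The continuous functional calculus respects intertwining operators. -/
theorem cfc_comp_of_intertwine {A : H →L[ℂ] H} {B : H' →L[ℂ] H'} (hA : IsSelfAdjoint A)
    (hB : IsSelfAdjoint B) {J : H' →L[ℂ] H} (h : A ∘L J = J ∘L B) {f : ℂ → ℂ}
    (hf : Continuous f) : cfc f A ∘L J = J ∘L cfc f B := by
  have hAn := hA.isStarNormal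
  have hBn := hB.isStarNormal
  -- On the union of the two spectra both calculi are restrictions of one algebra of continuous
  -- functions, and Stone–Weierstrass induction reduces the claim to constants, the identity and its
  -- conjugate.
  set K : Set ℂ := spectrum ℂ A ∪ spectrum ℂ B
  have hK : IsCompact K := (spectrum.isCompact A).union (spectrum.isCompact B)
  have : CompactSpace K := isCompact_iff_compactSpace.1 hK
  let iA : C(spectrum ℂ A, K) := ⟨Set.inclusion subset_union_left, by fun_prop⟩
  let iB : C(spectrum ℂ B, K) := ⟨Set.inclusion subset_union_right, by fun_prop⟩
  have key : ∀ g : C(K, ℂ), cfcHom hAn (g.comp iA) ∘L J = J ∘L cfcHom hBn (g.comp iB) := by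
    intro g
    induction g using ContinuousMap.induction_on_of_compact with
    | const r =>
      have e1 : (ContinuousMap.const K r).comp iA = algebraMap ℂ _ r := rfl
      have e2 : (ContinuousMap.const K r).comp iB = algebraMap ℂ _ r := rfl
      rw [e1, e2, AlgHomClass.commutes, AlgHomClass.commutes]
      ext v
      simp [Algebra.algebraMap_eq_smul_one]
    | id =>
      have e1 := cfcHom_id (R := ℂ) hAn
      have e2 := cfcHom_id (R := ℂ) hBn
      change cfcHom hAn (ContinuousMap.restrict _ (ContinuousMap.id ℂ)) ∘L J
        = J ∘L cfcHom hBn (ContinuousMap.restrict _ (ContinuousMap.id ℂ))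
      rw [e1, e2, h]
    | star_id =>
      change cfcHom hAn (star (ContinuousMap.restrict _ (ContinuousMap.id ℂ))) ∘L J
        = J ∘L cfcHom hBn (star (ContinuousMap.restrict _ (ContinuousMap.id ℂ)))
      rw [map_star, map_star, cfcHom_id hAn, cfcHom_id hBn, hA.star_eq, hB.star_eq, h]
    | add f g hf hg =>
      change cfcHom hAn (f.comp iA + g.comp iA) ∘L J = J ∘L cfcHom hBn (f.comp iB + g.comp iB)
      rw [map_add, map_add, ContinuousLinearMap.add_comp, hf, hg, ContinuousLinearMap.comp_add]
    | mul f g hf hg =>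
      change cfcHom hAn (f.comp iA * g.comp iA) ∘L J = J ∘L cfcHom hBn (f.comp iB * g.comp iB)
      rw [map_mul, map_mul, ContinuousLinearMap.mul_def, ContinuousLinearMap.mul_def,
        ContinuousLinearMap.comp_assoc, hg, ← ContinuousLinearMap.comp_assoc, hf,
        ContinuousLinearMap.comp_assoc]
    | frequently f hfr =>
      have c1 : Continuous fun g : C(K, ℂ) => cfcHom hAn (g.comp iA) ∘L J :=
        ((cfcHom_continuous hAn).comp (ContinuousMap.continuous_precomp iA)).clm_comp
          continuous_const
      have c2 : Continuous fun g : C(K, ℂ) => J ∘L cfcHom hBn (g.comp iB) :=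
        continuous_const.clm_comp
          ((cfcHom_continuous hBn).comp (ContinuousMap.continuous_precomp iB))
      exact (isClosed_eq c1 c2).closure_subset (mem_closure_iff_frequently.2 hfr)
  rw [cfc_apply f A hAn hf.continuousOn, cfc_apply f B hBn hf.continuousOn]
  exact key ⟨fun z => f z, by fun_prop⟩

/-- An eigenvector intertwines A with multiplication by l on the one-dimensional space ℂ. -/
theorem cfc_apply_eigenvector {A : H →L[ℂ] H} (hA : IsSelfAdjoint A) {w : H} {l : ℝ}
    (hw : A w = (l : ℂ) • w) {f : ℂ → ℂ} (hf : Continuous f) : cfc f A w = f l • w := by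
  have hB : IsSelfAdjoint (algebraMap ℂ (ℂ →L[ℂ] ℂ) (l : ℂ)) := by
    rw [isSelfAdjoint_iff, ← algebraMap_star_comm]; simp
  have h := cfc_comp_of_intertwine hA hB (J := ContinuousLinearMap.toSpanSingleton ℂ w)
    (by ext; simp [hw, Algebra.algebraMap_eq_smul_one]) hf
  have h1 := congrArg (fun T : ℂ →L[ℂ] H => T 1) h
  rw [cfc_algebraMap] at h1
  simpa using h1

theorem exp_eq_cfc {A : H →L[ℂ] H} (hA : IsSelfAdjoint A) (c : ℂ) :
    NormedSpace.exp (c • A) = cfc (fun z => Complex.exp (c * z)) A := by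
  have hAn := hA.isStarNormal
  have h2 : IsStarNormal (c • A) := by
    refine ⟨?_⟩
    rw [star_smul, hA.star_eq]
    exact ((Commute.refl A).smul_left _).smul_right _
  rw [← CFC.exp_eq_normedSpace_exp (𝕜 := ℂ) h2, ← cfc_comp_smul c NormedSpace.exp A
    (by rw [← Complex.exp_eq_exp_ℂ]; exact Complex.continuous_exp.continuousOn)]
  simp only [← Complex.exp_eq_exp_ℂ, smul_eq_mul]

/-- The resolvent, applied to a vector, through the functional calculus. -/
theorem cfc_inv_sub_apply {A : H →L[ℂ] H} (hA : IsSelfAdjoint A) {z : ℂ} (hz : z.im ≠ 0)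
    {g y : H} (hg : A g - z • g = y) : cfc (fun s => (s - z)⁻¹) A y = g := by
  have hAn := hA.isStarNormal
  have hne : ∀ s ∈ spectrum ℂ A, s - z ≠ 0 := fun s hs h => by
    rw [sub_eq_zero] at h
    rw [hA.mem_spectrum_eq_re hs] at h
    exact hz (by rw [← h]; simp)
  have h1 : cfc (fun s : ℂ => s - z) A = A - algebraMap ℂ _ z := by
    rw [cfc_sub _ _ A, cfc_id' ℂ A, cfc_const z A]
  have hc : ContinuousOn (fun s : ℂ => (s - z)⁻¹) (spectrum ℂ A) :=
    ContinuousOn.inv₀ (by fun_prop) hne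
  have h2 : cfc (fun s : ℂ => (s - z)⁻¹) A * (A - algebraMap ℂ _ z) = 1 := by
    rw [← h1, ← cfc_mul _ _ A hc (by fun_prop), ← cfc_one ℂ A]
    exact cfc_congr fun s hs => by simpa using inv_mul_cancel₀ (hne s hs)
  have h3 := congrArg (fun T : H →L[ℂ] H => T g) h2
  rw [← hg]
  simpa [Algebra.algebraMap_eq_smul_one] using h3

theorem cfc_inv_sub_conj {A : H →L[ℂ] H} (hA : IsSelfAdjoint A) (z : ℂ) :
    cfc (fun s => (s - conj z)⁻¹) A = star (cfc (fun s => (s - z)⁻¹) A) := by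
  rw [← cfc_star]
  refine cfc_congr fun s hs => ?_
  simp only [RCLike.star_def, map_inv₀, map_sub]
  congr 2
  rw [hA.mem_spectrum_eq_re hs, Complex.conj_ofReal]

/-- The Poisson smoothing of `f` at scale `ε`. -/
def poissonSmoothing (f : ℝ → ℂ) (ε : ℝ) (s : ℂ) : ℂ :=
  ∫ l : ℝ, f l * ((2 * Real.pi * Complex.I)⁻¹ *
    ((s - (l + ε * Complex.I))⁻¹ - (s - conj (l + ε * Complex.I : ℂ))⁻¹))

/-- On the real axis the difference of the two resolvents is the Poisson kernel of width ε.
Rescaling by ε makes the kernel independent of ε, and the right-hand side stays meaningful at ε = 0.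
-/
theorem poissonSmoothing_ofReal {f : ℝ → ℂ} {ε : ℝ} (hε : 0 < ε) (s : ℝ) :
    poissonSmoothing f ε s =
      ∫ v : ℝ, f (s + ε * v) * (((1 + v ^ 2)⁻¹ / Real.pi : ℝ) : ℂ) := by
  have h1 : poissonSmoothing f ε s =
      ∫ l : ℝ, f l * ((ε * ((s - l) ^ 2 + ε ^ 2)⁻¹ / Real.pi : ℝ) : ℂ) := by
    refine integral_congr_ae (Eventually.of_forall fun l => ?_)
    have h2 : ((s : ℂ) - (l + ε * Complex.I)) ≠ 0 := fun h => by
      have := congrArg Complex.im h; simp at this; exact hε.ne' this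
    have h3 : ((s : ℂ) - (l - ε * Complex.I)) ≠ 0 := fun h => by
      have := congrArg Complex.im h; simp at this; exact hε.ne' this
    have h4 : (((s - l) ^ 2 + ε ^ 2 : ℝ) : ℂ)
        = (s - (l + ε * Complex.I)) * (s - (l - ε * Complex.I)) := by
      push_cast; linear_combination ((ε : ℂ) ^ 2) * Complex.I_sq
    have h5 : conj (l + ε * Complex.I : ℂ) = l - ε * Complex.I := by
      simp [Complex.conj_ofReal, sub_eq_add_neg]
    have hpi : (Real.pi : ℂ) ≠ 0 := by exact_mod_cast Real.pi_ne_zero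
    simp only [h5]
    have h9 : ((s : ℂ) - (l - ε * Complex.I)) - (s - (l + ε * Complex.I))
        = 2 * ε * Complex.I := by ring
    rw [Complex.ofReal_div, Complex.ofReal_mul, Complex.ofReal_inv, h4, inv_sub_inv h2 h3, h9]
    field_simp
  rw [h1]
  have h6 := Measure.integral_comp_mul_left
    (fun l : ℝ => f (s + l) * ((ε * (l ^ 2 + ε ^ 2)⁻¹ / Real.pi : ℝ) : ℂ)) ε
  have h7 := integral_add_left_eq_self (μ := volume)
    (fun l : ℝ => f l * ((ε * ((s - l) ^ 2 + ε ^ 2)⁻¹ / Real.pi : ℝ) : ℂ)) s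
  rw [← h7]
  have h8 : ∀ l : ℝ, (s - (s + l)) ^ 2 = l ^ 2 := fun l => by ring
  simp only [h8]
  have h9 : ε • (∫ v : ℝ, f (s + ε * v) * ((ε * ((ε * v) ^ 2 + ε ^ 2)⁻¹ / Real.pi : ℝ) : ℂ))
      = ∫ l : ℝ, f (s + l) * ((ε * (l ^ 2 + ε ^ 2)⁻¹ / Real.pi : ℝ) : ℂ) := by
    rw [h6, abs_of_pos (inv_pos.2 hε), smul_inv_smul₀ hε.ne']
  rw [← h9, ← integral_smul]
  refine integral_congr_ae (Eventually.of_forall fun v => ?_)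
  have h10 : ε * (ε * ((ε * v) ^ 2 + ε ^ 2)⁻¹ / Real.pi) = (1 + v ^ 2)⁻¹ / Real.pi := by
    have : (ε * v) ^ 2 + ε ^ 2 = ε ^ 2 * (1 + v ^ 2) := by ring
    rw [this]
    field_simp
  simp only [Complex.real_smul]
  rw [← h10]
  push_cast
  ring

/-- The rescaled integral is jointly continuous in ε and s, including at ε = 0; compactness of K
makes the convergence uniform. -/
theorem tendstoUniformlyOn_poissonSmoothing {f : ℝ → ℂ} (hf : Continuous f)
    (hfc : HasCompactSupport f) {K : Set ℂ} (hK : IsCompact K) (hKr : ∀ z ∈ K, z = (z.re : ℂ)) :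
    TendstoUniformlyOn (poissonSmoothing f) (fun z => f z.re) (𝓝[>] 0) K ∧
      ∀ ε > 0, ContinuousOn (poissonSmoothing f ε) K := by
  obtain ⟨M, hM⟩ := hf.bounded_above_of_compact_support hfc
  set Φ : ℝ → K → ℂ := fun ε s =>
    ∫ v : ℝ, f ((s : ℂ).re + ε * v) * (((1 + v ^ 2)⁻¹ / Real.pi : ℝ) : ℂ)
  have hcont : Continuous (fun q : ℝ × K => Φ q.1 q.2) := by
    refine continuous_of_dominated (bound := fun v => M * ((1 + v ^ 2)⁻¹ / Real.pi)) ?_ ?_ ?_ ?_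
    · intro q
      have : ∀ v : ℝ, 1 + v ^ 2 ≠ 0 := fun v => by positivity
      exact Continuous.aestronglyMeasurable (by fun_prop (disch := assumption))
    · intro q
      refine Eventually.of_forall fun v => ?_
      have h0 : 0 ≤ (1 + v ^ 2)⁻¹ / Real.pi := by positivity
      rw [norm_mul, Complex.norm_real, Real.norm_of_nonneg h0]
      exact mul_le_mul_of_nonneg_right (hM _) h0
    · exact (integrable_inv_one_add_sq.div_const _).const_mul _
    · refine Eventually.of_forall fun v => ?_
      fun_prop
  have : CompactSpace K := isCompact_iff_compactSpace.1 hK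
  have h1 := Continuous.tendstoUniformly Φ hcont 0
  have h0 : Φ 0 = (fun z : ℂ => f z.re) ∘ Subtype.val := by
    ext s
    simp only [Φ, zero_mul, add_zero, Function.comp_apply]
    rw [integral_const_mul, integral_complex_ofReal, integral_div, integral_univ_inv_one_add_sq,
      div_self Real.pi_ne_zero]
    simp
  rw [h0] at h1
  have h3 : ∀ ε > 0, ∀ s : K, poissonSmoothing f ε s = Φ ε s := fun ε hε s => by
    have h4 := hKr s s.2
    rw [h4, poissonSmoothing_ofReal hε]
  refine ⟨?_, fun ε hε => ?_⟩
  · rw [tendstoUniformlyOn_iff_tendstoUniformly_comp_coe]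
    intro u hu
    filter_upwards [(h1 u hu).filter_mono nhdsWithin_le_nhds, self_mem_nhdsWithin] with ε h hε s
    rw [h3 ε hε]
    exact h s
  · rw [continuousOn_iff_continuous_domRestrict]
    have h5 : Continuous (Φ ε) := hcont.comp (Continuous.prodMk_right ε)
    exact h5.congr fun s => (h3 ε hε s).symm

/-- The functional calculus commutes with integration over the parameter l, so the smoothing of f
becomes an average of resolvent differences. -/
theorem cfc_poissonSmoothing {A : H →L[ℂ] H} (hA : IsSelfAdjoint A) {f : ℝ → ℂ}
    (hf : Continuous f) (hfc : HasCompactSupport f) {ε : ℝ} (hε : 0 < ε) :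
    Integrable (fun l : ℝ => f l • (2 * Real.pi * Complex.I : ℂ)⁻¹ •
      (cfc (fun s => (s - (l + ε * Complex.I))⁻¹) A
        - star (cfc (fun s => (s - (l + ε * Complex.I))⁻¹) A))) ∧
    cfc (poissonSmoothing f ε) A = ∫ l : ℝ, f l • (2 * Real.pi * Complex.I : ℂ)⁻¹ •
      (cfc (fun s => (s - (l + ε * Complex.I))⁻¹) A
        - star (cfc (fun s => (s - (l + ε * Complex.I))⁻¹) A)) := by
  have hAn := hA.isStarNormal
  have hne : ∀ (l : ℝ), ∀ s ∈ spectrum ℂ A, s - (l + ε * Complex.I) ≠ 0 := fun l s hs h => by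
    rw [hA.mem_spectrum_eq_re hs] at h
    have := congrArg Complex.im h; simp at this; exact hε.ne' this
  have hne' : ∀ (l : ℝ), ∀ s ∈ spectrum ℂ A, s - conj (l + ε * Complex.I : ℂ) ≠ 0 :=
    fun l s hs h => by
      rw [hA.mem_spectrum_eq_re hs] at h
      have := congrArg Complex.im h; simp at this; exact hε.ne' this
  set F : ℝ → ℂ → ℂ := fun l s => f l * ((2 * Real.pi * Complex.I)⁻¹ *
    ((s - (l + ε * Complex.I))⁻¹ - (s - conj (l + ε * Complex.I : ℂ))⁻¹))
  have hFc : ContinuousOn (Function.uncurry F) (univ ×ˢ spectrum ℂ A) := by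
    refine ContinuousOn.mul (by fun_prop) (ContinuousOn.mul continuousOn_const
      (ContinuousOn.sub (ContinuousOn.inv₀ (by fun_prop) ?_) (ContinuousOn.inv₀ ?_ ?_)))
    · exact fun q hq => hne q.1 q.2 hq.2
    · exact Continuous.continuousOn (continuous_snd.sub (Complex.continuous_conj.comp (by fun_prop)))
    · exact fun q hq => hne' q.1 q.2 hq.2
  set c := ‖(2 * Real.pi * Complex.I : ℂ)⁻¹‖ * (ε⁻¹ + ε⁻¹)
  have hb : ∀ᵐ l : ℝ, ∀ s ∈ spectrum ℂ A, ‖F l s‖ ≤ ‖f l‖ * c := by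
    refine Eventually.of_forall fun l s hs => ?_
    simp only [F, c, norm_mul]
    gcongr
    have hi : ∀ w : ℂ, |w.im| = ε → ‖w⁻¹‖ ≤ ε⁻¹ := fun w hw => by
      rw [norm_inv]
      exact inv_anti₀ hε (hw ▸ Complex.abs_im_le_norm w)
    have him : s.im = 0 := by rw [hA.mem_spectrum_eq_re hs]; simp
    refine (norm_sub_le _ _).trans (add_le_add (hi _ ?_) (hi _ ?_)) <;>
      simp [him, abs_of_pos hε]
  have hi : HasFiniteIntegral (fun l => ‖f l‖ * c) volume :=
    ((hf.integrable_of_hasCompactSupport hfc).norm.mul_const c).2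
  have hFl : ∀ l : ℝ, cfc (F l) A = f l • (2 * Real.pi * Complex.I : ℂ)⁻¹ •
      (cfc (fun s => (s - (l + ε * Complex.I))⁻¹) A
        - star (cfc (fun s => (s - (l + ε * Complex.I))⁻¹) A)) := by
    intro l
    have c1 : ContinuousOn (fun s : ℂ => (s - (l + ε * Complex.I))⁻¹) (spectrum ℂ A) :=
      ContinuousOn.inv₀ (by fun_prop) (hne l)
    have c2 : ContinuousOn (fun s : ℂ => (s - conj (l + ε * Complex.I : ℂ))⁻¹) (spectrum ℂ A) :=
      ContinuousOn.inv₀ (by fun_prop) (hne' l)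
    simp only [F]
    have c3 : ContinuousOn (fun s : ℂ => (s - (l + ε * Complex.I))⁻¹
        - (s - conj (l + ε * Complex.I : ℂ))⁻¹) (spectrum ℂ A) := c1.sub c2
    have c4 : ContinuousOn (fun s : ℂ => (2 * Real.pi * Complex.I : ℂ)⁻¹ *
        ((s - (l + ε * Complex.I))⁻¹ - (s - conj (l + ε * Complex.I : ℂ))⁻¹))
        (spectrum ℂ A) := continuousOn_const.mul c3
    rw [cfc_const_mul _ _ A c4, cfc_const_mul _ _ A c3, cfc_sub _ _ A c1 c2, cfc_inv_sub_conj hA]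
  simp only [← hFl]
  exact ⟨integrable_cfc F _ A hFc hb hi, cfc_integral F _ A hFc hb hi⟩

/-- Stone's formula for matrix elements of the functional calculus. -/
theorem inner_cfc_eq_integral {A : H →L[ℂ] H} (hA : IsSelfAdjoint A) {f : ℝ → ℂ}
    (hf : Continuous f) (hfc : HasCompactSupport f) {x y : H} {Gx Gy : ℂ → H} {g g' : ℝ → ℂ}
    {ε₀ M : ℝ} (hε₀ : 0 < ε₀)
    (hGx : ∀ z : ℂ, z.im ≠ 0 → A (Gx z) - z • Gx z = x)
    (hGy : ∀ z : ℂ, z.im ≠ 0 → A (Gy z) - z • Gy z = y)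
    (hM : ∀ l ∈ tsupport f, ∀ ε ∈ Ioo 0 ε₀, ‖inner ℂ x (Gy (l + ε * Complex.I))‖ ≤ M)
    (hM' : ∀ l ∈ tsupport f, ∀ ε ∈ Ioo 0 ε₀, ‖inner ℂ y (Gx (l + ε * Complex.I))‖ ≤ M)
    (hg : ∀ l ∈ tsupport f,
      Tendsto (fun ε : ℝ => inner ℂ x (Gy (l + ε * Complex.I))) (𝓝[>] 0) (𝓝 (g l)))
    (hg' : ∀ l ∈ tsupport f,
      Tendsto (fun ε : ℝ => inner ℂ y (Gx (l + ε * Complex.I))) (𝓝[>] 0) (𝓝 (g' l))) :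
    inner ℂ x (cfc (fun z => f z.re) A y) =
      ∫ l : ℝ, f l * ((2 * Real.pi * Complex.I)⁻¹ * (g l - conj (g' l))) := by
  have hAn := hA.isStarNormal
  have hpos : ∀ᶠ ε : ℝ in 𝓝[>] 0, ε ∈ Ioo 0 ε₀ := Ioo_mem_nhdsGT hε₀
  have h1 : Tendsto (fun ε => inner ℂ x (cfc (poissonSmoothing f ε) A y)) (𝓝[>] 0)
      (𝓝 (inner ℂ x (cfc (fun z => f z.re) A y))) := by
    have h2 : Tendsto (fun ε => cfc (poissonSmoothing f ε) A) (𝓝[>] 0)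
        (𝓝 (cfc (fun z => f z.re) A)) := by
      have h3 := tendstoUniformlyOn_poissonSmoothing hf hfc (spectrum.isCompact A)
        fun z hz => hA.mem_spectrum_eq_re hz
      refine tendsto_cfc_fun h3.1 ?_
      filter_upwards [hpos] with ε hε using h3.2 ε hε.1
    have h3 : Continuous fun T : H →L[ℂ] H => inner ℂ x (T y) := by fun_prop
    exact (h3.tendsto _).comp h2
  have hval : ∀ ε ∈ Ioo 0 ε₀, Integrable (fun l : ℝ => f l * ((2 * Real.pi * Complex.I)⁻¹ *
        (inner ℂ x (Gy (l + ε * Complex.I)) - conj (inner ℂ y (Gx (l + ε * Complex.I)))))) ∧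
      inner ℂ x (cfc (poissonSmoothing f ε) A y) = ∫ l : ℝ, f l * ((2 * Real.pi * Complex.I)⁻¹ *
        (inner ℂ x (Gy (l + ε * Complex.I)) - conj (inner ℂ y (Gx (l + ε * Complex.I))))) := by
    intro ε hε
    obtain ⟨hi, hc⟩ := cfc_poissonSmoothing hA hf hfc hε.1
    have him : ∀ l : ℝ, ((l : ℂ) + ε * Complex.I).im ≠ 0 := fun l => by simpa using hε.1.ne'
    let L : (H →L[ℂ] H) →L[ℂ] ℂ := (innerSL ℂ x).comp (ContinuousLinearMap.apply ℂ H y)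
    have hL : ∀ T, L T = inner ℂ x (T y) := fun T => rfl
    have hpt : ∀ l : ℝ, L (f l • (2 * Real.pi * Complex.I : ℂ)⁻¹ •
      (cfc (fun s => (s - (l + ε * Complex.I))⁻¹) A
        - star (cfc (fun s => (s - (l + ε * Complex.I))⁻¹) A))) =
        f l * ((2 * Real.pi * Complex.I)⁻¹ *
        (inner ℂ x (Gy (l + ε * Complex.I)) - conj (inner ℂ y (Gx (l + ε * Complex.I))))) := by
      intro l
      have e1 := cfc_inv_sub_apply hA (him l) (hGx _ (him l))
      have e2 := cfc_inv_sub_apply hA (him l) (hGy _ (him l))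
      -- The resolvent at the conjugate point is the adjoint of the one at z; moving it across the
      -- inner product leaves only resolvents in the upper half plane.
      rw [map_smul, map_smul, map_sub, hL, hL, e2, ContinuousLinearMap.star_eq_adjoint,
        ContinuousLinearMap.adjoint_inner_right, e1, inner_conj_symm, smul_eq_mul, smul_eq_mul]
    constructor
    · refine (L.integrable_comp hi).congr (Eventually.of_forall hpt)
    · rw [← hL, hc, ← L.integral_comp_comm hi]
      exact integral_congr_ae (Eventually.of_forall hpt)
  refine tendsto_nhds_unique h1 ?_
  have h4 : Tendsto (fun ε : ℝ => ∫ l : ℝ, f l * ((2 * Real.pi * Complex.I)⁻¹ *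
        (inner ℂ x (Gy (l + ε * Complex.I)) - conj (inner ℂ y (Gx (l + ε * Complex.I))))))
      (𝓝[>] 0) (𝓝 (∫ l : ℝ, f l * ((2 * Real.pi * Complex.I)⁻¹ * (g l - conj (g' l))))) := by
    refine tendsto_integral_filter_of_dominated_convergence
      (fun l => ‖f l‖ * (‖(2 * Real.pi * Complex.I : ℂ)⁻¹‖ * (M + M))) ?_ ?_ ?_ ?_
    · filter_upwards [hpos] with ε hε using (hval ε hε).1.aestronglyMeasurable
    · filter_upwards [hpos] with ε hε
      refine Eventually.of_forall fun l => ?_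
      by_cases hl : l ∈ tsupport f
      · rw [norm_mul, norm_mul]
        gcongr
        refine (norm_sub_le _ _).trans (add_le_add (hM l hl ε hε) ?_)
        rw [Complex.norm_conj]
        exact hM' l hl ε hε
      · simp [image_eq_zero_of_notMem_tsupport hl]
    · exact (hf.integrable_of_hasCompactSupport hfc).norm.mul_const _
    · refine Eventually.of_forall fun l => ?_
      by_cases hl : l ∈ tsupport f
      · exact (((hg l hl).sub ((Complex.continuous_conj.tendsto _).comp (hg' l hl))).const_mul
          _).const_mul _
      · simp [image_eq_zero_of_notMem_tsupport hl]
  refine h4.congr' ?_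
  filter_upwards [hpos] with ε hε using ((hval ε hε).2).symm

end Spectral

end DiscreteDirac
end

/-! ### Spectral cutoffs and the continuous subspace -/

noncomputable section

namespace DiscreteDirac

open MeasureTheory Set Filter Topology ComplexConjugate

section Projection

variable {H : Type*} [NormedAddCommGroup H] [InnerProductSpace ℂ H] [CompleteSpace H]

/-- The polynomial that is positive exactly on the interior of the continuous spectrum. -/
def bandPoly (m l : ℝ) : ℝ := (l ^ 2 - m ^ 2) * (m ^ 2 + 4 - l ^ 2)

theorem continuous_bandPoly (m : ℝ) : Continuous (bandPoly m) := by
  unfold bandPoly; fun_prop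

/-- Cutoff functions supported inside the continuous spectrum. -/
def bandCutoff (m : ℝ) (k : ℕ) (l : ℝ) : ℝ := max 0 (min 1 (k * bandPoly m l - 1))

theorem continuous_bandCutoff (m : ℝ) (k : ℕ) : Continuous (bandCutoff m k) := by
  have := continuous_bandPoly m
  unfold bandCutoff; fun_prop

theorem bandCutoff_nonneg (m : ℝ) (k : ℕ) (l : ℝ) : 0 ≤ bandCutoff m k l := le_max_left _ _

theorem bandCutoff_le_one (m : ℝ) (k : ℕ) (l : ℝ) : bandCutoff m k l ≤ 1 :=
  max_le zero_le_one (min_le_left _ _)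

theorem bandCutoff_eq_zero {m : ℝ} {k : ℕ} {l : ℝ} (h : k * bandPoly m l ≤ 1) :
    bandCutoff m k l = 0 :=
  max_eq_left ((min_le_right _ _).trans (by linarith))

theorem bandCutoff_eq_one {m : ℝ} {k : ℕ} {l : ℝ} (h : 2 ≤ k * bandPoly m l) :
    bandCutoff m k l = 1 := by
  unfold bandCutoff
  rw [min_eq_left (by linarith), max_eq_right zero_le_one]

/-- The cutoff differs from one only where `bandPoly` is below 2/k. -/
theorem one_sub_bandCutoff_mul_le {m : ℝ} {k : ℕ} (hk : 0 < k) {l : ℝ} (hl : 0 ≤ bandPoly m l) :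
    |(1 - bandCutoff m k l) * bandPoly m l| ≤ 2 / k := by
  have hk' : (0 : ℝ) < k := by exact_mod_cast hk
  rw [abs_of_nonneg (mul_nonneg (by linarith [bandCutoff_le_one m k l]) hl)]
  by_cases h : 2 ≤ k * bandPoly m l
  · rw [bandCutoff_eq_one h, sub_self, zero_mul]; positivity
  · push Not at h
    have h1 : bandPoly m l ≤ 2 / k := by rw [le_div_iff₀ hk']; linarith
    nlinarith [bandCutoff_nonneg m k l]

/-- If a self-adjoint operator has spectrum in the closed bands and no eigenvalue at their edges,
then the cutoffs converge strongly to the identity. -/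
theorem tendsto_cfc_bandCutoff {B : H →L[ℂ] H} (hB : IsSelfAdjoint B) (m : ℝ)
    (hs : ∀ l : ℝ, (l : ℂ) ∈ spectrum ℂ B → 0 ≤ bandPoly m l)
    (he : ∀ (l : ℝ) (w : H), B w = (l : ℂ) • w → w = 0) (v : H) :
    Tendsto (fun k : ℕ => cfc (fun z : ℂ => (bandCutoff m k z.re : ℂ)) B v) atTop (𝓝 v) := by
  have hBn := hB.isStarNormal
  have hcc : ∀ k, Continuous fun z : ℂ => (bandCutoff m k z.re : ℂ) := fun k =>
    Complex.continuous_ofReal.comp ((continuous_bandCutoff m k).comp Complex.continuous_re)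
  set r : ℝ := √(m ^ 2 + 4)
  have hr : r ^ 2 = m ^ 2 + 4 := Real.sq_sqrt (by positivity)
  set L : ℝ → H →L[ℂ] H := fun l => B - algebraMap ℂ _ (l : ℂ)
  have hL : ∀ l : ℝ, cfc (fun z : ℂ => z - (l : ℂ)) B = L l := fun l => by
    rw [cfc_sub _ _ B, cfc_id' ℂ B, cfc_const _ B]
  have hLsa : ∀ l, IsSelfAdjoint (L l) := fun l => by
    refine hB.sub ?_
    rw [isSelfAdjoint_iff, ← algebraMap_star_comm]; simp
  have hLinj : ∀ l w, L l w = 0 → w = 0 := fun l w h => he l w (by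
    simpa [L, Algebra.algebraMap_eq_smul_one, sub_eq_zero] using h)
  -- This is `bandPoly` of the operator, written as a product of four linear factors at the edges.
  -- Each factor is injective because no edge is an eigenvalue.
  set P : H →L[ℂ] H := cfc (fun z : ℂ => -((z - m) * ((z - (-m : ℝ)) *
    ((z - r) * (z - (-r : ℝ)))))) B
  have hPL : P = -(L m * (L (-m) * (L r * L (-r)))) := by
    simp only [P]
    rw [cfc_neg, cfc_mul _ _ B, cfc_mul _ _ B, cfc_mul _ _ B, hL, hL, hL, hL]
  have hPre : ∀ z ∈ spectrum ℂ B, -((z - m) * ((z - (-m : ℝ)) *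
      ((z - r) * (z - (-r : ℝ))))) = (bandPoly m z.re : ℂ) := by
    intro z hz
    have h1 := hB.mem_spectrum_eq_re hz
    have h2 : (r : ℂ) ^ 2 = m ^ 2 + 4 := by exact_mod_cast hr
    rw [h1]
    simp only [Complex.ofReal_re, bandPoly]
    push_cast
    linear_combination ((z.re : ℂ) ^ 2 - m ^ 2) * h2
  have hPinj : ∀ w, P w = 0 → w = 0 := by
    intro w hw
    rw [hPL] at hw
    simp only [neg_apply, neg_eq_zero, mul_apply_eq_comp] at hw
    exact hLinj _ _ (hLinj _ _ (hLinj _ _ (hLinj _ _ hw)))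
  have hPsa : IsSelfAdjoint P := by
    rw [isSelfAdjoint_iff]
    simp only [P]
    rw [← cfc_star]
    refine cfc_congr fun z hz => ?_
    rw [hPre z hz]; simp
  -- An injective self-adjoint operator has dense range. On that range the cutoffs converge at rate
  -- 2/k, and their uniform bound extends the convergence to every vector.
  have hdense : DenseRange P := by
    have h1 : (LinearMap.range (P : H →ₗ[ℂ] H))ᗮ = ⊥ := by
      rw [P.orthogonal_range, ← ContinuousLinearMap.star_eq_adjoint, hPsa.star_eq]
      exact LinearMap.ker_eq_bot'.2 hPinj
    have h2 := Submodule.topologicalClosure_eq_top_iff.2 h1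
    intro x
    have h3 : x ∈ (LinearMap.range (P : H →ₗ[ℂ] H)).topologicalClosure := by rw [h2]; trivial
    exact h3
  have hbound : ∀ k : ℕ, ‖cfc (fun z : ℂ => (bandCutoff m k z.re : ℂ)) B‖ ≤ 1 := fun k =>
    norm_cfc_le zero_le_one fun z _ => by
      rw [Complex.norm_real, Real.norm_of_nonneg (bandCutoff_nonneg _ _ _)]
      exact bandCutoff_le_one _ _ _
  have hP : ∀ k : ℕ, 0 < k → ‖P - cfc (fun z : ℂ => (bandCutoff m k z.re : ℂ)) B * P‖ ≤ 2 / k := by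
    intro k hk
    have c1 : Continuous fun z : ℂ => -((z - m) * ((z - (-m : ℝ)) *
      ((z - r) * (z - (-r : ℝ))))) := by fun_prop
    simp only [P]
    rw [← cfc_mul _ _ B (hcc k).continuousOn c1.continuousOn, ← cfc_sub
      (fun z : ℂ => -((z - m) * ((z - (-m : ℝ)) * ((z - r) * (z - (-r : ℝ))))))
      (fun z : ℂ => (bandCutoff m k z.re : ℂ) *
        -((z - m) * ((z - (-m : ℝ)) * ((z - r) * (z - (-r : ℝ)))))) B
      c1.continuousOn ((hcc k).mul c1).continuousOn]
    refine norm_cfc_le (by positivity) fun z hz => ?_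
    rw [hPre z hz]
    have h1 : 0 ≤ bandPoly m z.re := hs _ (by rw [← hB.mem_spectrum_eq_re hz]; exact hz)
    have h2 := one_sub_bandCutoff_mul_le hk h1
    rw [← Complex.ofReal_mul, ← Complex.ofReal_sub, Complex.norm_real, Real.norm_eq_abs]
    convert h2 using 2
    ring
  rw [Metric.tendsto_atTop]
  intro ε hε
  obtain ⟨w, hw⟩ := hdense.exists_dist_lt v (ε := ε / 4) (by positivity)
  rw [dist_eq_norm] at hw
  obtain ⟨N, hN⟩ := exists_nat_gt (2 * ‖w‖ / (ε / 4))
  refine ⟨N + 1, fun k hk => ?_⟩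
  have hk0 : 0 < k := by omega
  have hkr : (0 : ℝ) < k := by exact_mod_cast hk0
  set X := cfc (fun z : ℂ => (bandCutoff m k z.re : ℂ)) B
  have h1 : ‖P w - X (P w)‖ ≤ ε / 4 := by
    have h2 := (P - X * P).le_of_opNorm_le (hP k hk0) w
    refine h2.trans ?_
    have h3 : 2 * ‖w‖ / (ε / 4) < k := hN.trans (by exact_mod_cast (by omega : N < k))
    rw [div_lt_iff₀ (by positivity)] at h3
    rw [div_mul_eq_mul_div, div_le_iff₀ hkr]
    linarith
  rw [dist_eq_norm]
  calc ‖X v - v‖ = ‖X (v - P w) - (P w - X (P w)) - (v - P w)‖ := by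
        rw [map_sub]; congr 1; abel
    _ ≤ ‖X (v - P w)‖ + ‖P w - X (P w)‖ + ‖v - P w‖ :=
        (norm_sub_le _ _).trans (add_le_add_left (norm_sub_le _ _) _)
    _ ≤ 1 * ‖v - P w‖ + ε / 4 + ‖v - P w‖ :=
        add_le_add_left (add_le_add (X.le_of_opNorm_le (hbound k) _) h1) _
    _ < ε := by linarith

/-- The lower bound makes the range closed and the kernel trivial; by self-adjointness the trivial
kernel makes the range dense. -/
theorem isUnit_of_isSelfAdjoint_of_bounded_below {T : H →L[ℂ] H} (hT : IsSelfAdjoint T) {c : ℝ}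
    (hc : 0 < c) (h : ∀ w, c * ‖w‖ ≤ ‖T w‖) : IsUnit T := by
  have hinj : LinearMap.ker (T : H →ₗ[ℂ] H) = ⊥ := LinearMap.ker_eq_bot'.2 fun w hw => by
    have h1 := h w
    have h2 : T w = 0 := hw
    rw [h2, norm_zero] at h1
    exact norm_le_zero_iff.1 (by nlinarith [norm_nonneg w])
  have hanti : AntilipschitzWith (Real.toNNReal c⁻¹) T :=
    AddMonoidHomClass.antilipschitz_of_bound T fun w => by
      rw [Real.coe_toNNReal _ (inv_nonneg.2 hc.le), inv_mul_eq_div, le_div_iff₀ hc]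
      linarith [h w]
  have hclosed : IsClosed (LinearMap.range (T : H →ₗ[ℂ] H) : Set H) := by
    exact hanti.isClosed_range T.uniformContinuous
  have hrange : LinearMap.range (T : H →ₗ[ℂ] H) = ⊤ := by
    have h1 : (LinearMap.range (T : H →ₗ[ℂ] H))ᗮ = ⊥ := by
      rw [T.orthogonal_range, ← ContinuousLinearMap.star_eq_adjoint, hT.star_eq, hinj]
    have h2 := Submodule.topologicalClosure_eq_top_iff.2 h1
    rwa [hclosed.submodule_topologicalClosure_eq] at h2
  exact ContinuousLinearMap.isUnit_iff_bijective.2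
    ⟨LinearMap.ker_eq_bot.1 hinj, LinearMap.range_eq_top.1 hrange⟩

/-- Along an isometry onto an invariant subspace, A pulls back to a self-adjoint B with no
eigenvalues and spectrum in the bands, so the cutoffs converge strongly for B. Intertwining
transports the limit to A, and the remaining part y − J v is annihilated by every cutoff function.
-/
theorem tendsto_inner_exp_of_isometry {H' : Type*} [NormedAddCommGroup H']
    [InnerProductSpace ℂ H'] [CompleteSpace H'] {A : H →L[ℂ] H} (hA : IsSelfAdjoint A) (m : ℝ)
    (J : H' →ₗᵢ[ℂ] H) (hAJ : ∀ v, ∃ v', A (J v) = J v')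
    (h1 : ∀ l : ℝ, bandPoly m l < 0 → ∃ c > 0, ∀ v, c * ‖v‖ ≤ ‖A (J v) - (l : ℂ) • J v‖)
    (h2 : ∀ (l : ℝ) (v : H'), A (J v) = (l : ℂ) • J v → v = 0) {e : ℂ → ℂ} (he : Continuous e)
    (x y : H) (v : H')
    (hkill : ∀ k : ℕ, cfc (fun z : ℂ => e z * (bandCutoff m k z.re : ℂ)) A (y - J v) = 0) :
    Tendsto (fun k : ℕ => inner ℂ x
        (cfc (fun z : ℂ => e z * (bandCutoff m k z.re : ℂ)) A y)) atTop
      (𝓝 (inner ℂ x (cfc e A (J v)))) := by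
  have hcc : ∀ k, Continuous fun z : ℂ => (bandCutoff m k z.re : ℂ) := fun k =>
    Complex.continuous_ofReal.comp ((continuous_bandCutoff m k).comp Complex.continuous_re)
  set J' : H' →L[ℂ] H := J.toContinuousLinearMap
  set B : H' →L[ℂ] H' := (ContinuousLinearMap.adjoint J') ∘L A ∘L J'
  have hB : IsSelfAdjoint B := by
    have := hA.conj_adjoint (ContinuousLinearMap.adjoint J')
    rwa [ContinuousLinearMap.adjoint_adjoint] at this
  have hJJ : ∀ v, ContinuousLinearMap.adjoint J' (J v) = v := by
    intro v
    refine ext_inner_left ℂ fun w => ?_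
    rw [ContinuousLinearMap.adjoint_inner_right]
    exact J.inner_map_map w v
  have hBJ : ∀ v, J (B v) = A (J v) := by
    intro v
    obtain ⟨v', hv'⟩ := hAJ v
    have h3 : B v = ContinuousLinearMap.adjoint J' (A (J v)) := rfl
    rw [h3, hv', hJJ]
  have hint : A ∘L J' = J' ∘L B := by
    ext v
    exact (hBJ v).symm
  have hev : ∀ (l : ℝ) (w : H'), B w = (l : ℂ) • w → w = 0 := by
    intro l w hw
    exact h2 l w (by rw [← hBJ, hw, map_smul])
  have hspec : ∀ l : ℝ, (l : ℂ) ∈ spectrum ℂ B → 0 ≤ bandPoly m l := by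
    intro l hl
    by_contra hneg
    obtain ⟨c, hc, hb⟩ := h1 l (not_le.1 hneg)
    have hsa : IsSelfAdjoint (B - algebraMap ℂ _ (l : ℂ)) := by
      refine hB.sub ?_
      rw [isSelfAdjoint_iff, ← algebraMap_star_comm]; simp
    have hu : IsUnit (B - algebraMap ℂ _ (l : ℂ)) := by
      refine isUnit_of_isSelfAdjoint_of_bounded_below hsa hc fun w => ?_
      have h3 := hb w
      rw [← hBJ, ← map_smul, ← map_sub, J.norm_map] at h3
      simpa [Algebra.algebraMap_eq_smul_one] using h3
    rw [spectrum.mem_iff] at hl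
    exact hl (by rw [← IsUnit.neg_iff, neg_sub]; exact hu)
  have hBn := hB.isStarNormal
  have hlim : Tendsto (fun k : ℕ => cfc (fun z : ℂ => e z * (bandCutoff m k z.re : ℂ)) B v) atTop
      (𝓝 (cfc e B v)) := by
    have h3 := ((cfc e B).continuous.tendsto _).comp (tendsto_cfc_bandCutoff hB m hspec hev v)
    refine h3.congr fun k => ?_
    rw [cfc_mul _ _ B he.continuousOn (hcc k).continuousOn]
    rfl
  have hy : ∀ k : ℕ, cfc (fun z : ℂ => e z * (bandCutoff m k z.re : ℂ)) A y
      = J (cfc (fun z : ℂ => e z * (bandCutoff m k z.re : ℂ)) B v) := by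
    intro k
    have h3 : cfc (fun z : ℂ => e z * (bandCutoff m k z.re : ℂ)) A (J v)
        = J (cfc (fun z : ℂ => e z * (bandCutoff m k z.re : ℂ)) B v) :=
      congrArg (fun S : H' →L[ℂ] H => S v) (cfc_comp_of_intertwine hA hB hint (he.mul (hcc k)))
    rw [← h3, ← sub_eq_zero, ← map_sub]
    exact hkill k
  have hfin : cfc e A (J v) = J (cfc e B v) :=
    congrArg (fun S : H' →L[ℂ] H => S v) (cfc_comp_of_intertwine hA hB hint he)
  rw [hfin]
  have hJ : Continuous fun u : H' => inner ℂ x (J u) := by fun_prop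
  refine ((hJ.tendsto _).comp hlim).congr fun k => ?_
  simp only [Function.comp_apply]
  rw [← hy k]

/-- The span of the eigenvectors. -/
abbrev eigenvectorSpan (A : H →L[ℂ] H) : Submodule ℂ H :=
  ⨆ z : ℂ, Module.End.eigenspace (A : H →ₗ[ℂ] H) z

theorem apply_mem_orthogonal_eigenvectorSpan {A : H →L[ℂ] H} (hA : IsSelfAdjoint A) {v : H}
    (hv : v ∈ (eigenvectorSpan A)ᗮ) : A v ∈ (eigenvectorSpan A)ᗮ := by
  rw [Submodule.mem_orthogonal] at hv ⊢
  have hKi : ∀ u ∈ eigenvectorSpan A, A u ∈ eigenvectorSpan A := by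
    intro u hu
    refine Submodule.iSup_induction (p := fun z : ℂ => Module.End.eigenspace (A : H →ₗ[ℂ] H) z)
      (motive := fun u => A u ∈ eigenvectorSpan A) hu ?_ (by simp) ?_
    · intro z u hu
      have h3 : A u = z • u := Module.End.mem_eigenspace_iff.1 hu
      rw [h3]
      exact Submodule.smul_mem _ _ (Submodule.mem_iSup_of_mem z hu)
    · intro a b ha hb
      rw [map_add]; exact Submodule.add_mem _ ha hb
  intro u hu
  have h3 : inner ℂ u (A v) = inner ℂ (A u) v :=
    ((ContinuousLinearMap.isSelfAdjoint_iff_isSymmetric.1 hA) u v).symm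
  rw [h3]
  exact hv _ (hKi u hu)

/-- The propagator on the continuous subspace is a strong limit of functions of the operator
that are supported inside the continuous spectrum. -/
theorem tendsto_inner_exp_starProjection {A : H →L[ℂ] H} (hA : IsSelfAdjoint A) (m : ℝ)
    (h1 : ∀ l : ℝ, bandPoly m l < 0 → ∃ c > 0, ∀ w ∈ (eigenvectorSpan A)ᗮ,
      c * ‖w‖ ≤ ‖A w - (l : ℂ) • w‖)
    (h2 : ∀ (l : ℝ) (w : H), w ≠ 0 → A w = (l : ℂ) • w → bandPoly m l ≤ 0) (t : ℝ) (x y : H) :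
    Tendsto (fun k : ℕ => inner ℂ x (cfc (fun z : ℂ =>
        Complex.exp (-Complex.I * t * (z.re : ℂ)) * (bandCutoff m k z.re : ℂ)) A y)) atTop
      (𝓝 (inner ℂ x (NormedSpace.exp ((-Complex.I * (t : ℂ)) • A)
        ((eigenvectorSpan A)ᗮ.starProjection y)))) := by
  have hcc : ∀ k, Continuous fun z : ℂ => (bandCutoff m k z.re : ℂ) := fun k =>
    Complex.continuous_ofReal.comp ((continuous_bandCutoff m k).comp Complex.continuous_re)
  set K := eigenvectorSpan A
  set e : ℂ → ℂ := fun z => Complex.exp (-Complex.I * t * (z.re : ℂ))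
  have hec : Continuous e := by fun_prop
  have hexp : NormedSpace.exp ((-Complex.I * (t : ℂ)) • A) = cfc e A := by
    rw [exp_eq_cfc hA]
    refine cfc_congr fun z hz => ?_
    simp only [e]
    rw [← hA.mem_spectrum_eq_re hz]
  have hAn := hA.isStarNormal
  -- Every eigenvalue lies outside the open bands, where the cutoff is zero.
  have hkill : ∀ k : ℕ, ∀ u ∈ K,
      cfc (fun z : ℂ => e z * (bandCutoff m k z.re : ℂ)) A u = 0 := by
    intro k u hu
    refine Submodule.iSup_induction (p := fun z : ℂ => Module.End.eigenspace (A : H →ₗ[ℂ] H) z)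
      (motive := fun u => cfc (fun z : ℂ => e z * (bandCutoff m k z.re : ℂ)) A u = 0) hu ?_
      (by simp) (fun a b ha hb => by rw [map_add, ha, hb, add_zero])
    intro z u hu
    by_cases hu0 : u = 0
    · rw [hu0, map_zero]
    have h3 : A u = z • u := Module.End.mem_eigenspace_iff.1 hu
    have h4 : (z.re : ℂ) = z := by
      have := (ContinuousLinearMap.isSelfAdjoint_iff_isSymmetric.1 hA).conj_eigenvalue_eq_self
        (Module.End.hasEigenvalue_of_hasEigenvector ⟨hu, hu0⟩)
      exact Complex.conj_eq_iff_re.1 this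
    rw [← h4] at h3
    have h5 := h2 _ u hu0 h3
    have h6 : (bandCutoff m k z.re : ℂ) = 0 := by
      rw [bandCutoff_eq_zero, Complex.ofReal_zero]
      exact (mul_nonpos_of_nonneg_of_nonpos (Nat.cast_nonneg k) h5).trans zero_le_one
    have h7 := cfc_apply_eigenvector hA h3 (f := fun z : ℂ => e z * (bandCutoff m k z.re : ℂ))
      (hec.mul (hcc k))
    rw [h7]
    simp [h6]
  rw [hexp]
  refine tendsto_inner_exp_of_isometry hA m (Kᗮ).subtypeₗᵢ
    (fun v => ⟨⟨A v, apply_mem_orthogonal_eigenvectorSpan hA v.2⟩, rfl⟩)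
    (fun l hl => ?_) (fun l w hw => ?_) hec x y (Kᗮ.orthogonalProjectionOnto y) (fun k => ?_)
  · obtain ⟨c, hc, h⟩ := h1 l hl
    exact ⟨c, hc, fun v => h v v.2⟩
  · have h4 : (w : H) ∈ K :=
      Submodule.mem_iSup_of_mem (l : ℂ) (Module.End.mem_eigenspace_iff.2 hw)
    exact Subtype.ext (inner_self_eq_zero.1 (Submodule.inner_right_of_mem_orthogonal h4 w.2))
  · set T := cfc (fun z : ℂ => e z * (bandCutoff m k z.re : ℂ)) A
    -- The component of y along the closure of the eigenvector span is killed by continuity.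
    have h4 : K.topologicalClosure ≤ LinearMap.ker (T : H →ₗ[ℂ] H) :=
      Submodule.topologicalClosure_minimal _ (fun u hu => hkill k u hu) T.isClosed_ker
    refine h4 ?_
    rw [← Submodule.orthogonal_orthogonal_eq_closure]
    exact Submodule.sub_starProjection_mem_orthogonal y

end Projection

end DiscreteDirac
end

/-! ### Perturbed matrix products and abstract Jost limits -/

noncomputable section

namespace DiscreteDirac

open Set Filter Topology
open scoped ContDiff

set_option linter.unusedSectionVars false

section PartialProducts

variable {R : Type*} [Ring R]

/-- The ordered product `C 0 * C 1 * ⋯ * C (N - 1)`. -/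
def partialProd (C : ℕ → R) : ℕ → R
  | 0 => 1
  | N + 1 => partialProd C N * C N

theorem partialProd_succ' (C : ℕ → R) (N : ℕ) :
    partialProd C (N + 1) = C 0 * partialProd (fun k => C (k + 1)) N := by
  induction N with
  | zero => simp [partialProd]
  | succ N ih => rw [partialProd, ih, mul_assoc]; rfl

/-- Duhamel's formula: a perturbed product is the free power plus one term for the last occurrence
of the perturbation. -/
theorem partialProd_add_eq (B : R) (F : ℕ → R) (N : ℕ) :
    partialProd (fun k => B + F k) N = B ^ N + ∑ j ∈ Finset.range N,
      partialProd (fun k => B + F k) j * F j * B ^ (N - 1 - j) := by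
  induction N with
  | zero => simp [partialProd]
  | succ N ih =>
    rw [Finset.sum_range_succ, partialProd, mul_add]
    nth_rewrite 1 [ih]
    rw [add_mul, ← pow_succ, Finset.sum_mul]
    have : ∀ j ∈ Finset.range N, partialProd (fun k => B + F k) j * F j * B ^ (N - 1 - j) * B
        = partialProd (fun k => B + F k) j * F j * B ^ (N + 1 - 1 - j) := by
      intro j hj
      rw [Finset.mem_range] at hj
      rw [mul_assoc _ _ B, ← pow_succ]
      congr 2
      omega
    rw [Finset.sum_congr rfl this]
    simp [add_assoc]

/-- The hypothesis is the Cayley–Hamilton relation for eigenvalues 1 and μ. The formula involves no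
division by μ − 1 and so survives at the band edges, where the eigenvalues coincide. -/
theorem pow_eq_one_add_geom {B μ : R} (h : (B - 1) * B = μ * (B - 1)) (k : ℕ) :
    B ^ k = 1 + (∑ l ∈ Finset.range k, μ ^ l) * (B - 1) := by
  induction k with
  | zero => simp
  | succ k ih =>
    rw [pow_succ, ih, add_mul, mul_assoc, h, Finset.sum_range_succ', pow_zero]
    simp only [pow_succ]
    rw [← Finset.sum_mul]
    noncomm_ring

variable {ν : R → ℝ}

theorem map_sum_le_sum (h0 : ν 0 = 0) (hadd : ∀ a b, ν (a + b) ≤ ν a + ν b) (f : ℕ → R) (N : ℕ) :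
    ν (∑ j ∈ Finset.range N, f j) ≤ ∑ j ∈ Finset.range N, ν (f j) := by
  induction N with
  | zero => simp [h0]
  | succ N ih =>
    rw [Finset.sum_range_succ, Finset.sum_range_succ]
    exact (hadd _ _).trans (add_le_add_left ih _)

/-- The geometric sum loses one power of k. The estimate is stated for a subadditive and
submultiplicative size ν so that it serves both the norm and the seminorm of Taylor coefficients. -/
theorem map_pow_le (h0 : ν 0 = 0) (hnn : ∀ a, 0 ≤ ν a) (hmul : ∀ a b, ν (a * b) ≤ ν a * ν b)
    (hadd : ∀ a b, ν (a + b) ≤ ν a + ν b) {B μ : R} (h : (B - 1) * B = μ * (B - 1)) {s : ℕ}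
    {c : ℝ} (hc : 0 ≤ c) (hμ : ∀ l : ℕ, ν (μ ^ l) ≤ c * (1 + l) ^ s) (h1 : ν 1 ≤ c)
    (hB : ν (B - 1) ≤ c) (k : ℕ) : ν (B ^ k) ≤ (c + c * c) * (1 + k) ^ (s + 1) := by
  rw [pow_eq_one_add_geom h]
  have hk : (1 : ℝ) ≤ 1 + k := by linarith [(Nat.cast_nonneg k : (0 : ℝ) ≤ k)]
  have h2 : ν (∑ l ∈ Finset.range k, μ ^ l) ≤ c * (1 + k) ^ (s + 1) := by
    refine (map_sum_le_sum h0 hadd _ _).trans ?_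
    calc ∑ l ∈ Finset.range k, ν (μ ^ l) ≤ ∑ _l ∈ Finset.range k, c * (1 + (k : ℝ)) ^ s := by
          refine Finset.sum_le_sum fun l hl => (hμ l).trans ?_
          have : (l : ℝ) ≤ k := by exact_mod_cast (Finset.mem_range.1 hl).le
          gcongr
      _ = k * (c * (1 + (k : ℝ)) ^ s) := by simp
      _ ≤ (1 + k) * (c * (1 + (k : ℝ)) ^ s) := by gcongr; linarith
      _ = _ := by ring
  calc ν (1 + (∑ l ∈ Finset.range k, μ ^ l) * (B - 1))
      ≤ ν 1 + ν (∑ l ∈ Finset.range k, μ ^ l) * ν (B - 1) :=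
        (hadd _ _).trans (add_le_add_right (hmul _ _) _)
    _ ≤ c * (1 + k) ^ (s + 1) + c * (1 + k) ^ (s + 1) * c := by
        refine add_le_add (h1.trans (le_mul_of_one_le_right hc (one_le_pow₀ hk))) ?_
        exact mul_le_mul h2 hB (hnn _) (by positivity)
    _ = _ := by ring

/-- Discrete Gronwall bound for perturbed powers. -/
theorem map_partialProd_le (h0 : ν 0 = 0) (hnn : ∀ a, 0 ≤ ν a)
    (hmul : ∀ a b, ν (a * b) ≤ ν a * ν b) (hadd : ∀ a b, ν (a + b) ≤ ν a + ν b) {B : R}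
    {F : ℕ → R} {s : ℕ} {K M : ℝ} (hK : 0 ≤ K) (hB : ∀ k : ℕ, ν (B ^ k) ≤ K * (1 + k) ^ s)
    (hM : ∀ N, ∑ j ∈ Finset.range N, (1 + j : ℝ) ^ s * ν (F j) ≤ M) (N : ℕ) :
    ν (partialProd (fun k => B + F k) N) ≤ K * (1 + N) ^ s * Real.exp (K * M) := by
  set P := partialProd (fun k => B + F k)
  -- Y majorizes the Duhamel series. Its increments are bounded by Y itself times a summable factor,
  -- which yields the exponential bound.
  set Y : ℕ → ℝ := fun N => 1 + ∑ j ∈ Finset.range N, ν (P j) * ν (F j)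
  have hP : ∀ N, ν (P N) ≤ K * (1 + N) ^ s * Y N := by
    intro N
    simp only [P]
    rw [partialProd_add_eq]
    refine (hadd _ _).trans ?_
    have h2 : ν (∑ j ∈ Finset.range N, partialProd (fun k => B + F k) j * F j * B ^ (N - 1 - j))
        ≤ ∑ j ∈ Finset.range N, ν (P j) * ν (F j) * (K * (1 + N) ^ s) := by
      refine (map_sum_le_sum h0 hadd _ _).trans (Finset.sum_le_sum fun j hj => ?_)
      refine (hmul _ _).trans (mul_le_mul (hmul _ _) ((hB _).trans ?_) (hnn _)
        (mul_nonneg (hnn _) (hnn _)))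
      have : ((N - 1 - j : ℕ) : ℝ) ≤ N := by exact_mod_cast (by omega : N - 1 - j ≤ N)
      gcongr
    rw [← Finset.sum_mul] at h2
    simp only [Y]
    linarith [hB N]
  have hY : ∀ N, Y N ≤ Real.exp (K * ∑ j ∈ Finset.range N, (1 + j : ℝ) ^ s * ν (F j)) := by
    intro N
    induction N with
    | zero => simp [Y]
    | succ N ih =>
      have hYs : Y (N + 1) = Y N + ν (P N) * ν (F N) := by
        simp only [Y]; rw [Finset.sum_range_succ, add_assoc]
      have hY0 : 0 ≤ Y N := add_nonneg zero_le_one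
        (Finset.sum_nonneg fun j _ => mul_nonneg (hnn _) (hnn _))
      rw [Finset.sum_range_succ, mul_add, Real.exp_add, hYs]
      calc Y N + ν (P N) * ν (F N) ≤ Y N + K * (1 + N) ^ s * Y N * ν (F N) := by
            gcongr
            · exact hnn _
            · exact hP N
        _ = Y N * (K * ((1 + N) ^ s * ν (F N)) + 1) := by ring
        _ ≤ _ := by
            have h3 : 0 ≤ K * ((1 + N : ℝ) ^ s * ν (F N)) :=
              mul_nonneg hK (mul_nonneg (by positivity) (hnn _))
            exact mul_le_mul ih (Real.add_one_le_exp _) (by linarith) (Real.exp_pos _).le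
  refine (hP N).trans ?_
  gcongr
  exact (hY N).trans (Real.exp_le_exp.2 (mul_le_mul_of_nonneg_left (hM N) hK))

end PartialProducts

section Jost

variable {𝔄 : Type*} [NormedRing 𝔄] [NormOneClass 𝔄] [NormedAlgebra ℂ 𝔄] [CompleteSpace 𝔄]

/-- The limit of `C 0 * ⋯ * C (N - 1) * V` as a telescoping series. -/
def jostLimit (C : ℕ → 𝔄) (V : 𝔄) : 𝔄 := V + ∑' N, partialProd C N * (C N * V - V)

/-- Since B fixes V, only F N acts on V, while the product in front grows at most linearly. The
series therefore costs the first moment of F. -/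
theorem norm_jost_term_le {B μ V : 𝔄} {F : ℕ → 𝔄} (h : (B - 1) * B = μ * (B - 1)) (hμ : ‖μ‖ ≤ 1)
    {c M : ℝ} (hc : 1 ≤ c) (hB : ‖B - 1‖ ≤ c) (hV : B * V = V)
    (hM : ∀ N, ∑ j ∈ Finset.range N, (1 + j : ℝ) * ‖F j‖ ≤ M) (N : ℕ) :
    ‖partialProd (fun k => B + F k) N * ((B + F N) * V - V)‖ ≤
      (c + c * c) * Real.exp ((c + c * c) * M) * ‖V‖ * ((1 + N) * ‖F N‖) := by
  have h1 := map_partialProd_le (ν := fun a : 𝔄 => ‖a‖) (B := B) (F := F) (s := 1) (M := M)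
    norm_zero norm_nonneg norm_mul_le norm_add_le (by positivity : 0 ≤ c + c * c)
    (map_pow_le (s := 0) norm_zero norm_nonneg norm_mul_le norm_add_le h (by linarith)
      (fun l => by
        rw [pow_zero, mul_one]
        exact (norm_pow_le _ _).trans ((pow_le_one₀ (norm_nonneg _) hμ).trans hc))
      (by rw [norm_one]; exact hc) hB)
    (by simpa using hM) N
  rw [pow_one] at h1
  have h2 : (B + F N) * V - V = F N * V := by rw [add_mul, hV, add_sub_cancel_left]
  rw [h2]
  refine (norm_mul_le _ _).trans ((mul_le_mul h1 (norm_mul_le _ _) (norm_nonneg _)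
    (by positivity)).trans (le_of_eq (by ring)))

theorem tendsto_partialProd_mul {C : ℕ → 𝔄} {V : 𝔄}
    (h : Summable fun N => partialProd C N * (C N * V - V)) :
    Tendsto (fun N => partialProd C N * V) atTop (𝓝 (jostLimit C V)) := by
  have h1 : ∀ N, partialProd C N * V
      = V + ∑ j ∈ Finset.range N, partialProd C j * (C j * V - V) := by
    intro N
    induction N with
    | zero => simp [partialProd]
    | succ N ih =>
      rw [Finset.sum_range_succ, ← add_assoc, ← ih, partialProd]
      noncomm_ring
  simp only [h1]
  exact h.hasSum.tendsto_sum_nat.const_add V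

theorem jostLimit_eq_mul {C : ℕ → 𝔄} {V : 𝔄}
    (h : Summable fun N => partialProd C N * (C N * V - V))
    (h' : Summable fun N => partialProd (fun k => C (k + 1)) N * (C (N + 1) * V - V)) :
    jostLimit C V = C 0 * jostLimit (fun k => C (k + 1)) V := by
  have h1 := (tendsto_partialProd_mul h).comp (tendsto_add_atTop_nat 1)
  have h2 := (tendsto_partialProd_mul h').const_mul (C 0)
  refine tendsto_nhds_unique h1 (h2.congr fun N => ?_)
  rw [Function.comp_apply, partialProd_succ', mul_assoc]

theorem norm_jostLimit_sub_le {C : ℕ → 𝔄} {V : 𝔄} {b : ℕ → ℝ} {M : ℝ} (hb : HasSum b M)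
    (h : ∀ N, ‖partialProd C N * (C N * V - V)‖ ≤ b N) : ‖jostLimit C V - V‖ ≤ M := by
  rw [jostLimit, add_sub_cancel_left]
  exact tsum_of_norm_bounded hb h

/-- The seminorm collecting the first `r` Taylor coefficients at `θ`. -/
def taylorNorm (r : ℕ) (θ : ℝ) (f : ℝ → 𝔄) : ℝ :=
  ∑ k ∈ Finset.range (r + 1), ‖iteratedDeriv k f θ‖ / k.factorial

theorem taylorNorm_nonneg (r : ℕ) (θ : ℝ) (f : ℝ → 𝔄) : 0 ≤ taylorNorm r θ f :=
  Finset.sum_nonneg fun _ _ => by positivity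

theorem norm_iteratedDeriv_le_taylorNorm {r k : ℕ} (hk : k ≤ r) (θ : ℝ) (f : ℝ → 𝔄) :
    ‖iteratedDeriv k f θ‖ ≤ r.factorial * taylorNorm r θ f := by
  have h1 : ‖iteratedDeriv k f θ‖ / k.factorial ≤ taylorNorm r θ f :=
    Finset.single_le_sum (f := fun k => ‖iteratedDeriv k f θ‖ / (k.factorial : ℝ))
      (fun _ _ => by positivity) (Finset.mem_range.2 (by omega))
  rw [div_le_iff₀ (by positivity)] at h1
  refine h1.trans ?_
  rw [mul_comm]
  exact mul_le_mul_of_nonneg_right (by exact_mod_cast Nat.factorial_le hk)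
    (taylorNorm_nonneg _ _ _)

theorem taylorNorm_add_le {r : ℕ} {θ : ℝ} {f g : ℝ → 𝔄} (hf : ContDiff ℝ ∞ f)
    (hg : ContDiff ℝ ∞ g) : taylorNorm r θ (f + g) ≤ taylorNorm r θ f + taylorNorm r θ g := by
  unfold taylorNorm
  rw [← Finset.sum_add_distrib]
  refine Finset.sum_le_sum fun k _ => ?_
  rw [iteratedDeriv_add (hf.contDiffAt.of_le (mod_cast le_top))
    (hg.contDiffAt.of_le (mod_cast le_top)), ← add_div]
  gcongr
  exact norm_add_le _ _

/-- With the factorial weights the Leibniz rule becomes the product of truncated power series.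
Submultiplicativity lets the Gronwall bound treat derivatives and values alike. -/
theorem taylorNorm_mul_le {r : ℕ} {θ : ℝ} {f g : ℝ → 𝔄} (hf : ContDiff ℝ ∞ f)
    (hg : ContDiff ℝ ∞ g) : taylorNorm r θ (f * g) ≤ taylorNorm r θ f * taylorNorm r θ g := by
  set a : ℕ → ℝ := fun k => ‖iteratedDeriv k f θ‖ / k.factorial
  set b : ℕ → ℝ := fun k => ‖iteratedDeriv k g θ‖ / k.factorial
  have h1 : ∀ k, ‖iteratedDeriv k (f * g) θ‖ / k.factorial
      ≤ ∑ i ∈ Finset.range (k + 1), a i * b (k - i) := by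
    intro k
    have h2 := norm_iteratedFDeriv_mul_le hf hg θ (n := k) (mod_cast le_top)
    simp only [norm_iteratedFDeriv_eq_norm_iteratedDeriv] at h2
    rw [div_le_iff₀ (by positivity), Finset.sum_mul]
    refine h2.trans (Finset.sum_le_sum fun i hi => le_of_eq ?_)
    have hi' : i ≤ k := by rw [Finset.mem_range] at hi; omega
    have h3 : (k.choose i : ℝ) * i.factorial * (k - i).factorial = k.factorial := by
      exact_mod_cast Nat.choose_mul_factorial_mul_factorial hi'
    simp only [a, b]
    rw [← h3]
    field_simp
  unfold taylorNorm
  refine (Finset.sum_le_sum fun k _ => h1 k).trans ?_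
  rw [Finset.sum_range_diag_flip (r + 1) fun i j => a i * b j, Finset.sum_mul_sum]
  refine Finset.sum_le_sum fun i _ => ?_
  refine Finset.sum_le_sum_of_subset_of_nonneg (Finset.range_mono (by omega)) fun j _ _ => ?_
  positivity

theorem taylorNorm_const (r : ℕ) (θ : ℝ) (D : 𝔄) : taylorNorm r θ (fun _ => D) = ‖D‖ := by
  unfold taylorNorm
  rw [Finset.sum_eq_single 0]
  · simp
  · intro k _ hk
    rw [iteratedDeriv_const, if_neg hk]
    simp
  · simp

theorem exists_taylorNorm_le_of_periodic (r : ℕ) {f : ℝ → 𝔄} (hf : ContDiff ℝ ∞ f) {T : ℝ}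
    (hT : 0 < T) (hp : ∀ θ, f (θ + T) = f θ) : ∃ c, ∀ θ, taylorNorm r θ f ≤ c := by
  have hcont : Continuous fun θ => taylorNorm r θ f := by
    unfold taylorNorm
    refine continuous_finsetSum _ fun k _ => Continuous.div_const (Continuous.norm ?_) _
    exact hf.continuous_iteratedDeriv k (mod_cast le_top)
  have hper : Function.Periodic (fun θ => taylorNorm r θ f) T := by
    intro θ
    unfold taylorNorm
    refine Finset.sum_congr rfl fun k _ => ?_
    have h1 := congrFun (iteratedDeriv_comp_add_const k f T) θ
    simp only [hp] at h1
    rw [← h1]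
  obtain ⟨c, hc⟩ := (isCompact_Icc (a := (0 : ℝ)) (b := T)).bddAbove_image hcont.continuousOn
  refine ⟨c, fun θ => ?_⟩
  obtain ⟨y, hy, h⟩ := hper.exists_mem_Ico₀ hT θ
  refine (le_of_eq h).trans ?_
  exact hc ⟨y, ⟨hy.1, hy.2.le⟩, rfl⟩

theorem iteratedDeriv_cexp_const_mul_smul_one (a : ℂ) (k : ℕ) :
    iteratedDeriv k (fun θ : ℝ => Complex.exp (a * θ) • (1 : 𝔄))
      = fun θ : ℝ => (a ^ k * Complex.exp (a * θ)) • (1 : 𝔄) := by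
  induction k with
  | zero => simp
  | succ k ih =>
    rw [iteratedDeriv_succ, ih]
    ext θ
    have h1 : HasDerivAt (fun θ : ℝ => Complex.exp (a * θ)) (Complex.exp (a * θ) * (a * 1)) θ :=
      ((Complex.ofRealCLM.hasDerivAt (x := θ)).const_mul a).cexp
    have h2 := ((h1.const_mul (a ^ k)).smul_const (1 : 𝔄)).deriv
    rw [h2]
    congr 1
    ring

/-- Differentiating e^{2ilθ} up to r times costs l^r. Summing over l costs one more power, so r
derivatives of a Jost limit need r + 1 moments. -/
theorem taylorNorm_cexp_le (r l : ℕ) (θ : ℝ) :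
    taylorNorm r θ (fun θ : ℝ => Complex.exp ((2 * l * Complex.I : ℂ) * θ) • (1 : 𝔄))
      ≤ (r + 1) * 2 ^ r * (1 + l) ^ r := by
  unfold taylorNorm
  calc _ ≤ ∑ _k ∈ Finset.range (r + 1), (2 ^ r * (1 + l) ^ r : ℝ) := by
        refine Finset.sum_le_sum fun k hk => ?_
        have hk' : k ≤ r := by rw [Finset.mem_range] at hk; omega
        rw [iteratedDeriv_cexp_const_mul_smul_one]
        have h1 : ‖Complex.exp ((2 * l * Complex.I : ℂ) * θ)‖ = 1 := by
          have := Complex.norm_exp_ofReal_mul_I (2 * l * θ)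
          rw [← this]; congr 2; push_cast; ring
        have h2 : ‖(2 * l * Complex.I : ℂ)‖ = 2 * l := by simp
        rw [norm_smul, norm_one, mul_one, norm_mul, h1, mul_one, norm_pow, h2, ← mul_pow]
        have h3 : (1 : ℝ) ≤ k.factorial := by exact_mod_cast Nat.one_le_iff_ne_zero.2 k.factorial_ne_zero
        refine (div_le_self (by positivity) h3).trans ?_
        calc (2 * l : ℝ) ^ k ≤ (2 * (1 + l)) ^ k := by gcongr; linarith
          _ ≤ (2 * (1 + l)) ^ r := pow_le_pow_right₀ (by
              linarith [(Nat.cast_nonneg l : (0 : ℝ) ≤ l)]) hk'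
    _ = _ := by simp; ring

/-- Smooth algebra-valued functions of a real variable. -/
def smoothSubring (𝔄 : Type*) [NormedRing 𝔄] [NormedAlgebra ℂ 𝔄] : Subring (ℝ → 𝔄) where
  carrier := {f | ContDiff ℝ ∞ f}
  mul_mem' {f g} hf hg := by
    have hf' : ContDiff ℝ ∞ f := hf
    have hg' : ContDiff ℝ ∞ g := hg
    exact hf'.mul hg'
  one_mem' := by
    change ContDiff ℝ ∞ fun _ : ℝ => (1 : 𝔄)
    exact contDiff_const
  add_mem' {f g} hf hg := by
    have hf' : ContDiff ℝ ∞ f := hf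
    have hg' : ContDiff ℝ ∞ g := hg
    exact hf'.add hg'
  zero_mem' := by
    change ContDiff ℝ ∞ fun _ : ℝ => (0 : 𝔄)
    exact contDiff_const
  neg_mem' {f} hf := by
    have hf' : ContDiff ℝ ∞ f := hf
    exact hf'.neg

theorem partialProd_apply (C : ℕ → ℝ → 𝔄) (N : ℕ) (θ : ℝ) :
    partialProd C N θ = partialProd (fun k => C k θ) N := by
  induction N with
  | zero => rfl
  | succ N ih => simp [partialProd, ih]

theorem contDiff_partialProd {C : ℕ → ℝ → 𝔄} (h : ∀ k, ContDiff ℝ ∞ (C k)) (N : ℕ) :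
    ContDiff ℝ ∞ (partialProd C N) := by
  induction N with
  | zero => exact contDiff_const
  | succ N ih => exact ih.mul (h N)

theorem coe_partialProd {C : ℕ → smoothSubring 𝔄} (N : ℕ) :
    ((partialProd C N : smoothSubring 𝔄) : ℝ → 𝔄) = partialProd (fun k => (C k : ℝ → 𝔄)) N := by
  induction N with
  | zero => rfl
  | succ N ih => simp [partialProd, ih]

/-- The Gronwall bound is applied in the ring of smooth functions, on which the Taylor seminorm is
submultiplicative. -/
theorem taylorNorm_partialProd_le {r : ℕ} {θ : ℝ} {B μ : smoothSubring 𝔄}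
    {F : ℕ → smoothSubring 𝔄} (h : (B - 1) * B = μ * (B - 1))
    {c M : ℝ} (hc : 1 ≤ c)
    (hμ : ∀ l : ℕ, taylorNorm r θ ((μ ^ l : smoothSubring 𝔄) : ℝ → 𝔄) ≤ c * (1 + l) ^ r)
    (hB : taylorNorm r θ ((B - 1 : smoothSubring 𝔄) : ℝ → 𝔄) ≤ c)
    (hM : ∀ N, ∑ j ∈ Finset.range N, (1 + j : ℝ) ^ (r + 1) * taylorNorm r θ (F j : ℝ → 𝔄) ≤ M) (N : ℕ) :
    taylorNorm r θ ((partialProd (fun k => B + F k) N : smoothSubring 𝔄) : ℝ → 𝔄) ≤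
      (c + c * c) * (1 + N) ^ (r + 1) * Real.exp ((c + c * c) * M) := by
  let ν : smoothSubring 𝔄 → ℝ := fun a => taylorNorm r θ (a : ℝ → 𝔄)
  have hnn : ∀ a, 0 ≤ ν a := fun a => taylorNorm_nonneg _ _ _
  have hmul : ∀ a b, ν (a * b) ≤ ν a * ν b := fun a b => taylorNorm_mul_le a.2 b.2
  have hadd : ∀ a b, ν (a + b) ≤ ν a + ν b := fun a b => taylorNorm_add_le a.2 b.2
  have h0 : ν 0 = 0 := (taylorNorm_const r θ (0 : 𝔄)).trans norm_zero
  have h1 : ν 1 ≤ c := ((taylorNorm_const r θ (1 : 𝔄)).trans norm_one).le.trans hc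
  have hpow := map_pow_le (ν := ν) h0 hnn hmul hadd h (by linarith) hμ h1 hB
  exact map_partialProd_le (ν := ν) h0 hnn hmul hadd (by positivity) hpow hM N

theorem taylorNorm_jost_term_le {r : ℕ} {B V : ℝ → 𝔄} {F : ℕ → ℝ → 𝔄} (hBs : ContDiff ℝ ∞ B)
    (hVs : ContDiff ℝ ∞ V) (hFs : ∀ k, ContDiff ℝ ∞ (F k))
    (h : ∀ θ, (B θ - 1) * B θ = Complex.exp (2 * Complex.I * θ) • (B θ - 1))
    (hV : ∀ θ, B θ * V θ = V θ) {c M : ℝ} (hc : (r + 1) * 2 ^ r ≤ c) {θ : ℝ}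
    (hB : taylorNorm r θ (B - 1) ≤ c)
    (hM : ∀ N, ∑ j ∈ Finset.range N, (1 + j : ℝ) ^ (r + 1) * taylorNorm r θ (F j) ≤ M) (N : ℕ) :
    taylorNorm r θ (partialProd (fun k => B + F k) N * ((B + F N) * V - V)) ≤
      (c + c * c) * Real.exp ((c + c * c) * M) * taylorNorm r θ V *
        ((1 + N) ^ (r + 1) * taylorNorm r θ (F N)) := by
  have hc1 : 1 ≤ c := by
    refine le_trans ?_ hc
    have h1 : (1 : ℝ) ≤ 2 ^ r := one_le_pow₀ one_le_two
    have h2 : (0 : ℝ) ≤ r := Nat.cast_nonneg r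
    nlinarith
  have hμs : ContDiff ℝ ∞ (fun θ : ℝ => Complex.exp (2 * Complex.I * θ) • (1 : 𝔄)) := by
    refine ContDiff.smul (Complex.contDiff_exp.comp ?_) contDiff_const
    exact contDiff_const.mul Complex.ofRealCLM.contDiff
  let μ : smoothSubring 𝔄 := ⟨fun θ : ℝ => Complex.exp (2 * Complex.I * θ) • (1 : 𝔄), hμs⟩
  have hμpow : ∀ l : ℕ, ((μ ^ l : smoothSubring 𝔄) : ℝ → 𝔄)
      = fun θ : ℝ => Complex.exp ((2 * l * Complex.I : ℂ) * θ) • (1 : 𝔄) := by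
    intro l
    rw [SubmonoidClass.coe_pow]
    ext θ
    simp only [μ, Pi.pow_apply, smul_pow, one_pow]
    rw [← Complex.exp_nat_mul]
    congr 2
    ring
  have key := taylorNorm_partialProd_le (r := r) (θ := θ) (B := ⟨B, hBs⟩) (μ := μ)
    (F := fun k => ⟨F k, hFs k⟩) (M := M) (c := c) (by
      refine Subtype.ext (funext fun θ => ?_)
      have h3 := h θ
      rw [← one_mul (B θ - 1), ← smul_mul_assoc, one_mul] at h3
      exact h3) hc1
    (fun l => by
      rw [hμpow]
      exact (taylorNorm_cexp_le r l θ).trans (mul_le_mul_of_nonneg_right hc (by positivity)))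
    hB hM N
  rw [coe_partialProd] at key
  have e1 : (B + F N) * V - V = F N * V := by
    ext θ
    simp only [Pi.sub_apply, Pi.mul_apply, Pi.add_apply]
    rw [add_mul, hV, add_sub_cancel_left]
  rw [e1]
  have h4 := taylorNorm_mul_le (r := r) (θ := θ)
    (contDiff_partialProd (fun k => hBs.add (hFs k)) N) ((hFs N).mul hVs)
  have h5 := taylorNorm_mul_le (r := r) (θ := θ) (hFs N) hVs
  refine h4.trans ((mul_le_mul key h5 (taylorNorm_nonneg _ _ _) (by positivity)).trans
    (le_of_eq (by ring)))

/-- Regularity of Jost limits. -/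
theorem contDiff_jostLimit {r : ℕ} {C : ℕ → ℝ → 𝔄} {V : ℝ → 𝔄} (hCs : ∀ k, ContDiff ℝ ∞ (C k))
    (hVs : ContDiff ℝ ∞ V) {b : ℕ → ℝ} {M v : ℝ} (hb : HasSum b M)
    (hV : ∀ θ, taylorNorm r θ V ≤ v)
    (h : ∀ N θ, taylorNorm r θ (partialProd C N * (C N * V - V)) ≤ b N) :
    ContDiff ℝ r (fun θ => jostLimit (fun k => C k θ) (V θ)) ∧
    ∀ k ≤ r, ∀ θ, ‖iteratedDeriv k (fun θ => jostLimit (fun k => C k θ) (V θ)) θ‖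
      ≤ r.factorial * (v + M) := by
  set T : ℕ → ℝ → 𝔄 := fun N => partialProd C N * (C N * V - V)
  have hTs : ∀ N, ContDiff ℝ ∞ (T N) := fun N =>
    (contDiff_partialProd hCs N).mul (((hCs N).mul hVs).sub hVs)
  have hTr : ∀ N, ContDiff ℝ (r : ℕ∞) (T N) := fun N => (hTs N).of_le (mod_cast le_top)
  have hbound : ∀ (k N : ℕ) (θ : ℝ), (k : ℕ∞) ≤ (r : ℕ∞) →
      ‖iteratedFDeriv ℝ k (T N) θ‖ ≤ r.factorial * b N := by
    intro k N θ hk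
    rw [norm_iteratedFDeriv_eq_norm_iteratedDeriv]
    exact (norm_iteratedDeriv_le_taylorNorm (by exact_mod_cast hk) θ _).trans
      (mul_le_mul_of_nonneg_left (h N θ) (by positivity))
  have hsum : HasSum (fun N => r.factorial * b N) (r.factorial * M) := hb.mul_left _
  have hfun : (fun θ => jostLimit (fun k => C k θ) (V θ)) = V + fun θ => ∑' N, T N θ := by
    ext θ
    simp only [jostLimit, T, Pi.add_apply, Pi.mul_apply, Pi.sub_apply, partialProd_apply]
  have hcd : ContDiff ℝ (r : ℕ∞) (fun θ => ∑' N, T N θ) :=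
    contDiff_tsum hTr (fun _ _ => hsum.summable) hbound
  rw [hfun]
  refine ⟨(hVs.of_le (mod_cast le_top)).add hcd, fun k hk θ => ?_⟩
  rw [iteratedDeriv_add (hVs.contDiffAt.of_le (mod_cast le_top))
    (hcd.contDiffAt.of_le (mod_cast hk)), mul_add]
  refine (norm_add_le _ _).trans (add_le_add ?_ ?_)
  · exact (norm_iteratedDeriv_le_taylorNorm hk θ V).trans
      (mul_le_mul_of_nonneg_left (hV θ) (by positivity))
  · rw [← norm_iteratedFDeriv_eq_norm_iteratedDeriv, iteratedFDeriv_tsum_apply hTr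
      (fun _ _ => hsum.summable) hbound (by exact_mod_cast hk)]
    exact tsum_of_norm_bounded hsum fun N => hbound k N θ (by exact_mod_cast hk)

end Jost

end DiscreteDirac
end

/-! ### Transfer matrices -/

noncomputable section

namespace DiscreteDirac

open Set Filter Topology
open scoped ContDiff Matrix

attribute [local instance] Matrix.linftyOpNormedRing Matrix.linftyOpNormedAlgebra

/-- Complex two by two matrices, normed as operators on `ℂ²` with the supremum norm. -/
abbrev M2 : Type := Matrix (Fin 2) (Fin 2) ℂ

instance m2TopologicalSpace : TopologicalSpace M2 :=
  (inferInstance : PseudoMetricSpace M2).toUniformSpace.toTopologicalSpace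

theorem m2_norm_le {M : M2} {c : ℝ} (h : ∀ i j, ‖M i j‖ ≤ c) : ‖M‖ ≤ 2 * c := by
  have hc : 0 ≤ c := (norm_nonneg _).trans (h 0 0)
  rw [Matrix.linfty_opNorm_def]
  have : (Finset.univ.sup fun i => ∑ j, ‖M i j‖₊) ≤ Real.toNNReal (2 * c) := by
    refine Finset.sup_le fun i _ => ?_
    rw [← NNReal.coe_le_coe, Real.coe_toNNReal _ (by positivity), Fin.sum_univ_two]
    push_cast
    linarith [h i 0, h i 1]
  exact (NNReal.coe_le_coe.2 this).trans (by rw [Real.coe_toNNReal _ (by positivity)])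

theorem norm_entry_le (M : M2) (i j : Fin 2) : ‖M i j‖ ≤ ‖M‖ := by
  rw [Matrix.linfty_opNorm_def]
  have h1 : ‖M i j‖₊ ≤ ∑ j, ‖M i j‖₊ :=
    Finset.single_le_sum (f := fun j => ‖M i j‖₊) (fun _ _ => zero_le) (Finset.mem_univ j)
  have h2 : ∑ j, ‖M i j‖₊ ≤ Finset.univ.sup fun i => ∑ j, ‖M i j‖₊ :=
    Finset.le_sup (f := fun i => ∑ j, ‖M i j‖₊) (Finset.mem_univ i)
  exact NNReal.coe_le_coe.2 (h1.trans h2)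

/-- The `(i, j)` entry as a continuous linear functional. -/
def entryCLM (i j : Fin 2) : M2 →L[ℂ] ℂ :=
  LinearMap.mkContinuous
    { toFun := fun M => M i j
      map_add' := fun _ _ => rfl
      map_smul' := fun _ _ => rfl } 1 fun M => by rw [one_mul]; exact norm_entry_le M i j

/-- The total size of the potential at one site. -/
def potNorm (q : Matrix (Fin 2) (Fin 2) ℝ) : ℝ := ∑ i, ∑ j, |q i j|

theorem potNorm_nonneg (q : Matrix (Fin 2) (Fin 2) ℝ) : 0 ≤ potNorm q :=
  Finset.sum_nonneg fun _ _ => Finset.sum_nonneg fun _ _ => abs_nonneg _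

theorem abs_le_potNorm (q : Matrix (Fin 2) (Fin 2) ℝ) (i j : Fin 2) : |q i j| ≤ potNorm q :=
  (Finset.single_le_sum (f := fun j => |q i j|) (fun _ _ => abs_nonneg _)
    (Finset.mem_univ j)).trans (Finset.single_le_sum (f := fun i => ∑ j, |q i j|)
    (fun _ _ => Finset.sum_nonneg fun _ _ => abs_nonneg _) (Finset.mem_univ i))

/-- The one-site transfer matrix `(u (n - 1), v n) ↦ (u n, v (n + 1))`. -/
def transferMat (m : ℝ) (q : Matrix (Fin 2) (Fin 2) ℝ) (z : ℂ) : M2 :=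
  !![1 / (1 + q 1 0 : ℝ), (z + m - q 1 1) / (1 + q 1 0 : ℝ);
     (m + q 0 0 - z) / (1 + q 1 0 : ℝ),
     (m + q 0 0 - z) * (z + m - q 1 1) / (1 + q 1 0 : ℝ) + (1 + q 1 0 : ℝ)]

/-- The coefficients of the transfer matrix as a polynomial in the spectral parameter. -/
def transferCoeff (m : ℝ) (q : Matrix (Fin 2) (Fin 2) ℝ) : Fin 3 → M2 :=
  ![!![((1 / (1 + q 1 0) : ℝ) : ℂ), (((m - q 1 1) / (1 + q 1 0) : ℝ) : ℂ);
      (((m + q 0 0) / (1 + q 1 0) : ℝ) : ℂ),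
      (((m + q 0 0) * (m - q 1 1) / (1 + q 1 0) + (1 + q 1 0) : ℝ) : ℂ)],
    !![0, ((1 / (1 + q 1 0) : ℝ) : ℂ); ((-1 / (1 + q 1 0) : ℝ) : ℂ),
      (((q 0 0 + q 1 1) / (1 + q 1 0) : ℝ) : ℂ)],
    !![0, 0; 0, ((-1 / (1 + q 1 0) : ℝ) : ℂ)]]

theorem transferMat_eq_sum (m : ℝ) (q : Matrix (Fin 2) (Fin 2) ℝ) (z : ℂ) :
    transferMat m q z = ∑ l : Fin 3, z ^ (l : ℕ) • transferCoeff m q l := by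
  ext i j
  fin_cases i <;> fin_cases j <;>
    simp [transferMat, transferCoeff, Fin.sum_univ_three] <;> ring

/-- For two by two matrices the adjugate is linear, and for determinant one it is the inverse. The
inverse transfer matrices are thus quadratic in z too. -/
theorem adjugate_transferMat_eq_sum (m : ℝ) (q : Matrix (Fin 2) (Fin 2) ℝ) (z : ℂ) :
    (transferMat m q z).adjugate = ∑ l : Fin 3, z ^ (l : ℕ) • (transferCoeff m q l).adjugate := by
  rw [transferMat_eq_sum]
  ext i j
  fin_cases i <;> fin_cases j <;>
    simp [Matrix.adjugate_fin_two, Fin.sum_univ_three] <;> ring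

theorem det_transferMat {m : ℝ} {q : Matrix (Fin 2) (Fin 2) ℝ} (hq : q 1 0 ≠ -1) (z : ℂ) :
    (transferMat m q z).det = 1 := by
  have h : ((1 + q 1 0 : ℝ) : ℂ) ≠ 0 := by
    have : (1 + q 1 0 : ℝ) ≠ 0 := fun h => hq (by linarith)
    exact_mod_cast this
  rw [transferMat, Matrix.det_fin_two_of]
  field_simp
  ring

/-- Each difference of entries has a numerator at most quadratic in q over the denominator 1 + q₂₁,
plus at most a linear term. A controls the denominator, and b absorbs one factor of the quadratic
term. -/
theorem norm_transferCoeff_sub_le {m A b : ℝ} (hm : 0 < m) {q : Matrix (Fin 2) (Fin 2) ℝ}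
    (hq : q 1 0 ≠ -1) (hA : |1 / (1 + q 1 0)| ≤ A) (hb : potNorm q ≤ b) (l : Fin 3) (i j : Fin 2) :
    ‖(transferCoeff m q l - transferCoeff m 0 l) i j‖
      ≤ (A * (2 * m + b + m ^ 2 + 2) + 1) * potNorm q := by
  have ha : (1 + q 1 0 : ℝ) ≠ 0 := fun h => hq (by linarith)
  have hA0 : 0 ≤ A := (abs_nonneg _).trans hA
  have hp := potNorm_nonneg q
  have hb0 : 0 ≤ b := hp.trans hb
  have h00 := abs_le_potNorm q 0 0
  have h10 := abs_le_potNorm q 1 0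
  have h11 := abs_le_potNorm q 1 1
  set p := potNorm q
  set K := A * (2 * m + b + m ^ 2 + 2) + 1
  have hdiv : ∀ x d : ℝ, |x| ≤ (2 * m + b + m ^ 2 + 2) * p → |d| ≤ p →
      |x * (1 / (1 + q 1 0)) + d| ≤ K * p := by
    intro x d hx hd
    refine (abs_add_le _ _).trans ?_
    rw [abs_mul]
    have := mul_le_mul hx hA (abs_nonneg _) (by positivity)
    simp only [K]
    linarith
  have hdiv0 : ∀ x : ℝ, |x| ≤ (2 * m + b + m ^ 2 + 2) * p →
      |x * (1 / (1 + q 1 0))| ≤ K * p := fun x hx => by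
    have := hdiv x 0 hx (by rwa [abs_zero])
    rwa [add_zero] at this
  have hbp : 0 ≤ b * p := mul_nonneg (hp.trans hb) hp
  have hmp : 0 ≤ m * p := by positivity
  have hm2p : 0 ≤ m ^ 2 * p := by positivity
  have hmul : ∀ c x : ℝ, 0 ≤ c → |x| ≤ p → |c * x| ≤ c * p := fun c x hc hx => by
    rw [abs_mul, abs_of_nonneg hc]; exact mul_le_mul_of_nonneg_left hx hc
  have e1 : |1 / (1 + q 1 0) - 1| ≤ K * p := by
    have := hdiv0 (-q 1 0) (by rw [abs_neg]; nlinarith)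
    convert this using 2; field_simp; ring
  have e2 : |(m - q 1 1) / (1 + q 1 0) - m| ≤ K * p := by
    have := hdiv0 (-q 1 1 - m * q 1 0) (by
      have h1 := abs_sub (-q 1 1) (m * q 1 0)
      rw [abs_neg] at h1
      have h2 := hmul m _ hm.le h10
      linarith)
    convert this using 2; field_simp; ring
  have e3 : |(m + q 0 0) / (1 + q 1 0) - m| ≤ K * p := by
    have := hdiv0 (q 0 0 - m * q 1 0) (by
      have h1 := abs_sub (q 0 0) (m * q 1 0)
      have h2 := hmul m _ hm.le h10
      linarith)
    convert this using 2; field_simp; ring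
  have e4 : |(m + q 0 0) * (m - q 1 1) / (1 + q 1 0) + (1 + q 1 0) - (m * m + 1)| ≤ K * p := by
    have := hdiv (m * q 0 0 - m * q 1 1 - q 0 0 * q 1 1 - m ^ 2 * q 1 0) (q 1 0) (by
      have h1 := abs_sub (m * q 0 0 - m * q 1 1 - q 0 0 * q 1 1) (m ^ 2 * q 1 0)
      have h2 := abs_sub (m * q 0 0 - m * q 1 1) (q 0 0 * q 1 1)
      have h3 := abs_sub (m * q 0 0) (m * q 1 1)
      have h4 := hmul m _ hm.le h00
      have h5 := hmul m _ hm.le h11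
      have h6 := hmul (m ^ 2) _ (by positivity) h10
      have h7 : |q 0 0 * q 1 1| ≤ b * p := by
        rw [abs_mul]; exact mul_le_mul (h00.trans hb) h11 (abs_nonneg _) (hp.trans hb)
      linarith) h10
    convert this using 2; field_simp; ring
  have e5 : |-1 / (1 + q 1 0) - (-1)| ≤ K * p := by
    rw [← abs_neg]; convert e1 using 2; ring
  have e6 : |(q 0 0 + q 1 1) / (1 + q 1 0)| ≤ K * p := by
    have := hdiv0 (q 0 0 + q 1 1) (by
      have h1 := abs_add_le (q 0 0) (q 1 1)
      linarith)
    convert this using 2; field_simp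
  have e0 : 0 ≤ K * p := (abs_nonneg _).trans e1
  have hn : ∀ x y : ℝ, |x - y| ≤ K * p → ‖(x : ℂ) - (y : ℂ)‖ ≤ K * p := fun x y h => by
    rw [← Complex.ofReal_sub, Complex.norm_real]; exact h
  fin_cases l <;> fin_cases i <;> fin_cases j
  · simpa [transferCoeff] using hn _ _ e1
  · simpa [transferCoeff] using hn _ _ e2
  · simpa [transferCoeff] using hn _ _ e3
  · simpa [transferCoeff] using hn _ _ e4
  · simpa [transferCoeff] using e0
  · simpa [transferCoeff] using hn _ _ e1
  · simpa [transferCoeff] using hn _ _ e5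
  · have := hn _ 0 (by simpa using e6)
    rw [Complex.ofReal_zero, sub_zero] at this
    simpa [transferCoeff, -Complex.norm_div, -norm_div] using this
  · simpa [transferCoeff] using e0
  · simpa [transferCoeff] using e0
  · simpa [transferCoeff] using e0
  · simpa [transferCoeff] using hn _ _ e5


end DiscreteDirac
end

/-! ### Jost limits depending on spectral parameters -/

noncomputable section

namespace DiscreteDirac

open Set Filter Topology
open scoped ContDiff

set_option linter.unusedSectionVars false

section StepSum

variable {𝔄 : Type*} [NormedRing 𝔄] [NormOneClass 𝔄] [NormedAlgebra ℂ 𝔄] [CompleteSpace 𝔄]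

/-- The quadratic polynomial in `z` with coefficients `Y`, multiplied by `ζ`. -/
def stepSum (Y : Fin 3 → 𝔄) (z ζ : ℂ) : 𝔄 := ∑ l : Fin 3, (ζ * z ^ (l : ℕ)) • Y l

theorem stepSum_sub (Y Y' : Fin 3 → 𝔄) (z ζ : ℂ) :
    stepSum (Y - Y') z ζ = stepSum Y z ζ - stepSum Y' z ζ := by
  simp [stepSum, smul_sub]

theorem norm_stepSum_le {Y : Fin 3 → 𝔄} {z ζ : ℂ} {R p : ℝ} (hR : 1 ≤ R) (hz : ‖z‖ ≤ R)
    (hζ : ‖ζ‖ ≤ 1) (hY : ∀ l, ‖Y l‖ ≤ p) : ‖stepSum Y z ζ‖ ≤ 3 * R ^ 2 * p := by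
  have hp : 0 ≤ p := (norm_nonneg _).trans (hY 0)
  have h : ∀ l : Fin 3, ‖(ζ * z ^ (l : ℕ)) • Y l‖ ≤ R ^ 2 * p := by
    intro l
    rw [norm_smul, norm_mul, norm_pow]
    refine mul_le_mul ?_ (hY l) (norm_nonneg _) (by positivity)
    have h1 : ‖z‖ ^ (l : ℕ) ≤ R ^ (l : ℕ) := pow_le_pow_left₀ (norm_nonneg _) hz _
    have h2 : R ^ (l : ℕ) ≤ R ^ 2 := pow_le_pow_right₀ hR (by omega)
    have h3 := mul_le_mul hζ (h1.trans h2) (by positivity) zero_le_one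
    rwa [one_mul] at h3
  refine (norm_sum_le _ _).trans ((Finset.sum_le_sum fun l _ => h l).trans (le_of_eq ?_))
  simp
  ring

theorem continuous_stepSum (Y : Fin 3 → 𝔄) : Continuous fun p : ℂ × ℂ => stepSum Y p.1 p.2 := by
  unfold stepSum
  fun_prop

/-- The constant in the bound for the terms of the Jost series. -/
def jostConst (R y M : ℝ) : ℝ :=
  (3 * R ^ 2 * y + 1 + (3 * R ^ 2 * y + 1) * (3 * R ^ 2 * y + 1)) *
    Real.exp ((3 * R ^ 2 * y + 1 + (3 * R ^ 2 * y + 1) * (3 * R ^ 2 * y + 1)) *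
      (3 * R ^ 2 * M)) * (3 * R ^ 2)

theorem jostConst_nonneg {R y M : ℝ} (hy : 0 ≤ y) : 0 ≤ jostConst R y M := by
  unfold jostConst; positivity

/-- Uniform bound for the terms of the Jost series of a perturbed quadratic transfer problem. -/
theorem norm_jost_stepSum_term_le {Y₀ : Fin 3 → 𝔄} {Y : ℕ → Fin 3 → 𝔄} {p : ℕ → ℝ} {R y M : ℝ}
    (hR : 1 ≤ R) (hY₀ : ∀ l, ‖Y₀ l‖ ≤ y) (hY : ∀ k l, ‖Y k l - Y₀ l‖ ≤ p k)
    (hM : ∀ N, ∑ j ∈ Finset.range N, (1 + j : ℝ) * p j ≤ M) {z ζ : ℂ} {V : 𝔄} (hz : ‖z‖ ≤ R)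
    (hζ : ‖ζ‖ ≤ 1) (hB : (stepSum Y₀ z ζ - 1) * stepSum Y₀ z ζ = ζ ^ 2 • (stepSum Y₀ z ζ - 1))
    (hV : stepSum Y₀ z ζ * V = V) (N : ℕ) :
    ‖partialProd (fun k => stepSum (Y k) z ζ) N * (stepSum (Y N) z ζ * V - V)‖ ≤
      jostConst R y M * ‖V‖ * ((1 + N) * p N) := by
  have hy : 0 ≤ y := (norm_nonneg _).trans (hY₀ 0)
  unfold jostConst
  set c := 3 * R ^ 2 * y + 1
  have hc : 1 ≤ c := le_add_of_nonneg_left (by positivity)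
  set F : ℕ → 𝔄 := fun k => stepSum (Y k - Y₀) z ζ
  have hF : ∀ k, ‖F k‖ ≤ 3 * R ^ 2 * p k := fun k => norm_stepSum_le hR hz hζ (hY k)
  have hBF : ∀ k, stepSum (Y k) z ζ = stepSum Y₀ z ζ + F k := fun k => by
    simp only [F, stepSum_sub]; abel
  simp only [hBF]
  refine (norm_jost_term_le (μ := algebraMap ℂ 𝔄 (ζ ^ 2)) (c := c) (M := 3 * R ^ 2 * M)
    (by rw [hB, Algebra.smul_def]) ?_ hc ?_ hV ?_ N).trans ?_
  · rw [norm_algebraMap', norm_pow]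
    exact pow_le_one₀ (norm_nonneg _) hζ
  · refine (norm_sub_le _ _).trans ?_
    rw [norm_one]
    exact add_le_add_left (norm_stepSum_le hR hz hζ hY₀) _
  · intro N
    refine le_trans ?_ (mul_le_mul_of_nonneg_left (hM N) (by positivity : 0 ≤ 3 * R ^ 2))
    rw [Finset.mul_sum]
    refine Finset.sum_le_sum fun j _ => ?_
    have := mul_le_mul_of_nonneg_left (hF j) (by positivity : (0 : ℝ) ≤ 1 + j)
    linarith
  · have h1 : (1 + N : ℝ) * ‖F N‖ ≤ (1 + N) * (3 * R ^ 2 * p N) :=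
      mul_le_mul_of_nonneg_left (hF N) (by positivity)
    refine (mul_le_mul_of_nonneg_left h1 (by positivity)).trans (le_of_eq (by ring))

/-- Continuity of Jost limits in the spectral parameters. -/
theorem continuousOn_jostLimit_stepSum {Y₀ : Fin 3 → 𝔄} {Y : ℕ → Fin 3 → 𝔄} {p : ℕ → ℝ} {R : ℝ}
    (hR : 1 ≤ R) (hY : ∀ k l, ‖Y k l - Y₀ l‖ ≤ p k)
    (hp : Summable fun k : ℕ => (1 + k : ℝ) * p k) {Ω : Set (ℂ × ℂ)} {V : ℂ × ℂ → 𝔄}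
    (hVc : ContinuousOn V Ω) {v : ℝ} (hVb : ∀ x ∈ Ω, ‖V x‖ ≤ v) (hz : ∀ x ∈ Ω, ‖x.1‖ ≤ R)
    (hζ : ∀ x ∈ Ω, ‖x.2‖ ≤ 1)
    (hB : ∀ x ∈ Ω, (stepSum Y₀ x.1 x.2 - 1) * stepSum Y₀ x.1 x.2
      = x.2 ^ 2 • (stepSum Y₀ x.1 x.2 - 1))
    (hV : ∀ x ∈ Ω, stepSum Y₀ x.1 x.2 * V x = V x) :
    ContinuousOn (fun x => jostLimit (fun k => stepSum (Y k) x.1 x.2) (V x)) Ω := by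
  obtain ⟨y, hy⟩ : ∃ y, ∀ l, ‖Y₀ l‖ ≤ y := ⟨∑ l, ‖Y₀ l‖, fun l =>
    Finset.single_le_sum (f := fun l => ‖Y₀ l‖) (fun _ _ => norm_nonneg _) (Finset.mem_univ l)⟩
  have hp0 : ∀ k, 0 ≤ p k := fun k => (norm_nonneg _).trans (hY k 0)
  have hM : ∀ N, ∑ j ∈ Finset.range N, (1 + j : ℝ) * p j ≤ ∑' j : ℕ, (1 + j : ℝ) * p j :=
    fun N => hp.sum_le_tsum _ fun j _ => mul_nonneg (by positivity) (hp0 j)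
  have hPc : ∀ N, Continuous fun x : ℂ × ℂ => partialProd (fun k => stepSum (Y k) x.1 x.2) N := by
    intro N
    induction N with
    | zero => exact continuous_const
    | succ N ih => exact ih.mul (continuous_stepSum (Y N))
  refine hVc.add (continuousOn_tsum (u := fun N : ℕ => jostConst R y (∑' j : ℕ, (1 + j : ℝ) * p j) * v * ((1 + N : ℝ) * p N)) (fun N => ?_)
    (hp.mul_left _) fun N x hx => ?_)
  · exact (hPc N).continuousOn.mul (((continuous_stepSum (Y N)).continuousOn.mul hVc).sub hVc)
  · refine (norm_jost_stepSum_term_le hR hy hY hM (hz x hx) (hζ x hx) (hB x hx) (hV x hx) N).trans ?_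
    refine mul_le_mul_of_nonneg_right (mul_le_mul_of_nonneg_left (hVb x hx)
      (jostConst_nonneg ((norm_nonneg _).trans (hy 0)))) (mul_nonneg (by positivity) (hp0 N))

theorem contDiff_stepSum (Y : Fin 3 → 𝔄) {z ζ : ℝ → ℂ} (hz : ContDiff ℝ ∞ z)
    (hζ : ContDiff ℝ ∞ ζ) : ContDiff ℝ ∞ fun θ => stepSum Y (z θ) (ζ θ) := by
  unfold stepSum
  refine ContDiff.sum fun l _ => ContDiff.smul (hζ.mul (hz.pow _)) contDiff_const

/-- The dependence on θ sits in three fixed periodic scalar functions, so one constant τ serves all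
coefficients Y. -/
theorem exists_taylorNorm_stepSum_le (r : ℕ) {z ζ : ℝ → ℂ} (hz : ContDiff ℝ ∞ z)
    (hζ : ContDiff ℝ ∞ ζ) {T : ℝ} (hT : 0 < T) (hzp : ∀ θ, z (θ + T) = z θ)
    (hζp : ∀ θ, ζ (θ + T) = ζ θ) :
    ∃ τ : ℝ, 0 ≤ τ ∧ ∀ (Y : Fin 3 → 𝔄) (p θ : ℝ), (∀ l, ‖Y l‖ ≤ p) →
      taylorNorm r θ (fun θ => stepSum Y (z θ) (ζ θ)) ≤ τ * p := by
  have h1 : ∀ l : Fin 3, ContDiff ℝ ∞ fun θ => (ζ θ * z θ ^ (l : ℕ)) • (1 : 𝔄) := fun l =>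
    ContDiff.smul (hζ.mul (hz.pow _)) contDiff_const
  have h2 : ∀ l : Fin 3, ∃ c, ∀ θ, taylorNorm r θ (fun θ => (ζ θ * z θ ^ (l : ℕ)) • (1 : 𝔄)) ≤ c :=
    fun l => exists_taylorNorm_le_of_periodic r (h1 l) hT fun θ => by rw [hzp, hζp]
  choose c hc using h2
  have hc0 : ∀ l, 0 ≤ c l := fun l => (taylorNorm_nonneg r 0 _).trans (hc l 0)
  refine ⟨c 0 + c 1 + c 2, by linarith [hc0 0, hc0 1, hc0 2], fun Y p θ hY => ?_⟩
  have h3 : ∀ l : Fin 3, taylorNorm r θ ((fun θ => (ζ θ * z θ ^ (l : ℕ)) • (1 : 𝔄)) * fun _ => Y l)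
      ≤ c l * p := fun l => by
    refine (taylorNorm_mul_le (h1 l) contDiff_const).trans ?_
    rw [taylorNorm_const]
    exact mul_le_mul (hc l θ) (hY l) (norm_nonneg _) (hc0 l)
  have hs : ∀ l : Fin 3, ContDiff ℝ ∞ ((fun θ => (ζ θ * z θ ^ (l : ℕ)) • (1 : 𝔄)) * fun _ => Y l) :=
    fun l => (h1 l).mul contDiff_const
  have h4 : (fun θ => stepSum Y (z θ) (ζ θ))
      = ((fun θ => (ζ θ * z θ ^ ((0 : Fin 3) : ℕ)) • (1 : 𝔄)) * fun _ => Y 0)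
      + ((fun θ => (ζ θ * z θ ^ ((1 : Fin 3) : ℕ)) • (1 : 𝔄)) * fun _ => Y 1)
      + ((fun θ => (ζ θ * z θ ^ ((2 : Fin 3) : ℕ)) • (1 : 𝔄)) * fun _ => Y 2) := by
    ext θ
    simp [stepSum, Fin.sum_univ_three]
  rw [h4]
  have h5 := taylorNorm_add_le (r := r) (θ := θ) (hs 0) (hs 1)
  refine (taylorNorm_add_le ((hs 0).add (hs 1)) (hs 2)).trans
    ((add_le_add_left h5 _).trans ?_)
  linarith [h3 0, h3 1, h3 2]

/-- Jost limits of perturbations of a fixed transfer problem are uniformly regular on the unit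
circle. -/
theorem exists_contDiff_jostLimit_stepSum {r : ℕ} (hr : 1 ≤ r) (Y₀ : Fin 3 → 𝔄) {z : ℝ → ℂ}
    {V : ℝ → 𝔄} (hz : ContDiff ℝ ∞ z) (hV : ContDiff ℝ ∞ V) {T : ℝ} (hT : 0 < T)
    (hzp : ∀ θ, z (θ + T) = z θ) (hVp : ∀ θ, V (θ + T) = V θ)
    (hζp : ∀ θ : ℝ, Complex.exp (Complex.I * (θ + T : ℝ)) = Complex.exp (Complex.I * θ))
    (hB : ∀ θ : ℝ, (stepSum Y₀ (z θ) (Complex.exp (Complex.I * θ)) - 1)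
        * stepSum Y₀ (z θ) (Complex.exp (Complex.I * θ))
      = Complex.exp (Complex.I * θ) ^ 2 • (stepSum Y₀ (z θ) (Complex.exp (Complex.I * θ)) - 1))
    (hBV : ∀ θ : ℝ, stepSum Y₀ (z θ) (Complex.exp (Complex.I * θ)) * V θ = V θ) (M : ℝ) :
    ∃ K : ℝ, ∀ (Y : ℕ → Fin 3 → 𝔄) (p : ℕ → ℝ), (∀ k l, ‖Y k l - Y₀ l‖ ≤ p k) →
      (Summable fun k : ℕ => (1 + k : ℝ) ^ (r + 1) * p k) →
      (∑' k : ℕ, (1 + k : ℝ) ^ (r + 1) * p k ≤ M) → ∀ L : 𝔄 →L[ℂ] ℂ, ‖L‖ ≤ 1 →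
      ContDiff ℝ r (fun θ : ℝ =>
        L (jostLimit (fun k => stepSum (Y k) (z θ) (Complex.exp (Complex.I * θ))) (V θ))) ∧
      ∀ θ : ℝ,
        ‖L (jostLimit (fun k => stepSum (Y k) (z θ) (Complex.exp (Complex.I * θ))) (V θ))‖ ≤ K ∧
        ‖deriv (fun θ : ℝ =>
          L (jostLimit (fun k => stepSum (Y k) (z θ) (Complex.exp (Complex.I * θ))) (V θ))) θ‖
            ≤ K := by
  have hζ : ContDiff ℝ ∞ fun θ : ℝ => Complex.exp (Complex.I * θ) :=
    Complex.contDiff_exp.comp (contDiff_const.mul Complex.ofRealCLM.contDiff)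
  obtain ⟨τ, hτ, hτY⟩ := exists_taylorNorm_stepSum_le (𝔄 := 𝔄) r hz hζ hT hzp hζp
  obtain ⟨v, hv⟩ := exists_taylorNorm_le_of_periodic r hV hT hVp
  have hv0 : 0 ≤ v := (taylorNorm_nonneg r 0 V).trans (hv 0)
  set B : ℝ → 𝔄 := fun θ => stepSum Y₀ (z θ) (Complex.exp (Complex.I * θ))
  have hBs : ContDiff ℝ ∞ B := contDiff_stepSum Y₀ hz hζ
  obtain ⟨c₁, hc₁⟩ := exists_taylorNorm_le_of_periodic (f := B - 1) r
    (hBs.sub contDiff_const) hT fun θ => by simp only [B, Pi.sub_apply, hzp, hζp, Pi.one_apply]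
  set c := max c₁ ((r + 1) * 2 ^ r)
  have hc : (r + 1) * 2 ^ r ≤ c := le_max_right _ _
  have hc0 : 0 ≤ c := le_trans (by positivity) hc
  set A := (c + c * c) * Real.exp ((c + c * c) * (τ * M)) * v * τ
  have hA : 0 ≤ A := by positivity
  -- The constant depends on the perturbation only through the moment bound M; this makes it uniform
  -- over all starting sites of a half line.
  refine ⟨r.factorial * (v + A * M), fun Y p hY hp hpM L hL => ?_⟩
  have hp0 : ∀ k, 0 ≤ p k := fun k => (norm_nonneg _).trans (hY k 0)
  set F : ℕ → ℝ → 𝔄 := fun k θ => stepSum (Y k - Y₀) (z θ) (Complex.exp (Complex.I * θ))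
  have hFs : ∀ k, ContDiff ℝ ∞ (F k) := fun k => contDiff_stepSum _ hz hζ
  have hF : ∀ k θ, taylorNorm r θ (F k) ≤ τ * p k := fun k θ => hτY _ _ _ (hY k)
  have hBF : ∀ k θ, stepSum (Y k) (z θ) (Complex.exp (Complex.I * θ)) = (B + F k) θ := fun k θ => by
    simp only [B, F, stepSum_sub, Pi.add_apply]; abel
  have hterm : ∀ N θ, taylorNorm r θ
      (partialProd (fun k => B + F k) N * ((B + F N) * V - V))
      ≤ A * ((1 + N) ^ (r + 1) * p N) := by
    intro N θ
    refine (taylorNorm_jost_term_le (M := τ * M) hBs hV hFs (fun θ => ?_) hBV hc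
      ((hc₁ θ).trans (le_max_left _ _)) (fun N => ?_) N).trans ?_
    · have h := hB θ
      rw [← Complex.exp_nat_mul] at h
      simp only [B]
      rw [h]
      congr 2
      push_cast
      ring
    · refine le_trans ?_ (mul_le_mul_of_nonneg_left ((hp.sum_le_tsum (Finset.range N) fun j _ =>
        mul_nonneg (by positivity) (hp0 j)).trans hpM) hτ)
      rw [Finset.mul_sum]
      refine Finset.sum_le_sum fun j _ => ?_
      have := mul_le_mul_of_nonneg_left (hF j θ) (by positivity : (0 : ℝ) ≤ (1 + j) ^ (r + 1))
      linarith
    · have h1 : (1 + N : ℝ) ^ (r + 1) * taylorNorm r θ (F N) ≤ (1 + N) ^ (r + 1) * (τ * p N) :=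
        mul_le_mul_of_nonneg_left (hF N θ) (by positivity)
      have h2 := mul_le_mul (mul_le_mul_of_nonneg_left (hv θ)
        (by positivity : 0 ≤ (c + c * c) * Real.exp ((c + c * c) * (τ * M)))) h1
        (mul_nonneg (by positivity) (taylorNorm_nonneg _ _ _)) (by positivity)
      exact h2.trans (le_of_eq (by simp only [A]; ring))
  obtain ⟨hcd, hbd⟩ := contDiff_jostLimit (fun k => hBs.add (hFs k)) hV
    (hp.mul_left A).hasSum hv hterm
  have hA' : (∑' k : ℕ, A * ((1 + k : ℝ) ^ (r + 1) * p k)) ≤ A * M := by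
    rw [tsum_mul_left]; exact mul_le_mul_of_nonneg_left hpM hA
  have hle : r.factorial * (v + ∑' k : ℕ, A * ((1 + k : ℝ) ^ (r + 1) * p k))
      ≤ r.factorial * (v + A * M) := by gcongr
  simp only [hBF]
  set J : ℝ → 𝔄 := fun θ => jostLimit (fun k => (B + F k) θ) (V θ)
  have hL1 : ∀ x : 𝔄, ‖L x‖ ≤ ‖x‖ := fun x =>
    (L.le_opNorm x).trans (mul_le_of_le_one_left (norm_nonneg _) hL)
  refine ⟨(L.restrictScalars ℝ).contDiff.comp hcd, fun θ => ⟨?_, ?_⟩⟩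
  · have := hbd 0 (Nat.zero_le _) θ
    rw [iteratedDeriv_zero] at this
    exact (hL1 _).trans (this.trans hle)
  · have h1 := hbd 1 hr θ
    rw [iteratedDeriv_one] at h1
    have h2 : HasDerivAt J (deriv J θ) θ :=
      ((hcd.differentiable (by exact_mod_cast (by omega : r ≠ 0))) θ).hasDerivAt
    have h3 : HasDerivAt (fun θ => L (J θ)) (L (deriv J θ)) θ :=
      (L.restrictScalars ℝ).hasFDerivAt.comp_hasDerivAt θ h2
    rw [h3.deriv]
    exact (hL1 _).trans (h1.trans hle)

end StepSum

end DiscreteDirac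
end

/-! ### Moments of the potential and existence of Jost solutions -/

noncomputable section

namespace DiscreteDirac

open Set Filter Topology
open scoped ContDiff Matrix

attribute [local instance] Matrix.linftyOpNormedRing Matrix.linftyOpNormedAlgebra

theorem summable_moment_shift {a : ℤ → ℝ} (ha : ∀ n, 0 ≤ a n) {s : ℕ}
    (h : Summable fun n : ℤ => (1 + |(n : ℝ)|) ^ s * a n) (n : ℤ) :
    Summable fun k : ℕ => (1 + k : ℝ) ^ s * a (n + k) := by
  have hinj : Function.Injective fun k : ℕ => n + (k : ℤ) := fun i j hij => by
    simpa using hij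
  refine Summable.of_nonneg_of_le (fun k => mul_nonneg (by positivity) (ha _)) (fun k => ?_)
    ((h.comp_injective hinj).mul_left ((1 + |(n : ℝ)|) ^ s))
  simp only [Function.comp_apply]
  rw [← mul_assoc, ← mul_pow]
  refine mul_le_mul_of_nonneg_right (pow_le_pow_left₀ (by positivity) ?_ _) (ha _)
  push_cast
  have h1 : (k : ℝ) ≤ |(n : ℝ)| + |(n : ℝ) + k| := by
    have := abs_sub ((n : ℝ) + k) n
    rw [add_sub_cancel_left, Nat.abs_cast] at this
    linarith
  nlinarith [abs_nonneg (n : ℝ), abs_nonneg ((n : ℝ) + k)]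

/-- For n ≥ 0 the distance from the starting site is at most the distance from the origin. This is
why uniform bounds hold on a half line only. -/
theorem tsum_moment_shift_le {a : ℤ → ℝ} (ha : ∀ n, 0 ≤ a n) {s : ℕ}
    (h : Summable fun n : ℤ => (1 + |(n : ℝ)|) ^ s * a n) {n : ℤ} (hn : 0 ≤ n) :
    ∑' k : ℕ, (1 + k : ℝ) ^ s * a (n + k) ≤ ∑' j : ℤ, (1 + |(j : ℝ)|) ^ s * a j := by
  have hinj : Function.Injective fun k : ℕ => n + (k : ℤ) := fun i j hij => by
    simpa using hij
  refine (Summable.tsum_le_tsum (fun k => ?_) (summable_moment_shift ha h n)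
    (h.comp_injective hinj)).trans (tsum_comp_le_tsum_of_inj h
      (fun j => mul_nonneg (by positivity) (ha _)) hinj)
  simp only [Function.comp_apply]
  refine mul_le_mul_of_nonneg_right (pow_le_pow_left₀ (by positivity) ?_ _) (ha _)
  push_cast
  have : (0 : ℝ) ≤ n := by exact_mod_cast hn
  rw [abs_of_nonneg (by positivity)]
  linarith

theorem tendsto_tsum_moment_shift {a : ℤ → ℝ} (ha : ∀ n, 0 ≤ a n) {s : ℕ}
    (h : Summable fun n : ℤ => (1 + |(n : ℝ)|) ^ s * a n) :
    Tendsto (fun n : ℕ => ∑' k : ℕ, (1 + k : ℝ) ^ s * a ((n : ℤ) + k)) atTop (𝓝 0) := by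
  have hinj : Function.Injective fun k : ℕ => (k : ℤ) := Nat.cast_injective
  have h1 := h.comp_injective hinj
  refine squeeze_zero (fun n => tsum_nonneg fun k => mul_nonneg (by positivity) (ha _))
    (fun n => ?_) (tendsto_sum_nat_add ((fun n : ℤ => (1 + |(n : ℝ)|) ^ s * a n) ∘ fun k : ℕ => (k : ℤ)))
  refine Summable.tsum_le_tsum (fun k => ?_) (summable_moment_shift ha h n)
    ((summable_nat_add_iff n).2 h1)
  simp only [Function.comp_apply]
  have e : ((k + n : ℕ) : ℤ) = n + k := by push_cast; ring
  rw [e]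
  refine mul_le_mul_of_nonneg_right (pow_le_pow_left₀ (by positivity) ?_ _) (ha _)
  push_cast
  rw [abs_of_nonneg (by positivity)]
  linarith [(Nat.cast_nonneg n : (0 : ℝ) ≤ n)]

/-- The standing hypotheses on the mass and the potential, with `r + 1` moments. -/
structure Admissible (m : ℝ) (Q : ℤ → Matrix (Fin 2) (Fin 2) ℝ) (r : ℕ) : Prop where
  pos : 0 < m
  symm : ∀ n, Q n 0 1 = Q n 1 0
  ne : ∀ n, Q n 1 0 ≠ -1
  summable : Summable fun n : ℤ => (1 + |(n : ℝ)|) ^ (r + 1) * potNorm (Q n)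

theorem MemWeighted.summable {u : ℤ → ℝ} {s : ℕ} (h : MemWeighted 1 (s : ℝ) u) :
    Summable fun n : ℤ => (1 + |(n : ℝ)|) ^ s * |u n| := by
  simp only [MemWeighted, weightedNorm, ENNReal.one_ne_top, if_false, ENNReal.toReal_one,
    one_mul, Real.rpow_one, div_one, ENNReal.rpow_one, Real.norm_eq_abs, Real.rpow_natCast] at h
  have h1 := ENNReal.summable_toReal h.ne
  refine h1.congr fun n => ?_
  rw [ENNReal.toReal_ofReal (by positivity)]

theorem admissible_of_memWeighted {m : ℝ} (hm : 0 < m) {Q : ℤ → Matrix (Fin 2) (Fin 2) ℝ}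
    (hsymm : ∀ n, Q n 0 1 = Q n 1 0) (hne : ∀ n, Q n 1 0 ≠ -1) (r : ℕ)
    (hQ : ∀ i j, MemWeighted 1 ((r + 1 : ℕ) : ℝ) (fun n => Q n i j)) : Admissible m Q r where
  pos := hm
  symm := hsymm
  ne := hne
  summable := by
    simp only [potNorm, Finset.mul_sum]
    exact summable_sum fun i _ => summable_sum fun j _ => (hQ i j).summable

variable {m : ℝ} {Q : ℤ → Matrix (Fin 2) (Fin 2) ℝ} {r : ℕ}

theorem Admissible.mono (h : Admissible m Q r) {s : ℕ} (hs : s ≤ r) : Admissible m Q s where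
  pos := h.pos
  symm := h.symm
  ne := h.ne
  summable := by
    refine Summable.of_nonneg_of_le (fun n => mul_nonneg (by positivity) (potNorm_nonneg _))
      (fun n => ?_) h.summable
    exact mul_le_mul_of_nonneg_right (pow_le_pow_right₀ (by linarith [abs_nonneg (n : ℝ)])
      (by omega)) (potNorm_nonneg _)

theorem Admissible.summable_potNorm (h : Admissible m Q r) : Summable fun n => potNorm (Q n) := by
  refine Summable.of_nonneg_of_le (fun n => potNorm_nonneg _) (fun n => ?_) h.summable
  exact le_mul_of_one_le_left (potNorm_nonneg _)
    (one_le_pow₀ (by linarith [abs_nonneg (n : ℝ)]))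

/-- The potential tends to zero, so 1 + q₂₁ exceeds 1/2 off a finite set, and it is nonzero on that
set. -/
theorem Admissible.exists_bounds (h : Admissible m Q r) :
    ∃ A b : ℝ, ∀ n, |1 / (1 + Q n 1 0)| ≤ A ∧ potNorm (Q n) ≤ b := by
  have h1 := h.summable_potNorm
  have h2 : ∀ᶠ n in cofinite, potNorm (Q n) < 1 / 2 :=
    h1.tendsto_cofinite_zero.eventually (gt_mem_nhds (by norm_num))
  have hfin : {n | ¬ potNorm (Q n) < 1 / 2}.Finite := h2
  obtain ⟨A, hA⟩ := (hfin.image fun n => |1 / (1 + Q n 1 0)|).bddAbove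
  refine ⟨max A 2, ∑' n, potNorm (Q n), fun n => ⟨?_, h1.le_tsum n fun j _ => potNorm_nonneg _⟩⟩
  by_cases hn : potNorm (Q n) < 1 / 2
  · refine le_max_of_le_right ?_
    have h3 := (abs_le_potNorm (Q n) 1 0).trans hn.le
    have h4 := abs_le.1 h3
    rw [abs_of_nonneg (by apply div_nonneg zero_le_one; linarith), div_le_iff₀ (by linarith)]
    linarith
  · exact le_max_of_le_left (hA ⟨n, hn, rfl⟩)

/-- The coefficient sequences of the two transfer problems; `true` is the right half line (with
inverse transfer matrices), `false` the reflected left half line. -/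
def sideCoeff (m : ℝ) (Q : ℤ → Matrix (Fin 2) (Fin 2) ℝ) (b : Bool) (n : ℤ) (l : Fin 3) : M2 :=
  if b then (transferCoeff m (Q n) l).adjugate else transferCoeff m (Q (-n)) l

/-- The coefficients of the free transfer problems. -/
def freeCoeff (m : ℝ) (b : Bool) (l : Fin 3) : M2 :=
  if b then (transferCoeff m 0 l).adjugate else transferCoeff m 0 l

/-- The potential seen from one side. -/
def sidePot (Q : ℤ → Matrix (Fin 2) (Fin 2) ℝ) (b : Bool) (n : ℤ) : ℝ :=
  potNorm (Q (if b then n else -n))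

theorem sidePot_nonneg (b : Bool) (n : ℤ) : 0 ≤ sidePot Q b n := potNorm_nonneg _

theorem Admissible.summable_sidePot (h : Admissible m Q r) (b : Bool) :
    Summable fun n : ℤ => (1 + |(n : ℝ)|) ^ (r + 1) * sidePot Q b n := by
  cases b
  · have := (Equiv.neg ℤ).summable_iff.2 h.summable
    refine this.congr fun n => ?_
    simp [sidePot]
  · exact h.summable

theorem Admissible.exists_norm_sideCoeff_sub_le (h : Admissible m Q r) :
    ∃ K : ℝ, 0 ≤ K ∧ ∀ b n l, ‖sideCoeff m Q b n l - freeCoeff m b l‖ ≤ K * sidePot Q b n := by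
  obtain ⟨A, b, hAb⟩ := h.exists_bounds
  have hA0 : 0 ≤ A := (abs_nonneg _).trans (hAb 0).1
  have hb0 : 0 ≤ b := (potNorm_nonneg _).trans (hAb 0).2
  have hm := h.pos
  refine ⟨2 * (A * (2 * m + b + m ^ 2 + 2) + 1), by positivity, fun c n l => ?_⟩
  have key := fun n => norm_transferCoeff_sub_le hm (h.ne n) (hAb n).1 (hAb n).2 l
  rw [mul_assoc]
  refine m2_norm_le fun i j => ?_
  cases c
  · simpa [sideCoeff, freeCoeff, sidePot] using key (-n) i j
  · have k2 := key n
    simp only [Matrix.sub_apply] at k2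
    simp only [sideCoeff, freeCoeff, sidePot, if_true, Matrix.sub_apply]
    fin_cases i <;> fin_cases j <;> simp only [Matrix.adjugate_fin_two, Fin.mk_zero, Fin.mk_one,
      Matrix.of_apply, Matrix.cons_val', Matrix.cons_val_zero, Matrix.cons_val_one,
      Matrix.cons_val_fin_one, Fin.isValue]
    · exact k2 1 1
    · rw [neg_sub_neg, norm_sub_rev]; exact k2 0 1
    · rw [neg_sub_neg, norm_sub_rev]; exact k2 1 0
    · exact k2 0 0

/-- The matrix with first column an eigenvector of the free transfer matrix. -/
def jostVec (m : ℝ) (z ζ : ℂ) : M2 := !![z + m + 1 - ζ⁻¹, 0; ζ - 1 + m - z, 0]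

/-- The asymptotic vector of the Jost solution on one side. -/
def sideVec (m : ℝ) (b : Bool) (z ζ : ℂ) : M2 := jostVec m z (if b then ζ else ζ⁻¹)

/-- The dispersion curve relating spectral parameter and multiplier. -/
def OnCurve (m : ℝ) (z ζ : ℂ) : Prop := ζ ^ 2 + 1 = (2 + m ^ 2 - z ^ 2) * ζ

theorem OnCurve.ne_zero {z ζ : ℂ} (h : OnCurve m z ζ) : ζ ≠ 0 := by
  rintro rfl
  simp [OnCurve] at h

theorem OnCurve.inv {z ζ : ℂ} (h : OnCurve m z ζ) : OnCurve m z ζ⁻¹ := by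
  have h0 := h.ne_zero
  unfold OnCurve at *
  field_simp
  linear_combination h

theorem OnCurve.add_inv {z ζ : ℂ} (h : OnCurve m z ζ) : ζ + ζ⁻¹ = 2 + m ^ 2 - z ^ 2 := by
  have h0 := h.ne_zero
  unfold OnCurve at h
  field_simp
  linear_combination h

theorem transferMat_free (m : ℝ) (z : ℂ) :
    transferMat m 0 z = !![1, z + m; m - z, (m - z) * (z + m) + 1] := by
  ext i j
  fin_cases i <;> fin_cases j <;> simp [transferMat]

/-- The column is the sum of the two eigenvectors (z + m, ζ − 1) and (1 − ζ⁻¹, m − z), obtained from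
the two components of the equation. Either alone vanishes at some band edges; their sum does not
vanish on the bands. -/
theorem transferMat_free_mul_jostVec {z ζ : ℂ} (h : OnCurve m z ζ) :
    transferMat m 0 z * jostVec m z ζ = ζ • jostVec m z ζ := by
  have h1 := h.add_inv
  have h2 : ζ * ζ⁻¹ = 1 := mul_inv_cancel₀ h.ne_zero
  rw [transferMat_free, jostVec]
  ext i j
  fin_cases i <;> fin_cases j <;> simp [Matrix.mul_apply, Fin.sum_univ_two]
  · linear_combination -h1 + h2
  · linear_combination (-ζ - m + z) * h1 + h2

theorem stepSum_sideCoeff (b : Bool) (n : ℤ) (z ζ : ℂ) :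
    stepSum (sideCoeff m Q b n) z ζ = ζ • (if b then (transferMat m (Q n) z).adjugate
      else transferMat m (Q (-n)) z) := by
  cases b
  · simp [stepSum, sideCoeff, transferMat_eq_sum, Finset.smul_sum, smul_smul]
  · simp [stepSum, sideCoeff, adjugate_transferMat_eq_sum, Finset.smul_sum, smul_smul]

theorem stepSum_freeCoeff (b : Bool) (z ζ : ℂ) :
    stepSum (freeCoeff m b) z ζ = ζ • (if b then (transferMat m 0 z).adjugate
      else transferMat m 0 z) := by
  cases b
  · simp [stepSum, freeCoeff, transferMat_eq_sum, Finset.smul_sum, smul_smul]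
  · simp [stepSum, freeCoeff, adjugate_transferMat_eq_sum, Finset.smul_sum, smul_smul]

/-- The free transfer matrix has eigenvalues ζ and ζ⁻¹, so after multiplication by ζ they are ζ² and
1; this is Cayley–Hamilton. -/
theorem stepSum_freeCoeff_sub_one_mul {z ζ : ℂ} (h : OnCurve m z ζ) (b : Bool) :
    (stepSum (freeCoeff m b) z ζ - 1) * stepSum (freeCoeff m b) z ζ
      = ζ ^ 2 • (stepSum (freeCoeff m b) z ζ - 1) := by
  rw [stepSum_freeCoeff]
  unfold OnCurve at h
  cases b
  · simp only [Bool.false_eq_true, if_false, transferMat_free]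
    ext i j
    fin_cases i <;> fin_cases j <;> simp [Matrix.mul_apply, Fin.sum_univ_two]
    · linear_combination (-ζ) * h
    · linear_combination (-ζ * (z + m)) * h
    · linear_combination (-ζ * (m - z)) * h
    · linear_combination (-ζ * ((m - z) * (z + m) + 1)) * h
  · simp only [if_true, transferMat_free, Matrix.adjugate_fin_two]
    ext i j
    fin_cases i <;> fin_cases j <;> simp [Matrix.mul_apply, Fin.sum_univ_two]
    · linear_combination (-ζ * ((m - z) * (z + m) + 1)) * h
    · linear_combination (ζ * (z + m)) * h
    · linear_combination (ζ * (m - z)) * h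
    · linear_combination (-ζ) * h

theorem stepSum_freeCoeff_mul_sideVec {z ζ : ℂ} (h : OnCurve m z ζ) (b : Bool) :
    stepSum (freeCoeff m b) z ζ * sideVec m b z ζ = sideVec m b z ζ := by
  rw [stepSum_freeCoeff, sideVec]
  cases b
  · simp only [Bool.false_eq_true, if_false, Matrix.smul_mul]
    rw [transferMat_free_mul_jostVec h.inv, smul_smul, mul_inv_cancel₀ h.ne_zero, one_smul]
  · simp only [if_true, Matrix.smul_mul]
    rw [← Matrix.mul_smul, ← transferMat_free_mul_jostVec h, ← Matrix.mul_assoc,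
      Matrix.adjugate_mul, det_transferMat (by norm_num), one_smul, Matrix.one_mul]

/-- The matrix whose first column is the normalized Jost solution on one side. -/
def jost (m : ℝ) (Q : ℤ → Matrix (Fin 2) (Fin 2) ℝ) (b : Bool) (n : ℤ) (z ζ : ℂ) : M2 :=
  jostLimit (fun k : ℕ => stepSum (sideCoeff m Q b (n + k)) z ζ) (sideVec m b z ζ)

/-- The Jost series is dominated by the tail of the first moment of the potential. -/
theorem Admissible.exists_jost_term_le (h : Admissible m Q 0) {z ζ : ℂ} (hc : OnCurve m z ζ)
    (hζ : ‖ζ‖ ≤ 1) (b : Bool) (n : ℤ) :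
    ∃ K : ℝ, 0 ≤ K ∧ ∀ n', (0 ≤ n' ∨ n' = n) → ∀ N : ℕ,
      ‖partialProd (fun k : ℕ => stepSum (sideCoeff m Q b (n' + k)) z ζ) N
        * (stepSum (sideCoeff m Q b (n' + N)) z ζ * sideVec m b z ζ - sideVec m b z ζ)‖
      ≤ K * ((1 + N) * sidePot Q b (n' + N)) := by
  obtain ⟨K, hK, hKs⟩ := h.exists_norm_sideCoeff_sub_le
  have hs : Summable fun n : ℤ => (1 + |(n : ℝ)|) ^ 1 * sidePot Q b n := h.summable_sidePot b
  -- The bound has to cover all n' ≥ 0, for the asymptotics at infinity, and the given site n, for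
  -- the recurrence.
  set M₀ := max (∑' j : ℤ, (1 + |(j : ℝ)|) ^ 1 * sidePot Q b j)
    (∑' k : ℕ, (1 + k : ℝ) ^ 1 * sidePot Q b (n + k))
  have hM₀ : ∀ n', (0 ≤ n' ∨ n' = n) → ∑' k : ℕ, (1 + k : ℝ) ^ 1 * sidePot Q b (n' + k) ≤ M₀ := by
    rintro n' (h' | rfl)
    · exact (tsum_moment_shift_le (sidePot_nonneg b) hs h').trans (le_max_left _ _)
    · exact le_max_right _ _
  obtain ⟨y, hy⟩ : ∃ y, ∀ l, ‖freeCoeff m b l‖ ≤ y := ⟨∑ l, ‖freeCoeff m b l‖, fun l =>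
    Finset.single_le_sum (f := fun l => ‖freeCoeff m b l‖) (fun _ _ => norm_nonneg _)
      (Finset.mem_univ l)⟩
  have hy0 : 0 ≤ y := (norm_nonneg _).trans (hy 0)
  refine ⟨jostConst (max 1 ‖z‖) y (K * M₀) * ‖sideVec m b z ζ‖ * K,
    mul_nonneg (mul_nonneg (jostConst_nonneg hy0) (norm_nonneg _)) hK, fun n' hn' N => ?_⟩
  refine (norm_jost_stepSum_term_le (p := fun k : ℕ => K * sidePot Q b (n' + k)) (M := K * M₀)
    (le_max_left 1 ‖z‖) hy (fun k l => hKs b _ l) (fun N => ?_) (le_max_right _ _) hζ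
    (stepSum_freeCoeff_sub_one_mul hc b) (stepSum_freeCoeff_mul_sideVec hc b) N).trans
      (le_of_eq (by ring))
  have h1 := summable_moment_shift (sidePot_nonneg b) hs n'
  have h2 := (h1.sum_le_tsum (Finset.range N) fun j _ =>
    mul_nonneg (by positivity) (sidePot_nonneg b _)).trans (hM₀ n' hn')
  refine le_trans (le_of_eq ?_) (mul_le_mul_of_nonneg_left h2 hK)
  rw [Finset.mul_sum]
  refine Finset.sum_congr rfl fun j _ => ?_
  ring

theorem Admissible.summable_jost_term (h : Admissible m Q 0) {z ζ : ℂ} (hc : OnCurve m z ζ)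
    (hζ : ‖ζ‖ ≤ 1) (b : Bool) (n : ℤ) :
    Summable fun N : ℕ => partialProd (fun k : ℕ => stepSum (sideCoeff m Q b (n + k)) z ζ) N
      * (stepSum (sideCoeff m Q b (n + N)) z ζ * sideVec m b z ζ - sideVec m b z ζ) := by
  obtain ⟨K, hK, hb⟩ := h.exists_jost_term_le hc hζ b n
  have hs : Summable fun n : ℤ => (1 + |(n : ℝ)|) ^ 1 * sidePot Q b n := h.summable_sidePot b
  have h1 := summable_moment_shift (sidePot_nonneg b) hs n
  simp only [pow_one] at h1
  exact Summable.of_norm_bounded (h1.mul_left K) (hb n (Or.inr rfl))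

theorem Admissible.jost_eq (h : Admissible m Q 0) {z ζ : ℂ} (hc : OnCurve m z ζ)
    (hζ : ‖ζ‖ ≤ 1) (b : Bool) (n : ℤ) :
    jost m Q b n z ζ = stepSum (sideCoeff m Q b n) z ζ * jost m Q b (n + 1) z ζ := by
  have e : ∀ k : ℕ, n + ((k + 1 : ℕ) : ℤ) = n + 1 + k := fun k => by push_cast; ring
  have h1 := h.summable_jost_term hc hζ b n
  have h2 := h.summable_jost_term hc hζ b (n + 1)
  have h3 := jostLimit_eq_mul (C := fun k : ℕ => stepSum (sideCoeff m Q b (n + k)) z ζ)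
    (V := sideVec m b z ζ) h1 (by simpa only [e] using h2)
  simp only [e] at h3
  simpa [jost] using h3

theorem Admissible.tendsto_jost (h : Admissible m Q 0) {z ζ : ℂ} (hc : OnCurve m z ζ)
    (hζ : ‖ζ‖ ≤ 1) (b : Bool) :
    Tendsto (fun n : ℕ => jost m Q b n z ζ) atTop (𝓝 (sideVec m b z ζ)) := by
  obtain ⟨K, hK, hb⟩ := h.exists_jost_term_le hc hζ b 0
  have hs : Summable fun n : ℤ => (1 + |(n : ℝ)|) ^ 1 * sidePot Q b n := h.summable_sidePot b
  have h1 := (tendsto_tsum_moment_shift (sidePot_nonneg b) hs).const_mul K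
  rw [mul_zero] at h1
  rw [tendsto_iff_norm_sub_tendsto_zero]
  refine squeeze_zero (fun _ => norm_nonneg _) (fun n => ?_) h1
  have h2 := summable_moment_shift (sidePot_nonneg b) hs n
  have h3 := norm_jostLimit_sub_le (h2.mul_left K).hasSum
    (C := fun k : ℕ => stepSum (sideCoeff m Q b (n + k)) z ζ) (V := sideVec m b z ζ)
    (fun N => by simpa using hb n (Or.inl (Nat.cast_nonneg n)) N)
  rw [tsum_mul_left] at h3
  exact h3

/-- The part of the dispersion curve over a disc. -/
def curveSet (m R : ℝ) : Set (ℂ × ℂ) := {p | OnCurve m p.1 p.2 ∧ ‖p.1‖ ≤ R ∧ ‖p.2‖ ≤ 1}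

theorem continuousOn_jostVec {Ω : Set (ℂ × ℂ)} (f : ℂ × ℂ → ℂ) (hf : ContinuousOn f Ω)
    (h0 : ∀ p ∈ Ω, f p ≠ 0) : ContinuousOn (fun p => jostVec m p.1 (f p)) Ω := by
  have hinv := hf.inv₀ h0
  rw [continuousOn_iff_continuous_domRestrict] at *
  refine continuous_matrix fun i j => ?_
  have h1 : Continuous fun x : Ω => (x : ℂ × ℂ).1 := continuous_fst.comp continuous_subtype_val
  fin_cases i <;> fin_cases j <;> simp [jostVec]
  · exact ((h1.add continuous_const).add continuous_const).sub hinv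
  · exact continuous_const
  · exact ((hf.sub continuous_const).add continuous_const).sub h1
  · exact continuous_const

theorem isCompact_curveSet (m R : ℝ) : IsCompact (curveSet m R) := by
  have h1 : IsCompact (Metric.closedBall (0 : ℂ) R ×ˢ Metric.closedBall (0 : ℂ) 1) :=
    (isCompact_closedBall _ _).prod (isCompact_closedBall _ _)
  have h2 : IsClosed {p : ℂ × ℂ | p.2 ^ 2 + 1 = (2 + m ^ 2 - p.1 ^ 2) * p.2} :=
    isClosed_eq (by fun_prop) (by fun_prop)
  refine (h1.inter_right h2).of_isClosed_subset ?_ ?_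
  · have : curveSet m R = {p : ℂ × ℂ | p.2 ^ 2 + 1 = (2 + m ^ 2 - p.1 ^ 2) * p.2}
        ∩ (Metric.closedBall (0 : ℂ) R ×ˢ Metric.closedBall (0 : ℂ) 1) := by
      ext p; simp [curveSet, OnCurve]
    rw [this]
    exact h2.inter (Metric.isClosed_closedBall.prod Metric.isClosed_closedBall)
  · intro p hp
    simp only [curveSet, OnCurve, mem_ofPred_eq] at hp
    simp [hp.1, hp.2.1, hp.2.2]

theorem continuousOn_sideVec (R : ℝ) (b : Bool) :
    ContinuousOn (fun p : ℂ × ℂ => sideVec m b p.1 p.2) (curveSet m R) := by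
  cases b
  · exact continuousOn_jostVec (fun p => p.2⁻¹)
      (continuousOn_snd.inv₀ fun p hp => hp.1.ne_zero) fun p hp => inv_ne_zero hp.1.ne_zero
  · exact continuousOn_jostVec (fun p => p.2) continuousOn_snd fun p hp => hp.1.ne_zero

/-- Continuity holds up to the unit circle, where the parameter becomes real; limiting absorption
rests on it. The first moment suffices. -/
theorem Admissible.continuousOn_jost (h : Admissible m Q 0) {R : ℝ} (hR : 1 ≤ R) (b : Bool)
    (n : ℤ) : ContinuousOn (fun p : ℂ × ℂ => jost m Q b n p.1 p.2) (curveSet m R) := by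
  obtain ⟨K, hK, hKs⟩ := h.exists_norm_sideCoeff_sub_le
  have hs : Summable fun n : ℤ => (1 + |(n : ℝ)|) ^ 1 * sidePot Q b n := h.summable_sidePot b
  have h1 := (summable_moment_shift (sidePot_nonneg b) hs n).mul_left K
  obtain ⟨v, hv⟩ := (isCompact_curveSet m R).exists_bound_of_continuousOn
    (continuousOn_sideVec (m := m) R b)
  refine continuousOn_jostLimit_stepSum (Y := fun k : ℕ => sideCoeff m Q b (n + k))
    (p := fun k : ℕ => K * sidePot Q b (n + k)) hR (fun k l => hKs b _ l)
    (h1.congr fun k => by ring) (continuousOn_sideVec R b) hv (fun p hp => hp.2.1)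
    (fun p hp => hp.2.2) (fun p hp => stepSum_freeCoeff_sub_one_mul hp.1 b)
    fun p hp => stepSum_freeCoeff_mul_sideVec hp.1 b

end DiscreteDirac
end

/-! ### Jost solutions on the bands, Wronskians, equivalence with the Dirac equation -/

noncomputable section

namespace DiscreteDirac

open Set Filter Topology
open scoped ContDiff Matrix

attribute [local instance] Matrix.linftyOpNormedRing Matrix.linftyOpNormedAlgebra

section Generic

variable {𝔄 : Type*} [NormedRing 𝔄] [NormOneClass 𝔄] [NormedAlgebra ℂ 𝔄] [CompleteSpace 𝔄]

/-- Writing the asymptotic vector as scalar functions times constant matrices reduces its regularity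
and periodicity to those of scalar functions. -/
theorem exists_contDiff_jostLimit_stepSum_smul {r : ℕ} (hr : 1 ≤ r) (Y₀ : Fin 3 → 𝔄) {z f g : ℝ → ℂ}
    (A B : 𝔄) (hz : ContDiff ℝ ∞ z) (hf : ContDiff ℝ ∞ f) (hg : ContDiff ℝ ∞ g) {T : ℝ} (hT : 0 < T)
    (hzp : ∀ θ, z (θ + T) = z θ) (hfp : ∀ θ, f (θ + T) = f θ) (hgp : ∀ θ, g (θ + T) = g θ)
    (hζp : ∀ θ : ℝ, Complex.exp (Complex.I * (θ + T : ℝ)) = Complex.exp (Complex.I * θ))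
    (hB : ∀ θ : ℝ, (stepSum Y₀ (z θ) (Complex.exp (Complex.I * θ)) - 1)
        * stepSum Y₀ (z θ) (Complex.exp (Complex.I * θ))
      = Complex.exp (Complex.I * θ) ^ 2 • (stepSum Y₀ (z θ) (Complex.exp (Complex.I * θ)) - 1))
    {V : ℝ → 𝔄} (hV : ∀ θ, V θ = f θ • A + g θ • B)
    (hBV : ∀ θ : ℝ, stepSum Y₀ (z θ) (Complex.exp (Complex.I * θ)) * V θ = V θ) (M : ℝ) :
    ∃ K : ℝ, ∀ (Y : ℕ → Fin 3 → 𝔄) (p : ℕ → ℝ), (∀ k l, ‖Y k l - Y₀ l‖ ≤ p k) →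
      (Summable fun k : ℕ => (1 + k : ℝ) ^ (r + 1) * p k) →
      (∑' k : ℕ, (1 + k : ℝ) ^ (r + 1) * p k ≤ M) → ∀ L : 𝔄 →L[ℂ] ℂ, ‖L‖ ≤ 1 →
      ContDiff ℝ r (fun θ : ℝ =>
        L (jostLimit (fun k => stepSum (Y k) (z θ) (Complex.exp (Complex.I * θ))) (V θ))) ∧
      ∀ θ : ℝ,
        ‖L (jostLimit (fun k => stepSum (Y k) (z θ) (Complex.exp (Complex.I * θ))) (V θ))‖ ≤ K ∧
        ‖deriv (fun θ : ℝ =>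
          L (jostLimit (fun k => stepSum (Y k) (z θ) (Complex.exp (Complex.I * θ))) (V θ))) θ‖
            ≤ K := by
  refine exists_contDiff_jostLimit_stepSum hr Y₀ hz ?_ hT hzp (fun θ => ?_) hζp hB hBV M
  · rw [funext hV]
    exact (hf.smul contDiff_const).add (hg.smul contDiff_const)
  · rw [hV, hV, hfp, hgp]

end Generic

variable {m : ℝ} {Q : ℤ → Matrix (Fin 2) (Fin 2) ℝ} {r : ℕ}

/-- The spectral parameter on the two bands, `s = ±1`. -/
def band (m s : ℝ) (θ : ℝ) : ℂ := ((s * omega m θ : ℝ) : ℂ)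

/-- The unit circle. -/
def circ (θ : ℝ) : ℂ := Complex.exp (Complex.I * θ)

theorem norm_circ (θ : ℝ) : ‖circ θ‖ = 1 := by
  rw [circ, mul_comm, Complex.norm_exp_ofReal_mul_I]

theorem circ_ne_zero (θ : ℝ) : circ θ ≠ 0 := Complex.exp_ne_zero _

theorem circ_neg (θ : ℝ) : circ (-θ) = (circ θ)⁻¹ := by
  rw [circ, circ, ← Complex.exp_neg]; push_cast; ring_nf

theorem conj_circ (θ : ℝ) : (starRingEnd ℂ) (circ θ) = circ (-θ) := by
  rw [circ, circ, ← Complex.exp_conj]; simp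

theorem circ_eq (θ : ℝ) : circ θ = Real.cos θ + Real.sin θ * Complex.I := by
  rw [circ, mul_comm, Complex.exp_mul_I]; simp

theorem circ_zpow (θ : ℝ) (n : ℤ) : circ θ ^ n = Complex.exp (Complex.I * ((n * θ : ℝ) : ℂ)) := by
  rw [circ, ← Complex.exp_int_mul]; push_cast; ring_nf

theorem contDiff_circ : ContDiff ℝ ∞ circ :=
  Complex.contDiff_exp.comp (contDiff_const.mul Complex.ofRealCLM.contDiff)

theorem circ_add_two_pi (θ : ℝ) : circ (θ + 2 * Real.pi) = circ θ := by
  rw [circ, circ]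
  have : Complex.I * ((θ + 2 * Real.pi : ℝ) : ℂ) = Complex.I * θ + 2 * Real.pi * Complex.I := by
    push_cast; ring
  rw [this, Complex.exp_periodic]

theorem omega_add_two_pi (m θ : ℝ) : omega m (θ + 2 * Real.pi) = omega m θ := by
  simp [omega]

theorem omega_neg (m θ : ℝ) : omega m (-θ) = omega m θ := by
  simp [omega]

theorem contDiff_omega (hm : 0 < m) : ContDiff ℝ ∞ (omega m) := by
  have h : ContDiff ℝ ∞ fun θ : ℝ => m ^ 2 + 2 - 2 * Real.cos θ :=
    contDiff_const.sub (contDiff_const.mul Real.contDiff_cos)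
  refine h.sqrt fun θ => ?_
  have := Real.cos_le_one θ
  nlinarith [sq_nonneg m, mul_pos hm hm]

theorem contDiff_band (hm : 0 < m) (s : ℝ) : ContDiff ℝ ∞ (band m s) :=
  Complex.ofRealCLM.contDiff.comp (contDiff_const.mul (contDiff_omega hm))

theorem onCurve_band (hm : 0 < m) {s : ℝ} (hs : s ^ 2 = 1) (θ : ℝ) :
    OnCurve m (band m s θ) (circ θ) := by
  have h1 : (band m s θ) ^ 2 = m ^ 2 + 2 - 2 * Real.cos θ := by
    have h := omega_sq hm θ
    have h2 : (s * omega m θ) ^ 2 = m ^ 2 + 2 - 2 * Real.cos θ := by rw [mul_pow, hs, h, one_mul]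
    rw [band, ← Complex.ofReal_pow, h2]
    push_cast; ring
  unfold OnCurve
  rw [h1]
  have h2 : circ θ + (circ θ)⁻¹ = 2 * Real.cos θ := by
    rw [← circ_neg, circ_eq, circ_eq, Real.cos_neg, Real.sin_neg]; push_cast; ring
  have h3 := mul_inv_cancel₀ (circ_ne_zero θ)
  linear_combination circ θ * h2 - h3

/-- Regularity of the Jost solutions on the bands, uniformly on the half line. -/
theorem Admissible.exists_contDiff_jost (h : Admissible m Q r) (hr : 1 ≤ r) {s : ℝ}
    (hs : s ^ 2 = 1) (b : Bool) : ∃ K : ℝ, ∀ n : ℤ, 0 ≤ n → ∀ i : Fin 2,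
      ContDiff ℝ r (fun θ => jost m Q b n (band m s θ) (circ θ) i 0) ∧
      ∀ θ, ‖jost m Q b n (band m s θ) (circ θ) i 0‖ ≤ K ∧
        ‖deriv (fun θ => jost m Q b n (band m s θ) (circ θ) i 0) θ‖ ≤ K := by
  obtain ⟨K₀, hK₀, hKs⟩ := h.exists_norm_sideCoeff_sub_le
  have hsum := h.summable_sidePot b
  set ξ : ℝ → ℂ := fun θ => if b then circ θ else circ (-θ)
  have hξ : ContDiff ℝ ∞ ξ := by
    cases b
    · exact contDiff_circ.comp contDiff_neg
    · exact contDiff_circ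
  have hξp : ∀ θ, ξ (θ + 2 * Real.pi) = ξ θ := by
    intro θ
    cases b
    · simp only [ξ, circ_neg, circ_add_two_pi]
    · simp only [ξ, if_true, circ_add_two_pi]
  have hξ0 : ∀ θ, ξ θ ≠ 0 := by
    intro θ; cases b <;> exact circ_ne_zero _
  have hzp : ∀ θ, band m s (θ + 2 * Real.pi) = band m s θ := fun θ => by
    simp only [band, omega_add_two_pi]
  have hz := contDiff_band h.pos s
  obtain ⟨K, hK⟩ := exists_contDiff_jostLimit_stepSum_smul hr (freeCoeff m b)
    (z := band m s) (f := fun θ => band m s θ + m + 1 - (ξ θ)⁻¹)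
    (g := fun θ => ξ θ - 1 + m - band m s θ) !![1, 0; 0, 0] !![0, 0; 1, 0] hz
    (((hz.add contDiff_const).add contDiff_const).sub (hξ.inv hξ0))
    (((hξ.sub contDiff_const).add contDiff_const).sub hz) Real.two_pi_pos hzp
    (fun θ => by rw [hzp, hξp]) (fun θ => by rw [hzp, hξp]) circ_add_two_pi
    (fun θ => stepSum_freeCoeff_sub_one_mul (onCurve_band h.pos hs θ) b)
    (V := fun θ => sideVec m b (band m s θ) (circ θ)) (fun θ => by
      have : (if b then circ θ else (circ θ)⁻¹) = ξ θ := by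
        cases b
        · simp [ξ, circ_neg]
        · simp [ξ]
      simp only [sideVec, this, jostVec]
      ext i j
      fin_cases i <;> fin_cases j <;> simp)
    (fun θ => stepSum_freeCoeff_mul_sideVec (onCurve_band h.pos hs θ) b)
    (K₀ * ∑' j : ℤ, (1 + |(j : ℝ)|) ^ (r + 1) * sidePot Q b j)
  refine ⟨K, fun n hn i => ?_⟩
  have h1 := summable_moment_shift (sidePot_nonneg b) hsum n
  have e : ∀ k : ℕ, (1 + k : ℝ) ^ (r + 1) * (K₀ * sidePot Q b (n + k))
      = K₀ * ((1 + k : ℝ) ^ (r + 1) * sidePot Q b (n + k)) := fun k => by ring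
  have hL : ‖entryCLM i 0‖ ≤ 1 := LinearMap.mkContinuous_norm_le _ zero_le_one _
  refine hK (fun k : ℕ => sideCoeff m Q b (n + k)) (fun k : ℕ => K₀ * sidePot Q b (n + k))
    (fun k l => hKs b _ l) ((h1.mul_left K₀).congr fun k => (e k).symm) ?_ (entryCLM i 0) hL
  simp only [e]
  rw [tsum_mul_left]
  exact mul_le_mul_of_nonneg_left (tsum_moment_shift_le (sidePot_nonneg b) hsum hn) hK₀

/-- Entrywise complex conjugation. -/
def conjM : M2 →+* M2 := (starRingEnd ℂ).mapMatrix

theorem continuous_conjM : Continuous conjM := by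
  have : ∀ M : M2, ‖conjM M‖ ≤ 2 * ‖M‖ := fun M =>
    m2_norm_le fun i j => by
      simpa [conjM] using norm_entry_le M i j
  exact AddMonoidHomClass.continuous_of_bound conjM 2 this

theorem map_partialProd (σ : M2 →+* M2) (C : ℕ → M2) (N : ℕ) :
    σ (partialProd C N) = partialProd (fun k => σ (C k)) N := by
  induction N with
  | zero => simp [partialProd]
  | succ N ih => simp [partialProd, ih]

theorem conjM_stepSum_sideCoeff (b : Bool) (n : ℤ) (z ζ : ℂ) :
    conjM (stepSum (sideCoeff m Q b n) z ζ)
      = stepSum (sideCoeff m Q b n) ((starRingEnd ℂ) z) ((starRingEnd ℂ) ζ) := by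
  have h : ∀ q : Matrix (Fin 2) (Fin 2) ℝ, (transferMat m q z).map (starRingEnd ℂ)
      = transferMat m q ((starRingEnd ℂ) z) := by
    intro q
    ext i j
    fin_cases i <;> fin_cases j <;> simp [transferMat]
  rw [stepSum_sideCoeff, stepSum_sideCoeff]
  cases b
  · ext i j
    simp only [Bool.false_eq_true, if_false, conjM, RingHom.mapMatrix_apply, Matrix.map_apply,
      Matrix.smul_apply, smul_eq_mul, map_mul, ← h]
  · simp only [if_true]
    rw [← h]
    ext i j
    fin_cases i <;> fin_cases j <;> simp [conjM, Matrix.adjugate_fin_two]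

theorem conjM_sideVec (b : Bool) (z ζ : ℂ) :
    conjM (sideVec m b z ζ) = sideVec m b ((starRingEnd ℂ) z) ((starRingEnd ℂ) ζ) := by
  ext i j
  cases b <;> fin_cases i <;> fin_cases j <;> simp [conjM, sideVec, jostVec]

/-- The coefficients are real, so conjugation passes through every term of the Jost series. -/
theorem Admissible.conj_jost (h : Admissible m Q 0) {z ζ : ℂ} (hc : OnCurve m z ζ)
    (hζ : ‖ζ‖ ≤ 1) (b : Bool) (n : ℤ) (i : Fin 2) :
    (starRingEnd ℂ) (jost m Q b n z ζ i 0)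
      = jost m Q b n ((starRingEnd ℂ) z) ((starRingEnd ℂ) ζ) i 0 := by
  have h1 := h.summable_jost_term hc hζ b n
  have h2 := h1.hasSum.map conjM continuous_conjM
  have h3 : conjM (jost m Q b n z ζ)
      = jost m Q b n ((starRingEnd ℂ) z) ((starRingEnd ℂ) ζ) := by
    rw [jost, jostLimit, map_add, ← h2.tsum_eq, conjM_sideVec, jost, jostLimit]
    congr 1
    refine tsum_congr fun N => ?_
    simp only [Function.comp_apply, map_mul, map_sub, map_partialProd, conjM_stepSum_sideCoeff,
      conjM_sideVec]
  exact congrFun (congrFun h3 i) 0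

/-- Solutions of the first order recurrence equivalent to the eigenvalue equation. -/
def IsSol (m : ℝ) (Q : ℤ → Matrix (Fin 2) (Fin 2) ℝ) (z : ℂ) (S : ℤ → Fin 2 → ℂ) : Prop :=
  ∀ n, S (n + 1) = transferMat m (Q n) z *ᵥ S n

/-- The Jost solutions. -/
def jostSol (m : ℝ) (Q : ℤ → Matrix (Fin 2) (Fin 2) ℝ) (b : Bool) (z ζ : ℂ) (n : ℤ) :
    Fin 2 → ℂ := fun i =>
  if b then ζ ^ n * jost m Q true n z ζ i 0 else ζ ^ (-n) * jost m Q false (1 - n) z ζ i 0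

/-- On the left the reflected problem at −n uses the matrix at site n and leads from 1 − n to −n;
hence the index 1 − n in the left Jost solution. -/
theorem Admissible.isSol_jostSol (h : Admissible m Q 0) {z ζ : ℂ} (hc : OnCurve m z ζ)
    (hζ : ‖ζ‖ ≤ 1) (b : Bool) : IsSol m Q z (jostSol m Q b z ζ) := by
  intro n
  have h0 := hc.ne_zero
  cases b
  · have h1 := h.jost_eq hc hζ false (-n)
    rw [stepSum_sideCoeff] at h1
    have e : -n + 1 = 1 - n := by ring
    simp only [Bool.false_eq_true, if_false, neg_neg, Matrix.smul_mul, e] at h1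
    ext i
    have h2 := congrFun (congrFun h1 i) 0
    have e2 : 1 - (n + 1) = -n := by ring
    have e3 : ζ ^ (-n) = ζ ^ (-(n + 1)) * ζ := by
      rw [← zpow_add_one₀ h0]; congr 1; ring
    simp only [jostSol, Bool.false_eq_true, if_false, e2, h2, e3, Matrix.mulVec, dotProduct,
      Fin.sum_univ_two, Matrix.smul_apply, Matrix.mul_apply, smul_eq_mul]
    ring
  · have h1 := h.jost_eq hc hζ true n
    rw [stepSum_sideCoeff] at h1
    simp only [if_true] at h1
    have h2 : transferMat m (Q n) z * jost m Q true n z ζ = ζ • jost m Q true (n + 1) z ζ := by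
      rw [h1, Matrix.smul_mul, Matrix.mul_smul, ← Matrix.mul_assoc, Matrix.mul_adjugate,
        det_transferMat (h.ne n), one_smul, Matrix.one_mul]
    ext i
    have h3 := congrFun (congrFun h2 i) 0
    simp only [jostSol, if_true, Matrix.mulVec, dotProduct, Fin.sum_univ_two, Matrix.smul_apply,
      Matrix.mul_apply, smul_eq_mul] at h3 ⊢
    rw [zpow_add_one₀ h0]
    linear_combination -ζ ^ n * h3

/-- The Wronskian of two sequences. -/
def wr (S S' : ℤ → Fin 2 → ℂ) (n : ℤ) : ℂ := S n 0 * S' n 1 - S n 1 * S' n 0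

/-- Both solutions are advanced by the same matrix of determinant one. -/
theorem IsSol.wr_succ {z : ℂ} {S S' : ℤ → Fin 2 → ℂ} (hne : ∀ n, Q n 1 0 ≠ -1)
    (h : IsSol m Q z S) (h' : IsSol m Q z S') (n : ℤ) : wr S S' (n + 1) = wr S S' n := by
  have h1 := det_transferMat (m := m) (hne n) z
  rw [Matrix.det_fin_two] at h1
  simp only [wr, h n, h' n, Matrix.mulVec, dotProduct, Fin.sum_univ_two]
  linear_combination (S n 0 * S' n 1 - S n 1 * S' n 0) * h1

theorem IsSol.wr_const {z : ℂ} {S S' : ℤ → Fin 2 → ℂ} (hne : ∀ n, Q n 1 0 ≠ -1)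
    (h : IsSol m Q z S) (h' : IsSol m Q z S') (n k : ℤ) : wr S S' n = wr S S' k := by
  have key : ∀ n, wr S S' n = wr S S' 0 := by
    intro n
    induction n using Int.induction_on with
    | zero => rfl
    | succ i ih => rw [h.wr_succ hne h', ih]
    | pred i ih =>
      rw [← ih, ← h.wr_succ hne h' (-i - 1), sub_add_cancel]
  rw [key n, key k]

theorem IsSol.eq_zero {z : ℂ} {S : ℤ → Fin 2 → ℂ} (hne : ∀ n, Q n 1 0 ≠ -1)
    (h : IsSol m Q z S) {n₀ : ℤ} (h0 : S n₀ = 0) (n : ℤ) : S n = 0 := by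
  have hs : ∀ k, S k = 0 → S (k + 1) = 0 := fun k hk => by rw [h k, hk, Matrix.mulVec_zero]
  have hp : ∀ k, S (k + 1) = 0 → S k = 0 := fun k hk => by
    have h1 : (transferMat m (Q k) z).adjugate *ᵥ (transferMat m (Q k) z *ᵥ S k) = 0 := by
      rw [← h k, hk, Matrix.mulVec_zero]
    rwa [Matrix.mulVec_mulVec, Matrix.adjugate_mul, det_transferMat (hne k), one_smul,
      Matrix.one_mulVec] at h1
  have key : ∀ j : ℤ, S (n₀ + j) = 0 := by
    intro j
    induction j using Int.induction_on with
    | zero => simpa using h0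
    | succ i ih => rw [← add_assoc]; exact hs _ ih
    | pred i ih =>
      refine hp _ ?_
      convert ih using 2
      ring
  simpa using key (n - n₀)

theorem IsSol.sub_smul {z : ℂ} {S S' : ℤ → Fin 2 → ℂ} (h : IsSol m Q z S) (h' : IsSol m Q z S')
    (c : ℂ) : IsSol m Q z fun n => S n - c • S' n := fun n => by
  beta_reduce
  rw [h n, h' n, Matrix.mulVec_sub, Matrix.mulVec_smul]

theorem IsSol.exists_eq_smul {z : ℂ} {S S' : ℤ → Fin 2 → ℂ} (hne : ∀ n, Q n 1 0 ≠ -1)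
    (h : IsSol m Q z S) (h' : IsSol m Q z S') {n₀ : ℤ} (hw : wr S S' n₀ = 0) (h0 : S' n₀ ≠ 0) :
    ∃ c : ℂ, ∀ n, S n = c • S' n := by
  have : ∃ c : ℂ, S n₀ - c • S' n₀ = 0 := by
    unfold wr at hw
    by_cases h1 : S' n₀ 0 = 0
    · have h2 : S' n₀ 1 ≠ 0 := fun h2 => h0 (by ext i; fin_cases i <;> assumption)
      refine ⟨S n₀ 1 / S' n₀ 1, ?_⟩
      ext i
      fin_cases i
      · have : S n₀ 0 = 0 := by
          rw [h1] at hw; simpa [h2] using hw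
        simp [this, h1]
      · simp [h2]
    · refine ⟨S n₀ 0 / S' n₀ 0, ?_⟩
      ext i
      fin_cases i
      · simp [h1]
      · simp only [Fin.mk_one, Pi.sub_apply, Pi.smul_apply, smul_eq_mul, Pi.zero_apply]
        field_simp
        linear_combination -hw
  obtain ⟨c, hc⟩ := this
  exact ⟨c, fun n => sub_eq_zero.1 ((h.sub_smul h' c).eq_zero hne hc n)⟩

/-- The two-component sequence attached to a solution of the recurrence. -/
def spin (S : ℤ → Fin 2 → ℂ) (n : ℤ) : Spinor := !₂[S (n + 1) 0, S n 1]

theorem spin_zero (S : ℤ → Fin 2 → ℂ) (n : ℤ) : spin S n 0 = S (n + 1) 0 := rfl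

theorem spin_one (S : ℤ → Fin 2 → ℂ) (n : ℤ) : spin S n 1 = S n 1 := rfl

theorem diracSeq_zero (w : ℤ → Spinor) (n : ℤ) : diracSeq m Q w n 0
    = m * w n 0 + (w n 1 - w (n + 1) 1) + (Q n 0 0 * w n 0 + Q n 0 1 * w n 1) := rfl

theorem diracSeq_one (w : ℤ → Spinor) (n : ℤ) : diracSeq m Q w n 1
    = (w n 0 - w (n - 1) 0) - m * w n 1 + (Q n 1 0 * w n 0 + Q n 1 1 * w n 1) := rfl

/-- The second component equation is solved for u, which needs q₂₁ ≠ −1, and then the first one for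
v. Symmetry of q makes the coefficient of b equal to the same number 1 + q₂₁. -/
theorem transferMat_mulVec_eq_iff {q : Matrix (Fin 2) (Fin 2) ℝ} (hs : q 0 1 = q 1 0)
    (hq : q 1 0 ≠ -1) (z a b u v : ℂ) :
    ![u, v] = transferMat m q z *ᵥ ![a, b] ↔
      m * u + (b - v) + (q 0 0 * u + q 0 1 * b) = z * u ∧
      (u - a) - m * b + (q 1 0 * u + q 1 1 * b) = z * b := by
  have h : ((1 + q 1 0 : ℝ) : ℂ) ≠ 0 := by
    have : (1 + q 1 0 : ℝ) ≠ 0 := fun h => hq (by linarith)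
    exact_mod_cast this
  have key : transferMat m q z *ᵥ ![a, b] = ![(a + (z + m - q 1 1) * b) / (1 + q 1 0 : ℝ),
      (m + q 0 0 - z) * ((a + (z + m - q 1 1) * b) / (1 + q 1 0 : ℝ)) + (1 + q 1 0 : ℝ) * b] := by
    ext i
    fin_cases i <;> simp [transferMat, Matrix.mulVec, dotProduct, Fin.sum_univ_two] <;> ring
  rw [key]
  constructor
  · intro h1
    have e0 := congrFun h1 0
    have e1 := congrFun h1 1
    simp only [Matrix.cons_val_zero, Matrix.cons_val_one] at e0 e1
    rw [← e0] at e1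
    rw [eq_div_iff h] at e0
    push_cast at e0 e1
    rw [hs]
    exact ⟨by linear_combination -e1, by linear_combination e0⟩
  · rintro ⟨h1, h2⟩
    rw [hs] at h1
    have e0 : u = (a + (z + m - q 1 1) * b) / (1 + q 1 0 : ℝ) := by
      rw [eq_div_iff h]
      push_cast
      linear_combination h2
    rw [← e0]
    ext i
    fin_cases i
    · simp
    · simp only [Fin.mk_one, Matrix.cons_val_one, Matrix.cons_val_fin_one]
      push_cast
      linear_combination -h1

theorem Admissible.diracSeq_spin (h : Admissible m Q r) {z : ℂ} {S : ℤ → Fin 2 → ℂ}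
    (hS : IsSol m Q z S) (n : ℤ) : diracSeq m Q (spin S) n = z • spin S n := by
  have h1 := hS n
  have e1 : S (n + 1) = ![S (n + 1) 0, S (n + 1) 1] := by ext i; fin_cases i <;> rfl
  have e2 : S n = ![S n 0, S n 1] := by ext i; fin_cases i <;> rfl
  rw [e1, e2] at h1
  obtain ⟨h2, h3⟩ := (transferMat_mulVec_eq_iff (h.symm n) (h.ne n) _ _ _ _ _).1 h1
  ext i
  fin_cases i
  · exact h2
  · simpa [diracSeq_one, spin_zero, spin_one] using h3

/-- The solution of the recurrence attached to a two-component sequence. -/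
def unspin (w : ℤ → Spinor) (n : ℤ) : Fin 2 → ℂ := ![w (n - 1) 0, w n 1]

theorem Admissible.isSol_unspin (h : Admissible m Q r) {z : ℂ} {w : ℤ → Spinor}
    (hw : ∀ n, diracSeq m Q w n = z • w n) : IsSol m Q z (unspin w) := by
  intro n
  have h0 := congrArg (fun x : Spinor => x 0) (hw n)
  have h1 := congrArg (fun x : Spinor => x 1) (hw n)
  simp only [diracSeq_zero, diracSeq_one, PiLp.smul_apply, smul_eq_mul] at h0 h1
  unfold unspin
  rw [add_sub_cancel_right]
  exact (transferMat_mulVec_eq_iff (h.symm n) (h.ne n) _ _ _ _ _).2 ⟨h0, h1⟩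

end DiscreteDirac
end

/-! ### Amplitudes on (0, π) and quotients with simple zeros at the ends -/

noncomputable section

namespace DiscreteDirac

open Set Filter Topology Asymptotics
open scoped ContDiff

/-- Continuously differentiable functions on `(0, π)`, bounded together with the derivative. -/
structure BddC1 (M : ℝ) (a : ℝ → ℂ) : Prop where
  contDiffOn : ContDiffOn ℝ 1 a (Ioo 0 Real.pi)
  bound : ∀ θ ∈ Ioo 0 Real.pi, ‖a θ‖ ≤ M
  deriv_bound : ∀ θ ∈ Ioo 0 Real.pi, ‖deriv a θ‖ ≤ M

theorem pi_half_mem : Real.pi / 2 ∈ Ioo 0 Real.pi := by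
  constructor <;> linarith [Real.pi_pos]

theorem BddC1.nonneg {M : ℝ} {a : ℝ → ℂ} (h : BddC1 M a) : 0 ≤ M :=
  (norm_nonneg _).trans (h.bound _ pi_half_mem)

theorem BddC1.differentiableAt {M : ℝ} {a : ℝ → ℂ} (h : BddC1 M a) {θ : ℝ}
    (hθ : θ ∈ Ioo 0 Real.pi) : DifferentiableAt ℝ a θ :=
  (h.contDiffOn.differentiableOn one_ne_zero θ hθ).differentiableAt (isOpen_Ioo.mem_nhds hθ)

theorem BddC1.mono {M M' : ℝ} {a : ℝ → ℂ} (h : BddC1 M a) (hM : M ≤ M') : BddC1 M' a :=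
  ⟨h.contDiffOn, fun θ hθ => (h.bound θ hθ).trans hM, fun θ hθ => (h.deriv_bound θ hθ).trans hM⟩

theorem BddC1.mul {M M' : ℝ} {a b : ℝ → ℂ} (ha : BddC1 M a) (hb : BddC1 M' b) :
    BddC1 (2 * (M * M')) fun θ => a θ * b θ := by
  have h0 := mul_nonneg ha.nonneg hb.nonneg
  refine ⟨ha.contDiffOn.mul hb.contDiffOn, fun θ hθ => ?_, fun θ hθ => ?_⟩
  · rw [norm_mul]
    have := mul_le_mul (ha.bound θ hθ) (hb.bound θ hθ) (norm_nonneg _) ha.nonneg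
    linarith
  · have h1 := (ha.differentiableAt hθ).hasDerivAt.mul (hb.differentiableAt hθ).hasDerivAt
    have h2 : deriv (fun θ => a θ * b θ) θ = deriv a θ * b θ + a θ * deriv b θ := h1.deriv
    rw [h2]
    refine (norm_add_le _ _).trans ?_
    rw [norm_mul, norm_mul]
    have h3 := mul_le_mul (ha.bound θ hθ) (hb.deriv_bound θ hθ) (norm_nonneg _) ha.nonneg
    have h4 := mul_le_mul (ha.deriv_bound θ hθ) (hb.bound θ hθ) (norm_nonneg _) ha.nonneg
    linarith

theorem BddC1.neg {M : ℝ} {a : ℝ → ℂ} (ha : BddC1 M a) : BddC1 M fun θ => -a θ := by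
  refine ⟨ha.contDiffOn.neg, fun θ hθ => ?_, fun θ hθ => ?_⟩
  · rw [norm_neg]; exact ha.bound θ hθ
  · have h1 : deriv (fun θ => -a θ) θ = -deriv a θ := (ha.differentiableAt hθ).hasDerivAt.neg.deriv
    rw [h1, norm_neg]; exact ha.deriv_bound θ hθ

theorem BddC1.conj {M : ℝ} {a : ℝ → ℂ} (ha : BddC1 M a) :
    BddC1 M fun θ => (starRingEnd ℂ) (a θ) := by
  refine ⟨Complex.conjCLE.contDiff.comp_contDiffOn ha.contDiffOn, fun θ hθ => ?_, fun θ hθ => ?_⟩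
  · rw [RCLike.norm_conj]; exact ha.bound θ hθ
  · have h1 : HasDerivAt (fun θ => (starRingEnd ℂ) (a θ)) ((starRingEnd ℂ) (deriv a θ)) θ :=
      Complex.conjCLE.hasFDerivAt.comp_hasDerivAt θ (ha.differentiableAt hθ).hasDerivAt
    rw [h1.deriv, RCLike.norm_conj]; exact ha.deriv_bound θ hθ

theorem bddC1_zero {M : ℝ} (hM : 0 ≤ M) : BddC1 M fun _ => 0 :=
  ⟨contDiffOn_const, fun _ _ => by simpa using hM, fun _ _ => by simpa using hM⟩

theorem bddC1_of_contDiff {a : ℝ → ℂ} {n : WithTop ℕ∞} (hn : 1 ≤ n) (ha : ContDiff ℝ n a) {K : ℝ}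
    (h : ∀ θ, ‖a θ‖ ≤ K ∧ ‖deriv a θ‖ ≤ K) : BddC1 K a :=
  ⟨(ha.of_le hn).contDiffOn, fun θ _ => (h θ).1, fun θ _ => (h θ).2⟩

theorem exists_bddC1_of_contDiff {a : ℝ → ℂ} (ha : ContDiff ℝ 1 a) : ∃ M, BddC1 M a := by
  obtain ⟨M, hM⟩ := (isCompact_Icc (a := 0) (b := Real.pi)).exists_bound_of_continuousOn
    ha.continuous.continuousOn
  obtain ⟨M', hM'⟩ := (isCompact_Icc (a := 0) (b := Real.pi)).exists_bound_of_continuousOn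
    (ha.continuous_deriv le_rfl).continuousOn
  exact ⟨max M M', ha.contDiffOn,
    fun θ hθ => (hM θ (Ioo_subset_Icc_self hθ)).trans (le_max_left _ _),
    fun θ hθ => (hM' θ (Ioo_subset_Icc_self hθ)).trans (le_max_right _ _)⟩

/-- Compactness of [0, π]; at the two end points only one-sided bounds from inside are required. -/
theorem exists_bound_of_locally_bounded {f : ℝ → ℂ}
    (h : ∀ x ∈ Icc 0 Real.pi, ∃ M : ℝ, ∀ᶠ θ in 𝓝 x, θ ∈ Ioo 0 Real.pi → ‖f θ‖ ≤ M) :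
    ∃ M : ℝ, ∀ θ ∈ Ioo 0 Real.pi, ‖f θ‖ ≤ M := by
  have key : ∃ M : ℝ, ∀ θ ∈ Icc 0 Real.pi, θ ∈ Ioo 0 Real.pi → ‖f θ‖ ≤ M := by
    refine isCompact_Icc.induction_on (p := fun s => ∃ M : ℝ, ∀ θ ∈ s, θ ∈ Ioo 0 Real.pi → ‖f θ‖ ≤ M)
      ⟨0, by simp⟩ ?_ ?_ ?_
    · rintro s t hst ⟨M, hM⟩
      exact ⟨M, fun θ hθ => hM θ (hst hθ)⟩
    · rintro s t ⟨M, hM⟩ ⟨M', hM'⟩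
      refine ⟨max M M', fun θ hθ hI => ?_⟩
      rcases hθ with hθ | hθ
      · exact (hM θ hθ hI).trans (le_max_left _ _)
      · exact (hM' θ hθ hI).trans (le_max_right _ _)
    · intro x hx
      obtain ⟨M, hM⟩ := h x hx
      exact ⟨_, mem_nhdsWithin_of_mem_nhds hM, M, fun θ hθ => hθ⟩
  obtain ⟨M, hM⟩ := key
  exact ⟨M, fun θ hθ => hM θ (Ioo_subset_Icc_self hθ) hθ⟩

/-- Mean value inequality on the segment from e to θ, where the derivative is O(θ − e). -/
theorem isBigO_sq_of_hasDerivAt {N N' : ℝ → ℂ} {e : ℝ} (h : ∀ θ, HasDerivAt N (N' θ) θ)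
    (h0 : N e = 0) (hN : N' =O[𝓝 e] fun θ => θ - e) : N =O[𝓝 e] fun θ => (θ - e) ^ 2 := by
  obtain ⟨C, hC⟩ := hN.bound
  obtain ⟨δ, hδ, hb⟩ := Metric.eventually_nhds_iff_ball.1 hC
  refine IsBigO.of_bound C ?_
  filter_upwards [Metric.ball_mem_nhds e hδ] with θ hθ
  have hsub : ∀ x ∈ segment ℝ e θ, ‖N' x‖ ≤ C * ‖θ - e‖ := by
    intro x hx
    have h1 : ‖x - e‖ ≤ ‖θ - e‖ := by
      have := norm_sub_le_of_mem_segment hx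
      simpa using this
    have h2 : x ∈ Metric.ball e δ := by
      rw [Metric.mem_ball, dist_eq_norm] at hθ ⊢; exact h1.trans_lt hθ
    have h3 := hb x h2
    -- The constant in the big-O bound could be negative; a point different from e near it then
    -- gives a contradiction.
    have h4 : 0 ≤ C ∨ ‖x - e‖ = 0 := by
      by_contra hcon
      push Not at hcon
      have : 0 < ‖x - e‖ := lt_of_le_of_ne (norm_nonneg _) (Ne.symm hcon.2)
      nlinarith [norm_nonneg (N' x)]
    rcases h4 with h4 | h4
    · exact h3.trans (mul_le_mul_of_nonneg_left h1 h4)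
    · by_cases hC0 : 0 ≤ C
      · exact h3.trans (mul_le_mul_of_nonneg_left h1 hC0)
      · exfalso
        have h5 := hb ((e + min δ 1 / 2) : ℝ) (by
          rw [Metric.mem_ball, dist_eq_norm, add_sub_cancel_left, Real.norm_eq_abs,
            abs_of_pos (by positivity)]
          have := min_le_left δ 1
          linarith)
        rw [add_sub_cancel_left, Real.norm_eq_abs, abs_of_pos (by positivity)] at h5
        have h6 : 0 < min δ 1 / 2 := by positivity
        nlinarith [norm_nonneg (N' (e + min δ 1 / 2))]
  have h5 := (convex_segment e θ).norm_image_sub_le_of_norm_hasDerivWithin_le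
    (fun x _ => (h x).hasDerivWithinAt) hsub (left_mem_segment ℝ e θ) (right_mem_segment ℝ e θ)
  rw [h0, sub_zero] at h5
  rw [norm_pow]
  linarith [h5, sq ‖θ - e‖]

theorem hasDerivAt_div_of_ne {X W : ℝ → ℂ} (hX : ContDiff ℝ 1 X) (hW : ContDiff ℝ 1 W) {θ : ℝ}
    (h : W θ ≠ 0) : HasDerivAt (fun θ => X θ / W θ)
      ((deriv X θ * W θ - X θ * deriv W θ) / W θ ^ 2) θ :=
  ((hX.differentiable one_ne_zero) θ).hasDerivAt.div
    ((hW.differentiable one_ne_zero) θ).hasDerivAt h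

/-- Regularity of quotients whose denominator vanishes at most to first order at the end points,
together with the numerator. -/
theorem exists_bddC1_div {X W : ℝ → ℂ} (hX : ContDiff ℝ 1 X) (hW : ContDiff ℝ 1 W)
    (h0 : ∀ θ ∈ Ioo 0 Real.pi, W θ ≠ 0)
    (he : ∀ e, e = 0 ∨ e = Real.pi → W e ≠ 0 ∨ (ContDiff ℝ 2 X ∧ ContDiff ℝ 2 W ∧ X e = 0 ∧
      W e = 0 ∧ ∃ c : ℝ, 0 < c ∧ ∀ θ, c * |Real.sin θ| ≤ ‖W θ‖)) :
    ∃ M, BddC1 M fun θ => X θ / W θ := by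
  have hXd : ∀ θ, HasDerivAt X (deriv X θ) θ := fun θ =>
    ((hX.differentiable one_ne_zero) θ).hasDerivAt
  have hWd : ∀ θ, HasDerivAt W (deriv W θ) θ := fun θ =>
    ((hW.differentiable one_ne_zero) θ).hasDerivAt
  have hXc := hX.continuous_deriv le_rfl
  have hWc := hW.continuous_deriv le_rfl
  have hreg : ∀ x, W x ≠ 0 → ∃ M : ℝ, ∀ᶠ θ in 𝓝 x, ‖X θ / W θ‖ ≤ M ∧
      ‖(deriv X θ * W θ - X θ * deriv W θ) / W θ ^ 2‖ ≤ M := by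
    intro x hx
    have c1 : ContinuousAt (fun θ => X θ / W θ) x :=
      hX.continuous.continuousAt.div hW.continuous.continuousAt hx
    have c2 : ContinuousAt (fun θ => (deriv X θ * W θ - X θ * deriv W θ) / W θ ^ 2) x :=
      ((hXc.mul hW.continuous).sub (hX.continuous.mul hWc)).continuousAt.div
        (hW.continuous.pow 2).continuousAt (pow_ne_zero 2 hx)
    refine ⟨max (‖X x / W x‖ + 1) (‖(deriv X x * W x - X x * deriv W x) / W x ^ 2‖ + 1), ?_⟩
    filter_upwards [c1.norm.eventually (gt_mem_nhds (lt_add_one _)),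
      c2.norm.eventually (gt_mem_nhds (lt_add_one _))] with θ h1 h2
    exact ⟨h1.le.trans (le_max_left _ _), h2.le.trans (le_max_right _ _)⟩
  have hloc : ∀ x ∈ Icc 0 Real.pi, ∃ M : ℝ, ∀ᶠ θ in 𝓝 x, θ ∈ Ioo 0 Real.pi →
      ‖X θ / W θ‖ ≤ M ∧ ‖(deriv X θ * W θ - X θ * deriv W θ) / W θ ^ 2‖ ≤ M := by
    intro x hx
    by_cases hWx : W x = 0
    swap
    · obtain ⟨M, hM⟩ := hreg x hWx
      exact ⟨M, hM.mono fun θ h _ => h⟩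
    have hedge : x = 0 ∨ x = Real.pi := by
      by_contra hcon
      push Not at hcon
      exact h0 x ⟨lt_of_le_of_ne hx.1 (Ne.symm hcon.1), lt_of_le_of_ne hx.2 hcon.2⟩ hWx
    obtain ⟨hX2, hW2, hX0, -, c, hc, hcW⟩ := (he x hedge).resolve_left (not_not.2 hWx)
    have hX1 : ContDiff ℝ 1 (deriv X) := by
      have : ContDiff ℝ (1 + 1) X := by exact_mod_cast hX2
      exact (contDiff_succ_iff_deriv.1 this).2.2
    have hW1 : ContDiff ℝ 1 (deriv W) := by
      have : ContDiff ℝ (1 + 1) W := by exact_mod_cast hW2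
      exact (contDiff_succ_iff_deriv.1 this).2.2
    have bX : X =O[𝓝 x] fun θ => θ - x := by
      have := (hXd x).isBigO_sub
      simpa [hX0] using this
    have bW : W =O[𝓝 x] fun θ => θ - x := by
      have := (hWd x).isBigO_sub
      simpa [hWx] using this
    have bX2 : deriv (deriv X) =O[𝓝 x] fun _ => (1 : ℝ) :=
      (hX1.continuous_deriv le_rfl).continuousAt.norm.isBoundedUnder_le.isBigO_one ℝ
    have bW2 : deriv (deriv W) =O[𝓝 x] fun _ => (1 : ℝ) :=
      (hW1.continuous_deriv le_rfl).continuousAt.norm.isBoundedUnder_le.isBigO_one ℝ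
    have hN : ∀ θ, HasDerivAt (fun θ => deriv X θ * W θ - X θ * deriv W θ)
        (deriv (deriv X) θ * W θ - X θ * deriv (deriv W) θ) θ := fun θ => by
      have h1 := (((hX1.differentiable one_ne_zero) θ).hasDerivAt.mul (hWd θ)).sub
        ((hXd θ).mul ((hW1.differentiable one_ne_zero) θ).hasDerivAt)
      refine h1.congr_deriv ?_
      ring
    have bN' : (fun θ => deriv (deriv X) θ * W θ - X θ * deriv (deriv W) θ)
        =O[𝓝 x] fun θ => θ - x := by
      have h1 := bX2.mul bW
      have h2 := bX.mul bW2
      simp only [one_mul, mul_one] at h1 h2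
      exact h1.sub h2
    -- The numerator X'W − XW' of the quotient rule vanishes at the edge and has derivative X''W −
    -- XW'' = O(θ − x), so it is O((θ − x)²), which the denominator W² compensates. This is where
    -- second derivatives, and hence the third moment, are needed.
    have bN := isBigO_sq_of_hasDerivAt hN (by simp [hX0, hWx]) bN'
    obtain ⟨C₁, hC₁⟩ := bX.bound
    obtain ⟨C₂, hC₂⟩ := bN.bound
    -- The factor 2/π is Jordan's bound for the sine near its zero.
    set c' := c * (2 / Real.pi)
    have hc' : 0 < c' := by positivity
    refine ⟨max (C₁ / c') (C₂ / c' ^ 2), ?_⟩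
    filter_upwards [hC₁, hC₂, Metric.ball_mem_nhds x (by positivity : 0 < Real.pi / 2)]
      with θ h1 h2 h3 hθ
    have hne : θ - x ≠ 0 := by
      intro h
      rcases hedge with rfl | rfl
      · linarith [hθ.1]
      · linarith [hθ.2]
    have hpos : 0 < ‖θ - x‖ := norm_pos_iff.2 hne
    have hsin : |Real.sin θ| = |Real.sin (θ - x)| := by
      rcases hedge with rfl | rfl
      · rw [sub_zero]
      · rw [Real.sin_sub_pi, abs_neg]
    have hlow : c' * ‖θ - x‖ ≤ ‖W θ‖ := by
      refine le_trans ?_ (hcW θ)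
      rw [hsin, mul_assoc]
      rw [Metric.mem_ball, dist_eq_norm] at h3
      exact mul_le_mul_of_nonneg_left (Real.mul_abs_le_abs_sin h3.le) hc.le
    have hWpos : 0 < ‖W θ‖ := lt_of_lt_of_le (by positivity) hlow
    rw [norm_pow] at h2
    constructor
    · refine le_trans ?_ (le_max_left _ _)
      rw [norm_div, div_le_div_iff₀ hWpos hc']
      have hC : 0 ≤ C₁ := by
        by_contra hcon
        nlinarith [norm_nonneg (X θ)]
      nlinarith [mul_le_mul_of_nonneg_left hlow hC, mul_le_mul_of_nonneg_right h1 hc'.le]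
    · refine le_trans ?_ (le_max_right _ _)
      rw [norm_div, norm_pow, div_le_div_iff₀ (by positivity) (by positivity)]
      have hC : 0 ≤ C₂ := by
        by_contra hcon
        nlinarith [norm_nonneg (deriv X θ * W θ - X θ * deriv W θ), sq_nonneg ‖θ - x‖,
          mul_pos hpos hpos]
      have h5 : (c' * ‖θ - x‖) ^ 2 ≤ ‖W θ‖ ^ 2 := pow_le_pow_left₀ (by positivity) hlow 2
      nlinarith [mul_le_mul_of_nonneg_left h5 hC, mul_le_mul_of_nonneg_right h2 (sq_nonneg c')]
  obtain ⟨M₁, hM₁⟩ := exists_bound_of_locally_bounded (f := fun θ => X θ / W θ) fun x hx => by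
    obtain ⟨M, hM⟩ := hloc x hx
    exact ⟨M, hM.mono fun θ h hθ => (h hθ).1⟩
  obtain ⟨M₂, hM₂⟩ := exists_bound_of_locally_bounded
    (f := fun θ => (deriv X θ * W θ - X θ * deriv W θ) / W θ ^ 2) fun x hx => by
    obtain ⟨M, hM⟩ := hloc x hx
    exact ⟨M, hM.mono fun θ h hθ => (h hθ).2⟩
  refine ⟨max M₁ M₂, (hX.contDiffOn.mul (hW.contDiffOn.inv h0)).congr fun θ _ => div_eq_mul_inv _ _,
    fun θ hθ => (hM₁ θ hθ).trans (le_max_left _ _), fun θ hθ => ?_⟩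
  rw [(hasDerivAt_div_of_ne hX hW (h0 θ hθ)).deriv]
  exact (hM₂ θ hθ).trans (le_max_right _ _)

end DiscreteDirac
end

/-! ### Wronskian identities, resonances and absence of embedded eigenvalues -/

noncomputable section

namespace DiscreteDirac

open Set Filter Topology
open scoped ContDiff Matrix

attribute [local instance] Matrix.linftyOpNormedRing Matrix.linftyOpNormedAlgebra

variable {m : ℝ} {Q : ℤ → Matrix (Fin 2) (Fin 2) ℝ} {r : ℕ}

theorem Admissible.tendsto_jost_entry (h : Admissible m Q 0) {z ζ : ℂ} (hc : OnCurve m z ζ)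
    (hζ : ‖ζ‖ ≤ 1) (b : Bool) (i : Fin 2) :
    Tendsto (fun n : ℕ => jost m Q b n z ζ i 0) atTop (𝓝 (sideVec m b z ζ i 0)) :=
  ((entryCLM i 0).continuous.tendsto _).comp (h.tendsto_jost hc hζ b)

theorem Admissible.exists_norm_jost_le (h : Admissible m Q 0) {z ζ : ℂ} (hc : OnCurve m z ζ)
    (hζ : ‖ζ‖ ≤ 1) (b : Bool) : ∃ K : ℝ, ∀ n : ℤ, 0 ≤ n → ∀ i, ‖jost m Q b n z ζ i 0‖ ≤ K := by
  have h1 : ∀ i, ∃ K, ∀ n : ℕ, ‖jost m Q b n z ζ i 0‖ ≤ K := fun i => by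
    obtain ⟨K, hK⟩ := (h.tendsto_jost_entry hc hζ b i).norm.bddAbove_range
    exact ⟨K, fun n => hK ⟨n, rfl⟩⟩
  choose K hK using h1
  refine ⟨max (K 0) (K 1), fun n hn i => ?_⟩
  lift n to ℕ using hn
  fin_cases i
  · exact (hK 0 n).trans (le_max_left _ _)
  · exact (hK 1 n).trans (le_max_right _ _)

theorem jostSol_true (z ζ : ℂ) (n : ℤ) (i : Fin 2) :
    jostSol m Q true z ζ n i = ζ ^ n * jost m Q true n z ζ i 0 := rfl

theorem jostSol_false (z ζ : ℂ) (n : ℤ) (i : Fin 2) :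
    jostSol m Q false z ζ n i = ζ ^ (-n) * jost m Q false (1 - n) z ζ i 0 := rfl

/-- A Jost solution does not vanish as soon as its asymptotic vector does not. -/
theorem Admissible.exists_jostSol_ne_zero (h : Admissible m Q 0) {z ζ : ℂ} (hc : OnCurve m z ζ)
    (hζ : ‖ζ‖ ≤ 1) (b : Bool) {i : Fin 2} (hV : sideVec m b z ζ i 0 ≠ 0) :
    ∃ n, jostSol m Q b z ζ n ≠ 0 := by
  have h1 := (h.tendsto_jost_entry hc hζ b i).eventually_ne hV
  obtain ⟨n, hn⟩ := h1.exists
  have h0 := hc.ne_zero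
  cases b
  · refine ⟨1 - n, fun hcon => ?_⟩
    have h2 := congrFun hcon i
    rw [jostSol_false, sub_sub_cancel] at h2
    exact mul_ne_zero (zpow_ne_zero _ h0) hn h2
  · refine ⟨n, fun hcon => ?_⟩
    have h2 := congrFun hcon i
    rw [jostSol_true] at h2
    exact mul_ne_zero (zpow_ne_zero _ h0) hn h2

/-- The Jost solutions on the bands. -/
def bandSol (m : ℝ) (Q : ℤ → Matrix (Fin 2) (Fin 2) ℝ) (s : ℝ) (b : Bool) (θ : ℝ) :
    ℤ → Fin 2 → ℂ := jostSol m Q b (band m s θ) (circ θ)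

theorem band_neg (m s θ : ℝ) : band m s (-θ) = band m s θ := by simp only [band, omega_neg]

theorem Admissible.isSol_bandSol (h : Admissible m Q 0) {s : ℝ} (hs : s ^ 2 = 1) (b : Bool)
    (θ : ℝ) : IsSol m Q (band m s θ) (bandSol m Q s b θ) :=
  h.isSol_jostSol (onCurve_band h.pos hs θ) (norm_circ θ).le b

theorem Admissible.isSol_bandSol_neg (h : Admissible m Q 0) {s : ℝ} (hs : s ^ 2 = 1) (b : Bool)
    (θ : ℝ) : IsSol m Q (band m s θ) (bandSol m Q s b (-θ)) := by
  rw [← band_neg]; exact h.isSol_bandSol hs b (-θ)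

/-- On the bands the spectral parameter is real and even in θ, so conjugation amounts to θ ↦ −θ. -/
theorem Admissible.conj_bandSol (h : Admissible m Q 0) {s : ℝ} (hs : s ^ 2 = 1) (b : Bool)
    (θ : ℝ) (n : ℤ) (i : Fin 2) :
    (starRingEnd ℂ) (bandSol m Q s b θ n i) = bandSol m Q s b (-θ) n i := by
  have h1 := fun n => h.conj_jost (onCurve_band h.pos hs θ) (norm_circ θ).le b n i
  have h2 : (starRingEnd ℂ) (band m s θ) = band m s θ := Complex.conj_ofReal _
  cases b
  · simp only [bandSol, jostSol_false, map_mul, map_zpow₀, h1, h2, conj_circ, band_neg]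
  · simp only [bandSol, jostSol_true, map_mul, map_zpow₀, h1, h2, conj_circ, band_neg]

/-- The nonvanishing factor in the Wronskian of the two free waves. -/
def waveFactor (m s θ : ℝ) : ℝ := 2 * (s * omega m θ) + (2 - 2 * Real.cos θ)

/-- With u = 2 − 2 cos θ in [0, 4] one has (2ω)² − u² = 4m² + u(4 − u) ≥ 4m², and 2ω + u is at most
2m + 8. -/
theorem le_abs_waveFactor (hm : 0 < m) {s : ℝ} (hs : s ^ 2 = 1) (θ : ℝ) :
    4 * m ^ 2 / (2 * m + 8) ≤ |waveFactor m s θ| := by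
  have h1 := omega_sq hm θ
  have h2 := omega_le hm θ
  have h3 := omega_pos hm θ
  have h4 := Real.cos_le_one θ
  have h5 := Real.neg_one_le_cos θ
  set u := 2 - 2 * Real.cos θ with hu
  have hω : omega m θ ^ 2 = m ^ 2 + u := by rw [h1, hu]; ring
  have hu0 : 0 ≤ u := by rw [hu]; linarith
  have hu4 : u ≤ 4 := by rw [hu]; linarith
  have h6 : 4 * m ^ 2 ≤ (2 * omega m θ - u) * (2 * omega m θ + u) := by nlinarith
  have h7 : 0 < 2 * omega m θ - u := by
    by_contra hcon
    nlinarith [mul_pos hm hm]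
  have h8 : 4 * m ^ 2 / (2 * m + 8) ≤ 2 * omega m θ - u := by
    rw [div_le_iff₀ (by positivity)]
    nlinarith
  refine h8.trans ?_
  unfold waveFactor
  rw [← hu]
  rcases sq_eq_one_iff.1 hs with rfl | rfl
  · rw [abs_of_nonneg (by nlinarith)]; linarith
  · rw [abs_of_nonpos (by nlinarith)]; linarith

theorem waveFactor_ne_zero (hm : 0 < m) {s : ℝ} (hs : s ^ 2 = 1) (θ : ℝ) :
    waveFactor m s θ ≠ 0 := by
  have h1 := le_abs_waveFactor hm hs θ
  have h2 : 0 < 4 * m ^ 2 / (2 * m + 8) := by positivity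
  exact abs_pos.1 (h2.trans_le h1)

/-- The Wronskian of the two free waves. -/
def waveWr (m s θ : ℝ) : ℂ := -2 * Complex.I * Real.sin θ * waveFactor m s θ

theorem jostVec_wr (z ζ : ℂ) :
    jostVec m z ζ 0 0 * jostVec m z ζ⁻¹ 1 0 - jostVec m z ζ 1 0 * jostVec m z ζ⁻¹ 0 0
      = (ζ⁻¹ - ζ) * (2 * z + 2 - ζ - ζ⁻¹) := by
  simp [jostVec]
  ring

theorem jostVec_wr_band (s θ : ℝ) :
    jostVec m (band m s θ) (circ θ) 0 0 * jostVec m (band m s θ) (circ θ)⁻¹ 1 0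
      - jostVec m (band m s θ) (circ θ) 1 0 * jostVec m (band m s θ) (circ θ)⁻¹ 0 0
      = waveWr m s θ := by
  rw [jostVec_wr, ← circ_neg, circ_eq, circ_eq, Real.cos_neg, Real.sin_neg, band, waveWr,
    waveFactor]
  push_cast
  ring

/-- The Wronskian is constant in the site, and the opposite plane waves cancel in it; its value is
read off at infinity from the asymptotic vectors. -/
theorem Admissible.wr_true (h : Admissible m Q 0) {s : ℝ} (hs : s ^ 2 = 1) (θ : ℝ) (n : ℤ) :
    wr (bandSol m Q s true θ) (bandSol m Q s true (-θ)) n = waveWr m s θ := by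
  have hc := onCurve_band h.pos hs
  have t := fun θ i => h.tendsto_jost_entry (hc θ) (norm_circ θ).le true i
  have h1 := ((t θ 0).mul (t (-θ) 1)).sub ((t θ 1).mul (t (-θ) 0))
  have h2 : ∀ k : ℕ, wr (bandSol m Q s true θ) (bandSol m Q s true (-θ)) n
      = jost m Q true k (band m s θ) (circ θ) 0 0 * jost m Q true k (band m s (-θ)) (circ (-θ)) 1 0
        - jost m Q true k (band m s θ) (circ θ) 1 0
          * jost m Q true k (band m s (-θ)) (circ (-θ)) 0 0 := fun k => by
    rw [(h.isSol_bandSol hs true θ).wr_const h.ne (h.isSol_bandSol_neg hs true θ) n k]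
    have h3 : circ θ ^ (k : ℤ) * circ (-θ) ^ (k : ℤ) = 1 := by
      rw [circ_neg, inv_zpow, mul_inv_cancel₀ (zpow_ne_zero _ (circ_ne_zero θ))]
    simp only [wr, bandSol, jostSol_true]
    linear_combination (jost m Q true k (band m s θ) (circ θ) 0 0
      * jost m Q true k (band m s (-θ)) (circ (-θ)) 1 0
        - jost m Q true k (band m s θ) (circ θ) 1 0
          * jost m Q true k (band m s (-θ)) (circ (-θ)) 0 0) * h3
  have h4 := tendsto_nhds_unique (tendsto_const_nhds.congr h2) h1
  rw [h4, band_neg, circ_neg]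
  exact jostVec_wr_band s θ

theorem Admissible.wr_false (h : Admissible m Q 0) {s : ℝ} (hs : s ^ 2 = 1) (θ : ℝ) (n : ℤ) :
    wr (bandSol m Q s false θ) (bandSol m Q s false (-θ)) n = -waveWr m s θ := by
  have hc := onCurve_band h.pos hs
  have t := fun θ i => h.tendsto_jost_entry (hc θ) (norm_circ θ).le false i
  have h1 := ((t θ 0).mul (t (-θ) 1)).sub ((t θ 1).mul (t (-θ) 0))
  have h2 : ∀ k : ℕ, wr (bandSol m Q s false θ) (bandSol m Q s false (-θ)) n
      = jost m Q false k (band m s θ) (circ θ) 0 0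
          * jost m Q false k (band m s (-θ)) (circ (-θ)) 1 0
        - jost m Q false k (band m s θ) (circ θ) 1 0
          * jost m Q false k (band m s (-θ)) (circ (-θ)) 0 0 := fun k => by
    rw [(h.isSol_bandSol hs false θ).wr_const h.ne (h.isSol_bandSol_neg hs false θ) n (1 - k)]
    have h3 : circ θ ^ (-(1 - k : ℤ)) * circ (-θ) ^ (-(1 - k : ℤ)) = 1 := by
      rw [circ_neg, inv_zpow, mul_inv_cancel₀ (zpow_ne_zero _ (circ_ne_zero θ))]
    simp only [wr, bandSol, jostSol_false, sub_sub_cancel]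
    linear_combination (jost m Q false k (band m s θ) (circ θ) 0 0
      * jost m Q false k (band m s (-θ)) (circ (-θ)) 1 0
        - jost m Q false k (band m s θ) (circ θ) 1 0
          * jost m Q false k (band m s (-θ)) (circ (-θ)) 0 0) * h3
  have h4 := tendsto_nhds_unique (tendsto_const_nhds.congr h2) h1
  rw [h4, band_neg, circ_neg]
  have h5 := jostVec_wr_band (m := m) s θ
  simp only [sideVec, Bool.false_eq_true, if_false, inv_inv]
  linear_combination -h5

/-- The Wronskian of the two Jost solutions on a band. -/
def wrW (m : ℝ) (Q : ℤ → Matrix (Fin 2) (Fin 2) ℝ) (s θ : ℝ) : ℂ :=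
  wr (bandSol m Q s false θ) (bandSol m Q s true θ) 0

/-- The Wronskian of the left Jost solution and the conjugate right one. -/
def wrT (m : ℝ) (Q : ℤ → Matrix (Fin 2) (Fin 2) ℝ) (s θ : ℝ) : ℂ :=
  wr (bandSol m Q s false θ) (bandSol m Q s true (-θ)) 0

theorem Admissible.conj_wrW (h : Admissible m Q 0) {s : ℝ} (hs : s ^ 2 = 1) (θ : ℝ) :
    (starRingEnd ℂ) (wrW m Q s θ) = wrW m Q s (-θ) := by
  simp only [wrW, wr, map_sub, map_mul, h.conj_bandSol hs]

theorem Admissible.conj_wrT (h : Admissible m Q 0) {s : ℝ} (hs : s ^ 2 = 1) (θ : ℝ) :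
    (starRingEnd ℂ) (wrT m Q s θ) = wrT m Q s (-θ) := by
  simp only [wrT, wr, map_sub, map_mul, h.conj_bandSol hs]

/-- Conservation of flux. It is the Plücker relation between the Wronskians of the left solution,
the right solution and their conjugates, with conjugation realized as θ ↦ −θ. -/
theorem Admissible.norm_wrW_sq (h : Admissible m Q 0) {s : ℝ} (hs : s ^ 2 = 1) (θ : ℝ) :
    ‖wrW m Q s θ‖ ^ 2 = (2 * Real.sin θ * waveFactor m s θ) ^ 2 + ‖wrT m Q s θ‖ ^ 2 := by
  have h1 := h.wr_true hs θ 0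
  have h2 := h.wr_false hs θ 0
  have h3 := h.conj_wrW hs θ
  have h4 := h.conj_wrT hs θ
  have h5 : wrW m Q s θ * (starRingEnd ℂ) (wrW m Q s θ)
      = ((2 * Real.sin θ * waveFactor m s θ : ℝ) : ℂ) ^ 2
        + wrT m Q s θ * (starRingEnd ℂ) (wrT m Q s θ) := by
    rw [h3, h4]
    have h6 : -waveWr m s θ * waveWr m s θ = ((2 * Real.sin θ * waveFactor m s θ : ℝ) : ℂ) ^ 2 := by
      rw [waveWr]
      simp only [Complex.ofReal_mul, Complex.ofReal_ofNat]
      linear_combination (-4 * (Real.sin θ : ℂ) ^ 2 * (waveFactor m s θ : ℂ) ^ 2) * Complex.I_sq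
    rw [← h6]
    simp only [wrW, wrT, neg_neg]
    rw [← h2]
    nth_rewrite 1 [← h1]
    simp only [wr]
    ring
  rw [Complex.mul_conj, Complex.mul_conj, Complex.normSq_eq_norm_sq,
    Complex.normSq_eq_norm_sq] at h5
  exact_mod_cast h5

/-- Dropping the second square in the flux identity shows that the Wronskian can vanish only at the
band edges and at most to first order. -/
theorem Admissible.le_norm_wrW (h : Admissible m Q 0) {s : ℝ} (hs : s ^ 2 = 1) (θ : ℝ) :
    2 * (4 * m ^ 2 / (2 * m + 8)) * |Real.sin θ| ≤ ‖wrW m Q s θ‖ := by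
  have h1 := h.norm_wrW_sq hs θ
  have h2 : |2 * Real.sin θ * waveFactor m s θ| ≤ ‖wrW m Q s θ‖ := by
    refine abs_le_of_sq_le_sq (by rw [h1]; nlinarith [sq_nonneg ‖wrT m Q s θ‖]) (norm_nonneg _)
  refine le_trans ?_ h2
  rw [abs_mul, abs_mul, abs_two]
  have h3 := le_abs_waveFactor h.pos hs θ
  nlinarith [mul_le_mul_of_nonneg_left h3 (abs_nonneg (Real.sin θ))]

theorem Admissible.wrW_ne_zero (h : Admissible m Q 0) {s : ℝ} (hs : s ^ 2 = 1) {θ : ℝ}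
    (hθ : Real.sin θ ≠ 0) : wrW m Q s θ ≠ 0 := by
  have h1 := h.le_norm_wrW hs θ
  have hm := h.pos
  have h2 : 0 < 2 * (4 * m ^ 2 / (2 * m + 8)) * |Real.sin θ| :=
    mul_pos (by positivity) (abs_pos.2 hθ)
  exact norm_pos_iff.1 (h2.trans_le h1)

theorem circ_edge {e : ℝ} (he : e = 0 ∨ e = Real.pi) : circ (-e) = circ e := by
  rcases he with rfl | rfl
  · rw [neg_zero]
  · rw [circ_eq, circ_eq]; simp

/-- At an edge the wave and its conjugate coincide, so a zero of the denominator of the reflection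
coefficient is also a zero of its numerator. -/
theorem wrT_edge (s : ℝ) {e : ℝ} (he : e = 0 ∨ e = Real.pi) : wrT m Q s e = wrW m Q s e := by
  rw [wrT, wrW, bandSol, bandSol, bandSol, band_neg, circ_edge he]

/-- The real part 2m of the sum shows that the asymptotic vector is nonzero on the whole band, edges
included. -/
theorem sideVec_add (b : Bool) (s θ : ℝ) :
    sideVec m b (band m s θ) (circ θ) 0 0 + sideVec m b (band m s θ) (circ θ) 1 0
      = 2 * m + (if b then 2 else -2) * Real.sin θ * Complex.I := by
  cases b
  · simp only [sideVec, jostVec, Bool.false_eq_true, if_false, inv_inv, Matrix.of_apply,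
      Matrix.cons_val', Matrix.cons_val_zero, Matrix.cons_val_one, Matrix.cons_val_fin_one]
    rw [← circ_neg, circ_eq, circ_eq]
    simp
    ring
  · simp only [sideVec, jostVec, if_true, Matrix.of_apply,
      Matrix.cons_val', Matrix.cons_val_zero, Matrix.cons_val_one, Matrix.cons_val_fin_one]
    rw [← circ_neg, circ_eq, circ_eq]
    simp
    ring

theorem Admissible.exists_bandSol_ne_zero (h : Admissible m Q 0) {s : ℝ} (hs : s ^ 2 = 1)
    (b : Bool) (θ : ℝ) : ∃ n, bandSol m Q s b θ n ≠ 0 := by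
  have h1 := sideVec_add (m := m) b s θ
  have h2 : ∃ i, sideVec m b (band m s θ) (circ θ) i 0 ≠ 0 := by
    by_contra hcon
    push Not at hcon
    rw [hcon, hcon, add_zero] at h1
    have h3 := congrArg Complex.re h1
    have hm := h.pos
    cases b <;> simp at h3 <;> exact hm.ne' h3
  obtain ⟨i, hi⟩ := h2
  exact h.exists_jostSol_ne_zero (onCurve_band h.pos hs θ) (norm_circ θ).le b hi

theorem Admissible.exists_norm_bandSol_le (h : Admissible m Q 0) {s : ℝ} (hs : s ^ 2 = 1)
    (θ : ℝ) : ∃ K : ℝ, (∀ n : ℤ, 0 ≤ n → ∀ i, ‖bandSol m Q s true θ n i‖ ≤ K) ∧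
      ∀ n : ℤ, n ≤ 1 → ∀ i, ‖bandSol m Q s false θ n i‖ ≤ K := by
  have hb := fun b => h.exists_norm_jost_le (onCurve_band h.pos hs θ) (norm_circ θ).le b
  obtain ⟨K, hK⟩ := hb true
  obtain ⟨K', hK'⟩ := hb false
  refine ⟨max K K', fun n hn i => ?_, fun n hn i => ?_⟩
  · rw [bandSol, jostSol_true, norm_mul, norm_zpow, norm_circ, one_zpow, one_mul]
    exact (hK n hn i).trans (le_max_left _ _)
  · rw [bandSol, jostSol_false, norm_mul, norm_zpow, norm_circ, one_zpow, one_mul]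
    exact (hK' (1 - n) (by omega) i).trans (le_max_right _ _)

theorem spinor_norm_le (x : Spinor) : ‖x‖ ≤ ‖x 0‖ + ‖x 1‖ := by
  rw [EuclideanSpace.norm_eq, Fin.sum_univ_two]
  refine Real.sqrt_le_iff.2 ⟨by positivity, ?_⟩
  nlinarith [norm_nonneg (x 0), norm_nonneg (x 1)]

/-- Vanishing of the Wronskian at a band edge produces a resonance. -/
theorem Admissible.isResonance_of_wrW_eq_zero (h : Admissible m Q 0) {s : ℝ} (hs : s ^ 2 = 1)
    {θ : ℝ} (hW : wrW m Q s θ = 0) : IsResonance m Q (s * omega m θ) := by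
  obtain ⟨n₁, hn₁⟩ := h.exists_bandSol_ne_zero hs false θ
  obtain ⟨n₂, hn₂⟩ := h.exists_bandSol_ne_zero hs true θ
  obtain ⟨K, hK, hK'⟩ := h.exists_norm_bandSol_le hs θ
  have hF := h.isSol_bandSol hs false θ
  have hT := h.isSol_bandSol hs true θ
  -- A zero Wronskian makes the right Jost solution a multiple of the left one, hence bounded on
  -- both half lines.
  obtain ⟨c, hc⟩ := hT.exists_eq_smul h.ne hF (n₀ := n₁) (by
    have h1 := hF.wr_const h.ne hT n₁ 0
    rw [show wr (bandSol m Q s false θ) (bandSol m Q s true θ) 0 = 0 from hW] at h1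
    simp only [wr] at h1 ⊢
    linear_combination -h1) hn₁
  have hbd : ∀ n i, ‖bandSol m Q s true θ n i‖ ≤ max K (‖c‖ * K) := by
    intro n i
    rcases le_total 0 n with hn | hn
    · exact (hK n hn i).trans (le_max_left _ _)
    · rw [hc n, Pi.smul_apply, norm_smul]
      exact (mul_le_mul_of_nonneg_left (hK' n (by omega) i) (norm_nonneg c)).trans
        (le_max_right _ _)
  refine ⟨spin (bandSol m Q s true θ), fun hcon => hn₂ ?_, ?_, fun n => h.diracSeq_spin hT n⟩
  · ext i
    fin_cases i
    · have h1 := congrArg (fun x : Spinor => x 0) (congrFun hcon (n₂ - 1))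
      simpa [spin_zero] using h1
    · have h1 := congrArg (fun x : Spinor => x 1) (congrFun hcon n₂)
      simpa [spin_one] using h1
  · simp only [MemWeighted, weightedNorm, if_true, Real.rpow_zero, one_mul]
    refine lt_of_le_of_lt (iSup_le fun n => ENNReal.ofReal_le_ofReal ?_)
      (ENNReal.ofReal_lt_top (r := max K (‖c‖ * K) + max K (‖c‖ * K)))
    exact (spinor_norm_le _).trans (add_le_add (hbd _ _) (hbd _ _))

theorem omega_zero (hm : 0 < m) : omega m 0 = m := by
  rw [omega, Real.cos_zero]
  have : m ^ 2 + 2 - 2 * 1 = m ^ 2 := by ring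
  rw [this, Real.sqrt_sq hm.le]

theorem omega_pi : omega m Real.pi = √(4 + m ^ 2) := by
  rw [omega, Real.cos_pi]; congr 1; ring

theorem Admissible.wrW_edge_ne_zero (h : Admissible m Q 0) (hnr : ¬ ResonantCase m Q) {s : ℝ}
    (hs : s ^ 2 = 1) {e : ℝ} (he : e = 0 ∨ e = Real.pi) : wrW m Q s e ≠ 0 := by
  intro hW
  refine hnr ⟨s * omega m e, ?_, h.isResonance_of_wrW_eq_zero hs hW⟩
  rcases he with rfl | rfl <;> rcases sq_eq_one_iff.1 hs with rfl | rfl <;>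
    simp [omega_zero h.pos, omega_pi]

theorem exists_band_of_bandPoly_pos {l : ℝ} (hl : 0 < bandPoly m l) :
    ∃ s θ : ℝ, s ^ 2 = 1 ∧ 0 < s * l ∧ θ ∈ Ioo 0 Real.pi ∧ l = s * omega m θ := by
  unfold bandPoly at hl
  have h1 : m ^ 2 < l ^ 2 ∧ l ^ 2 < m ^ 2 + 4 := by
    constructor <;> by_contra hcon <;> push Not at hcon <;> nlinarith
  set u := (m ^ 2 + 2 - l ^ 2) / 2 with hu
  have hu1 : u < 1 := by rw [hu]; linarith
  have hu2 : -1 < u := by rw [hu]; linarith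
  have hω : omega m (Real.arccos u) = |l| := by
    rw [omega, Real.cos_arccos hu2.le hu1.le, hu, ← Real.sqrt_sq_eq_abs]; congr 1; ring
  have hθ : Real.arccos u ∈ Ioo 0 Real.pi := by
    refine ⟨Real.arccos_pos.2 hu1, lt_of_le_of_ne (Real.arccos_le_pi _) fun h => ?_⟩
    have := Real.arccos_eq_pi.1 h
    linarith
  have hl0 : l ≠ 0 := by rintro rfl; nlinarith [sq_nonneg m]
  rcases lt_or_gt_of_ne hl0 with hneg | hpos
  · exact ⟨-1, _, by norm_num, by linarith, hθ, by rw [hω, abs_of_neg hneg]; ring⟩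
  · exact ⟨1, _, by norm_num, by linarith, hθ, by rw [hω, abs_of_pos hpos]; ring⟩

/-- There are no square summable eigenvectors inside the bands. -/
theorem Admissible.bandPoly_nonpos_of_eigenvector (h : Admissible m Q 0) {l : ℝ} {w : ℤ → Spinor}
    (hw : ∀ n, diracSeq m Q w n = (l : ℂ) • w n) (hw0 : Tendsto (fun n : ℕ => ‖w n‖) atTop (𝓝 0))
    (hne : w ≠ 0) : bandPoly m l ≤ 0 := by
  by_contra hcon
  push Not at hcon
  obtain ⟨s, θ, hs, -, hθ, rfl⟩ := exists_band_of_bandPoly_pos hcon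
  have hS := h.isSol_unspin hw
  set S := unspin w
  have hS0 : ∀ i, Tendsto (fun n : ℕ => S ((n : ℤ) + 1) i) atTop (𝓝 0) := by
    intro i
    rw [tendsto_zero_iff_norm_tendsto_zero]
    fin_cases i
    · refine squeeze_zero (fun _ => norm_nonneg _) (fun n => ?_) hw0
      have : S ((n : ℤ) + 1) 0 = w n 0 := by simp [S, unspin]
      simp only [Fin.zero_eta]
      rw [this]
      exact PiLp.norm_apply_le _ _
    · refine squeeze_zero (fun _ => norm_nonneg _) (fun n => ?_)
        (hw0.comp (tendsto_add_atTop_nat 1))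
      have : S ((n : ℤ) + 1) 1 = w ((n + 1 : ℕ) : ℤ) 1 := by simp [S, unspin]
      simp only [Fin.mk_one]
      rw [this]
      exact PiLp.norm_apply_le _ _
  -- The Wronskian of a solution decaying at +∞ with one bounded there tends to zero, and it is
  -- constant.
  have hz : ∀ T : ℤ → Fin 2 → ℂ, IsSol m Q (band m s θ) T →
      (∃ K, ∀ n : ℤ, 0 ≤ n → ∀ i, ‖T n i‖ ≤ K) → ∀ n, wr S T n = 0 := by
    rintro T hT ⟨K, hK⟩ n
    have hb : ∀ i, IsBoundedUnder (· ≤ ·) atTop (norm ∘ fun n : ℕ => T ((n : ℤ) + 1) i) := fun i =>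
      isBoundedUnder_of ⟨K, fun n => hK _ (by positivity) i⟩
    have h1 := ((hS0 0).zero_mul_isBoundedUnder_le (hb 1)).sub
      ((hS0 1).zero_mul_isBoundedUnder_le (hb 0))
    rw [sub_zero] at h1
    exact tendsto_nhds_unique
      (tendsto_const_nhds.congr fun k : ℕ => IsSol.wr_const h.ne hS hT n ((k : ℤ) + 1)) h1
  obtain ⟨K, hK, -⟩ := h.exists_norm_bandSol_le hs θ
  obtain ⟨K', hK', -⟩ := h.exists_norm_bandSol_le hs (-θ)
  have z1 := hz _ (h.isSol_bandSol hs true θ) ⟨K, hK⟩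
  have z2 := hz _ (h.isSol_bandSol_neg hs true θ) ⟨K', hK'⟩
  have hd : waveWr m s θ ≠ 0 := by
    have h1 : (Real.sin θ : ℂ) ≠ 0 := by exact_mod_cast (Real.sin_pos_of_mem_Ioo hθ).ne'
    have h2 : (waveFactor m s θ : ℂ) ≠ 0 := by exact_mod_cast waveFactor_ne_zero h.pos hs θ
    unfold waveWr
    exact mul_ne_zero (mul_ne_zero (mul_ne_zero (by norm_num) Complex.I_ne_zero) h1) h2
  have hS1 : ∀ n i, S n i = 0 := by
    intro n i
    have a := z1 n
    have b := z2 n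
    have c := h.wr_true hs θ n
    simp only [wr] at a b c
    -- Inside a band the right Jost solution and its conjugate are a basis, and S has zero Wronskian
    -- with both.
    have : S n i * waveWr m s θ = 0 := by
      rw [← c]
      fin_cases i
      · simp only [Fin.zero_eta]
        linear_combination bandSol m Q s true θ n 0 * b - bandSol m Q s true (-θ) n 0 * a
      · simp only [Fin.mk_one]
        linear_combination bandSol m Q s true θ n 1 * b - bandSol m Q s true (-θ) n 1 * a
    exact (mul_eq_zero.1 this).resolve_right hd
  apply hne
  ext n i
  fin_cases i
  · have := hS1 (n + 1) 0
    simpa [S, unspin] using this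
  · have := hS1 n 1
    simpa [S, unspin] using this

end DiscreteDirac
end

/-! ### Uniform amplitude bounds and decay of band integrals -/

noncomputable section

namespace DiscreteDirac

open Set Filter Topology MeasureTheory
open scoped ContDiff Matrix

attribute [local instance] Matrix.linftyOpNormedRing Matrix.linftyOpNormedAlgebra

/-- Sums of two plane waves in `θ` with frequencies at most `N` and amplitudes bounded by `M`
together with their derivatives. -/
def Amp (N M : ℝ) (F : ℝ → ℂ) : Prop :=
  ∃ (p q : ℝ) (a b : ℝ → ℂ), |p| ≤ N ∧ |q| ≤ N ∧ BddC1 M a ∧ BddC1 M b ∧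
    ∀ θ ∈ Ioo 0 Real.pi, F θ = Complex.exp (Complex.I * ((p * θ : ℝ) : ℂ)) * a θ
      + Complex.exp (Complex.I * ((q * θ : ℝ) : ℂ)) * b θ

theorem Amp.conj {N M : ℝ} {F : ℝ → ℂ} (h : Amp N M F) :
    Amp N M fun θ => (starRingEnd ℂ) (F θ) := by
  obtain ⟨p, q, a, b, hp, hq, ha, hb, hF⟩ := h
  refine ⟨-p, -q, _, _, by rwa [abs_neg], by rwa [abs_neg], ha.conj, hb.conj, fun θ hθ => ?_⟩
  beta_reduce
  rw [hF θ hθ, map_add, map_mul, map_mul, ← Complex.exp_conj, ← Complex.exp_conj]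
  simp

theorem Amp.mono {N M N' M' : ℝ} {F : ℝ → ℂ} (h : Amp N M F) (hN : N ≤ N') (hM : M ≤ M') :
    Amp N' M' F := by
  obtain ⟨p, q, a, b, hp, hq, ha, hb, hF⟩ := h
  exact ⟨p, q, a, b, hp.trans hN, hq.trans hN, ha.mono hM, hb.mono hM, hF⟩

theorem Amp.norm_le {N M : ℝ} {F : ℝ → ℂ} (h : Amp N M F) {θ : ℝ} (hθ : θ ∈ Ioo 0 Real.pi) :
    ‖F θ‖ ≤ 2 * M := by
  obtain ⟨p, q, a, b, hp, hq, ha, hb, hF⟩ := h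
  rw [hF θ hθ]
  refine (norm_add_le _ _).trans ?_
  rw [norm_mul, norm_mul, norm_cexp_phase, norm_cexp_phase, one_mul, one_mul]
  linarith [ha.bound θ hθ, hb.bound θ hθ]

theorem Amp.continuousOn {N M : ℝ} {F : ℝ → ℂ} (h : Amp N M F) :
    ContinuousOn F (Ioo 0 Real.pi) := by
  obtain ⟨p, q, a, b, hp, hq, ha, hb, hF⟩ := h
  refine ContinuousOn.congr ?_ hF
  have h1 : ∀ p : ℝ, Continuous fun θ : ℝ => Complex.exp (Complex.I * ((p * θ : ℝ) : ℂ)) := by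
    intro p; fun_prop
  exact ((h1 p).continuousOn.mul ha.contDiffOn.continuousOn).add
    ((h1 q).continuousOn.mul hb.contDiffOn.continuousOn)

/-- The time evolution factor on a band. -/
def bandExp (m s t θ : ℝ) : ℂ := Complex.exp (-Complex.I * t * band m s θ)

theorem continuous_bandExp (m s t : ℝ) : Continuous (bandExp m s t) := by
  have := continuous_omega m
  unfold bandExp band
  fun_prop

theorem norm_bandExp (m s t θ : ℝ) : ‖bandExp m s t θ‖ = 1 := by
  have : -Complex.I * t * band m s θ = Complex.I * ((-(t * (s * omega m θ)) : ℝ) : ℂ) := by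
    rw [band]; push_cast; ring
  rw [bandExp, this, norm_cexp_phase]

/-- On the upper band the phase is −tω + pθ, the negative of tω − pθ; on the lower band it is tω +
pθ. Hence the hypothesis is asked for both signs of p. -/
theorem subintervalBound_bandExp {m t p K s : ℝ} (hs : s ^ 2 = 1)
    (h : ∀ p', |p'| = |p| → SubintervalBound (phaseExp m t p') 0 Real.pi K) :
    SubintervalBound (fun θ => bandExp m s t θ * Complex.exp (Complex.I * ((p * θ : ℝ) : ℂ)))
      0 Real.pi K := by
  intro x y hx hxy hy
  rcases sq_eq_one_iff.1 hs with rfl | rfl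
  · have h1 := h (-p) (abs_neg p) x y hx hxy hy
    unfold phaseExp at h1
    rw [← norm_integral_phase_neg] at h1
    refine le_of_eq_of_le (congrArg norm (intervalIntegral.integral_congr fun θ _ => ?_)) h1
    rw [bandExp, ← Complex.exp_add, band]
    congr 1
    push_cast
    ring
  · have h1 := h p rfl x y hx hxy hy
    unfold phaseExp at h1
    refine le_of_eq_of_le (congrArg norm (intervalIntegral.integral_congr fun θ _ => ?_)) h1
    rw [bandExp, ← Complex.exp_add, band]
    congr 1
    push_cast
    ring

theorem Amp.norm_integral_le {m s t N M K : ℝ} (hs : s ^ 2 = 1) {F : ℝ → ℂ} (hF : Amp N M F)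
    (h : ∀ p, |p| ≤ N → SubintervalBound (phaseExp m t p) 0 Real.pi K) :
    ‖∫ θ in 0..Real.pi, bandExp m s t θ * F θ‖ ≤ 2 * (K * M * (1 + Real.pi)) := by
  obtain ⟨p, q, a, b, hp, hq, ha, hb, hFe⟩ := hF
  have hE : ∀ p : ℝ, Continuous fun θ : ℝ =>
      bandExp m s t θ * Complex.exp (Complex.I * ((p * θ : ℝ) : ℂ)) := by
    intro p
    have := continuous_bandExp m s t
    fun_prop
  have key : ∀ (p : ℝ) (a : ℝ → ℂ), |p| ≤ N → BddC1 M a →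
      ‖∫ θ in 0..Real.pi, bandExp m s t θ * Complex.exp (Complex.I * ((p * θ : ℝ) : ℂ)) * a θ‖
        ≤ K * M * (1 + Real.pi) := by
    intro p a hp ha
    have h1 := (subintervalBound_bandExp hs fun p' hp' => h p' (hp'.le.trans hp)).norm_integral_mul_le
      (hE p) Real.pi_pos (fun θ => by
        rw [norm_mul, norm_bandExp, norm_cexp_phase, one_mul]) ha.contDiffOn ha.bound ha.deriv_bound
    rwa [sub_zero] at h1
  have hint : ∀ (p : ℝ) (a : ℝ → ℂ), BddC1 M a → IntervalIntegrable
      (fun θ => bandExp m s t θ * Complex.exp (Complex.I * ((p * θ : ℝ) : ℂ)) * a θ)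
      volume 0 Real.pi := by
    intro p a ha
    rw [intervalIntegrable_iff_integrableOn_Ioo_of_le Real.pi_pos.le]
    refine IntegrableOn.of_bound (by simp)
      (((hE p).continuousOn.mul ha.contDiffOn.continuousOn).aestronglyMeasurable measurableSet_Ioo)
      M ?_
    refine (ae_restrict_iff' measurableSet_Ioo).2 (Eventually.of_forall fun θ hθ => ?_)
    rw [norm_mul, norm_mul, norm_bandExp, norm_cexp_phase, one_mul, one_mul]
    exact ha.bound θ hθ
  have e : ∫ θ in 0..Real.pi, bandExp m s t θ * F θ
      = (∫ θ in 0..Real.pi, bandExp m s t θ * Complex.exp (Complex.I * ((p * θ : ℝ) : ℂ)) * a θ)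
        + ∫ θ in 0..Real.pi, bandExp m s t θ * Complex.exp (Complex.I * ((q * θ : ℝ) : ℂ)) * b θ := by
    rw [← intervalIntegral.integral_add (hint p a ha) (hint q b hb),
      intervalIntegral.integral_of_le Real.pi_pos.le, intervalIntegral.integral_of_le Real.pi_pos.le,
      integral_Ioc_eq_integral_Ioo, integral_Ioc_eq_integral_Ioo]
    refine setIntegral_congr_fun measurableSet_Ioo fun θ hθ => ?_
    simp only [hFe θ hθ]
    ring
  rw [e]
  refine (norm_add_le _ _).trans ?_
  linarith [key p a hp ha, key q b hq hb]

/-- Decay of oscillatory integrals over a band. -/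
theorem exists_amp_decay {m : ℝ} (hm : 0 < m) : ∃ C c : ℝ, 0 ≤ C ∧ 0 < c ∧
    ∀ s : ℝ, s ^ 2 = 1 → ∀ t N M : ℝ, 1 ≤ t → ∀ F : ℝ → ℂ, Amp N M F →
      ‖∫ θ in 0..Real.pi, bandExp m s t θ * F θ‖ ≤ C * M * t ^ (-(1 / 3) : ℝ) ∧
      (N ≤ c * t → ‖∫ θ in 0..Real.pi, bandExp m s t θ * F θ‖ ≤ C * M * t ^ (-(1 / 2) : ℝ)) := by
  obtain ⟨C₁, h1⟩ := exists_subintervalBound_third hm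
  obtain ⟨C₂, c, hc, h2⟩ := exists_subintervalBound_half hm
  have hpi := Real.pi_pos
  refine ⟨2 * (1 + Real.pi) * max 0 (max C₁ C₂), c, by positivity, hc,
    fun s hs t N M ht F hF => ⟨?_, fun hN => ?_⟩⟩
  · have hM : 0 ≤ M := by obtain ⟨p, q, a, b, -, -, ha, -, -⟩ := hF; exact ha.nonneg
    refine (hF.norm_integral_le hs fun p _ => h1 t p ht).trans ?_
    have h3 : C₁ ≤ max 0 (max C₁ C₂) := (le_max_left _ _).trans (le_max_right _ _)
    have h4 : 0 ≤ t ^ (-(1 / 3) : ℝ) := by positivity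
    have h5 := mul_le_mul_of_nonneg_right h3 (by positivity : 0 ≤ M * t ^ (-(1 / 3) : ℝ) * (1 + Real.pi))
    linarith
  · have hM : 0 ≤ M := by obtain ⟨p, q, a, b, -, -, ha, -, -⟩ := hF; exact ha.nonneg
    refine (hF.norm_integral_le hs fun p hp => h2 t p ht (hp.trans hN)).trans ?_
    have h3 : C₂ ≤ max 0 (max C₁ C₂) := (le_max_right _ _).trans (le_max_right _ _)
    have h4 : 0 ≤ t ^ (-(1 / 2) : ℝ) := by positivity
    have h5 := mul_le_mul_of_nonneg_right h3 (by positivity : 0 ≤ M * t ^ (-(1 / 2) : ℝ) * (1 + Real.pi))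
    linarith

variable {m : ℝ} {Q : ℤ → Matrix (Fin 2) (Fin 2) ℝ} {r : ℕ}

theorem Admissible.contDiff_wrW (h : Admissible m Q r) (hr : 1 ≤ r) {s : ℝ} (hs : s ^ 2 = 1) :
    ContDiff ℝ r (wrW m Q s) ∧ ContDiff ℝ r (wrT m Q s) := by
  obtain ⟨K, hK⟩ := h.exists_contDiff_jost hr hs true
  obtain ⟨K', hK'⟩ := h.exists_contDiff_jost hr hs false
  have a := fun i => (hK 0 le_rfl i).1
  have a' : ∀ i, ContDiff ℝ r fun θ => jost m Q true 0 (band m s (-θ)) (circ (-θ)) i 0 := fun i =>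
    (a i).comp contDiff_neg
  have b := fun i => (hK' 1 zero_le_one i).1
  constructor
  · have e : wrW m Q s = fun θ => jost m Q false 1 (band m s θ) (circ θ) 0 0
        * jost m Q true 0 (band m s θ) (circ θ) 1 0
        - jost m Q false 1 (band m s θ) (circ θ) 1 0
        * jost m Q true 0 (band m s θ) (circ θ) 0 0 := by
      ext θ
      simp [wrW, wr, bandSol, jostSol_true, jostSol_false]
    rw [e]
    exact ((b 0).mul (a 1)).sub ((b 1).mul (a 0))
  · have e : wrT m Q s = fun θ => jost m Q false 1 (band m s θ) (circ θ) 0 0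
        * jost m Q true 0 (band m s (-θ)) (circ (-θ)) 1 0
        - jost m Q false 1 (band m s θ) (circ θ) 1 0
        * jost m Q true 0 (band m s (-θ)) (circ (-θ)) 0 0 := by
      ext θ
      simp [wrT, wr, bandSol, jostSol_true, jostSol_false]
    rw [e]
    exact ((b 0).mul (a' 1)).sub ((b 1).mul (a' 0))

/-- The scattering coefficients are bounded together with their derivatives. -/
theorem Admissible.exists_bddC1_scattering (h : Admissible m Q 1)
    (hres : ResonantCase m Q → Admissible m Q 2) {s : ℝ} (hs : s ^ 2 = 1) :
    ∃ M, (BddC1 M fun θ => (Real.sin θ : ℂ) / wrW m Q s θ) ∧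
      (BddC1 M fun θ => wrT m Q s θ / wrW m Q s θ) ∧
      BddC1 M fun θ => wrT m Q s (-θ) / wrW m Q s θ := by
  have h0 := h.mono zero_le_one
  obtain ⟨hW, hT⟩ := h.contDiff_wrW le_rfl hs
  rw [Nat.cast_one] at hW hT
  have hne : ∀ θ ∈ Ioo 0 Real.pi, wrW m Q s θ ≠ 0 := fun θ hθ =>
    h0.wrW_ne_zero hs (Real.sin_pos_of_mem_Ioo hθ).ne'
  have hsin : ∀ n : WithTop ℕ∞, ContDiff ℝ n fun θ : ℝ => (Real.sin θ : ℂ) := fun n =>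
    Complex.ofRealCLM.contDiff.comp Real.contDiff_sin
  have key : ∀ X : ℝ → ℂ, ContDiff ℝ 1 X → (Admissible m Q 2 → ContDiff ℝ 2 X) →
      (∀ e, e = 0 ∨ e = Real.pi → wrW m Q s e = 0 → X e = 0) →
      ∃ M, BddC1 M fun θ => X θ / wrW m Q s θ := by
    intro X hX hX2 hXe
    refine exists_bddC1_div hX hW hne fun e he => ?_
    by_cases hWe : wrW m Q s e = 0
    · right
      -- A zero of the Wronskian at an edge forces the resonant case, and only then is the second
      -- derivative of W, hence the extra moment, required.
      have hr : ResonantCase m Q := by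
        by_contra hnr
        exact h0.wrW_edge_ne_zero hnr hs he hWe
      have h2 := hres hr
      have hW2 := (h2.contDiff_wrW one_le_two hs).1
      refine ⟨hX2 h2, by exact_mod_cast hW2, hXe e he hWe, hWe, 2 * (4 * m ^ 2 / (2 * m + 8)), ?_,
        h0.le_norm_wrW hs⟩
      have := h.pos
      positivity
    · exact Or.inl hWe
  have hT0 : ∀ e, e = 0 ∨ e = Real.pi → wrW m Q s e = 0 → wrT m Q s e = 0 := fun e he hWe => by
    rw [wrT_edge s he, hWe]
  obtain ⟨M₁, h1⟩ := key (fun θ => (Real.sin θ : ℂ)) (hsin 1) (fun _ => hsin 2) fun e he _ => by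
    rcases he with rfl | rfl <;> simp
  obtain ⟨M₂, h2⟩ := key (wrT m Q s) hT (fun h2 => by
    exact_mod_cast (h2.contDiff_wrW one_le_two hs).2) hT0
  obtain ⟨M₃, h3⟩ := key (fun θ => wrT m Q s (-θ)) (hT.comp contDiff_neg) (fun h2 => by
    have h4 : ContDiff ℝ 2 (wrT m Q s) := by exact_mod_cast (h2.contDiff_wrW one_le_two hs).2
    exact h4.comp contDiff_neg) fun e he hWe => by
      rw [← h0.conj_wrT hs, hT0 e he hWe, map_zero]
  exact ⟨max M₁ (max M₂ M₃), h1.mono (le_max_left _ _),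
    h2.mono ((le_max_left _ _).trans (le_max_right _ _)),
    h3.mono ((le_max_right _ _).trans (le_max_right _ _))⟩

/-- The density of the resolvent kernel over a band is a sum of two plane waves with uniformly
bounded amplitudes. -/
theorem Admissible.exists_amp (h : Admissible m Q 1)
    (hres : ResonantCase m Q → Admissible m Q 2) {s : ℝ} (hs : s ^ 2 = 1) :
    ∃ M : ℝ, ∀ (n l : ℤ) (i j : Fin 2), l ≤ n → Amp (|(n : ℝ)| + |(l : ℝ)|) M fun θ =>
      bandSol m Q s true θ n i * bandSol m Q s false θ l j / wrW m Q s θ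
        * (Real.sin θ / omega m θ : ℝ) := by
  have h0 := h.mono zero_le_one
  obtain ⟨M, hS, hT, hT'⟩ := h.exists_bddC1_scattering hres hs
  obtain ⟨K₁, hK₁⟩ := h.exists_contDiff_jost le_rfl hs true
  obtain ⟨K₂, hK₂⟩ := h.exists_contDiff_jost le_rfl hs false
  have bP : ∀ n : ℤ, 0 ≤ n → ∀ i, BddC1 K₁ fun θ => jost m Q true n (band m s θ) (circ θ) i 0 :=
    fun n hn i => bddC1_of_contDiff (by norm_num) (hK₁ n hn i).1 (hK₁ n hn i).2
  have bM : ∀ n : ℤ, 0 ≤ n → ∀ i, BddC1 K₂ fun θ => jost m Q false n (band m s θ) (circ θ) i 0 :=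
    fun n hn i => bddC1_of_contDiff (by norm_num) (hK₂ n hn i).1 (hK₂ n hn i).2
  have refl : ∀ (f : ℝ → ℂ) (K : ℝ), ContDiff ℝ (1 : ℕ) f → (∀ θ, ‖f θ‖ ≤ K ∧ ‖deriv f θ‖ ≤ K) →
      BddC1 K fun θ => f (-θ) := by
    intro f K hf hK
    refine bddC1_of_contDiff (by norm_num) (hf.comp contDiff_neg) fun θ => ⟨(hK _).1, ?_⟩
    have e : deriv (f ∘ fun p => -p) θ = -deriv f (-θ) := deriv_comp_neg f θ
    rw [e, norm_neg]
    exact (hK _).2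
  have bP' : ∀ n : ℤ, 0 ≤ n → ∀ i, BddC1 K₁ fun θ =>
      jost m Q true n (band m s (-θ)) (circ (-θ)) i 0 := fun n hn i =>
    refl _ _ (hK₁ n hn i).1 (hK₁ n hn i).2
  have bM' : ∀ n : ℤ, 0 ≤ n → ∀ i, BddC1 K₂ fun θ =>
      jost m Q false n (band m s (-θ)) (circ (-θ)) i 0 := fun n hn i =>
    refl _ _ (hK₂ n hn i).1 (hK₂ n hn i).2
  obtain ⟨K₃, bω⟩ : ∃ K, BddC1 K fun θ => ((omega m θ : ℝ) : ℂ)⁻¹ := by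
    refine exists_bddC1_of_contDiff (ContDiff.inv ?_ fun θ => ?_)
    · exact Complex.ofRealCLM.contDiff.comp ((contDiff_omega h.pos).of_le (mod_cast le_top))
    · exact_mod_cast (omega_pos h.pos θ).ne'
  -- When a scattering relation is used, the factor sin θ of the density cancels the one in the
  -- Wronskian of the free waves; this bounded smooth factor remains.
  obtain ⟨K₄, bκ⟩ : ∃ K, BddC1 K fun θ =>
      (-2 * Complex.I * waveFactor m s θ)⁻¹ * ((omega m θ : ℝ) : ℂ)⁻¹ := by
    have hω := (contDiff_omega h.pos).of_le (m := 1) (mod_cast le_top)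
    refine exists_bddC1_of_contDiff (ContDiff.mul (ContDiff.inv ?_ fun θ => ?_)
      (ContDiff.inv ?_ fun θ => ?_))
    · refine contDiff_const.mul (Complex.ofRealCLM.contDiff.comp ?_)
      exact (contDiff_const.mul (contDiff_const.mul hω)).add
        (contDiff_const.sub (contDiff_const.mul Real.contDiff_cos))
    · have h2 : (waveFactor m s θ : ℂ) ≠ 0 := by exact_mod_cast waveFactor_ne_zero h.pos hs θ
      exact mul_ne_zero (mul_ne_zero (by norm_num) Complex.I_ne_zero) h2
    · exact Complex.ofRealCLM.contDiff.comp hω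
    · exact_mod_cast (omega_pos h.pos θ).ne'
  have hM := hS.nonneg
  have hK3 := bω.nonneg
  have hK4 := bκ.nonneg
  have hK1 := (bP 0 le_rfl 0).nonneg
  have hK2 := (bM 0 le_rfl 0).nonneg
  set A₁ := 2 * (2 * (K₁ * K₂) * (2 * (M * K₃)))
  set A₂ := 2 * (2 * (K₁ * K₁) * (2 * (M * K₄)))
  set A₃ := 2 * (2 * (K₁ * K₁) * K₄)
  set A₄ := 2 * (2 * (K₂ * K₂) * (2 * (M * K₄)))
  set A₅ := 2 * (2 * (K₂ * K₂) * K₄)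
  have p1 : 0 ≤ A₁ := by positivity
  have p2 : 0 ≤ A₂ := by positivity
  have p3 : 0 ≤ A₃ := by positivity
  have p4 : 0 ≤ A₄ := by positivity
  have p5 : 0 ≤ A₅ := by positivity
  refine ⟨A₁ + A₂ + A₃ + A₄ + A₅, fun n l i j hnl => ?_⟩
  have habs : ∀ ε δ : ℝ, |ε| = 1 → |δ| = 1 → |ε * n + δ * l| ≤ |(n : ℝ)| + |(l : ℝ)| := by
    intro ε δ hε hδ
    refine (abs_add_le _ _).trans (le_of_eq ?_)
    rw [abs_mul, abs_mul, hε, hδ, one_mul, one_mul]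
  have hne : ∀ θ ∈ Ioo 0 Real.pi, (Real.sin θ : ℂ) ≠ 0 ∧ wrW m Q s θ ≠ 0 ∧
      (waveFactor m s θ : ℂ) ≠ 0 ∧ (omega m θ : ℂ) ≠ 0 := fun θ hθ => by
    have h1 := (Real.sin_pos_of_mem_Ioo hθ).ne'
    exact ⟨by exact_mod_cast h1, h0.wrW_ne_zero hs h1,
      by exact_mod_cast waveFactor_ne_zero h.pos hs θ, by exact_mod_cast (omega_pos h.pos θ).ne'⟩
  have ephase : ∀ (θ : ℝ) (a b : ℤ) (p : ℝ), p = a + b →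
      Complex.exp (Complex.I * ((p * θ : ℝ) : ℂ)) = circ θ ^ a * circ θ ^ b := by
    rintro θ a b p rfl
    rw [circ_zpow, circ_zpow, ← Complex.exp_add]; push_cast; ring_nf
  by_cases hl : l ≤ 1
  · by_cases hn : 0 ≤ n
    · refine ⟨1 * n + (-1) * l, 0, _, _, habs _ _ (by norm_num) (by norm_num), ?_,
        (((bP n hn i).mul (bM (1 - l) (by omega) j)).mul (hS.mul bω)).mono (by linarith),
        bddC1_zero (by positivity), fun θ hθ => ?_⟩
      · rw [abs_zero]; positivity
      · obtain ⟨-, hW, -, hω⟩ := hne θ hθ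
        rw [ephase θ n (-l) _ (by push_cast; ring)]
        simp only [bandSol, jostSol_true, jostSol_false, mul_zero, add_zero]
        rw [Complex.ofReal_div]
        field_simp
    · have hn' : 0 ≤ 1 - n := by omega
      refine ⟨(-1) * n + (-1) * l, 1 * n + (-1) * l, _, _, habs _ _ (by norm_num) (by norm_num),
        habs _ _ (by norm_num) (by norm_num),
        (((bM (1 - n) hn' i).mul (bM (1 - l) (by omega) j)).mul (hT'.mul bκ)).mono (by linarith),
        (((bM' (1 - n) hn' i).mul (bM (1 - l) (by omega) j)).mul bκ).neg.mono (by linarith),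
        fun θ hθ => ?_⟩
      obtain ⟨hsin, hW, hκ, hω⟩ := hne θ hθ
      have e1 : -waveWr m s θ * bandSol m Q s true θ n i
          = wrW m Q s θ * bandSol m Q s false (-θ) n i
            - wrT m Q s (-θ) * bandSol m Q s false θ n i := by
        have w1 := h0.wr_false hs θ n
        have w2 : wrW m Q s θ = _ :=
          (h0.isSol_bandSol hs false θ).wr_const h.ne (h0.isSol_bandSol hs true θ) 0 n
        have w3 : wrT m Q s (-θ) = wr (bandSol m Q s false (-θ)) (bandSol m Q s true θ) n := by
          have := (h0.isSol_bandSol_neg hs false θ).wr_const h.ne (h0.isSol_bandSol hs true θ) 0 n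
          rw [wrT, neg_neg]
          exact this
        rw [← w1, w2, w3]
        simp only [wr]
        fin_cases i <;> simp only [Fin.zero_eta, Fin.mk_one] <;> ring
      rw [ephase θ (-n) (-l) _ (by push_cast; ring), ephase θ n (-l) _ (by push_cast; ring)]
      have e2 : bandSol m Q s true θ n i = (wrT m Q s (-θ) * bandSol m Q s false θ n i
          - wrW m Q s θ * bandSol m Q s false (-θ) n i) / waveWr m s θ := by
        rw [eq_div_iff (by
          unfold waveWr
          exact mul_ne_zero (mul_ne_zero (mul_ne_zero (by norm_num) Complex.I_ne_zero) hsin) hκ)]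
        linear_combination -e1
      beta_reduce
      rw [e2]
      simp only [bandSol, jostSol_false, waveWr, circ_neg, inv_zpow, zpow_neg, inv_inv]
      rw [Complex.ofReal_div]
      have hI := Complex.I_ne_zero
      have hc := zpow_ne_zero n (circ_ne_zero θ)
      have hc' := zpow_ne_zero l (circ_ne_zero θ)
      field_simp
      ring
  · have hn : 0 ≤ n := by omega
    have hl' : 0 ≤ l := by omega
    refine ⟨1 * n + 1 * l, 1 * n + (-1) * l, _, _, habs _ _ (by norm_num) (by norm_num),
      habs _ _ (by norm_num) (by norm_num),
      (((bP n hn i).mul (bP l hl' j)).mul (hT.mul bκ)).mono (by linarith),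
      (((bP n hn i).mul (bP' l hl' j)).mul bκ).neg.mono (by linarith),
      fun θ hθ => ?_⟩
    obtain ⟨hsin, hW, hκ, hω⟩ := hne θ hθ
    have e1 : waveWr m s θ * bandSol m Q s false θ l j
        = wrT m Q s θ * bandSol m Q s true θ l j
          - wrW m Q s θ * bandSol m Q s true (-θ) l j := by
      have w1 := h0.wr_true hs θ l
      have w2 : wrW m Q s θ = _ :=
        (h0.isSol_bandSol hs false θ).wr_const h.ne (h0.isSol_bandSol hs true θ) 0 l
      have w3 : wrT m Q s θ = _ :=
        (h0.isSol_bandSol hs false θ).wr_const h.ne (h0.isSol_bandSol_neg hs true θ) 0 l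
      rw [← w1, w2, w3]
      simp only [wr]
      fin_cases j <;> simp only [Fin.zero_eta, Fin.mk_one] <;> ring
    rw [ephase θ n l _ (by ring), ephase θ n (-l) _ (by push_cast; ring)]
    have e2 : bandSol m Q s false θ l j = (wrT m Q s θ * bandSol m Q s true θ l j
          - wrW m Q s θ * bandSol m Q s true (-θ) l j) / waveWr m s θ := by
      rw [eq_div_iff (by
        unfold waveWr
        exact mul_ne_zero (mul_ne_zero (mul_ne_zero (by norm_num) Complex.I_ne_zero) hsin) hκ)]
      linear_combination e1
    beta_reduce
    rw [e2]
    simp only [bandSol, jostSol_true, waveWr, circ_neg, inv_zpow, zpow_neg]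
    rw [Complex.ofReal_div]
    have hI := Complex.I_ne_zero
    have hc := zpow_ne_zero n (circ_ne_zero θ)
    have hc' := zpow_ne_zero l (circ_ne_zero θ)
    field_simp
    ring

end DiscreteDirac
end

/-! ### The operator on square summable sequences: self-adjointness and lower bounds off the bands
-/

noncomputable section

namespace DiscreteDirac

open Set Filter Topology

variable {m : ℝ} {Q : ℤ → Matrix (Fin 2) (Fin 2) ℝ} {r : ℕ}

theorem dirac_apply (hQ : BoundedPotential Q) (w : L2) (n : ℤ) :
    dirac m Q hQ w n = diracSeq m Q w n := rfl

theorem summable_norm_sq (w : L2) : Summable fun n => ‖w n‖ ^ 2 := by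
  have := (lp.memℓp w).summable (by norm_num)
  simpa using this

theorem norm_sq_eq_tsum (w : L2) : ‖w‖ ^ 2 = ∑' n, ‖w n‖ ^ 2 := by
  have := lp.norm_rpow_eq_tsum (p := 2) (by norm_num) w
  simpa using this

theorem l2_norm_le_of_sum_le {f : L2} {c : ℝ} (hc : 0 ≤ c)
    (h : ∀ s : Finset ℤ, ∑ n ∈ s, ‖f n‖ ^ 2 ≤ c ^ 2) : ‖f‖ ≤ c :=
  lp.norm_le_of_forall_sum_le (by norm_num) hc fun s => by simpa using h s

theorem l2_norm_le_of_forall_le {f g : L2} {c : ℝ} (hc : 0 ≤ c) (h : ∀ n, ‖f n‖ ≤ c * ‖g n‖) :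
    ‖f‖ ≤ c * ‖g‖ := by
  refine l2_norm_le_of_sum_le (by positivity) fun s => ?_
  calc ∑ n ∈ s, ‖f n‖ ^ 2 ≤ ∑ n ∈ s, c ^ 2 * ‖g n‖ ^ 2 := Finset.sum_le_sum fun n _ => by
        rw [← mul_pow]; exact pow_le_pow_left₀ (norm_nonneg _) (h n) 2
    _ = c ^ 2 * ∑ n ∈ s, ‖g n‖ ^ 2 := by rw [Finset.mul_sum]
    _ ≤ c ^ 2 * ‖g‖ ^ 2 := by
        rw [norm_sq_eq_tsum]
        exact mul_le_mul_of_nonneg_left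
          ((summable_norm_sq g).sum_le_tsum _ fun _ _ => by positivity) (by positivity)
    _ = (c * ‖g‖) ^ 2 := by ring

theorem tendsto_norm_apply (w : L2) : Tendsto (fun n : ℕ => ‖w n‖) atTop (𝓝 0) := by
  have h1 := (summable_norm_sq w).tendsto_cofinite_zero
  have h2 : Tendsto (fun n : ℕ => (n : ℤ)) atTop cofinite := by
    rw [← Nat.cofinite_eq_atTop]
    exact Nat.cast_injective.tendsto_cofinite
  have h3 := (h1.comp h2).sqrt
  simpa using h3

theorem summable_norm_mul_shift (v w : L2) (k : ℤ) :
    Summable fun n => ‖v n‖ * ‖w (n + k)‖ := by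
  have h1 := summable_norm_sq v
  have h2 : Summable fun n => ‖w (n + k)‖ ^ 2 :=
    (Equiv.addRight k).summable_iff.2 (summable_norm_sq w)
  refine Summable.of_nonneg_of_le (fun n => by positivity) (fun n => ?_) (h1.add h2)
  nlinarith [sq_nonneg (‖v n‖ - ‖w (n + k)‖), sq_nonneg ‖v n‖, sq_nonneg ‖w (n + k)‖]

theorem inner_spinor (x y : Spinor) :
    inner ℂ x y = (starRingEnd ℂ) (x 0) * y 0 + (starRingEnd ℂ) (x 1) * y 1 := by
  rw [PiLp.inner_apply, Fin.sum_univ_two, RCLike.inner_apply', RCLike.inner_apply']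

/-- The potential and the mass cancel, being real and symmetric; what remains is a pair of shift
differences, which sum to zero. -/
theorem inner_diracSeq_sub (hs : ∀ n, Q n 0 1 = Q n 1 0) (v w : ℤ → Spinor) (n : ℤ) :
    inner ℂ (diracSeq m Q v n) (w n) - inner ℂ (v n) (diracSeq m Q w n)
      = (starRingEnd ℂ) (v n 1) * w (n - 1) 0 - (starRingEnd ℂ) (v (n + 1) 1) * w n 0
        + (starRingEnd ℂ) (v n 0) * w (n + 1) 1 - (starRingEnd ℂ) (v (n - 1) 0) * w n 1 := by
  rw [inner_spinor, inner_spinor]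
  simp only [diracSeq_zero, diracSeq_one, map_add, map_sub, map_mul, Complex.conj_ofReal, hs]
  ring

theorem hasSum_shift_sub {a : ℤ → ℂ} (ha : Summable a) (k : ℤ) :
    HasSum (fun n => a n - a (n + k)) 0 := by
  have h : HasSum (fun n => a (n + k)) (∑' n, a n) :=
    (Equiv.addRight k).hasSum_iff.2 ha.hasSum
  simpa using ha.hasSum.sub h

/-- Summation by parts: the boundary terms are differences of a summable sequence and its shift. -/
theorem isSelfAdjoint_dirac (hs : ∀ n, Q n 0 1 = Q n 1 0) (hQ : BoundedPotential Q) :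
    IsSelfAdjoint (dirac m Q hQ) := by
  rw [ContinuousLinearMap.isSelfAdjoint_iff_isSymmetric]
  intro v w
  have hle : ∀ (x y : Spinor) i j, ‖(starRingEnd ℂ) (x i) * y j‖ ≤ ‖x‖ * ‖y‖ := fun x y i j => by
    rw [norm_mul, RCLike.norm_conj]
    exact mul_le_mul (PiLp.norm_apply_le x i) (PiLp.norm_apply_le y j) (norm_nonneg _)
      (norm_nonneg _)
  have ha : Summable fun n => (starRingEnd ℂ) (v n 1) * w (n + -1) 0 :=
    Summable.of_norm_bounded (summable_norm_mul_shift v w (-1)) fun n => hle _ _ 1 0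
  have hb : Summable fun n => (starRingEnd ℂ) (v n 0) * w (n + 1) 1 :=
    Summable.of_norm_bounded (summable_norm_mul_shift v w 1) fun n => hle _ _ 0 1
  have h0 := (hasSum_shift_sub ha 1).add (hasSum_shift_sub hb (-1))
  have h1 := (lp.hasSum_inner (𝕜 := ℂ) (dirac m Q hQ v) w).sub
    (lp.hasSum_inner (𝕜 := ℂ) v (dirac m Q hQ w))
  have h2 : ∀ n, inner ℂ (dirac m Q hQ v n) (w n) - inner ℂ (v n) (dirac m Q hQ w n)
      = (starRingEnd ℂ) (v n 1) * w (n + -1) 0 - (starRingEnd ℂ) (v (n + 1) 1) * w (n + 1 + -1) 0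
        + ((starRingEnd ℂ) (v n 0) * w (n + 1) 1
          - (starRingEnd ℂ) (v (n + -1) 0) * w (n + -1 + 1) 1) := fun n => by
    rw [dirac_apply, dirac_apply, inner_diracSeq_sub hs, add_neg_cancel_right,
      neg_add_cancel_right, ← sub_eq_add_neg]
    ring
  have h3 := h1.unique (h0.congr_fun h2)
  rw [add_zero] at h3
  exact sub_eq_zero.1 h3

theorem Admissible.bandPoly_nonpos (h : Admissible m Q 0) (hQ : BoundedPotential Q) (l : ℝ)
    (w : L2) (hw : w ≠ 0) (he : dirac m Q hQ w = (l : ℂ) • w) : bandPoly m l ≤ 0 := by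
  refine h.bandPoly_nonpos_of_eigenvector (w := w) (fun n => ?_) (tendsto_norm_apply w)
    fun hcon => hw (lp.ext hcon)
  rw [← dirac_apply hQ, he]
  rfl

/-- Evaluation at a site. -/
def evalCLM (n : ℤ) : L2 →L[ℂ] Spinor :=
  LinearMap.mkContinuous
    { toFun := fun w => w n
      map_add' := fun _ _ => rfl
      map_smul' := fun _ _ => rfl } 1 fun w => by
        rw [one_mul]; exact lp.norm_apply_le_norm (by norm_num) w n

/-- The action of the potential at one site. -/
def potAct (q : Matrix (Fin 2) (Fin 2) ℝ) : Spinor →ₗ[ℂ] Spinor where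
  toFun x := !₂[q 0 0 * x 0 + q 0 1 * x 1, q 1 0 * x 0 + q 1 1 * x 1]
  map_add' x y := by ext i; fin_cases i <;> simp <;> ring
  map_smul' c x := by ext i; fin_cases i <;> simp <;> ring

theorem potAct_zero (q : Matrix (Fin 2) (Fin 2) ℝ) (x : Spinor) :
    potAct q x 0 = q 0 0 * x 0 + q 0 1 * x 1 := rfl

theorem potAct_one (q : Matrix (Fin 2) (Fin 2) ℝ) (x : Spinor) :
    potAct q x 1 = q 1 0 * x 0 + q 1 1 * x 1 := rfl

theorem norm_potAct_le (q : Matrix (Fin 2) (Fin 2) ℝ) (x : Spinor) :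
    ‖potAct q x‖ ≤ potNorm q * ‖x‖ := by
  refine (spinor_norm_le _).trans ?_
  rw [potAct_zero, potAct_one]
  have h : ∀ i j, ‖(q i j : ℂ) * x j‖ ≤ |q i j| * ‖x‖ := fun i j => by
    rw [norm_mul, Complex.norm_real, Real.norm_eq_abs]
    exact mul_le_mul_of_nonneg_left (PiLp.norm_apply_le x j) (abs_nonneg _)
  have h1 := norm_add_le ((q 0 0 : ℂ) * x 0) (q 0 1 * x 1)
  have h2 := norm_add_le ((q 1 0 : ℂ) * x 0) (q 1 1 * x 1)
  simp only [potNorm, Fin.sum_univ_two]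
  linarith [h 0 0, h 0 1, h 1 0, h 1 1]

theorem boundedPotential_zero : BoundedPotential 0 := ⟨0, fun _ _ _ => by simp⟩

theorem dirac_sub_free_apply (hQ : BoundedPotential Q) (w : L2) (n : ℤ) :
    (dirac m Q hQ - dirac m 0 boundedPotential_zero) w n = potAct (Q n) (w n) := by
  change dirac m Q hQ w n - dirac m 0 boundedPotential_zero w n = _
  rw [dirac_apply, dirac_apply]
  ext i
  fin_cases i
  · simp [diracSeq_zero, potAct_zero]
  · simp [diracSeq_one, potAct_one]

/-- A summable potential is a compact perturbation. -/
theorem Admissible.isCompactOperator_sub_free (h : Admissible m Q 0) (hQ : BoundedPotential Q) :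
    IsCompactOperator (dirac m Q hQ - dirac m 0 boundedPotential_zero) := by
  set K := dirac m Q hQ - dirac m 0 boundedPotential_zero
  set T : ℤ → L2 →L[ℂ] L2 := fun n =>
    (lp.singleContinuousLinearMap ℂ (fun _ : ℤ => Spinor) 2 n).comp
      ((LinearMap.toContinuousLinearMap (potAct (Q n))).comp (evalCLM n))
  have hT : ∀ n, IsCompactOperator (T n) := by
    intro n
    have h1 := isCompactOperator_of_locallyCompactSpace_rng
      ((lp.singleContinuousLinearMap ℂ (fun _ : ℤ => Spinor) 2 n).comp
        (LinearMap.toContinuousLinearMap (potAct (Q n))))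
    exact h1.comp_clm (evalCLM n)
  have hTs : ∀ s : Finset ℤ, IsCompactOperator (∑ n ∈ s, T n : L2 →L[ℂ] L2) := by
    intro s
    induction s using Finset.induction_on with
    | empty => exact isCompactOperator_zero
    | insert a s ha ih =>
      rw [Finset.sum_insert ha]
      exact (hT a).add ih
  have hTa : ∀ (s : Finset ℤ) (w : L2) (k : ℤ),
      (∑ n ∈ s, T n : L2 →L[ℂ] L2) w k = if k ∈ s then potAct (Q k) (w k) else 0 := by
    intro s w k
    have h1 : ∀ n, T n w = lp.single 2 n (potAct (Q n) (w n)) := fun n => rfl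
    rw [_root_.sum_apply, lp.coeFn_sum, Finset.sum_apply]
    simp only [h1, lp.coeFn_single]
    rw [Finset.sum_pi_single]
  -- Truncations of the potential to finitely many sites have finite rank and converge in norm, with
  -- error controlled by the potential off the finite set.
  refine isCompactOperator_of_tendsto (l := atTop) (F := fun s : Finset ℤ => ∑ n ∈ s, T n) ?_
    (Eventually.of_forall hTs)
  rw [Metric.tendsto_nhds]
  intro ε hε
  have h2 : ∀ᶠ n in cofinite, potNorm (Q n) < ε / 2 :=
    h.summable_potNorm.tendsto_cofinite_zero.eventually (gt_mem_nhds (by positivity))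
  have hfin : {n | ¬ potNorm (Q n) < ε / 2}.Finite := h2
  filter_upwards [eventually_ge_atTop hfin.toFinset] with s hs
  rw [dist_eq_norm]
  refine lt_of_le_of_lt (ContinuousLinearMap.opNorm_le_bound _ (by positivity) fun w => ?_)
    (half_lt_self hε)
  refine l2_norm_le_of_forall_le (by positivity) fun n => ?_
  change ‖(∑ n ∈ s, T n : L2 →L[ℂ] L2) w n - K w n‖ ≤ _
  rw [hTa, dirac_sub_free_apply]
  by_cases hn : n ∈ s
  · rw [if_pos hn, sub_self, norm_zero]; positivity
  · rw [if_neg hn, zero_sub, norm_neg]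
    refine (norm_potAct_le _ _).trans (mul_le_mul_of_nonneg_right ?_ (norm_nonneg _))
    by_contra hcon
    exact hn (hs (by simpa using fun h => hcon (le_of_lt h)))

/-- The square of the free operator is a scalar second difference operator acting componentwise,
which reduces the spectral gap to a bound on shifts. -/
theorem diracSeq_free_free (w : ℤ → Spinor) (n : ℤ) :
    diracSeq m 0 (diracSeq m 0 w) n = ((m ^ 2 + 2 : ℝ) : ℂ) • w n - (w (n + 1) + w (n - 1)) := by
  ext i
  fin_cases i
  · simp [diracSeq_zero, diracSeq_one]; ring
  · simp [diracSeq_zero, diracSeq_one]; ring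

theorem norm_add_shift_le {g w : L2} (h : ∀ n, g n = w (n + 1) + w (n - 1)) : ‖g‖ ≤ 2 * ‖w‖ := by
  refine l2_norm_le_of_sum_le (by positivity) fun s => ?_
  have hsh : ∀ e : ℤ ≃ ℤ, ∑ n ∈ s, ‖w (e n)‖ ^ 2 ≤ ‖w‖ ^ 2 := by
    intro e
    rw [norm_sq_eq_tsum]
    have h1 : Summable fun n => ‖w (e n)‖ ^ 2 := e.summable_iff.2 (summable_norm_sq w)
    refine (h1.sum_le_tsum _ fun _ _ => by positivity).trans (le_of_eq ?_)
    exact e.tsum_eq fun n => ‖w n‖ ^ 2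
  have s1 := hsh (Equiv.addRight 1)
  have s2 := hsh (Equiv.subRight 1)
  simp only [Equiv.coe_addRight, Equiv.subRight_apply] at s1 s2
  calc ∑ n ∈ s, ‖g n‖ ^ 2 ≤ ∑ n ∈ s, (2 * ‖w (n + 1)‖ ^ 2 + 2 * ‖w (n - 1)‖ ^ 2) := by
        refine Finset.sum_le_sum fun n _ => ?_
        rw [h n]
        have := pow_le_pow_left₀ (norm_nonneg _) (norm_add_le (w (n + 1)) (w (n - 1))) 2
        nlinarith [sq_nonneg (‖w (n + 1)‖ - ‖w (n - 1)‖)]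
    _ ≤ (2 * ‖w‖) ^ 2 := by
        rw [Finset.sum_add_distrib, ← Finset.mul_sum, ← Finset.mul_sum]
        nlinarith

/-- Off the bands the free operator is bounded below. -/
theorem free_bounded_below {l : ℝ} (hl : bandPoly m l < 0) : ∃ c > 0, ∀ w : L2,
    c * ‖w‖ ≤ ‖dirac m 0 boundedPotential_zero w - (l : ℂ) • w‖ := by
  set A := dirac m 0 boundedPotential_zero
  set μ := m ^ 2 + 2 - l ^ 2 with hμ
  -- This is the identity μ² − 4 = −`bandPoly m l`.
  have h1 : 2 < |μ| := by
    unfold bandPoly at hl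
    have : 2 ^ 2 < μ ^ 2 := by rw [hμ]; nlinarith
    simpa using sq_lt_sq.1 this
  refine ⟨(|μ| - 2) / (‖A‖ + |l| + 1), by
    have := norm_nonneg A
    have := abs_nonneg l
    apply div_pos <;> linarith, fun w => ?_⟩
  set y := A w - (l : ℂ) • w
  -- Here g is μw minus the product of the free operator shifted by +l and by −l, applied to w; only
  -- the two neighbouring shifts of w remain, so its norm is at most 2‖w‖.
  set g : L2 := (μ : ℂ) • w - (A y + (l : ℂ) • y)
  have hg : ∀ n, g n = w (n + 1) + w (n - 1) := by
    intro n
    have h2 : A y + (l : ℂ) • y = A (A w) - ((l ^ 2 : ℝ) : ℂ) • w := by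
      simp only [y, map_sub, map_smul, smul_sub, smul_smul]
      push_cast
      rw [pow_two]
      abel
    have h3 : g = (μ : ℂ) • w - (A (A w) - ((l ^ 2 : ℝ) : ℂ) • w) := by rw [← h2]
    have h4 : A (A w) n = ((m ^ 2 + 2 : ℝ) : ℂ) • w n - (w (n + 1) + w (n - 1)) :=
      diracSeq_free_free w n
    have h5 : g n = (μ : ℂ) • w n - (A (A w) n - ((l ^ 2 : ℝ) : ℂ) • w n) := by rw [h3]; rfl
    rw [h5, h4, hμ]
    push_cast
    module
  have h2 := norm_add_shift_le hg
  have h3 : (μ : ℂ) • w = g + (A y + (l : ℂ) • y) := by simp [g]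
  have h4 : |μ| * ‖w‖ ≤ 2 * ‖w‖ + (‖A‖ * ‖y‖ + |l| * ‖y‖) := by
    calc |μ| * ‖w‖ = ‖(μ : ℂ) • w‖ := by rw [norm_smul, Complex.norm_real, Real.norm_eq_abs]
      _ ≤ ‖g‖ + (‖A y‖ + ‖(l : ℂ) • y‖) := by
          rw [h3]; exact (norm_add_le _ _).trans (add_le_add_right (norm_add_le _ _) _)
      _ ≤ _ := by
          rw [norm_smul, Complex.norm_real, Real.norm_eq_abs]
          linarith [A.le_opNorm y]
  rw [div_mul_eq_mul_div, div_le_iff₀ (by have := norm_nonneg A; have := abs_nonneg l; linarith)]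
  nlinarith [norm_nonneg y]

/-- Off the bands the operator is bounded below on the orthogonal complement of its
eigenvectors. -/
theorem Admissible.bounded_below (h : Admissible m Q 0) (hQ : BoundedPotential Q) (l : ℝ)
    (hl : bandPoly m l < 0) : ∃ c > 0, ∀ w ∈ (eigenvectorSpan (dirac m Q hQ))ᗮ,
      c * ‖w‖ ≤ ‖dirac m Q hQ w - (l : ℂ) • w‖ := by
  set D := dirac m Q hQ
  set A := dirac m 0 boundedPotential_zero
  by_contra hcon
  push Not at hcon
  obtain ⟨c, hc, hA⟩ := free_bounded_below hl
  -- If no bound held there would be a normalized sequence of approximate eigenvectors in the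
  -- orthogonal complement.
  have hseq : ∀ k : ℕ, ∃ w ∈ (eigenvectorSpan D)ᗮ, ‖w‖ = 1 ∧
      ‖D w - (l : ℂ) • w‖ ≤ 1 / ((k : ℝ) + 1) := by
    intro k
    obtain ⟨w, hw, hlt⟩ := hcon (1 / ((k : ℝ) + 1)) (by positivity)
    have hw0 : 0 < ‖w‖ := by
      by_contra h0
      have : w = 0 := norm_le_zero_iff.1 (not_lt.1 h0)
      rw [this] at hlt
      simp at hlt
    refine ⟨((‖w‖⁻¹ : ℝ) : ℂ) • w, Submodule.smul_mem _ _ hw, ?_, ?_⟩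
    · rw [norm_smul, Complex.norm_real, Real.norm_eq_abs, abs_of_pos (inv_pos.2 hw0),
        inv_mul_cancel₀ hw0.ne']
    · rw [map_smul, smul_comm, ← smul_sub, norm_smul, Complex.norm_real, Real.norm_eq_abs,
        abs_of_pos (inv_pos.2 hw0), inv_mul_le_iff₀ hw0, mul_comm]
      exact hlt.le
  choose w hw hw1 hw2 using hseq
  obtain ⟨S, hS, hsub⟩ := (h.isCompactOperator_sub_free hQ).image_closedBall_subset_compact
    (f := (D - A : L2 →L[ℂ] L2).toLinearMap) 1
  have hmem : ∀ k, (D - A) (w k) ∈ S := fun k => hsub ⟨w k, by simp [hw1 k], rfl⟩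
  obtain ⟨y, -, φ, hφ, hlim⟩ := hS.tendsto_subseq hmem
  have hres : Tendsto (fun k => D (w k) - (l : ℂ) • w k) atTop (𝓝 0) :=
    squeeze_zero_norm hw2 tendsto_one_div_add_atTop_nhds_zero_nat
  have hfree : Tendsto (fun k => A (w (φ k)) - (l : ℂ) • w (φ k)) atTop (𝓝 (0 - y)) := by
    refine ((hres.comp hφ.tendsto_atTop).sub hlim).congr fun k => ?_
    simp only [Function.comp_apply, _root_.sub_apply]
    abel
  -- The compact difference converges along the subsequence, so the free part does too, and the free
  -- lower bound makes the vectors Cauchy. Their limit is a unit eigenvector orthogonal to all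
  -- eigenvectors.
  have hcau : CauchySeq fun k => w (φ k) := by
    have h1 := hfree.cauchySeq
    rw [Metric.cauchySeq_iff'] at h1 ⊢
    intro ε hε
    obtain ⟨N, hN⟩ := h1 (c * ε) (by positivity)
    refine ⟨N, fun n hn => ?_⟩
    have h2 := hN n hn
    rw [dist_eq_norm] at h2 ⊢
    have h3 := hA (w (φ n) - w (φ N))
    have h4 : A (w (φ n) - w (φ N)) - (l : ℂ) • (w (φ n) - w (φ N))
        = A (w (φ n)) - (l : ℂ) • w (φ n) - (A (w (φ N)) - (l : ℂ) • w (φ N)) := by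
      rw [map_sub, smul_sub]; abel
    rw [h4] at h3
    exact lt_of_mul_lt_mul_left (h3.trans_lt h2) hc.le
  obtain ⟨v, hv⟩ := cauchySeq_tendsto_of_complete hcau
  have hv1 : ‖v‖ = 1 := by
    have := hv.norm
    simp only [hw1] at this
    exact tendsto_nhds_unique this tendsto_const_nhds |>.symm ▸ rfl
  have hvm : v ∈ (eigenvectorSpan D)ᗮ :=
    (Submodule.isClosed_orthogonal _).mem_of_tendsto hv (Eventually.of_forall fun k => hw _)
  have hev : D v - (l : ℂ) • v = 0 :=
    tendsto_nhds_unique (((D.continuous.tendsto v).comp hv).sub (hv.const_smul (l : ℂ)))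
      (hres.comp hφ.tendsto_atTop)
  have hvs : v ∈ eigenvectorSpan D := by
    refine Submodule.mem_iSup_of_mem (l : ℂ) ?_
    exact Module.End.mem_eigenspace_iff.2 (sub_eq_zero.1 hev)
  have hin := Submodule.inner_right_of_mem_orthogonal hvs hvm
  have : v = 0 := inner_self_eq_zero.1 hin
  rw [this, norm_zero] at hv1
  exact zero_ne_one hv1

end DiscreteDirac
end

/-! ### The Green function and the root of the dispersion relation in the disc -/

noncomputable section

namespace DiscreteDirac

open Set Filter Topology
open scoped ContDiff Matrix

attribute [local instance] Matrix.linftyOpNormedRing Matrix.linftyOpNormedAlgebra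

variable {m : ℝ} {Q : ℤ → Matrix (Fin 2) (Fin 2) ℝ} {r : ℕ}

/-- The unit vectors. -/
def delta (y : ℤ) (j : Fin 2) : L2 := lp.single 2 y (EuclideanSpace.single j (1 : ℂ))

theorem delta_apply (y : ℤ) (j : Fin 2) (x : ℤ) (i : Fin 2) :
    delta y j x i = if x = y ∧ i = j then 1 else 0 := by
  rw [delta, lp.coeFn_single]
  by_cases h : x = y
  · subst h; simp
  · simp [h]

theorem inner_delta (x : ℤ) (i : Fin 2) (w : L2) : inner ℂ (delta x i) w = w x i := by
  rw [delta, lp.inner_single_left, EuclideanSpace.inner_single_left]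
  simp

/-- The position of a component in the Jacobi ordering. -/
def rank (x : ℤ) (i : Fin 2) : ℤ := 2 * x - (i : ℕ)

/-- Entries of the Green function built from two solutions. -/
def greenEntry (p q : ℤ → Spinor) (W : ℂ) (y : ℤ) (j : Fin 2) (x : ℤ) (i : Fin 2) : ℂ :=
  -W⁻¹ * if rank y j ≤ rank x i then p x i * q y j else q x i * p y j

/-- Columns of the Green function. -/
def green (p q : ℤ → Spinor) (W : ℂ) (y : ℤ) (j : Fin 2) (x : ℤ) : Spinor :=
  !₂[greenEntry p q W y j x 0, greenEntry p q W y j x 1]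

theorem green_apply (p q : ℤ → Spinor) (W : ℂ) (y : ℤ) (j : Fin 2) (x : ℤ) (i : Fin 2) :
    green p q W y j x i = greenEntry p q W y j x i := by
  fin_cases i <;> rfl

theorem eq_of_rank_eq {x y : ℤ} {i j : Fin 2} (h : rank x i = rank y j) : x = y ∧ i = j := by
  unfold rank at h
  fin_cases i <;> fin_cases j <;> simp at h ⊢ <;> omega

theorem greenEntry_symm (p q : ℤ → Spinor) (W : ℂ) (y : ℤ) (j : Fin 2) (x : ℤ) (i : Fin 2) :
    greenEntry p q W x i y j = greenEntry p q W y j x i := by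
  unfold greenEntry
  rcases lt_trichotomy (rank y j) (rank x i) with h | h | h
  · rw [if_neg h.not_ge, if_pos h.le, mul_comm (q y j)]
  · obtain ⟨rfl, rfl⟩ := eq_of_rank_eq h
    rfl
  · rw [if_pos h.le, if_neg h.not_ge, mul_comm (p y j)]

/-- Interleaving the two components makes the operator tridiagonal, so the Green function is built
from p after the source and q before it. Off the source each row is the equation for p or for q; at
the source the jump is the Wronskian divided by W. -/
theorem diracSeq_green {p q : ℤ → Spinor} {z W : ℂ} (hs : ∀ n, Q n 0 1 = Q n 1 0)
    (hp : ∀ n, diracSeq m Q p n = z • p n) (hq : ∀ n, diracSeq m Q q n = z • q n)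
    (hW : ∀ n, q (n - 1) 0 * p n 1 - q n 1 * p (n - 1) 0 = W) (hW0 : W ≠ 0) (y : ℤ) (j : Fin 2)
    (n : ℤ) (i : Fin 2) : diracSeq m Q (green p q W y j) n i - z * green p q W y j n i
      = if n = y ∧ i = j then 1 else 0 := by
  have p0 : diracSeq m Q p n 0 = z * p n 0 := by rw [hp n]; rfl
  have p1 : diracSeq m Q p n 1 = z * p n 1 := by rw [hp n]; rfl
  have q0 : diracSeq m Q q n 0 = z * q n 0 := by rw [hq n]; rfl
  have q1 : diracSeq m Q q n 1 = z * q n 1 := by rw [hq n]; rfl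
  have hWn := hW n
  rw [diracSeq_zero] at p0 q0
  rw [diracSeq_one] at p1 q1
  have hQn : (Q n 0 1 : ℂ) = Q n 1 0 := by rw [hs]
  have hinv : W⁻¹ * W = 1 := inv_mul_cancel₀ hW0
  fin_cases i
  · simp only [Fin.zero_eta, diracSeq_zero, green_apply, greenEntry]
    have r0 : rank n 0 = 2 * n := by simp [rank]
    have r1 : rank n 1 = 2 * n - 1 := by simp [rank]
    have r2 : rank (n + 1) 1 = 2 * n + 1 := by simp [rank]; ring
    rw [r0, r1, r2]
    rcases lt_trichotomy (rank y j) (2 * n) with h | h | h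
    · rw [if_pos (show rank y j ≤ 2 * n by omega), if_pos (show rank y j ≤ 2 * n - 1 by omega),
        if_pos (show rank y j ≤ 2 * n + 1 by omega), if_neg]
      · linear_combination (-W⁻¹ * q y j) * p0
      · rintro ⟨h1, h2⟩
        rw [← h1, ← h2, r0] at h
        omega
    · rw [if_pos (show rank y j ≤ 2 * n by omega), if_neg (show ¬ rank y j ≤ 2 * n - 1 by omega),
        if_pos (show rank y j ≤ 2 * n + 1 by omega)]
      obtain ⟨rfl, rfl⟩ := eq_of_rank_eq (h.trans r0.symm)
      rw [if_pos ⟨rfl, rfl⟩]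
      -- The Wronskian W is taken between the sites n − 1 and n, while the jump involves components
      -- at the same site; the second component equations of p and q convert one into the other.
      linear_combination (-W⁻¹ * q y 0) * p0 + W⁻¹ * q y 1 * p1 * (-1) + W⁻¹ * p y 1 * q1
        + hinv + W⁻¹ * hWn + W⁻¹ * (p y 1 * q y 0 - q y 1 * p y 0) * hQn
    · rcases eq_or_lt_of_le (show 2 * n + 1 ≤ rank y j by omega) with h' | h'
      · rw [if_neg (show ¬ rank y j ≤ 2 * n by omega), if_neg (show ¬ rank y j ≤ 2 * n - 1 by omega),
          if_pos (show rank y j ≤ 2 * n + 1 by omega), if_neg]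
        · obtain ⟨rfl, rfl⟩ := eq_of_rank_eq (h'.symm.trans r2.symm)
          linear_combination (-W⁻¹ * p (n + 1) 1) * q0
        · rintro ⟨h1, h2⟩
          rw [← h1, ← h2, r0] at h
          omega
      · rw [if_neg (show ¬ rank y j ≤ 2 * n by omega), if_neg (show ¬ rank y j ≤ 2 * n - 1 by omega),
          if_neg (show ¬ rank y j ≤ 2 * n + 1 by omega), if_neg]
        · linear_combination (-W⁻¹ * p y j) * q0
        · rintro ⟨h1, h2⟩
          rw [← h1, ← h2, r0] at h
          omega
  · simp only [Fin.mk_one, diracSeq_one, green_apply, greenEntry]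
    have r0 : rank n 0 = 2 * n := by simp [rank]
    have r1 : rank n 1 = 2 * n - 1 := by simp [rank]
    have r2 : rank (n - 1) 0 = 2 * n - 2 := by simp [rank]; ring
    rw [r0, r1, r2]
    rcases lt_trichotomy (rank y j) (2 * n - 1) with h | h | h
    · rw [if_pos (show rank y j ≤ 2 * n by omega), if_pos (show rank y j ≤ 2 * n - 1 by omega),
        if_pos (show rank y j ≤ 2 * n - 2 by omega), if_neg]
      · linear_combination (-W⁻¹ * q y j) * p1
      · rintro ⟨h1, h2⟩
        rw [← h1, ← h2, r1] at h
        omega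
    · rw [if_pos (show rank y j ≤ 2 * n by omega), if_pos (show rank y j ≤ 2 * n - 1 by omega),
        if_neg (show ¬ rank y j ≤ 2 * n - 2 by omega)]
      obtain ⟨rfl, rfl⟩ := eq_of_rank_eq (h.trans r1.symm)
      rw [if_pos ⟨rfl, rfl⟩]
      linear_combination (-W⁻¹ * q y 1) * p1 + hinv + W⁻¹ * hWn
    · rcases eq_or_lt_of_le (show 2 * n ≤ rank y j by omega) with h' | h'
      · rw [if_pos (show rank y j ≤ 2 * n by omega), if_neg (show ¬ rank y j ≤ 2 * n - 1 by omega),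
          if_neg (show ¬ rank y j ≤ 2 * n - 2 by omega), if_neg]
        · obtain ⟨rfl, rfl⟩ := eq_of_rank_eq (h'.symm.trans r0.symm)
          linear_combination (-W⁻¹ * p y 0) * q1
        · rintro ⟨h1, h2⟩
          rw [← h1, ← h2, r1] at h
          omega
      · rw [if_neg (show ¬ rank y j ≤ 2 * n by omega), if_neg (show ¬ rank y j ≤ 2 * n - 1 by omega),
          if_neg (show ¬ rank y j ≤ 2 * n - 2 by omega), if_neg]
        · linear_combination (-W⁻¹ * p y j) * q1
        · rintro ⟨h1, h2⟩
          rw [← h1, ← h2, r1] at h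
          omega

/-- Sequences with geometrically small tails are square summable. -/
theorem memℓp_of_tails {f : ℤ → Spinor} {C ρ : ℝ} (N : ℕ) (hρ : 0 ≤ ρ) (hρ1 : ρ < 1)
    (h1 : ∀ n : ℕ, N ≤ n → ‖f n‖ ≤ C * ρ ^ n) (h2 : ∀ n : ℕ, N ≤ n → ‖f (-n)‖ ≤ C * ρ ^ n) :
    Memℓp f 2 := by
  have key : ∀ g : ℕ → Spinor, (∀ n : ℕ, N ≤ n → ‖g n‖ ≤ C * ρ ^ n) →
      Summable fun n => ‖g n‖ ^ 2 := by
    intro g hg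
    refine (summable_nat_add_iff N).1 (Summable.of_nonneg_of_le (fun n => by positivity)
      (fun n => ?_) (((summable_geometric_of_lt_one (sq_nonneg ρ)
        (by nlinarith : ρ ^ 2 < 1)).mul_left (C ^ 2)).comp_injective (add_left_injective N)))
    refine (pow_le_pow_left₀ (norm_nonneg _) (hg (n + N) (by omega)) 2).trans (le_of_eq ?_)
    simp only [Function.comp_apply]
    rw [mul_pow, ← pow_mul, ← pow_mul, mul_comm 2]
  refine memℓp_gen ?_
  simp only [ENNReal.toReal_ofNat, Real.rpow_ofNat]
  exact Summable.of_nat_of_neg (key _ h1) (key (fun n => f (-n)) h2)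

theorem Admissible.exists_norm_spin_le (h : Admissible m Q 0) {z ζ : ℂ} (hc : OnCurve m z ζ)
    (hζ : ‖ζ‖ ≤ 1) : ∃ K, 0 ≤ K ∧ (∀ n : ℕ, ‖spin (jostSol m Q true z ζ) n‖ ≤ K * ‖ζ‖ ^ n) ∧
      ∀ n : ℕ, ‖spin (jostSol m Q false z ζ) (-n)‖ ≤ K * ‖ζ‖ ^ n := by
  obtain ⟨K, hK⟩ := h.exists_norm_jost_le hc hζ true
  obtain ⟨K', hK'⟩ := h.exists_norm_jost_le hc hζ false
  have h0 : 0 < ‖ζ‖ := norm_pos_iff.2 hc.ne_zero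
  have hK0 : 0 ≤ K := (norm_nonneg _).trans (hK 0 le_rfl 0)
  have hK0' : 0 ≤ K' := (norm_nonneg _).trans (hK' 0 le_rfl 0)
  refine ⟨2 * K + (K' + K' * ‖ζ‖⁻¹), by positivity, fun n => ?_, fun n => ?_⟩
  · refine (spinor_norm_le _).trans ?_
    rw [spin_zero, spin_one, jostSol_true, jostSol_true, norm_mul, norm_mul, norm_zpow, norm_zpow,
      zpow_natCast, zpow_add_one₀ h0.ne', zpow_natCast]
    have a := hK (n + 1) (by positivity) 0
    have b := hK n (by positivity) 1
    have c : 0 ≤ ‖ζ‖ ^ n := by positivity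
    have d : ‖ζ‖ ^ n * ‖ζ‖ ≤ ‖ζ‖ ^ n := mul_le_of_le_one_right c hζ
    have e := mul_le_mul d a (norm_nonneg _) c
    have f := mul_le_mul_of_nonneg_left b c
    have g : 0 ≤ (K' + K' * ‖ζ‖⁻¹) * ‖ζ‖ ^ n := by positivity
    linarith
  · refine (spinor_norm_le _).trans ?_
    rw [spin_zero, spin_one, jostSol_false, jostSol_false, norm_mul, norm_mul, norm_zpow,
      norm_zpow, neg_add, neg_neg, zpow_add₀ h0.ne', zpow_natCast, zpow_neg_one]
    have a := hK' (1 - (-n + 1)) (by omega) 0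
    have b := hK' (1 - -n) (by omega) 1
    have c : 0 ≤ ‖ζ‖ ^ n := by positivity
    have e := mul_le_mul_of_nonneg_left a (by positivity : 0 ≤ ‖ζ‖ ^ n * ‖ζ‖⁻¹)
    have f := mul_le_mul_of_nonneg_left b c
    have g : 0 ≤ 2 * K * ‖ζ‖ ^ n := by positivity
    linarith

/-- Away from the real axis the dispersion relation has a root inside the unit disc. -/
theorem norm_ne_one_of_onCurve {z ζ : ℂ} (hc : OnCurve m z ζ) (hz : z.im ≠ 0) : ‖ζ‖ ≠ 1 := by
  intro h1
  have h2 := hc.add_inv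
  rw [Complex.inv_eq_conj h1, Complex.add_conj] at h2
  have hre := congrArg Complex.re h2
  have him := congrArg Complex.im h2
  simp [pow_two] at hre him
  have h3 : z.re = 0 := by
    rcases mul_eq_zero.1 (by linarith : z.re * z.im = 0) with h | h
    · exact h
    · exact absurd h hz
  have h4 : ζ.re ≤ 1 := (Complex.re_le_norm ζ).trans h1.le
  rw [h3] at hre
  nlinarith [mul_self_pos.2 hz, sq_nonneg m]

/-- The two roots are inverse to each other, and for nonreal z neither has modulus one. -/
theorem exists_onCurve_norm_lt_one (m : ℝ) {z : ℂ} (hz : z.im ≠ 0) :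
    ∃ ζ, OnCurve m z ζ ∧ ‖ζ‖ < 1 := by
  obtain ⟨d, hd⟩ := IsAlgClosed.exists_eq_mul_self (discrim 1 (-(2 + (m : ℂ) ^ 2 - z ^ 2)) 1)
  obtain ⟨ζ, hζ⟩ := exists_quadratic_eq_zero (one_ne_zero) ⟨d, hd⟩
  have hc : OnCurve m z ζ := by
    unfold OnCurve
    linear_combination hζ
  rcases lt_or_gt_of_ne (norm_ne_one_of_onCurve hc hz) with h | h
  · exact ⟨ζ, hc, h⟩
  · exact ⟨ζ⁻¹, hc.inv, by rw [norm_inv]; exact inv_lt_one_of_one_lt₀ h⟩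

/-- The sign of the imaginary part of the root inside the disc. -/
theorem OnCurve.im_mul_pos {z ζ : ℂ} (hc : OnCurve m z ζ) (hζ : ‖ζ‖ < 1)
    (hz : z.re * z.im ≠ 0) : 0 < ζ.im * (z.re * z.im) := by
  have h1 := congrArg Complex.im hc.add_inv
  simp only [Complex.add_im, Complex.inv_im, Complex.sub_im, pow_two, Complex.mul_im,
    Complex.ofReal_im, Complex.ofReal_re, Complex.im_ofNat] at h1
  have h0 : 0 < Complex.normSq ζ := Complex.normSq_pos.2 hc.ne_zero
  have h2 : Complex.normSq ζ < 1 := by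
    rw [Complex.normSq_eq_norm_sq]
    nlinarith [norm_nonneg ζ]
  have h3 : ζ.im * (1 - Complex.normSq ζ) = 2 * (z.re * z.im) * Complex.normSq ζ := by
    field_simp at h1
    nlinarith
  have h4 : ζ.im * (z.re * z.im) * (1 - Complex.normSq ζ)
      = 2 * (z.re * z.im) ^ 2 * Complex.normSq ζ := by
    calc _ = ζ.im * (1 - Complex.normSq ζ) * (z.re * z.im) := by ring
      _ = _ := by rw [h3]; ring
  have h5 : 0 < 2 * (z.re * z.im) ^ 2 * Complex.normSq ζ := by positivity
  rw [← h4] at h5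
  exact pos_of_mul_pos_left h5 (by linarith)

end DiscreteDirac
end

/-! ### Limiting absorption -/

noncomputable section

namespace DiscreteDirac

open Set Filter Topology
open scoped ContDiff Matrix

attribute [local instance] Matrix.linftyOpNormedRing Matrix.linftyOpNormedAlgebra

variable {m : ℝ} {Q : ℤ → Matrix (Fin 2) (Fin 2) ℝ} {r : ℕ}

theorem Admissible.continuousOn_jostSol (h : Admissible m Q 0) {R : ℝ} (hR : 1 ≤ R) (b : Bool)
    (n : ℤ) (i : Fin 2) :
    ContinuousOn (fun p : ℂ × ℂ => jostSol m Q b p.1 p.2 n i) (curveSet m R) := by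
  have h1 : ∀ n : ℤ, ContinuousOn (fun p : ℂ × ℂ => p.2 ^ n) (curveSet m R) := fun n =>
    continuousOn_snd.zpow₀ n fun p hp => Or.inl hp.1.ne_zero
  have h2 : ∀ n : ℤ, ContinuousOn (fun p : ℂ × ℂ => jost m Q b n p.1 p.2 i 0) (curveSet m R) :=
    fun n => (entryCLM i 0).continuous.comp_continuousOn (h.continuousOn_jost hR b n)
  cases b
  · exact (h1 (-n)).mul (h2 (1 - n))
  · exact (h1 n).mul (h2 n)

/-- The Wronskian of the two Jost solutions. -/
def curveW (m : ℝ) (Q : ℤ → Matrix (Fin 2) (Fin 2) ℝ) (z ζ : ℂ) : ℂ :=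
  wr (jostSol m Q false z ζ) (jostSol m Q true z ζ) 0

/-- The Green function on the dispersion curve. -/
def curveGreen (m : ℝ) (Q : ℤ → Matrix (Fin 2) (Fin 2) ℝ) (z ζ : ℂ) :
    ℤ → Fin 2 → ℤ → Fin 2 → ℂ :=
  greenEntry (spin (jostSol m Q true z ζ)) (spin (jostSol m Q false z ζ)) (curveW m Q z ζ)

theorem spin_apply (S : ℤ → Fin 2 → ℂ) (n : ℤ) (i : Fin 2) : spin S n i = S (n + 1 - (i : ℕ)) i := by
  fin_cases i
  · simp [spin_zero]
  · simp [spin_one]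

theorem Admissible.continuousOn_curveW (h : Admissible m Q 0) {R : ℝ} (hR : 1 ≤ R) :
    ContinuousOn (fun p : ℂ × ℂ => curveW m Q p.1 p.2) (curveSet m R) :=
  ((h.continuousOn_jostSol hR false 0 0).mul (h.continuousOn_jostSol hR true 0 1)).sub
    ((h.continuousOn_jostSol hR false 0 1).mul (h.continuousOn_jostSol hR true 0 0))

theorem Admissible.continuousOn_curveGreen (h : Admissible m Q 0) {R : ℝ} (hR : 1 ≤ R)
    {Ω : Set (ℂ × ℂ)} (hΩ : Ω ⊆ curveSet m R) (hW : ∀ p ∈ Ω, curveW m Q p.1 p.2 ≠ 0)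
    (y : ℤ) (j : Fin 2) (x : ℤ) (i : Fin 2) :
    ContinuousOn (fun p : ℂ × ℂ => curveGreen m Q p.1 p.2 y j x i) Ω := by
  have h1 := fun b n i => (h.continuousOn_jostSol hR b n i).mono hΩ
  have h2 := (((h.continuousOn_curveW hR).mono hΩ).inv₀ hW).neg
  unfold curveGreen greenEntry
  simp only [spin_apply]
  split_ifs
  · exact h2.mul ((h1 _ _ _).mul (h1 _ _ _))
  · exact h2.mul ((h1 _ _ _).mul (h1 _ _ _))

/-- If both components vanished, their imaginary parts would give Im ξ = Im z and Im z (|ξ|² + 1) =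
0. -/
theorem exists_jostVec_ne_zero {z ξ : ℂ} (hξ : ξ ≠ 0) (hz : z.im ≠ 0) :
    ∃ i, jostVec m z ξ i 0 ≠ 0 := by
  by_contra hcon
  push Not at hcon
  have h0 : z + m + 1 - ξ⁻¹ = 0 := hcon 0
  have h1 : ξ - 1 + m - z = 0 := hcon 1
  have e0 := congrArg Complex.im h0
  have e1 := congrArg Complex.im h1
  have hN : 0 < Complex.normSq ξ := Complex.normSq_pos.2 hξ
  simp only [Complex.add_im, Complex.sub_im, Complex.inv_im, Complex.ofReal_im, Complex.one_im,
    Complex.zero_im] at e0 e1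
  have e2 : z.im * (Complex.normSq ξ + 1) = 0 := by
    have e3 : ξ.im = z.im := by linarith
    rw [e3] at e0
    field_simp at e0
    linarith
  rcases mul_eq_zero.1 e2 with h | h
  · exact hz h
  · linarith

/-- Otherwise the Jost solutions are proportional and decay at both ends, producing an eigenvector
of a self-adjoint operator with a nonreal eigenvalue. -/
theorem Admissible.curveW_ne_zero (h : Admissible m Q 0) (hQ : BoundedPotential Q) {z ζ : ℂ}
    (hc : OnCurve m z ζ) (hζ : ‖ζ‖ ≤ 1) (hz : z.im ≠ 0) : curveW m Q z ζ ≠ 0 := by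
  have hζ1 : ‖ζ‖ < 1 := lt_of_le_of_ne hζ (norm_ne_one_of_onCurve hc hz)
  intro hW
  obtain ⟨i₁, hi₁⟩ := exists_jostVec_ne_zero (m := m) (inv_ne_zero hc.ne_zero) hz
  obtain ⟨i₂, hi₂⟩ := exists_jostVec_ne_zero (m := m) hc.ne_zero hz
  obtain ⟨n₁, hn₁⟩ := h.exists_jostSol_ne_zero hc hζ false (i := i₁) hi₁
  obtain ⟨n₂, hn₂⟩ := h.exists_jostSol_ne_zero hc hζ true (i := i₂) hi₂
  have hF := h.isSol_jostSol hc hζ false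
  have hT := h.isSol_jostSol hc hζ true
  obtain ⟨c, hcs⟩ := hT.exists_eq_smul h.ne hF (n₀ := n₁) (by
    have h1 := hF.wr_const h.ne hT n₁ 0
    rw [show wr (jostSol m Q false z ζ) (jostSol m Q true z ζ) 0 = 0 from hW] at h1
    simp only [wr] at h1 ⊢
    linear_combination -h1) hn₁
  obtain ⟨K, hK, hr, hl⟩ := h.exists_norm_spin_le hc hζ
  have hsp : ∀ n, spin (jostSol m Q true z ζ) n = c • spin (jostSol m Q false z ζ) n := fun n => by
    ext i
    rw [PiLp.smul_apply, spin_apply, spin_apply, hcs]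
    rfl
  have hmem : Memℓp (spin (jostSol m Q true z ζ)) 2 := by
    refine memℓp_of_tails (C := (1 + ‖c‖) * K) 0 (norm_nonneg ζ) hζ1 (fun n _ => ?_) fun n _ => ?_
    · refine (hr n).trans (mul_le_mul_of_nonneg_right ?_ (by positivity))
      nlinarith [norm_nonneg c]
    · rw [hsp, norm_smul, add_mul, add_mul, mul_assoc, mul_assoc]
      have := mul_le_mul_of_nonneg_left (hl n) (norm_nonneg c)
      have : 0 ≤ 1 * (K * ‖ζ‖ ^ n) := by positivity
      linarith
  set w : L2 := ⟨_, hmem⟩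
  have hw0 : w ≠ 0 := by
    intro h0
    have h1 : ∀ n, spin (jostSol m Q true z ζ) n = 0 := fun n => by
      change w n = 0
      rw [h0]; rfl
    apply hn₂
    ext i
    have h2 := spin_apply (jostSol m Q true z ζ) (n₂ - 1 + (i : ℕ)) i
    rw [h1] at h2
    have h3 : n₂ - 1 + ((i : ℕ) : ℤ) + 1 - ((i : ℕ) : ℤ) = n₂ := by ring
    rw [h3] at h2
    exact h2.symm
  have hev : dirac m Q hQ w = z • w := lp.ext (funext fun n => h.diracSeq_spin hT n)
  have hsym := (ContinuousLinearMap.isSelfAdjoint_iff_isSymmetric.1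
    (isSelfAdjoint_dirac (m := m) h.symm hQ))
  have hreal := hsym.conj_eigenvalue_eq_self (μ := z)
    (Module.End.hasEigenvalue_of_hasEigenvector
      (Module.End.hasEigenvector_iff.2 ⟨Module.End.mem_eigenspace_iff.2 hev, hw0⟩))
  exact hz (Complex.conj_eq_iff_im.1 hreal)

/-- At a band point the dispersion relation has the two roots e^{iθ} and e^{-iθ}; the product of the
distances of ζ to them measures the distance of z² from the squared band value. -/
theorem OnCurve.factor (hm : 0 < m) {z ζ : ℂ} (hc : OnCurve m z ζ) {s : ℝ} (hs : s ^ 2 = 1)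
    (θ : ℝ) : (ζ - circ θ) * (ζ - circ (-θ)) = (band m s θ ^ 2 - z ^ 2) * ζ := by
  have h1 := (onCurve_band hm hs θ).add_inv
  have h2 : circ θ * (circ θ)⁻¹ = 1 := mul_inv_cancel₀ (circ_ne_zero θ)
  rw [circ_neg]
  unfold OnCurve at hc
  linear_combination hc - ζ * h1 + h2

theorem Admissible.curveW_ne_zero_of_real (h : Admissible m Q 0) {l : ℝ} (hl : 0 < bandPoly m l)
    {ζ : ℂ} (hc : OnCurve m l ζ) : curveW m Q l ζ ≠ 0 := by
  obtain ⟨s, θ, hs, -, hθ, hlθ⟩ := exists_band_of_bandPoly_pos hl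
  have h1 := hc.factor h.pos hs θ
  have hb : (l : ℂ) = band m s θ := by rw [hlθ]; rfl
  have hsin := (Real.sin_pos_of_mem_Ioo hθ).ne'
  rw [hb, sub_self, zero_mul] at h1
  rw [hb]
  rcases mul_eq_zero.1 h1 with h2 | h2
  · rw [sub_eq_zero.1 h2]
    exact h.wrW_ne_zero hs hsin
  · rw [sub_eq_zero.1 h2, ← band_neg]
    exact h.wrW_ne_zero hs (by rwa [Real.sin_neg, neg_ne_zero])

/-- A compact neighbourhood, in the upper half plane, of a compact part of the bands. -/
def bandNhd (m : ℝ) (k : ℕ) : Set (ℂ × ℂ) :=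
  curveSet m (m + 3) ∩ {p | 1 ≤ k * bandPoly m p.1.re ∧ 0 ≤ p.1.im ∧ p.1.im ≤ 1}

theorem isCompact_bandNhd (m : ℝ) (k : ℕ) : IsCompact (bandNhd m k) := by
  refine (isCompact_curveSet m _).inter_right ?_
  have h1 : Continuous fun p : ℂ × ℂ => (k : ℝ) * bandPoly m p.1.re :=
    continuous_const.mul ((continuous_bandPoly m).comp (Complex.continuous_re.comp continuous_fst))
  have h2 : Continuous fun p : ℂ × ℂ => p.1.im := Complex.continuous_im.comp continuous_fst
  exact (isClosed_le continuous_const h1).inter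
    ((isClosed_le continuous_const h2).inter (isClosed_le h2 continuous_const))

theorem Admissible.curveW_ne_zero_of_mem (h : Admissible m Q 0) (hQ : BoundedPotential Q) {k : ℕ}
    {p : ℂ × ℂ} (hp : p ∈ bandNhd m k) : curveW m Q p.1 p.2 ≠ 0 := by
  obtain ⟨⟨hc, -, hζ⟩, hb, hi, -⟩ := hp
  rcases eq_or_ne p.1.im 0 with h0 | h0
  · have hr : p.1 = (p.1.re : ℂ) := by
      apply Complex.ext
      · simp
      · simpa using h0
    have hpos : 0 < bandPoly m p.1.re := by
      by_contra hcon
      have : (k : ℝ) * bandPoly m p.1.re ≤ 0 :=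
        mul_nonpos_of_nonneg_of_nonpos (Nat.cast_nonneg k) (not_lt.1 hcon)
      linarith
    rw [hr] at hc ⊢
    exact h.curveW_ne_zero_of_real hpos hc
  · exact h.curveW_ne_zero hQ hc hζ h0

/-- The root of the dispersion relation inside the unit disc. -/
def diskRoot (m : ℝ) (z : ℂ) : ℂ :=
  if h : z.im ≠ 0 then (exists_onCurve_norm_lt_one m h).choose else 0

theorem diskRoot_spec (m : ℝ) {z : ℂ} (hz : z.im ≠ 0) :
    OnCurve m z (diskRoot m z) ∧ ‖diskRoot m z‖ < 1 := by
  rw [diskRoot, dif_pos hz]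
  exact (exists_onCurve_norm_lt_one m hz).choose_spec

theorem circ_im (θ : ℝ) : (circ θ).im = Real.sin θ := by
  rw [circ_eq, Complex.add_im, Complex.ofReal_im, Complex.mul_I_im, Complex.ofReal_re, zero_add]

/-- The sign of the imaginary part of the root inside the disc depends on the band and keeps it at
distance at least sin θ from the wrong boundary root. The factorization then forces convergence to
the other one, hence e^{iθ} above and e^{-iθ} on the lower band. -/
theorem tendsto_diskRoot (hm : 0 < m) {s θ : ℝ} (hs : s ^ 2 = 1) (hθ : θ ∈ Ioo 0 Real.pi) :
    Tendsto (fun ε : ℝ => diskRoot m (band m s θ + ε * Complex.I)) (𝓝[>] 0) (𝓝 (circ (s * θ))) := by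
  have hsin := Real.sin_pos_of_mem_Ioo hθ
  have hω := omega_pos hm θ
  have habs : |s| = 1 := by rcases sq_eq_one_iff.1 hs with rfl | rfl <;> simp
  have hsinS : Real.sin (s * θ) = s * Real.sin θ := by
    rcases sq_eq_one_iff.1 hs with rfl | rfl <;> simp
  have hband : band m s (s * θ) = band m s θ := by
    rcases sq_eq_one_iff.1 hs with rfl | rfl
    · rw [one_mul]
    · rw [neg_one_mul, band_neg]
  rw [tendsto_iff_norm_sub_tendsto_zero]
  have hlim : Tendsto (fun ε : ℝ =>
      ‖(band m s θ) ^ 2 - (band m s θ + ε * Complex.I) ^ 2‖ / Real.sin θ) (𝓝[>] 0) (𝓝 0) := by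
    have hcont : Continuous fun ε : ℝ =>
      ‖(band m s θ) ^ 2 - (band m s θ + ε * Complex.I) ^ 2‖ / Real.sin θ := by fun_prop
    have := hcont.tendsto 0
    simp only [Complex.ofReal_zero, zero_mul, add_zero, sub_self, norm_zero, zero_div] at this
    exact this.mono_left nhdsWithin_le_nhds
  refine squeeze_zero' (Eventually.of_forall fun _ => norm_nonneg _) ?_ hlim
  filter_upwards [self_mem_nhdsWithin] with ε hε
  have hε' : 0 < ε := hε
  set z : ℂ := band m s θ + ε * Complex.I with hz
  have hzi : z.im = ε := by simp [hz, band]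
  have hzr : z.re = s * omega m θ := by simp [hz, band]
  obtain ⟨hc, hlt⟩ := diskRoot_spec m (z := z) (by rw [hzi]; exact hε'.ne')
  set ζ := diskRoot m z
  have hs0 : s ≠ 0 := by rintro rfl; norm_num at hs
  have hi := hc.im_mul_pos hlt (by rw [hzi, hzr]; positivity)
  rw [hzi, hzr] at hi
  have hsim : 0 < s * ζ.im := by
    have h1 : ζ.im * (s * omega m θ * ε) = (s * ζ.im) * (omega m θ * ε) := by ring
    rw [h1] at hi
    exact pos_of_mul_pos_left hi (by positivity)
  have hfac := hc.factor hm hs (s * θ)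
  rw [hband] at hfac
  have h2 : Real.sin θ ≤ ‖ζ - circ (-(s * θ))‖ := by
    have h3 : (ζ - circ (-(s * θ))).im = ζ.im + s * Real.sin θ := by
      rw [Complex.sub_im, circ_im, Real.sin_neg, hsinS, sub_neg_eq_add]
    have h4 : s * (ζ - circ (-(s * θ))).im ≤ ‖ζ - circ (-(s * θ))‖ := by
      refine (le_abs_self _).trans ?_
      rw [abs_mul, habs, one_mul]
      exact Complex.abs_im_le_norm _
    rw [h3] at h4
    nlinarith
  rw [le_div_iff₀ hsin]
  calc ‖ζ - circ (s * θ)‖ * Real.sin θ ≤ ‖ζ - circ (s * θ)‖ * ‖ζ - circ (-(s * θ))‖ :=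
        mul_le_mul_of_nonneg_left h2 (norm_nonneg _)
    _ = ‖band m s θ ^ 2 - z ^ 2‖ * ‖ζ‖ := by rw [← norm_mul, hfac, norm_mul]
    _ ≤ _ := mul_le_of_le_one_right (norm_nonneg _) hlt.le

theorem mem_bandNhd (hm : 0 < m) {k : ℕ} {l ε : ℝ} (hl : 1 ≤ k * bandPoly m l) (h0 : 0 ≤ ε)
    (h1 : ε ≤ 1) {ζ : ℂ} (hc : OnCurve m (l + ε * Complex.I) ζ) (hζ : ‖ζ‖ ≤ 1) :
    ((l + ε * Complex.I : ℂ), ζ) ∈ bandNhd m k := by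
  have hre : ((l : ℂ) + ε * Complex.I).re = l := by simp
  have him : ((l : ℂ) + ε * Complex.I).im = ε := by simp
  refine ⟨⟨hc, ?_, hζ⟩, ?_⟩
  · have hl2 : |l| ≤ m + 2 := by
      refine abs_le_of_sq_le_sq (by
        by_contra hcon
        push Not at hcon
        have : bandPoly m l ≤ 0 := by
          unfold bandPoly
          exact mul_nonpos_of_nonneg_of_nonpos (by nlinarith) (by nlinarith)
        have := mul_nonpos_of_nonneg_of_nonpos (Nat.cast_nonneg (α := ℝ) k) this
        linarith) (by linarith)
    change ‖(l : ℂ) + ε * Complex.I‖ ≤ m + 3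
    refine (norm_add_le _ _).trans ?_
    rw [norm_mul, Complex.norm_I, Complex.norm_real, Complex.norm_real, Real.norm_eq_abs,
      Real.norm_eq_abs, abs_of_nonneg h0]
    linarith
  · change 1 ≤ k * bandPoly m ((l : ℂ) + ε * Complex.I).re
      ∧ 0 ≤ ((l : ℂ) + ε * Complex.I).im ∧ ((l : ℂ) + ε * Complex.I).im ≤ 1
    rw [hre, him]
    exact ⟨hl, h0, h1⟩

theorem bandPoly_band (hm : 0 < m) {s : ℝ} (hs : s ^ 2 = 1) (θ : ℝ) :
    bandPoly m (s * omega m θ) = 4 * Real.sin θ ^ 2 := by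
  have h1 : (s * omega m θ) ^ 2 = m ^ 2 + 2 - 2 * Real.cos θ := by
    rw [mul_pow, hs, one_mul, omega_sq hm]
  rw [bandPoly, h1, Real.sin_sq]
  ring

theorem Admissible.memℓp_green (h : Admissible m Q 0) {z ζ : ℂ} (hc : OnCurve m z ζ)
    (hlt : ‖ζ‖ < 1) (y : ℤ) (j : Fin 2) :
    Memℓp (green (spin (jostSol m Q true z ζ)) (spin (jostSol m Q false z ζ))
      (curveW m Q z ζ) y j) 2 := by
  obtain ⟨K, hK, hr, hl⟩ := h.exists_norm_spin_le hc hlt.le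
  set p := spin (jostSol m Q true z ζ)
  set q := spin (jostSol m Q false z ζ)
  set W := curveW m Q z ζ
  set B := ‖W⁻¹‖ * (K * (‖q y j‖ + ‖p y j‖))
  have hB : ∀ (n : ℕ) (v : Spinor) (i : Fin 2) (a : ℂ), ‖v‖ ≤ K * ‖ζ‖ ^ n →
      ‖a‖ ≤ ‖q y j‖ + ‖p y j‖ → ‖-W⁻¹ * (v i * a)‖ ≤ B * ‖ζ‖ ^ n := by
    intro n v i a hv ha
    rw [norm_mul, norm_neg, norm_mul, mul_assoc]
    refine mul_le_mul_of_nonneg_left ?_ (norm_nonneg _)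
    calc ‖v i‖ * ‖a‖ ≤ (K * ‖ζ‖ ^ n) * (‖q y j‖ + ‖p y j‖) :=
          mul_le_mul ((PiLp.norm_apply_le v i).trans hv) ha (norm_nonneg _) (by positivity)
      _ = _ := by ring
  -- Beyond this threshold the sites n and −n lie on opposite sides of the source, so the column is
  -- a multiple of the solution decaying in that direction.
  refine memℓp_of_tails (C := 2 * B) (2 * y.natAbs + 2) (norm_nonneg ζ) hlt (fun n hn => ?_)
    fun n hn => ?_
  · have : ∀ i, ‖green p q W y j n i‖ ≤ B * ‖ζ‖ ^ n := fun i => by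
      rw [green_apply, greenEntry, if_pos (by unfold rank; have := i.2; omega)]
      exact hB n _ i _ (hr n) (by linarith [norm_nonneg (p y j)])
    refine (spinor_norm_le _).trans ?_
    linarith [this 0, this 1]
  · have : ∀ i, ‖green p q W y j (-n) i‖ ≤ B * ‖ζ‖ ^ n := fun i => by
      rw [green_apply, greenEntry, if_neg (by unfold rank; have := j.2; omega)]
      exact hB n _ i _ (hl n) (by linarith [norm_nonneg (q y j)])
    refine (spinor_norm_le _).trans ?_
    linarith [this 0, this 1]

theorem Admissible.diracSeq_green_jostSol (h : Admissible m Q 0) (hQ : BoundedPotential Q)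
    {z ζ : ℂ} (hz : z.im ≠ 0) (hc : OnCurve m z ζ) (hlt : ‖ζ‖ ≤ 1) (y : ℤ) (j : Fin 2) (n : ℤ)
    (i : Fin 2) {g : ℤ → Spinor} (hg : g = green (spin (jostSol m Q true z ζ))
      (spin (jostSol m Q false z ζ)) (curveW m Q z ζ) y j) :
    diracSeq m Q g n i - z * g n i = if n = y ∧ i = j then 1 else 0 := by
  have hT := h.isSol_jostSol hc hlt true
  have hF := h.isSol_jostSol hc hlt false
  rw [hg]
  exact diracSeq_green (W := curveW m Q z ζ) h.symm
    (fun n => h.diracSeq_spin hT n) (fun n => h.diracSeq_spin hF n) (fun n => by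
      rw [spin_zero, spin_zero, spin_one, spin_one, sub_add_cancel]
      exact hF.wr_const h.ne hT n 0) (h.curveW_ne_zero hQ hc hlt hz) y j n i

/-- Limiting absorption: the columns of the resolvent are locally bounded up to the bands and have
boundary values given by the Jost solutions. -/
theorem Admissible.exists_resolvent (h : Admissible m Q 0) (hQ : BoundedPotential Q) (y : ℤ)
    (j : Fin 2) : ∃ G : ℂ → L2,
      (∀ z : ℂ, z.im ≠ 0 → dirac m Q hQ (G z) - z • G z = delta y j) ∧
      (∀ x i (k : ℕ), ∃ M, ∀ l : ℝ, 1 ≤ k * bandPoly m l → ∀ ε ∈ Ioo (0 : ℝ) 1,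
        ‖G (l + ε * Complex.I) x i‖ ≤ M) ∧
      ∀ x i (s θ : ℝ), s ^ 2 = 1 → θ ∈ Ioo 0 Real.pi →
        Tendsto (fun ε : ℝ => G (band m s θ + ε * Complex.I) x i) (𝓝[>] 0)
          (𝓝 (curveGreen m Q (band m s θ) (circ (s * θ)) y j x i)) := by
  have hex : ∀ z : ℂ, ∃ g : L2, z.im ≠ 0 → (g : ℤ → Spinor)
      = green (spin (jostSol m Q true z (diskRoot m z)))
        (spin (jostSol m Q false z (diskRoot m z))) (curveW m Q z (diskRoot m z)) y j := by
    intro z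
    by_cases hz : z.im = 0
    · exact ⟨0, fun h => absurd hz h⟩
    · obtain ⟨hc, hlt⟩ := diskRoot_spec m hz
      exact ⟨⟨_, h.memℓp_green hc hlt y j⟩, fun _ => rfl⟩
  choose G hG using hex
  have hGi : ∀ z, z.im ≠ 0 → ∀ x i, G z x i = curveGreen m Q z (diskRoot m z) y j x i := by
    intro z hz x i
    rw [hG z hz, green_apply]
    rfl
  have hmemN : ∀ (k : ℕ) (l ε : ℝ), 1 ≤ k * bandPoly m l → ε ∈ Ioo (0 : ℝ) 1 →
      ((l + ε * Complex.I : ℂ), diskRoot m (l + ε * Complex.I)) ∈ bandNhd m k := by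
    intro k l ε hl hε
    obtain ⟨hc, hlt⟩ := diskRoot_spec m (z := (l + ε * Complex.I : ℂ)) (by simpa using hε.1.ne')
    exact mem_bandNhd h.pos hl hε.1.le hε.2.le hc hlt.le
  have hcont := fun k x i => h.continuousOn_curveGreen (R := m + 3) (by linarith [h.pos])
    (Ω := bandNhd m k) inter_subset_left (fun p hp => h.curveW_ne_zero_of_mem hQ hp) y j x i
  refine ⟨G, fun z hz => ?_, fun x i k => ?_, fun x i s θ hs hθ => ?_⟩
  · obtain ⟨hc, hlt⟩ := diskRoot_spec m hz
    refine lp.ext (funext fun n => ?_)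
    ext i
    rw [delta_apply, ← h.diracSeq_green_jostSol hQ hz hc hlt.le y j n i (hG z hz)]
    rfl
  · obtain ⟨M, hM⟩ := (isCompact_bandNhd m k).exists_bound_of_continuousOn (hcont k x i)
    refine ⟨M, fun l hl ε hε => ?_⟩
    have h1 := hmemN k l ε hl hε
    have h2 : ((l : ℂ) + ε * Complex.I).im ≠ 0 := by simpa using hε.1.ne'
    generalize (l : ℂ) + ε * Complex.I = z at h1 h2 ⊢
    rw [hGi z h2]
    exact hM (z, diskRoot m z) h1
  · set l := s * omega m θ with hl
    have hbl : band m s θ = (l : ℂ) := rfl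
    have hsin := Real.sin_pos_of_mem_Ioo hθ
    have hpos : 0 < bandPoly m l := by rw [hl, bandPoly_band h.pos hs]; positivity
    -- Any interior point of a band belongs to the compact neighbourhood for k large.
    obtain ⟨k, hk⟩ := exists_nat_ge (1 / bandPoly m l)
    have hk1 : 1 ≤ k * bandPoly m l := by rwa [div_le_iff₀ hpos] at hk
    have hmem : ∀ᶠ ε : ℝ in 𝓝[>] 0, ((band m s θ + ε * Complex.I : ℂ),
        diskRoot m (band m s θ + ε * Complex.I)) ∈ bandNhd m k := by
      filter_upwards [Ioo_mem_nhdsGT one_pos] with ε hε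
      exact hmemN k l ε hk1 hε
    have h2 : Tendsto (fun ε : ℝ => ((band m s θ + ε * Complex.I : ℂ),
        diskRoot m (band m s θ + ε * Complex.I))) (𝓝[>] 0) (𝓝 (band m s θ, circ (s * θ))) := by
      refine Tendsto.prodMk_nhds ?_ (tendsto_diskRoot h.pos hs hθ)
      have hcont : Continuous fun ε : ℝ => (band m s θ + ε * Complex.I : ℂ) := by fun_prop
      have := hcont.tendsto 0
      simp only [Complex.ofReal_zero, zero_mul, add_zero] at this
      exact this.mono_left nhdsWithin_le_nhds
    have h3 := (isCompact_bandNhd m k).isClosed.mem_of_tendsto h2 hmem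
    refine ((hcont k x i _ h3).tendsto.comp (tendsto_nhdsWithin_iff.2 ⟨h2, hmem⟩)).congr' ?_
    filter_upwards [self_mem_nhdsWithin] with ε hε
    have h1 : (band m s θ + ε * Complex.I).im ≠ 0 := by
      simpa [hbl] using (mem_Ioi.1 hε).ne'
    exact (hGi _ h1 x i).symm

end DiscreteDirac
end

/-! ### Spectral density and pointwise decay of the kernel -/

noncomputable section

namespace DiscreteDirac

open MeasureTheory Set Filter Topology ComplexConjugate

variable {m : ℝ} {Q : ℤ → Matrix (Fin 2) (Fin 2) ℝ} {r : ℕ}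

theorem injOn_band (hm : 0 < m) {s : ℝ} (hs : s ^ 2 = 1) :
    InjOn (fun θ => s * omega m θ) (Ioo 0 Real.pi) := by
  intro a ha b hb hab
  have h1 : (s * omega m a) ^ 2 = (s * omega m b) ^ 2 := by
    have : s * omega m a = s * omega m b := hab
    rw [this]
  rw [mul_pow, mul_pow, hs, omega_sq hm, omega_sq hm] at h1
  exact Real.injOn_cos (Ioo_subset_Icc_self ha) (Ioo_subset_Icc_self hb) (by linarith)

theorem hasDerivAt_band (hm : 0 < m) (s θ : ℝ) :
    HasDerivAt (fun θ => s * omega m θ) (s * (Real.sin θ / omega m θ)) θ :=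
  (hasDerivAt_omega hm θ).const_mul s

theorem abs_deriv_band (hm : 0 < m) {s : ℝ} (hs : s ^ 2 = 1) {θ : ℝ} (hθ : θ ∈ Ioo 0 Real.pi) :
    |s * (Real.sin θ / omega m θ)| = Real.sin θ / omega m θ := by
  have h1 := Real.sin_pos_of_mem_Ioo hθ
  have h2 := omega_pos hm θ
  rcases sq_eq_one_iff.1 hs with rfl | rfl
  · rw [one_mul, abs_of_pos (by positivity)]
  · rw [neg_one_mul, abs_neg, abs_of_pos (by positivity)]

theorem integral_band (hm : 0 < m) {s : ℝ} (hs : s ^ 2 = 1) {F : ℝ → ℂ}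
    (hint : IntegrableOn (fun θ => ((Real.sin θ / omega m θ : ℝ) : ℂ) * F (s * omega m θ))
      (Ioo 0 Real.pi)) :
    IntegrableOn F ((fun θ => s * omega m θ) '' Ioo 0 Real.pi) ∧
      ∫ l in (fun θ => s * omega m θ) '' Ioo 0 Real.pi, F l
        = ∫ θ in Ioo 0 Real.pi, ((Real.sin θ / omega m θ : ℝ) : ℂ) * F (s * omega m θ) := by
  have hd := fun θ (_ : θ ∈ Ioo 0 Real.pi) =>
    (hasDerivAt_band hm s θ).hasDerivWithinAt (s := Ioo 0 Real.pi)
  have hcongr : EqOn (fun θ => |s * (Real.sin θ / omega m θ)| • F (s * omega m θ))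
      (fun θ => ((Real.sin θ / omega m θ : ℝ) : ℂ) * F (s * omega m θ)) (Ioo 0 Real.pi) := by
    intro θ hθ
    beta_reduce
    rw [abs_deriv_band hm hs hθ, Complex.real_smul]
  constructor
  · rw [integrableOn_image_iff_integrableOn_abs_deriv_smul measurableSet_Ioo hd (injOn_band hm hs)]
    exact hint.congr_fun hcongr.symm measurableSet_Ioo
  · rw [integral_image_eq_integral_abs_deriv_smul measurableSet_Ioo hd (injOn_band hm hs)]
    exact setIntegral_congr_fun measurableSet_Ioo hcongr

/-- Change of variables from the spectral parameter to the quasi-momentum. -/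
theorem integral_eq_add_bands (hm : 0 < m) {F : ℝ → ℂ} (hF : ∀ l, bandPoly m l ≤ 0 → F l = 0)
    (hint : ∀ s : ℝ, s ^ 2 = 1 → IntegrableOn
      (fun θ => ((Real.sin θ / omega m θ : ℝ) : ℂ) * F (s * omega m θ)) (Ioo 0 Real.pi)) :
    ∫ l, F l = (∫ θ in Ioo 0 Real.pi, ((Real.sin θ / omega m θ : ℝ) : ℂ) * F (1 * omega m θ))
      + ∫ θ in Ioo 0 Real.pi, ((Real.sin θ / omega m θ : ℝ) : ℂ) * F (-1 * omega m θ) := by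
  obtain ⟨i1, e1⟩ := integral_band hm (one_pow 2) (hint 1 (one_pow 2))
  obtain ⟨i2, e2⟩ := integral_band hm (neg_one_sq) (hint (-1) neg_one_sq)
  set U := (fun θ => 1 * omega m θ) '' Ioo 0 Real.pi
  set V := (fun θ => -1 * omega m θ) '' Ioo 0 Real.pi
  have hV : MeasurableSet V := measurable_image_of_fderivWithin measurableSet_Ioo
    (fun θ _ => (hasDerivAt_band hm (-1) θ).hasFDerivAt.hasFDerivWithinAt)
    (injOn_band hm neg_one_sq)
  have hdis : Disjoint U V := by
    rw [Set.disjoint_left]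
    rintro _ ⟨a, _, rfl⟩ ⟨b, _, hb⟩
    have := omega_pos hm a
    have := omega_pos hm b
    simp only at hb
    linarith
  rw [← e1, ← e2, ← setIntegral_union hdis hV i1 i2]
  refine (setIntegral_eq_integral_of_forall_compl_eq_zero fun l hl => ?_).symm
  refine hF l ?_
  by_contra hcon
  obtain ⟨s, θ, hs, -, hθ, rfl⟩ := exists_band_of_bandPoly_pos (not_le.1 hcon)
  rcases sq_eq_one_iff.1 hs with rfl | rfl
  · exact hl (Or.inl ⟨θ, hθ, rfl⟩)
  · exact hl (Or.inr ⟨θ, hθ, rfl⟩)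

/-- The quasi-momentum on the unit circle belonging to the boundary value from above. -/
def bandCirc (m l : ℝ) : ℂ :=
  circ ((if 0 < l then 1 else -1) * Real.arccos ((m ^ 2 + 2 - l ^ 2) / 2))

theorem bandCirc_band (hm : 0 < m) {s θ : ℝ} (hs : s ^ 2 = 1) (hθ : θ ∈ Ioo 0 Real.pi) :
    bandCirc m (s * omega m θ) = circ (s * θ) := by
  have h1 : Real.arccos ((m ^ 2 + 2 - (s * omega m θ) ^ 2) / 2) = θ := by
    rw [mul_pow, hs, one_mul, omega_sq hm]
    have : (m ^ 2 + 2 - (m ^ 2 + 2 - 2 * Real.cos θ)) / 2 = Real.cos θ := by ring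
    rw [this, Real.arccos_cos hθ.1.le hθ.2.le]
  have h2 := omega_pos hm θ
  rw [bandCirc, h1]
  rcases sq_eq_one_iff.1 hs with rfl | rfl
  · rw [if_pos (by linarith)]
  · rw [if_neg (by linarith)]

/-- The spectral density of the continuous part. -/
def specDensity (m : ℝ) (Q : ℤ → Matrix (Fin 2) (Fin 2) ℝ) (y : ℤ) (j : Fin 2) (x : ℤ) (i : Fin 2)
    (l : ℝ) : ℂ :=
  (2 * Real.pi * Complex.I)⁻¹ * (curveGreen m Q l (bandCirc m l) y j x i
    - conj (curveGreen m Q l (bandCirc m l) y j x i))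

theorem tsupport_cutoff_subset (m : ℝ) (k : ℕ) (e : ℝ → ℂ) :
    tsupport (fun l => e l * (bandCutoff m k l : ℂ)) ⊆ {l | 1 ≤ k * bandPoly m l} := by
  refine closure_minimal (fun l hl => ?_)
    (isClosed_le continuous_const (continuous_const.mul (continuous_bandPoly m)))
  by_contra hcon
  refine hl ?_
  beta_reduce
  rw [bandCutoff_eq_zero (not_le.1 hcon).le, Complex.ofReal_zero, mul_zero]

theorem hasCompactSupport_cutoff (m : ℝ) (k : ℕ) (e : ℝ → ℂ) :
    HasCompactSupport (fun l => e l * (bandCutoff m k l : ℂ)) := by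
  refine IsCompact.of_isClosed_subset (isCompact_Icc (a := -(m ^ 2 + 4 + 1)) (b := m ^ 2 + 4 + 1))
    (isClosed_tsupport _) ((tsupport_cutoff_subset m k e).trans fun l hl => ?_)
  have h1 : 1 ≤ k * bandPoly m l := hl
  have h2 : l ^ 2 ≤ m ^ 2 + 4 := by
    by_contra hcon
    push Not at hcon
    have : bandPoly m l ≤ 0 := by
      unfold bandPoly
      exact mul_nonpos_of_nonneg_of_nonpos (by nlinarith) (by nlinarith)
    have := mul_nonpos_of_nonneg_of_nonpos (Nat.cast_nonneg (α := ℝ) k) this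
    linarith
  exact ⟨by nlinarith [sq_nonneg (l - 1), sq_nonneg (l + 1)],
    by nlinarith [sq_nonneg (l - 1), sq_nonneg (l + 1)]⟩

/-- Stone's formula with the boundary values from limiting absorption. Symmetry of the Green
function merges the two matrix elements into a single entry minus its conjugate. -/
theorem Admissible.inner_cfc_delta (h : Admissible m Q 0) (hQ : BoundedPotential Q) {e : ℝ → ℂ}
    (he : Continuous e) (k : ℕ) (y : ℤ) (j : Fin 2) (x : ℤ) (i : Fin 2) :
    inner ℂ (delta x i) (cfc (fun z : ℂ => e z.re * (bandCutoff m k z.re : ℂ)) (dirac m Q hQ)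
      (delta y j)) = ∫ l, e l * (bandCutoff m k l : ℂ) * specDensity m Q y j x i l := by
  obtain ⟨Gy, hy, hyM, hyl⟩ := h.exists_resolvent hQ y j
  obtain ⟨Gx, hx, hxM, hxl⟩ := h.exists_resolvent hQ x i
  obtain ⟨M, hM⟩ := hyM x i k
  obtain ⟨M', hM'⟩ := hxM y j k
  have hts := fun l (hl : l ∈ tsupport fun l => e l * (bandCutoff m k l : ℂ)) =>
    tsupport_cutoff_subset m k e hl
  have hlim : ∀ (G : ℂ → L2) (y : ℤ) (j : Fin 2) (x : ℤ) (i : Fin 2),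
      (∀ (s θ : ℝ), s ^ 2 = 1 → θ ∈ Ioo 0 Real.pi →
        Tendsto (fun ε : ℝ => G (band m s θ + ε * Complex.I) x i) (𝓝[>] 0)
          (𝓝 (curveGreen m Q (band m s θ) (circ (s * θ)) y j x i))) →
      ∀ l ∈ tsupport fun l => e l * (bandCutoff m k l : ℂ),
        Tendsto (fun ε : ℝ => inner ℂ (delta x i) (G (l + ε * Complex.I))) (𝓝[>] 0)
          (𝓝 (curveGreen m Q l (bandCirc m l) y j x i)) := by
    intro G y j x i hG l hl
    have h1 : 1 ≤ k * bandPoly m l := hts l hl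
    have h2 : 0 < bandPoly m l := by
      by_contra hcon
      have := mul_nonpos_of_nonneg_of_nonpos (Nat.cast_nonneg (α := ℝ) k) (not_lt.1 hcon)
      linarith
    obtain ⟨s, θ, hs, -, hθ, rfl⟩ := exists_band_of_bandPoly_pos h2
    simp only [inner_delta]
    rw [bandCirc_band h.pos hs hθ]
    exact hG s θ hs hθ
  have hsa := isSelfAdjoint_dirac (m := m) h.symm hQ
  have hc : Continuous fun l => e l * (bandCutoff m k l : ℂ) :=
    he.mul (Complex.continuous_ofReal.comp (continuous_bandCutoff m k))
  have key := inner_cfc_eq_integral hsa (f := fun l => e l * (bandCutoff m k l : ℂ)) hc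
    (hasCompactSupport_cutoff m k e) (x := delta x i) (y := delta y j) (Gx := Gx) (Gy := Gy)
    (g := fun l => curveGreen m Q l (bandCirc m l) y j x i)
    (g' := fun l => curveGreen m Q l (bandCirc m l) x i y j) (M := max M M') one_pos hx hy
    (fun l hl ε hε => by
      rw [inner_delta]; exact (hM l (hts l hl) ε hε).trans (le_max_left _ _))
    (fun l hl ε hε => by
      rw [inner_delta]; exact (hM' l (hts l hl) ε hε).trans (le_max_right _ _))
    (hlim Gy y j x i (hyl x i)) (hlim Gx x i y j (hxl y j))
  rw [key]
  refine integral_congr_ae (Eventually.of_forall fun l => ?_)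
  simp only [specDensity, curveGreen, greenEntry_symm _ _ _ x i y j]

/-- The density on a band is the imaginary part of a product of two Jost solutions. -/
theorem Admissible.exists_specDensity_eq (h : Admissible m Q 0) (y : ℤ) (j : Fin 2) (x : ℤ)
    (i : Fin 2) : ∃ (n l : ℤ) (i' j' : Fin 2), l ≤ n ∧
      |(n : ℝ)| + |(l : ℝ)| ≤ |(x : ℝ)| + |(y : ℝ)| + 2 ∧
      ∀ s : ℝ, s ^ 2 = 1 → ∀ θ ∈ Ioo 0 Real.pi,
        ((Real.sin θ / omega m θ : ℝ) : ℂ) * specDensity m Q y j x i (s * omega m θ)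
          = -s * (2 * Real.pi * Complex.I)⁻¹ *
            (bandSol m Q s true θ n i' * bandSol m Q s false θ l j' / wrW m Q s θ
                * (Real.sin θ / omega m θ : ℝ)
              - conj (bandSol m Q s true θ n i' * bandSol m Q s false θ l j' / wrW m Q s θ
                * (Real.sin θ / omega m θ : ℝ))) := by
  -- Components are stored with the first one shifted by a site, so each index moves by at most one;
  -- this is the 2 in the frequency bound. The Jacobi ordering of the components turns into l ≤ n.
  have hex : ∃ (n l : ℤ) (i' j' : Fin 2), l ≤ n ∧
      |(n : ℝ)| + |(l : ℝ)| ≤ |(x : ℝ)| + |(y : ℝ)| + 2 ∧ ∀ (S T : ℤ → Fin 2 → ℂ) (W : ℂ),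
        greenEntry (spin S) (spin T) W y j x i = -W⁻¹ * (S n i' * T l j') := by
    have ha : ∀ (x : ℤ) (i : Fin 2), |((x + 1 - (i : ℕ) : ℤ) : ℝ)| ≤ |(x : ℝ)| + 1 := by
      intro x i
      have h1 : ((x + 1 - (i : ℕ) : ℤ) : ℝ) = x + (1 - ((i : ℕ) : ℝ)) := by push_cast; ring
      have h2 : |1 - ((i : ℕ) : ℝ)| ≤ 1 := by fin_cases i <;> simp
      rw [h1]
      exact (abs_add_le _ _).trans (by linarith)
    have hx := ha x i
    have hy := ha y j
    by_cases hr : rank y j ≤ rank x i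
    · refine ⟨x + 1 - (i : ℕ), y + 1 - (j : ℕ), i, j, ?_, by linarith, fun S T W => ?_⟩
      · unfold rank at hr
        have := i.2
        have := j.2
        omega
      · rw [greenEntry, if_pos hr, spin_apply, spin_apply]
    · refine ⟨y + 1 - (j : ℕ), x + 1 - (i : ℕ), j, i, ?_, by linarith, fun S T W => ?_⟩
      · unfold rank at hr
        have := i.2
        have := j.2
        omega
      · rw [greenEntry, if_neg hr, spin_apply, spin_apply, mul_comm (T _ _)]
  obtain ⟨n, l, i', j', hnl, habs, hg⟩ := hex
  refine ⟨n, l, i', j', hnl, habs, fun s hs θ hθ => ?_⟩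
  rw [specDensity, bandCirc_band h.pos hs hθ]
  have e1 : curveGreen m Q ((s * omega m θ : ℝ) : ℂ) (circ (s * θ)) y j x i
      = -(wrW m Q s (s * θ))⁻¹ * (bandSol m Q s true (s * θ) n i'
        * bandSol m Q s false (s * θ) l j') := by
    have hb : ((s * omega m θ : ℝ) : ℂ) = band m s (s * θ) := by
      rcases sq_eq_one_iff.1 hs with rfl | rfl
      · rw [one_mul θ]; rfl
      · rw [neg_one_mul θ, band_neg]; rfl
    rw [hb]
    exact hg _ _ _
  rw [e1]
  rcases sq_eq_one_iff.1 hs with rfl | rfl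
  · simp only [one_mul, map_mul, map_div₀, map_neg, map_inv₀, Complex.conj_ofReal,
      Complex.ofReal_one]
    ring
  -- On the lower band the boundary value sits at −θ, that is, at the conjugate solutions; this
  -- accounts for the factor s in the density.
  · have c1 := h.conj_wrW (s := -1) (by norm_num) θ
    have c2 := h.conj_bandSol (s := -1) (by norm_num) true θ n i'
    have c3 := h.conj_bandSol (s := -1) (by norm_num) false θ l j'
    simp only [neg_one_mul θ, ← c1, ← c2, ← c3, map_mul, map_div₀, map_neg, map_inv₀,
      Complex.conj_ofReal, Complex.conj_conj, Complex.ofReal_neg, Complex.ofReal_one]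
    ring

/-- Pointwise decay of the kernel of the propagator on the continuous subspace. -/
theorem Admissible.exists_kernel_decay (h : Admissible m Q 1)
    (hres : ResonantCase m Q → Admissible m Q 2) (hQ : BoundedPotential Q) :
    ∃ C c : ℝ, 0 ≤ C ∧ 0 < c ∧ ∀ (t : ℝ), 1 ≤ t → ∀ x i y j,
      ‖inner ℂ (delta x i) (NormedSpace.exp ((-Complex.I * (t : ℂ)) • dirac m Q hQ)
        ((eigenvectorSpan (dirac m Q hQ))ᗮ.starProjection (delta y j)))‖
          ≤ C * t ^ (-(1 / 3) : ℝ) ∧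
      (|(x : ℝ)| + |(y : ℝ)| + 2 ≤ c * t →
        ‖inner ℂ (delta x i) (NormedSpace.exp ((-Complex.I * (t : ℂ)) • dirac m Q hQ)
          ((eigenvectorSpan (dirac m Q hQ))ᗮ.starProjection (delta y j)))‖
            ≤ C * t ^ (-(1 / 2) : ℝ)) := by
  have h0 := h.mono zero_le_one
  have hm := h.pos
  obtain ⟨C, c, hC, hc, hdec⟩ := exists_amp_decay hm
  obtain ⟨M₁, hM₁⟩ := h.exists_amp hres (one_pow 2 : (1 : ℝ) ^ 2 = 1)
  obtain ⟨M₂, hM₂⟩ := h.exists_amp hres (neg_one_sq : (-1 : ℝ) ^ 2 = 1)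
  set M := max 0 (max M₁ M₂)
  have hM : ∀ s : ℝ, s ^ 2 = 1 → ∀ (n l : ℤ) (i j : Fin 2), l ≤ n →
      Amp (|(n : ℝ)| + |(l : ℝ)|) M fun θ => bandSol m Q s true θ n i *
        bandSol m Q s false θ l j / wrW m Q s θ * (Real.sin θ / omega m θ : ℝ) := by
    intro s hs n l i j hnl
    rcases sq_eq_one_iff.1 hs with rfl | rfl
    · exact (hM₁ n l i j hnl).mono le_rfl ((le_max_left _ _).trans (le_max_right _ _))
    · exact (hM₂ n l i j hnl).mono le_rfl ((le_max_right _ _).trans (le_max_right _ _))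
  have hM0 : 0 ≤ M := le_max_left _ _
  refine ⟨4 * (C * M), c, by positivity, hc, fun t ht x i y j => ?_⟩
  obtain ⟨n, l, i', j', hnl, habs, hden⟩ := h0.exists_specDensity_eq (m := m) y j x i
  set B : ℝ → ℝ → ℂ := fun s θ => bandSol m Q s true θ n i' * bandSol m Q s false θ l j'
    / wrW m Q s θ * (Real.sin θ / omega m θ : ℝ)
  set a : ℂ := (2 * Real.pi * Complex.I)⁻¹
  have ha : ‖a‖ ≤ 1 := by
    simp only [a, norm_inv, norm_mul, Complex.norm_I, Complex.norm_real, Complex.norm_ofNat,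
      Real.norm_eq_abs, abs_of_pos Real.pi_pos, mul_one]
    exact inv_le_one_of_one_le₀ (by linarith [Real.pi_gt_three])
  set A : ℝ → ℝ → ℂ := fun s θ => -s * a * (B s θ - conj (B s θ))
  have hAmp := fun s hs => hM s hs n l i' j' hnl
  have hAc : ∀ s : ℝ, s ^ 2 = 1 → ContinuousOn (A s) (Ioo 0 Real.pi) := fun s hs =>
    continuousOn_const.mul ((hAmp s hs).continuousOn.sub (hAmp s hs).conj.continuousOn)
  have hAb : ∀ s : ℝ, s ^ 2 = 1 → ∀ θ ∈ Ioo 0 Real.pi, ‖A s θ‖ ≤ 4 * M := by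
    intro s hs θ hθ
    have habs' : ‖(-s : ℂ)‖ = 1 := by
      rcases sq_eq_one_iff.1 hs with rfl | rfl <;> simp
    have h1 : ‖B s θ‖ ≤ 2 * M := (hAmp s hs).norm_le hθ
    have h2 : ‖conj (B s θ)‖ ≤ 2 * M := (hAmp s hs).conj.norm_le hθ
    calc ‖A s θ‖ = ‖a‖ * ‖B s θ - conj (B s θ)‖ := by
          simp only [A, norm_mul, habs', one_mul]
      _ ≤ 1 * (2 * M + 2 * M) := mul_le_mul ha ((norm_sub_le _ _).trans (add_le_add h1 h2))
          (norm_nonneg _) zero_le_one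
      _ = 4 * M := by ring
  have hfin : volume (Ioo 0 Real.pi) ≠ ⊤ := by simp
  have hint : ∀ s : ℝ, s ^ 2 = 1 → ∀ f : ℝ → ℂ, Continuous f → (∀ θ, ‖f θ‖ ≤ 1) →
      IntegrableOn (fun θ => f θ * A s θ) (Ioo 0 Real.pi) := by
    intro s hs f hf hf1
    refine IntegrableOn.of_bound (C := 4 * M) (lt_top_iff_ne_top.2 hfin)
      ((hf.continuousOn.mul (hAc s hs)).aestronglyMeasurable measurableSet_Ioo) ?_
    refine (ae_restrict_iff' measurableSet_Ioo).2 (Eventually.of_forall fun θ hθ => ?_)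
    rw [norm_mul]
    calc ‖f θ‖ * ‖A s θ‖ ≤ 1 * (4 * M) :=
          mul_le_mul (hf1 θ) (hAb s hs θ hθ) (norm_nonneg _) zero_le_one
      _ = 4 * M := one_mul _
  set e : ℝ → ℂ := fun l => Complex.exp (-Complex.I * t * (l : ℂ))
  have hec : Continuous e := by fun_prop
  have he1 : ∀ l, ‖e l‖ = 1 := fun l => by
    have : -Complex.I * t * (l : ℂ) = ((-(t * l) : ℝ) : ℂ) * Complex.I := by push_cast; ring
    simp only [e]
    rw [this, Complex.norm_exp_ofReal_mul_I]
  have hcut : ∀ k l, ‖e l * (bandCutoff m k l : ℂ)‖ ≤ 1 := fun k l => by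
    rw [norm_mul, he1, one_mul, Complex.norm_real, Real.norm_eq_abs,
      abs_of_nonneg (bandCutoff_nonneg m k l)]
    exact bandCutoff_le_one m k l
  have hcutc : ∀ k, Continuous fun l => e l * (bandCutoff m k l : ℂ) := fun k =>
    hec.mul (Complex.continuous_ofReal.comp (continuous_bandCutoff m k))
  have hωc : ∀ s : ℝ, Continuous fun θ => s * omega m θ := fun s =>
    continuous_const.mul (continuous_omega m)
  have hcongr : ∀ (k : ℕ) (s : ℝ), s ^ 2 = 1 → EqOn
      (fun θ => e (s * omega m θ) * (bandCutoff m k (s * omega m θ) : ℂ) * A s θ)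
      (fun θ => ((Real.sin θ / omega m θ : ℝ) : ℂ) * (e (s * omega m θ)
        * (bandCutoff m k (s * omega m θ) : ℂ) * specDensity m Q y j x i (s * omega m θ)))
      (Ioo 0 Real.pi) := by
    intro k s hs θ hθ
    have h1 : A s θ = ((Real.sin θ / omega m θ : ℝ) : ℂ)
      * specDensity m Q y j x i (s * omega m θ) := (hden s hs θ hθ).symm
    beta_reduce
    rw [h1]
    ring
  have hk : ∀ k : ℕ, inner ℂ (delta x i) (cfc (fun z : ℂ => e z.re * (bandCutoff m k z.re : ℂ))
      (dirac m Q hQ) (delta y j))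
      = (∫ θ in Ioo 0 Real.pi, e (1 * omega m θ) * (bandCutoff m k (1 * omega m θ) : ℂ) * A 1 θ)
        + ∫ θ in Ioo 0 Real.pi,
          e (-1 * omega m θ) * (bandCutoff m k (-1 * omega m θ) : ℂ) * A (-1) θ := by
    intro k
    rw [h0.inner_cfc_delta hQ hec k y j x i, integral_eq_add_bands hm]
    · rw [setIntegral_congr_fun measurableSet_Ioo (hcongr k 1 (one_pow 2)),
        setIntegral_congr_fun measurableSet_Ioo (hcongr k (-1) neg_one_sq)]
    · intro l hl
      have : (k : ℝ) * bandPoly m l ≤ 0 :=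
        mul_nonpos_of_nonneg_of_nonpos (Nat.cast_nonneg (α := ℝ) k) hl
      rw [bandCutoff_eq_zero (by linarith), Complex.ofReal_zero, mul_zero, zero_mul]
    · intro s hs
      exact (hint s hs _ ((hcutc k).comp (hωc s)) fun θ => hcut k _).congr_fun (hcongr k s hs)
        measurableSet_Ioo
  -- Dominated convergence removes the cutoff, since the density in θ stays bounded up to the band
  -- edges.
  have hlim : ∀ s : ℝ, s ^ 2 = 1 → Tendsto (fun k : ℕ => ∫ θ in Ioo 0 Real.pi,
      e (s * omega m θ) * (bandCutoff m k (s * omega m θ) : ℂ) * A s θ) atTop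
      (𝓝 (∫ θ in Ioo 0 Real.pi, bandExp m s t θ * A s θ)) := by
    intro s hs
    refine tendsto_integral_of_dominated_convergence (fun _ => 4 * M) (fun k => ?_)
      (integrableOn_const hfin) (fun k => ?_) ?_
    · exact (hint s hs _ ((hcutc k).comp (hωc s)) fun θ => hcut k _).aestronglyMeasurable
    · refine (ae_restrict_iff' measurableSet_Ioo).2 (Eventually.of_forall fun θ hθ => ?_)
      rw [norm_mul]
      calc _ ≤ 1 * (4 * M) :=
            mul_le_mul (hcut k _) (hAb s hs θ hθ) (norm_nonneg _) zero_le_one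
        _ = 4 * M := one_mul _
    · refine (ae_restrict_iff' measurableSet_Ioo).2 (Eventually.of_forall fun θ hθ => ?_)
      have hsin := Real.sin_pos_of_mem_Ioo hθ
      have hpos : 0 < bandPoly m (s * omega m θ) := by rw [bandPoly_band hm hs]; positivity
      obtain ⟨k₀, hk₀⟩ := exists_nat_ge (2 / bandPoly m (s * omega m θ))
      refine tendsto_const_nhds.congr' ?_
      filter_upwards [eventually_ge_atTop k₀] with k hk
      rw [bandCutoff_eq_one, Complex.ofReal_one, mul_one]
      · rfl
      · rw [← div_le_iff₀ hpos]
        exact hk₀.trans (by exact_mod_cast hk)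
  -- The same limit of cutoffs computes the propagator on the continuous subspace and the
  -- oscillatory integrals.
  have hval := tendsto_nhds_unique
    (tendsto_inner_exp_starProjection (isSelfAdjoint_dirac (m := m) h.symm hQ) m
      (fun l hl => h0.bounded_below hQ l hl) (fun l w hw he => h0.bandPoly_nonpos hQ l w hw he) t
      (delta x i) (delta y j))
    (((hlim 1 (one_pow 2)).add (hlim (-1) neg_one_sq)).congr fun k => (hk k).symm)
  rw [hval]
  have hbd : ∀ s : ℝ, s ^ 2 = 1 →
      ‖∫ θ in Ioo 0 Real.pi, bandExp m s t θ * A s θ‖ ≤ 2 * (C * M * t ^ (-(1 / 3) : ℝ)) ∧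
      (|(x : ℝ)| + |(y : ℝ)| + 2 ≤ c * t → ‖∫ θ in Ioo 0 Real.pi, bandExp m s t θ * A s θ‖
        ≤ 2 * (C * M * t ^ (-(1 / 2) : ℝ))) := by
    intro s hs
    have habs' : ‖(-s : ℂ)‖ = 1 := by
      rcases sq_eq_one_iff.1 hs with rfl | rfl <;> simp
    have hI : ∀ N F, Amp N M F →
        IntervalIntegrable (fun θ => bandExp m s t θ * F θ) volume 0 Real.pi := by
      intro N F hF
      rw [intervalIntegrable_iff_integrableOn_Ioo_of_le Real.pi_pos.le]
      refine IntegrableOn.of_bound (C := 2 * M) (lt_top_iff_ne_top.2 hfin)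
        (((continuous_bandExp m s t).continuousOn.mul
          hF.continuousOn).aestronglyMeasurable measurableSet_Ioo) ?_
      refine (ae_restrict_iff' measurableSet_Ioo).2 (Eventually.of_forall fun θ hθ => ?_)
      rw [norm_mul, norm_bandExp, one_mul]
      exact hF.norm_le hθ
    have e1 : ∫ θ in Ioo 0 Real.pi, bandExp m s t θ * A s θ
        = -s * a * ((∫ θ in 0..Real.pi, bandExp m s t θ * B s θ)
          - ∫ θ in 0..Real.pi, bandExp m s t θ * conj (B s θ)) := by
      rw [← intervalIntegral.integral_sub (hI _ _ (hAmp s hs)) (hI _ _ (hAmp s hs).conj),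
        ← intervalIntegral.integral_const_mul, intervalIntegral.integral_of_le Real.pi_pos.le,
        integral_Ioc_eq_integral_Ioo]
      refine setIntegral_congr_fun measurableSet_Ioo fun θ _ => ?_
      simp only [A]
      ring
    have key : ∀ K, ‖∫ θ in 0..Real.pi, bandExp m s t θ * B s θ‖ ≤ K →
        ‖∫ θ in 0..Real.pi, bandExp m s t θ * conj (B s θ)‖ ≤ K →
        ‖∫ θ in Ioo 0 Real.pi, bandExp m s t θ * A s θ‖ ≤ 2 * K := by
      intro K h1 h2
      rw [e1, norm_mul, norm_mul, habs', one_mul]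
      calc _ ≤ 1 * (K + K) := mul_le_mul ha ((norm_sub_le _ _).trans (add_le_add h1 h2))
            (norm_nonneg _) zero_le_one
        _ = 2 * K := by ring
    have d1 := hdec s hs t _ M ht _ (hAmp s hs)
    have d2 := hdec s hs t _ M ht _ (hAmp s hs).conj
    exact ⟨key _ d1.1 d2.1, fun hx => key _ (d1.2 (habs.trans hx)) (d2.2 (habs.trans hx))⟩
  have b1 := hbd 1 (one_pow 2)
  have b2 := hbd (-1) neg_one_sq
  refine ⟨(norm_add_le _ _).trans ?_, fun hx => (norm_add_le _ _).trans ?_⟩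
  · linarith [b1.1, b2.1]
  · linarith [b1.2 hx, b2.2 hx]

end DiscreteDirac
end

/-! ### From kernel bounds to weighted operator norms -/

noncomputable section

namespace DiscreteDirac

open Set Filter Topology

/-- Matrix entries of an operator. -/
def kernel (T : L2 →L[ℂ] L2) (x : ℤ) (i : Fin 2) (y : ℤ) (j : Fin 2) : ℂ :=
  inner ℂ (delta x i) (T (delta y j))

theorem single_eq_add (y : ℤ) (v : Spinor) :
    (lp.single 2 y v : L2) = v 0 • delta y 0 + v 1 • delta y 1 := by
  refine lp.ext (funext fun n => ?_)
  ext i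
  change (lp.single 2 y v : L2) n i = v 0 * delta y 0 n i + v 1 * delta y 1 n i
  rw [lp.coeFn_single, delta_apply, delta_apply]
  by_cases h : n = y
  · subst h
    fin_cases i <;> simp
  · simp [h]

/-- The factor 4 counts the entries of a two by two block. -/
theorem norm_apply_single_le {T : L2 →L[ℂ] L2} {x y : ℤ} {κ : ℝ}
    (hT : ∀ i j, ‖kernel T x i y j‖ ≤ κ) (v : Spinor) :
    ‖T (lp.single 2 y v) x‖ ≤ 4 * κ * ‖v‖ := by
  have key : ∀ i, ‖T (lp.single 2 y v) x i‖ ≤ 2 * κ * ‖v‖ := by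
    intro i
    rw [← inner_delta, single_eq_add, map_add, map_smul, map_smul, inner_add_right,
      inner_smul_right, inner_smul_right]
    refine (norm_add_le _ _).trans ?_
    rw [norm_mul, norm_mul]
    have h0 := mul_le_mul (PiLp.norm_apply_le v 0) (hT i 0) (norm_nonneg _) (norm_nonneg _)
    have h1 := mul_le_mul (PiLp.norm_apply_le v 1) (hT i 1) (norm_nonneg _) (norm_nonneg _)
    unfold kernel at h0 h1
    linarith
  refine (spinor_norm_le _).trans ?_
  linarith [key 0, key 1]

theorem weightedOpNorm_one_top_le {T : L2 →L[ℂ] L2} {κ : ℝ} (hκ : 0 ≤ κ)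
    (hT : ∀ x i y j, ‖kernel T x i y j‖ ≤ κ) :
    weightedOpNorm 1 0 ⊤ 0 T ≤ ENNReal.ofReal (4 * κ) := by
  refine iSup₂_le fun f hf => ?_
  simp only [weightedNorm, ENNReal.one_ne_top, if_false, if_true, ENNReal.toReal_one, mul_zero,
    Real.rpow_zero, one_mul, Real.rpow_one, div_one, ENNReal.rpow_one] at hf ⊢
  have hs : Summable fun n => ‖f n‖ := by
    have := ENNReal.summable_toReal (hf.trans_lt ENNReal.one_lt_top).ne
    exact this.congr fun n => ENNReal.toReal_ofReal (norm_nonneg _)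
  have hle : ∑' n, ‖f n‖ ≤ 1 := by
    rw [← ENNReal.ofReal_tsum_of_nonneg (fun n => norm_nonneg _) hs] at hf
    exact ENNReal.ofReal_le_one.1 hf
  refine iSup_le fun x => ENNReal.ofReal_le_ofReal ?_
  have h1 : HasSum (fun y => T (lp.single 2 y (f y)) x) (T f x) :=
    ((evalCLM x).comp T).hasSum (lp.hasSum_single (by norm_num) f)
  have h2 : ∀ y, ‖T (lp.single 2 y (f y)) x‖ ≤ 4 * κ * ‖f y‖ := fun y =>
    norm_apply_single_le (fun i j => hT x i y j) (f y)
  rw [← h1.tsum_eq]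
  refine (tsum_of_norm_bounded (hs.mul_left (4 * κ)).hasSum h2).trans ?_
  rw [tsum_mul_left]
  exact mul_le_of_le_one_right (by positivity) hle

theorem sum_le_of_weightedNorm_two_le {σ : ℝ} {u : ℤ → Spinor} (h : weightedNorm 2 σ u ≤ 1)
    (F : Finset ℤ) : ∑ n ∈ F, (1 + |(n : ℝ)|) ^ (2 * σ) * ‖u n‖ ^ 2 ≤ 1 := by
  simp only [weightedNorm, ENNReal.ofNat_ne_top, if_false, ENNReal.toReal_ofNat,
    Real.rpow_ofNat] at h
  have h1 := ENNReal.rpow_le_rpow h (show (0 : ℝ) ≤ 2 by norm_num)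
  rw [← ENNReal.rpow_mul, ENNReal.one_rpow, one_div_mul_cancel two_ne_zero, ENNReal.rpow_one] at h1
  have h2 := (ENNReal.sum_le_tsum F).trans h1
  rw [← ENNReal.ofReal_sum_of_nonneg fun n _ => by positivity] at h2
  exact ENNReal.ofReal_le_one.1 h2

theorem weightedNorm_two_le {σ B : ℝ} {u : ℤ → Spinor} (hB : 0 ≤ B)
    (h : ∀ F : Finset ℤ, ∑ n ∈ F, (1 + |(n : ℝ)|) ^ (2 * σ) * ‖u n‖ ^ 2 ≤ B ^ 2) :
    weightedNorm 2 σ u ≤ ENNReal.ofReal B := by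
  simp only [weightedNorm, ENNReal.ofNat_ne_top, if_false, ENNReal.toReal_ofNat,
    Real.rpow_ofNat]
  have h1 : ∑' n : ℤ, ENNReal.ofReal ((1 + |(n : ℝ)|) ^ (2 * σ) * ‖u n‖ ^ 2)
      ≤ ENNReal.ofReal (B ^ 2) := by
    rw [ENNReal.tsum_eq_iSup_sum]
    refine iSup_le fun F => ?_
    rw [← ENNReal.ofReal_sum_of_nonneg fun n _ => by positivity]
    exact ENNReal.ofReal_le_ofReal (h F)
  refine (ENNReal.rpow_le_rpow h1 (by norm_num)).trans (le_of_eq ?_)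
  rw [ENNReal.ofReal_rpow_of_nonneg (by positivity) (by norm_num), ← Real.sqrt_eq_rpow,
    Real.sqrt_sq hB]

theorem summable_weight {b : ℝ} (hb : 1 < b) : Summable fun n : ℤ => (1 + |(n : ℝ)|) ^ (-b) := by
  refine Summable.of_norm_bounded_eventually (g := fun n : ℤ => |(n : ℝ)| ^ (-b))
    (Real.summable_abs_int_rpow hb) ?_
  have : ∀ᶠ n : ℤ in cofinite, n ≠ 0 := (Set.finite_singleton (0 : ℤ)).compl_mem_cofinite
  filter_upwards [this] with n hn
  have h0 : 0 < |(n : ℝ)| := abs_pos.2 (by exact_mod_cast hn)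
  rw [Real.norm_eq_abs, abs_of_nonneg (by positivity)]
  exact Real.rpow_le_rpow_of_nonpos h0 (by linarith) (by linarith)

/-- A contraction whose kernel is small near the diagonal origin is small between weighted
spaces. -/
theorem weightedOpNorm_two_le {T : L2 →L[ℂ] L2} (hT1 : ‖T‖ ≤ 1) {σ R κ B : ℝ} (hσ : 1 / 2 < σ)
    (hR : 0 ≤ R)
    (hT : ∀ (x : ℤ) i (y : ℤ) j, |(x : ℝ)| ≤ R → |(y : ℝ)| ≤ R → ‖kernel T x i y j‖ ≤ κ) (hB : 0 ≤ B)
    (hle : 32 * κ ^ 2 * (∑' n : ℤ, (1 + |(n : ℝ)|) ^ (-(2 * σ))) ^ 2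
      + 4 * (1 + R) ^ (-(2 * σ)) ≤ B ^ 2) :
    weightedOpNorm 2 σ 2 (-σ) T ≤ ENNReal.ofReal B := by
  refine iSup₂_le fun f hf => weightedNorm_two_le hB fun F => ?_
  have hf1 := sum_le_of_weightedNorm_two_le hf
  have hΛ := summable_weight (b := 2 * σ) (by linarith)
  set Λ := ∑' n : ℤ, (1 + |(n : ℝ)|) ^ (-(2 * σ))
  set ρ := (1 + R) ^ (-(2 * σ)) with hρ
  have hρ0 : 0 ≤ ρ := by positivity
  have hΛF : ∀ F : Finset ℤ, ∑ n ∈ F, (1 + |(n : ℝ)|) ^ (-(2 * σ)) ≤ Λ := fun F =>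
    hΛ.sum_le_tsum F fun n _ => by positivity
  have hΛ0 : 0 ≤ Λ := tsum_nonneg fun n => by positivity
  have hw1 : ∀ n : ℤ, (1 + |(n : ℝ)|) ^ (-(2 * σ)) ≤ 1 := fun n =>
    Real.rpow_le_one_of_one_le_of_nonpos (by linarith [abs_nonneg (n : ℝ)]) (by linarith)
  have hwR : ∀ n : ℤ, ¬ |(n : ℝ)| ≤ R → (1 + |(n : ℝ)|) ^ (-(2 * σ)) ≤ ρ := fun n hn =>
    Real.rpow_le_rpow_of_nonpos (by linarith) (by linarith [not_le.1 hn]) (by linarith)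
  have hwinv : ∀ n : ℤ, (1 + |(n : ℝ)|) ^ (-(2 * σ)) * (1 + |(n : ℝ)|) ^ (2 * σ) = 1 := fun n => by
    rw [← Real.rpow_add (by positivity), neg_add_cancel, Real.rpow_zero]
  -- The sites at distance at most R from the origin, where the kernel bound is available.
  set S : Finset ℤ := Finset.Icc (-⌊R⌋) ⌊R⌋
  have hS : ∀ n : ℤ, n ∈ S ↔ |(n : ℝ)| ≤ R := fun n => by
    rw [Finset.mem_Icc, abs_le, neg_le, Int.le_floor, Int.le_floor, neg_le]
    push_cast
    constructor <;> rintro ⟨a, b⟩ <;> constructor <;> linarith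
  set f₁ : L2 := ∑ y ∈ S, lp.single 2 y (f y)
  set f₂ : L2 := f - f₁
  have hf₁ : ∀ n, f₁ n = if n ∈ S then f n else 0 := by
    intro n
    simp only [f₁]
    rw [lp.coeFn_sum, Finset.sum_apply]
    simp only [lp.coeFn_single]
    rw [Finset.sum_pi_single]
  have hf₂ : ∀ n, f₂ n = if n ∈ S then 0 else f n := by
    intro n
    have : f₂ n = f n - f₁ n := rfl
    rw [this, hf₁]
    split_ifs <;> simp
  have hnf : ‖f‖ ≤ 1 := by
    refine l2_norm_le_of_sum_le zero_le_one fun F => ?_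
    rw [one_pow]
    refine le_trans (Finset.sum_le_sum fun n _ => ?_) (hf1 F)
    exact le_mul_of_one_le_left (by positivity)
      (Real.one_le_rpow (by linarith [abs_nonneg (n : ℝ)]) (by linarith))
  have hnf₁ : ‖f₁‖ ≤ 1 := by
    refine (l2_norm_le_of_forall_le (g := f) zero_le_one fun n => ?_).trans (by linarith)
    rw [hf₁, one_mul]
    split_ifs
    · exact le_rfl
    · rw [norm_zero]; exact norm_nonneg _
  have hnf₂ : ‖f₂‖ ^ 2 ≤ ρ := by
    have : ‖f₂‖ ≤ √ρ := by
      refine l2_norm_le_of_sum_le (Real.sqrt_nonneg _) fun F => ?_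
      rw [Real.sq_sqrt hρ0]
      calc ∑ n ∈ F, ‖f₂ n‖ ^ 2 ≤ ∑ n ∈ F, ρ * ((1 + |(n : ℝ)|) ^ (2 * σ) * ‖f n‖ ^ 2) := by
            refine Finset.sum_le_sum fun n _ => ?_
            rw [hf₂]
            split_ifs with hn
            · rw [norm_zero, zero_pow two_ne_zero]; positivity
            · rw [hS] at hn
              have h1 := mul_le_mul_of_nonneg_right (hwR n hn)
                (by positivity : 0 ≤ (1 + |(n : ℝ)|) ^ (2 * σ) * ‖f n‖ ^ 2)
              rwa [← mul_assoc, hwinv, one_mul] at h1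
        _ ≤ ρ := by
            rw [← Finset.mul_sum]
            exact mul_le_of_le_one_right hρ0 (hf1 F)
    calc ‖f₂‖ ^ 2 ≤ √ρ ^ 2 := pow_le_pow_left₀ (norm_nonneg _) this 2
      _ = ρ := Real.sq_sqrt hρ0
  have hTn : ∀ v, ‖T v‖ ≤ ‖v‖ := fun v =>
    (T.le_opNorm v).trans (mul_le_of_le_one_left (norm_nonneg _) hT1)
  have hL : ∀ (v : L2) (F : Finset ℤ), ∑ n ∈ F, ‖v n‖ ^ 2 ≤ ‖v‖ ^ 2 := fun v F => by
    rw [norm_sq_eq_tsum]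
    exact (summable_norm_sq v).sum_le_tsum _ fun _ _ => by positivity
  -- Cauchy–Schwarz with the weights; 2σ > 1 makes Λ finite.
  have hsum : (∑ y ∈ S, ‖f y‖) ^ 2 ≤ Λ := by
    have h1 := Finset.sum_mul_sq_le_sq_mul_sq S (fun n : ℤ => (1 + |(n : ℝ)|) ^ (-σ))
      fun n => (1 + |(n : ℝ)|) ^ σ * ‖f n‖
    have e1 : ∀ n : ℤ, (1 + |(n : ℝ)|) ^ (-σ) * ((1 + |(n : ℝ)|) ^ σ * ‖f n‖) = ‖f n‖ := fun n => by
      rw [← mul_assoc, ← Real.rpow_add (by positivity), neg_add_cancel, Real.rpow_zero, one_mul]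
    have e2 : ∀ (n : ℤ) (a : ℝ), ((1 + |(n : ℝ)|) ^ a) ^ 2 = (1 + |(n : ℝ)|) ^ (2 * a) :=
      fun n a => by
        rw [← Real.rpow_natCast, ← Real.rpow_mul (by positivity), mul_comm]
        norm_num
    simp only [e1, mul_pow, e2, mul_neg] at h1
    refine h1.trans ?_
    calc _ ≤ Λ * 1 := mul_le_mul (hΛF S) (hf1 S) (Finset.sum_nonneg fun n _ => by positivity) hΛ0
      _ = Λ := mul_one _
  have hg₁ : ∀ n ∈ S, ‖T f₁ n‖ ^ 2 ≤ 16 * κ ^ 2 * Λ := by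
    intro n hn
    have h1 : T f₁ n = ∑ y ∈ S, T (lp.single 2 y (f y)) n := by
      simp only [f₁]
      rw [map_sum, lp.coeFn_sum, Finset.sum_apply]
    have h2 : ‖T f₁ n‖ ≤ 4 * κ * ∑ y ∈ S, ‖f y‖ := by
      rw [h1, Finset.mul_sum]
      refine norm_sum_le_of_le _ fun y hy => norm_apply_single_le (fun i j => ?_) _
      exact hT n i y j ((hS n).1 hn) ((hS y).1 hy)
    calc ‖T f₁ n‖ ^ 2 ≤ (4 * κ * ∑ y ∈ S, ‖f y‖) ^ 2 := pow_le_pow_left₀ (norm_nonneg _) h2 2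
      _ = 16 * κ ^ 2 * (∑ y ∈ S, ‖f y‖) ^ 2 := by ring
      _ ≤ _ := mul_le_mul_of_nonneg_left hsum (by positivity)
  have hsplit : ∀ n, T f n = T f₁ n + T f₂ n := by
    intro n
    have : T f = T f₁ + T f₂ := by rw [← map_add]; congr 1; simp [f₂]
    rw [this]
    rfl
  -- For output sites in S the kernel bound acts on the inner part of f; for the others the weight
  -- is at most ρ and T is a contraction. The outer part of f has squared norm at most ρ. Summation
  -- gives 32κ²Λ² + 4ρ.
  have hterm : ∀ n : ℤ, (1 + |(n : ℝ)|) ^ (-(2 * σ)) * ‖T f n‖ ^ 2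
      ≤ 2 * (16 * κ ^ 2 * Λ * (1 + |(n : ℝ)|) ^ (-(2 * σ)) + ρ * ‖T f₁ n‖ ^ 2)
        + 2 * ‖T f₂ n‖ ^ 2 := by
    intro n
    have h1 : ‖T f n‖ ^ 2 ≤ 2 * ‖T f₁ n‖ ^ 2 + 2 * ‖T f₂ n‖ ^ 2 := by
      rw [hsplit]
      have := pow_le_pow_left₀ (norm_nonneg _) (norm_add_le (T f₁ n) (T f₂ n)) 2
      nlinarith [sq_nonneg (‖T f₁ n‖ - ‖T f₂ n‖)]
    have h0 : 0 ≤ (1 + |(n : ℝ)|) ^ (-(2 * σ)) := by positivity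
    have h2 := mul_le_mul_of_nonneg_left h1 h0
    have h3 : (1 + |(n : ℝ)|) ^ (-(2 * σ)) * ‖T f₁ n‖ ^ 2
        ≤ 16 * κ ^ 2 * Λ * (1 + |(n : ℝ)|) ^ (-(2 * σ)) + ρ * ‖T f₁ n‖ ^ 2 := by
      by_cases hn : n ∈ S
      · have := mul_le_mul_of_nonneg_left (hg₁ n hn) h0
        have : 0 ≤ ρ * ‖T f₁ n‖ ^ 2 := by positivity
        linarith
      · have := mul_le_mul_of_nonneg_right (hwR n (mt (hS n).2 hn)) (sq_nonneg ‖T f₁ n‖)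
        have : 0 ≤ 16 * κ ^ 2 * Λ * (1 + |(n : ℝ)|) ^ (-(2 * σ)) := by positivity
        linarith
    have h4 := mul_le_mul_of_nonneg_right (hw1 n) (sq_nonneg ‖T f₂ n‖)
    linarith
  rw [mul_neg]
  refine (Finset.sum_le_sum fun n _ => hterm n).trans (le_trans ?_ hle)
  rw [Finset.sum_add_distrib, ← Finset.mul_sum, ← Finset.mul_sum, Finset.sum_add_distrib,
    ← Finset.mul_sum, ← Finset.mul_sum]
  have a1 := mul_le_mul_of_nonneg_left (hΛF F) (by positivity : 0 ≤ 16 * κ ^ 2 * Λ)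
  have a2 : ∑ n ∈ F, ‖T f₁ n‖ ^ 2 ≤ 1 := (hL _ F).trans (by
    have := (hTn f₁).trans hnf₁
    nlinarith [norm_nonneg (T f₁)])
  have a3 : ∑ n ∈ F, ‖T f₂ n‖ ^ 2 ≤ ρ := (hL _ F).trans
    ((pow_le_pow_left₀ (norm_nonneg _) (hTn f₂) 2).trans hnf₂)
  have a4 := mul_le_mul_of_nonneg_left a2 hρ0
  nlinarith

/-- The exponential of i times a self-adjoint operator is unitary. -/
theorem norm_exp_apply {H : Type*} [NormedAddCommGroup H] [InnerProductSpace ℂ H] [CompleteSpace H]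
    {A : H →L[ℂ] H} (hA : IsSelfAdjoint A) (t : ℝ) (v : H) :
    ‖NormedSpace.exp ((-Complex.I * (t : ℂ)) • A) v‖ = ‖v‖ := by
  have hsa : IsSelfAdjoint (((-t : ℝ) : ℂ) • A) :=
    IsSelfAdjoint.smul (by rw [isSelfAdjoint_iff, Complex.star_def, Complex.conj_ofReal]) hA
  have e : NormedSpace.exp ((-Complex.I * (t : ℂ)) • A)
      = (selfAdjoint.expUnitary ⟨((-t : ℝ) : ℂ) • A, hsa⟩ : H →L[ℂ] H) := by
    rw [selfAdjoint.expUnitary_coe, smul_smul]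
    congr 2
    push_cast
    ring
  rw [e]
  exact ContinuousLinearMap.norm_map_of_mem_unitary (Subtype.prop _) v

theorem norm_propagator_comp_le {A : L2 →L[ℂ] L2} (hA : IsSelfAdjoint A) (t : ℝ) :
    ‖propagator A t ∘L continuousProjection A‖ ≤ 1 := by
  refine ContinuousLinearMap.opNorm_le_bound _ zero_le_one fun v => ?_
  rw [ContinuousLinearMap.comp_apply, propagator, norm_exp_apply hA]
  exact ContinuousLinearMap.le_of_opNorm_le _ (Submodule.starProjection_norm_le _) v

/-- Decay of the propagator in the weighted norms. -/
theorem Admissible.weightedOpNorm_decay {m : ℝ} {Q : ℤ → Matrix (Fin 2) (Fin 2) ℝ}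
    (h : Admissible m Q 1) (hres : ResonantCase m Q → Admissible m Q 2) (hQ : BoundedPotential Q) :
    (∃ C : ℝ, ∀ᶠ t : ℝ in atTop, weightedOpNorm 1 0 ⊤ 0
      (propagator (dirac m Q hQ) t ∘L continuousProjection (dirac m Q hQ))
        ≤ ENNReal.ofReal (C * t ^ (-(1 / 3) : ℝ))) ∧
    ∀ σ : ℝ, 1 / 2 < σ → ∃ C : ℝ, ∀ᶠ t : ℝ in atTop, weightedOpNorm 2 σ 2 (-σ)
      (propagator (dirac m Q hQ) t ∘L continuousProjection (dirac m Q hQ))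
        ≤ ENNReal.ofReal (C * t ^ (-(1 / 2) : ℝ)) := by
  obtain ⟨C, c, hC, hc, hker⟩ := h.exists_kernel_decay hres hQ
  have hk := fun (t : ℝ) (ht : 1 ≤ t) (x : ℤ) i (y : ℤ) j =>
    (hker t ht x i y j : ‖kernel (propagator (dirac m Q hQ) t ∘L
      continuousProjection (dirac m Q hQ)) x i y j‖ ≤ C * t ^ (-(1 / 3) : ℝ) ∧
      (|(x : ℝ)| + |(y : ℝ)| + 2 ≤ c * t → ‖kernel (propagator (dirac m Q hQ) t ∘L
        continuousProjection (dirac m Q hQ)) x i y j‖ ≤ C * t ^ (-(1 / 2) : ℝ)))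
  have hn := norm_propagator_comp_le (isSelfAdjoint_dirac (m := m) h.symm hQ)
  refine ⟨⟨4 * C, ?_⟩, fun σ hσ => ?_⟩
  · filter_upwards [eventually_ge_atTop 1] with t ht
    rw [mul_assoc]
    exact weightedOpNorm_one_top_le (by positivity) fun x i y j => (hk t ht x i y j).1
  · set Λ := ∑' n : ℤ, (1 + |(n : ℝ)|) ^ (-(2 * σ)) with hΛ
    refine ⟨√(32 * C ^ 2 * Λ ^ 2 + 8 / c), ?_⟩
    filter_upwards [eventually_ge_atTop 1, eventually_ge_atTop (2 / c)] with t ht htc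
    have ht0 : 0 < t := by linarith
    have h1 : 1 ≤ c * t / 2 := by
      rw [div_le_iff₀ hc] at htc
      linarith
    -- With this R, sites in the box satisfy |x| + |y| + 2 ≤ ct, the region of fast decay.
    refine weightedOpNorm_two_le (hn t) (R := c * t / 2 - 1) (κ := C * t ^ (-(1 / 2) : ℝ)) hσ
      (by linarith) (fun x i y j hx hy => (hk t ht x i y j).2 (by linarith))
      (by positivity) ?_
    have h2 : (t ^ (-(1 / 2) : ℝ)) ^ 2 = t⁻¹ := by
      rw [← Real.rpow_natCast, ← Real.rpow_mul ht0.le, ← Real.rpow_neg_one]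
      norm_num
    -- As 2σ > 1 and ct/2 ≥ 1, the outer weight is at most the inverse first power of t up to a
    -- constant, matching the squared kernel bound.
    have h3 : (c * t / 2) ^ (-(2 * σ)) ≤ 2 / c * t⁻¹ := by
      calc (c * t / 2) ^ (-(2 * σ)) ≤ (c * t / 2) ^ (-1 : ℝ) :=
            Real.rpow_le_rpow_of_exponent_le h1 (by linarith)
        _ = 2 / c * t⁻¹ := by
            rw [Real.rpow_neg_one]
            field_simp
    rw [add_sub_cancel, mul_pow, mul_pow, h2, Real.sq_sqrt (by positivity), ← hΛ]
    calc _ ≤ 32 * (C ^ 2 * t⁻¹) * Λ ^ 2 + 4 * (2 / c * t⁻¹) :=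
          add_le_add_right (mul_le_mul_of_nonneg_left h3 (by norm_num)) _
      _ = _ := by ring

end DiscreteDirac
end
theorem theorem6p1 (m : ℝ) (hm : 0 < m) (Q : ℤ → Matrix (Fin 2) (Fin 2) ℝ)
    (hsymm : ∀ n, Q n 0 1 = Q n 1 0) (hne : ∀ n, Q n 1 0 ≠ -1)
    (hQ : ∀ i j, DiscreteDirac.MemWeighted 1 2 (fun n => Q n i j))
    (hres : DiscreteDirac.ResonantCase m Q →
      ∀ i j, DiscreteDirac.MemWeighted 1 3 (fun n => Q n i j))
    (D Pc : DiscreteDirac.L2 →L[ℂ] DiscreteDirac.L2)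
    (hD : D = DiscreteDirac.dirac m Q
      (DiscreteDirac.boundedPotential_of_memWeighted zero_le_two hQ))
    (hPc : Pc = DiscreteDirac.continuousProjection D) :
    (∃ C : ℝ, ∀ᶠ t : ℝ in Filter.atTop,
      DiscreteDirac.weightedOpNorm 1 0 ⊤ 0 (DiscreteDirac.propagator D t ∘L Pc)
        ≤ ENNReal.ofReal (C * t ^ (-(1 / 3) : ℝ))) ∧
    ∀ σ : ℝ, 1 / 2 < σ → ∃ C : ℝ, ∀ᶠ t : ℝ in Filter.atTop,
      DiscreteDirac.weightedOpNorm 2 σ 2 (-σ) (DiscreteDirac.propagator D t ∘L Pc)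
        ≤ ENNReal.ofReal (C * t ^ (-(1 / 2) : ℝ)) := by
  subst hD hPc
  -- The index counts derivatives of the Jost solutions: two moments give one derivative, and three
  -- moments give the second one needed at a resonance.
  have h1 : DiscreteDirac.Admissible m Q 1 :=
    DiscreteDirac.admissible_of_memWeighted hm hsymm hne 1 (by exact_mod_cast hQ)
  have h2 : DiscreteDirac.ResonantCase m Q → DiscreteDirac.Admissible m Q 2 := fun hr =>
    DiscreteDirac.admissible_of_memWeighted hm hsymm hne 2 (by exact_mod_cast hres hr)
  exact h1.weightedOpNorm_decay h2 _
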